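/- Let $R$ be a commutative ring. **Derived rings.** Let $s\mathcal N^\flat_R$ be the category of simplicial commutative $R$-algebras $A$ such that the kernel $I_A$ of $A\to\pi_0A$ is nilpotent and the normalisation satisfies $N_iA=0$ for $i\gg0$. If $R$ is a $\mathbb Q$-algebra, let $dg_+\mathcal N^\flat_R$ be the category of graded-commutative differential graded $R$-algebras $A$ in non-negative chain degrees such that the kernel $I_A$ of $A\to H_0A$ is nilpotent and $A_i=0$ for $i\gg0$. Write $d\mathcal N^\flat_R$ for $s\mathcal N^\flat_R$ or (if $R$ is a $\mathbb Q$-algebra) $dg_+\mathcal N^\flat_R$. For $n\ge0$ let $(A^{\Delta^n})_0$ be $\mathrm{Hom}(\Delta^n,A)=A_n$ in the simplicial case, and in the dg case the ring of degree $0$ cycles of $A\otimes_{\mathbb Q}\Omega_n$, where $\Omega_n=\mathbb Q[t_0,\dots,t_n,dt_0,\dots,dt_n]/(\sum t_i-1,\sum dt_i)$ is the dg algebra of polynomial differential forms on the $n$-simplex. A *square-zero extension* is a surjection $A\to B$ whose kernel has square zero. A *tiny acyclic extension* in $d\mathcal N^\flat_R$ is a surjection $A\to B$ whose kernel $K$ satisfies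 $I_A\cdot K=0$ and for which $NK$ (resp. $K$) is of the form $\mathrm{cone}(M)[-r]$ for a $\pi_0A$-module (resp. $H_0A$-module) $M$ and some $r\ge0$, i.e. it is concentrated in degrees $r,r+1$ with an isomorphism as differential. **Properties of functors.** A functor $F$ on $d\mathcal N^\flat_R$ or on the category $\mathrm{Alg}_R$ of commutative $R$-algebras is *homogeneous* if $F(A\times_BC)\to F(A)\times_{F(B)}F(C)$ is an isomorphism for all square-zero extensions $A\to B$ and all $C\to B$. A group-valued functor on $\mathrm{Alg}_R$ is *formally smooth* if it maps square-zero extensions to surjections. A functor $F$ from $d\mathcal N^\flat_R$ to simplicial sets is *homotopic* (resp. *pre-homotopic*) if it maps tiny acyclic extensions to trivial Kan fibrations (resp. surjective Kan fibrations), *formally quasi-presmooth* if it maps square-zero extensions to Kan fibrations, and *formally quasi-smooth* if it is formally quasi-presmooth and homotopic. **Deligne groupoids.** Let $G=G^\bullet_\bullet$ be a cosimplicial simplicial group, with cosimplicial operations $\partial^i,\sigma^i$ and simplicial operations $\partial_i,\sigma_i$. The simplicial set $\underline{\mathrm{MC}}(G)\subset\prod_{n\ge0}(G^{n+1})^{\Delta^n}$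 (where $(G^{n+1})^{\Delta^n}$ is the simplicial mapping space, and $\partial_i,\sigma_i$ also denote the operations coming from $\Delta^n$) consists of the $(\omega_n)_{n\ge0}$ with $$\partial_i\omega_n=\partial^{i+1}\omega_{n-1}\ (i>0),\quad \partial_0\omega_n=(\partial^1\omega_{n-1})\cdot(\partial^0\omega_{n-1})^{-1},\quad \sigma_i\omega_n=\sigma^{i+1}\omega_{n+1},\quad \sigma^0\omega_n=1 .$$ The simplicial group $G^0$ acts on it by $(g\star\omega)_n=((\partial^1)^{n+1}(\sigma_0)^ng)\cdot\omega_n\cdot(\partial^0(\partial^1)^n(\sigma_0)^ng^{-1})$, where $(\sigma_0)^n$ is the canonical map $G^0\to(G^0)^{\Delta^n}$. The *derived Deligne groupoid* is the simplicial groupoid $[\underline{\mathrm{MC}}(G)/G^0]$, and $\mathrm{Del}(G)=[\underline{\mathrm{MC}}(G)_0/G^0_0]$ is its level $0$; here, for a group $\Gamma$ acting on a set $X$, $[X/\Gamma]$ has objects $x\in X$ and morphisms $x\to y$ the $g\in\Gamma$ with $g\cdot x=y$. Let $B$ be the nerve, and let $\bar W$ of a simplicial groupoid be the simplicial set obtained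 from its levelwise nerve, a bisimplicial set, by the right adjoint $\bar W$ of Illusie's total décalage functor. **Proposition.** Let $G:\mathrm{Alg}_R\to c\mathrm{Gp}$ be a homogeneous functor to cosimplicial groups such that each functor $G^n:\mathrm{Alg}_R\to\mathrm{Gp}$ is formally smooth. For $A\in d\mathcal N^\flat_R$ let $\underline G(A)$ be the cosimplicial simplicial group $\underline G(A)^m_n=G^m((A^{\Delta^n})_0)$. Then, both for $d\mathcal N^\flat_R=s\mathcal N^\flat_R$ and, if $R$ is a $\mathbb Q$-algebra, for $d\mathcal N^\flat_R=dg_+\mathcal N^\flat_R$: 1. the functor $A\mapsto\bar W[\underline{\mathrm{MC}}(\underline G(A))/\underline G(A)^0]$ from $d\mathcal N^\flat_R$ to simplicial sets is homogeneous and formally quasi-smooth; 2. the functor $A\mapsto B\,\mathrm{Del}(\underline G(A))$ from $d\mathcal N^\flat_R$ to simplicial sets is homogeneous, pre-homotopic and formally quasi-presmooth. -/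

import Mathlib

open CategoryTheory Simplicial Opposite

universe u w

namespace DerivedDeligne

noncomputable section

/-! ### Cosimplicial simplicial groups, Maurer–Cartan spaces and the gauge action -/

/-- The category `csGp` of cosimplicial simplicial groups. -/
abbrev CsGrp := SimplexCategory ⥤ SimplexCategoryᵒᵖ ⥤ GrpCat.{w}

/-- An `m`-simplex of the Maurer–Cartan space `mmc(G) ⊆ ∏ₙ (Gⁿ⁺¹)^{Δⁿ}` of a cosimplicial
simplicial group. The component `ω n`, an `m`-simplex of the mapping space `(Gⁿ⁺¹)^{Δⁿ}`, is a map
of simplicial sets `Δⁿ × Δᵐ → Gⁿ⁺¹`; it is recorded by its values on the `k`-simplices `(a, b)` of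
`Δⁿ × Δᵐ`. On `Δⁿ`, the face `∂ᵢ` (degeneracy `σᵢ`) of `(Gⁿ⁺¹)^{Δⁿ}` is composition with the
`i`-th coface (codegeneracy) map. -/
@[ext]
structure MC (G : CsGrp.{w}) (m : SimplexCategory) where
  /-- the value of the map `ωₙ : Δⁿ × Δᵐ → Gⁿ⁺¹` at `(a, b)` -/
  ω (n : ℕ) {k : SimplexCategory} (a : k ⟶ ⦋n⦌) (b : k ⟶ m) : (G.obj ⦋n + 1⦌).obj (op k)
  naturality (n : ℕ) {k l : SimplexCategory} (f : l ⟶ k) (a : k ⟶ ⦋n⦌) (b : k ⟶ m) :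
    (G.obj ⦋n + 1⦌).map f.op (ω n a b) = ω n (f ≫ a) (f ≫ b)
  /-- `∂₀ ωₙ₊₁ = (∂¹ ωₙ) · (∂⁰ ωₙ)⁻¹` -/
  face_zero (n : ℕ) {k : SimplexCategory} (a : k ⟶ ⦋n⦌) (b : k ⟶ m) :
    ω (n + 1) (a ≫ SimplexCategory.δ 0) b =
      (G.map (SimplexCategory.δ 1)).app (op k) (ω n a b) *
        ((G.map (SimplexCategory.δ 0)).app (op k) (ω n a b))⁻¹
  /-- `∂ᵢ ωₙ₊₁ = ∂ⁱ⁺¹ ωₙ` for `i > 0` -/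
  face_succ (n : ℕ) (i : Fin (n + 1)) {k : SimplexCategory} (a : k ⟶ ⦋n⦌) (b : k ⟶ m) :
    ω (n + 1) (a ≫ SimplexCategory.δ i.succ) b =
      (G.map (SimplexCategory.δ i.succ.succ)).app (op k) (ω n a b)
  /-- `σᵢ ωₙ = σⁱ⁺¹ ωₙ₊₁` -/
  degeneracy (n : ℕ) (i : Fin (n + 1)) {k : SimplexCategory} (a : k ⟶ ⦋n + 1⦌) (b : k ⟶ m) :
    ω n (a ≫ SimplexCategory.σ i) b =
      (G.map (SimplexCategory.σ i.succ)).app (op k) (ω (n + 1) a b)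
  /-- `σ⁰ ωₙ = 1` -/
  codegeneracy_zero (n : ℕ) {k : SimplexCategory} (a : k ⟶ ⦋n⦌) (b : k ⟶ m) :
    (G.map (SimplexCategory.σ 0)).app (op k) (ω n a b) = 1

namespace MC

variable {G H K : CsGrp.{w}} {m m' m'' : SimplexCategory}

/-- The simplicial structure of `mmc(G)`. -/
def pull (f : m' ⟶ m) (x : MC G m) : MC G m' where
  ω n _ a b := x.ω n a (b ≫ f)
  naturality n k l g a b := by simpa using x.naturality n g a (b ≫ f)
  face_zero n k a b := x.face_zero n a (b ≫ f)
  face_succ n i k a b := x.face_succ n i a (b ≫ f)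
  degeneracy n i k a b := x.degeneracy n i a (b ≫ f)
  codegeneracy_zero n k a b := x.codegeneracy_zero n a (b ≫ f)

/-- The functoriality of `mmc(G)` in `G`. -/
def push (φ : G ⟶ H) (x : MC G m) : MC H m where
  ω n k a b := (φ.app ⦋n + 1⦌).app (op k) (x.ω n a b)
  naturality n k l f a b := by
    have := ConcreteCategory.congr_hom ((φ.app ⦋n + 1⦌).naturality f.op) (x.ω n a b)
    simp only [ConcreteCategory.comp_apply] at this
    rw [← this, x.naturality]
  face_zero n k a b := by
    have h (i : Fin (n + 1 + 2)) := ConcreteCategory.congr_hom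
      (congr_app (φ.naturality (SimplexCategory.δ i)) (op k)) (x.ω n a b)
    simp only [NatTrans.comp_app, ConcreteCategory.comp_apply] at h
    rw [← h, ← h, x.face_zero, map_mul, map_inv]
  face_succ n i k a b := by
    have h (i : Fin (n + 1 + 2)) := ConcreteCategory.congr_hom
      (congr_app (φ.naturality (SimplexCategory.δ i)) (op k)) (x.ω n a b)
    simp only [NatTrans.comp_app, ConcreteCategory.comp_apply] at h
    rw [← h, x.face_succ]
  degeneracy n i k a b := by
    have h (i : Fin (n + 1 + 1)) := ConcreteCategory.congr_hom
      (congr_app (φ.naturality (SimplexCategory.σ i)) (op k)) (x.ω (n + 1) a b)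
    simp only [NatTrans.comp_app, ConcreteCategory.comp_apply] at h
    rw [← h, x.degeneracy]
  codegeneracy_zero n k a b := by
    have h := ConcreteCategory.congr_hom
      (congr_app (φ.naturality (SimplexCategory.σ (0 : Fin (n + 1)))) (op k)) (x.ω n a b)
    simp only [NatTrans.comp_app, ConcreteCategory.comp_apply] at h
    rw [← h, x.codegeneracy_zero, map_one]

/-- `(∂¹)ⁿ⁺¹ (σ₀)ⁿ g`, for `g` in level `m` of the simplicial group `G⁰`, evaluated at a simplex
`(a, b)` of `Δⁿ × Δᵐ` (it only depends on `b`): the iterated coface `(∂¹)ⁿ⁺¹` is the map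
`[0] → [n+1]` with image `0`, and `(σ₀)ⁿ` is the inclusion of constant maps `G⁰ → (G⁰)^{Δⁿ}`. -/
def gaugeL (g : (G.obj ⦋0⦌).obj (op m)) (n : ℕ) {k : SimplexCategory} (b : k ⟶ m) :
    (G.obj ⦋n + 1⦌).obj (op k) :=
  (G.map (SimplexCategory.const ⦋0⦌ ⦋n + 1⦌ 0)).app (op k) ((G.obj ⦋0⦌).map b.op g)

/-- `∂⁰ (∂¹)ⁿ (σ₀)ⁿ g`, as in `gaugeL`: the iterated coface `∂⁰ (∂¹)ⁿ` is the map `[0] → [n+1]` with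
image `1`. -/
def gaugeR (g : (G.obj ⦋0⦌).obj (op m)) (n : ℕ) {k : SimplexCategory} (b : k ⟶ m) :
    (G.obj ⦋n + 1⦌).obj (op k) :=
  (G.map (SimplexCategory.const ⦋0⦌ ⦋n + 1⦌ 1)).app (op k) ((G.obj ⦋0⦌).map b.op g)

lemma gauge_aux (g : (G.obj ⦋0⦌).obj (op m)) {n n' : ℕ} (i : Fin (n + 2)) (j : Fin (n' + 2))
    (f : ⦋n + 1⦌ ⟶ ⦋n' + 1⦌) (hf : f.toOrderHom i = j) {k : SimplexCategory} (b : k ⟶ m) :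
    (G.map f).app (op k) ((G.map (SimplexCategory.const ⦋0⦌ ⦋n + 1⦌ i)).app (op k)
      ((G.obj ⦋0⦌).map b.op g)) =
    (G.map (SimplexCategory.const ⦋0⦌ ⦋n' + 1⦌ j)).app (op k) ((G.obj ⦋0⦌).map b.op g) := by
  subst hf
  rw [← SimplexCategory.const_comp, G.map_comp]
  rfl

lemma gauge_nat (g : (G.obj ⦋0⦌).obj (op m)) {n : ℕ} (i : Fin (n + 2))
    {k l : SimplexCategory} (f : l ⟶ k) (b : k ⟶ m) :
    (G.obj ⦋n + 1⦌).map f.op ((G.map (SimplexCategory.const ⦋0⦌ ⦋n + 1⦌ i)).app (op k)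
      ((G.obj ⦋0⦌).map b.op g)) =
    (G.map (SimplexCategory.const ⦋0⦌ ⦋n + 1⦌ i)).app (op l)
      ((G.obj ⦋0⦌).map (f ≫ b).op g) := by
  have := ConcreteCategory.congr_hom
    ((G.map (SimplexCategory.const ⦋0⦌ ⦋n + 1⦌ i)).naturality f.op) ((G.obj ⦋0⦌).map b.op g)
  simp only [ConcreteCategory.comp_apply] at this
  rw [← this, op_comp, Functor.map_comp]
  rfl

/-- The gauge action of the group `(G⁰)_m` on `mmc(G)_m`:
`(g ⋆ ω)ₙ = ((∂¹)ⁿ⁺¹ (σ₀)ⁿ g) · ωₙ · (∂⁰ (∂¹)ⁿ (σ₀)ⁿ g⁻¹)`. -/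
def gauge (g : (G.obj ⦋0⦌).obj (op m)) (x : MC G m) : MC G m where
  ω n k a b := gaugeL g n b * x.ω n a b * (gaugeR g n b)⁻¹
  naturality n k l f a b := by
    rw [map_mul, map_mul, map_inv, x.naturality]
    simp only [gaugeL, gaugeR, gauge_nat]
  face_zero n k a b := by
    simp only [map_mul, map_inv, x.face_zero, gaugeL, gaugeR]
    rw [gauge_aux g 0 0 (SimplexCategory.δ 1) rfl, gauge_aux g 0 1 (SimplexCategory.δ 0) rfl,
      gauge_aux g 1 2 (SimplexCategory.δ 1) (Fin.succAbove_of_le_castSucc (1 : Fin (n + 3))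
        (1 : Fin (n + 2)) (by simp)),
      gauge_aux g 1 2 (SimplexCategory.δ 0) rfl]
    group
  face_succ n i k a b := by
    simp only [map_mul, map_inv, x.face_succ, gaugeL, gaugeR]
    rw [gauge_aux g 0 0 (SimplexCategory.δ i.succ.succ)
        (Fin.succAbove_of_castSucc_lt i.succ.succ (0 : Fin (n + 2)) (by simp)),
      gauge_aux g 1 1 (SimplexCategory.δ i.succ.succ)
        (Fin.succAbove_of_castSucc_lt i.succ.succ (1 : Fin (n + 2)) (by
          rw [Fin.lt_def]; simp))]
  degeneracy n i k a b := by
    simp only [map_mul, map_inv, x.degeneracy, gaugeL, gaugeR]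
    rw [gauge_aux g 0 0 (SimplexCategory.σ i.succ)
        (Fin.predAbove_of_le_castSucc i.succ (0 : Fin (n + 3)) (by simp)),
      gauge_aux g 1 1 (SimplexCategory.σ i.succ)
        (Fin.predAbove_of_le_castSucc i.succ (1 : Fin (n + 3)) (by
          rw [Fin.le_def]; simp))]
  codegeneracy_zero n k a b := by
    have h (i : Fin (n + 2)) (hi : i.val ≤ 1) : (G.map (SimplexCategory.σ (0 : Fin (n + 1)))).app
        (op k) ((G.map (SimplexCategory.const ⦋0⦌ ⦋n + 1⦌ i)).app (op k)
          ((G.obj ⦋0⦌).map b.op g)) =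
        (G.map (SimplexCategory.const ⦋0⦌ ⦋n⦌ 0)).app (op k) ((G.obj ⦋0⦌).map b.op g) := by
      have h0 : (SimplexCategory.σ (0 : Fin (n + 1))).toOrderHom i = 0 := by
        change Fin.predAbove (0 : Fin (n + 1)) i = 0
        obtain ⟨i, hi'⟩ := i
        obtain rfl | rfl : i = 0 ∨ i = 1 := by simp at hi; omega
        · rfl
        · rfl
      have h1 : SimplexCategory.const ⦋0⦌ ⦋n + 1⦌ i ≫ SimplexCategory.σ (0 : Fin (n + 1)) =
          SimplexCategory.const ⦋0⦌ ⦋n⦌ 0 := by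
        rw [SimplexCategory.const_comp, h0]
      rw [← h1, G.map_comp]
      rfl
    rw [map_mul, map_mul, map_inv, x.codegeneracy_zero, gaugeL, gaugeR, h 0 (by simp),
      h 1 (by simp)]
    group

instance : MulAction ((G.obj ⦋0⦌).obj (op m)) (MC G m) where
  smul g x := gauge g x
  one_smul x := by
    ext n k a b
    change gaugeL 1 n b * x.ω n a b * (gaugeR 1 n b)⁻¹ = _
    simp [gaugeL, gaugeR]
  mul_smul g h x := by
    ext n k a b
    change gaugeL (g * h) n b * x.ω n a b * (gaugeR (g * h) n b)⁻¹ =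
      gaugeL g n b * (gaugeL h n b * x.ω n a b * (gaugeR h n b)⁻¹) * (gaugeR g n b)⁻¹
    simp only [gaugeL, gaugeR, map_mul]
    group

lemma smul_ω (g : (G.obj ⦋0⦌).obj (op m)) (x : MC G m) (n : ℕ) {k : SimplexCategory}
    (a : k ⟶ ⦋n⦌) (b : k ⟶ m) :
    (g • x).ω n a b = gaugeL g n b * x.ω n a b * (gaugeR g n b)⁻¹ := rfl

lemma pull_id (x : MC G m) : pull (𝟙 m) x = x := by
  ext n k a b
  simp [pull]

lemma pull_comp (f : m'' ⟶ m') (f' : m' ⟶ m) (x : MC G m) :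
    pull (f ≫ f') x = pull f (pull f' x) := by
  ext n k a b
  simp [pull]

lemma pull_smul (f : m' ⟶ m) (g : (G.obj ⦋0⦌).obj (op m)) (x : MC G m) :
    pull f (g • x) = (G.obj ⦋0⦌).map f.op g • pull f x := by
  ext n k a b
  simp only [smul_ω, pull, gaugeL, gaugeR, op_comp, Functor.map_comp]
  rfl

lemma push_smul (φ : G ⟶ H) (g : (G.obj ⦋0⦌).obj (op m)) (x : MC G m) :
    push φ (g • x) = (φ.app ⦋0⦌).app (op m) g • push φ x := by
  ext n k a b
  have h (i : Fin (n + 2)) := ConcreteCategory.congr_hom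
    (congr_app (φ.naturality (SimplexCategory.const ⦋0⦌ ⦋n + 1⦌ i)) (op k))
    ((G.obj ⦋0⦌).map b.op g)
  have h' := ConcreteCategory.congr_hom ((φ.app ⦋0⦌).naturality b.op) g
  simp only [NatTrans.comp_app, ConcreteCategory.comp_apply] at h h'
  simp only [smul_ω, push, gaugeL, gaugeR, map_mul, map_inv, h, h']

end MC

/-! ### The Deligne groupoids -/

/-- The functor between translation groupoids `[X/M] ⥤ [Y/N]` induced by an equivariant map. -/
@[simps]
def actionFunctor {M N : Type w} [Group M] [Group N] {X Y : Type w} [MulAction M X] [MulAction N Y]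
    (φ : M →* N) (ψ : X → Y) (h : ∀ (g : M) (x : X), ψ (g • x) = φ g • ψ x) :
    ActionCategory M X ⥤ ActionCategory N Y where
  obj x := ⟨(), ψ x.back⟩
  map {x _} f := ⟨φ f.1, (h f.1 x.back).symm.trans (congrArg ψ f.2)⟩
  map_id _ := Subtype.ext (map_one φ)
  map_comp f g := Subtype.ext (map_mul φ g.1 f.1)

lemma actionFunctor_ext {M N : Type w} [Group M] [Group N] {X Y : Type w} [MulAction M X]
    [MulAction N Y] {P Q : ActionCategory M X ⥤ ActionCategory N Y}
    (h₀ : ∀ x, (P.obj x).back = (Q.obj x).back)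
    (h₁ : ∀ {x y : ActionCategory M X} (f : x ⟶ y), (P.map f).1 = (Q.map f).1) : P = Q := by
  have h : ∀ x, P.obj x = Q.obj x := fun x => Sigma.ext rfl (heq_of_eq (h₀ x))
  refine CategoryTheory.Functor.ext h fun x y f => ?_
  have key : ∀ {z z' : ActionCategory N Y} (e : z = z'), ((eqToHom e).1 : N) = 1 := by
    intro z z' e
    subst e
    rfl
  apply Subtype.ext
  rw [ActionCategory.comp_val, ActionCategory.comp_val, key, key, h₁ f]
  have h2 : ∀ n : N, n = 1 * n * 1 := by simp
  exact h2 _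

/-- The derived Deligne groupoid `[mmc(G)/G⁰]`, a simplicial groupoid: in level `m` its objects are
the elements `x` of `mmc(G)_m`, and morphisms `x ⟶ y` are the `g` in `(G⁰)_m` with `g ⋆ x = y`. -/
def derivedDel : CsGrp.{w} ⥤ SimplexCategoryᵒᵖ ⥤ Cat.{w, w} where
  obj G :=
    { obj := fun m => Cat.of (ActionCategory ((G.obj ⦋0⦌).obj (op m.unop)) (MC G m.unop))
      map := fun f => (actionFunctor ((G.obj ⦋0⦌).map f.unop.op).hom (MC.pull f.unop)
        (MC.pull_smul f.unop)).toCatHom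
      map_id := fun m => by
        apply Cat.ext
        apply actionFunctor_ext
        · intro x
          exact MC.pull_id x.back
        · intro x y f
          exact ConcreteCategory.congr_hom ((G.obj ⦋0⦌).map_id m) f.1
      map_comp := fun f g => by
        apply Cat.ext
        apply actionFunctor_ext
        · intro x
          exact MC.pull_comp g.unop f.unop x.back
        · intro x y h
          exact ConcreteCategory.congr_hom ((G.obj ⦋0⦌).map_comp f g) h.1 }
  map {G H} φ :=
    { app := fun m => (actionFunctor ((φ.app ⦋0⦌).app (op m.unop)).hom (MC.push φ)
        (MC.push_smul φ)).toCatHom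
      naturality := fun m m' f => by
        apply Cat.ext
        apply actionFunctor_ext
        · intro x
          rfl
        · intro x y h
          exact ConcreteCategory.congr_hom ((φ.app ⦋0⦌).naturality f) h.1 }
  map_id G := by
    apply NatTrans.ext
    funext m
    apply Cat.ext
    apply actionFunctor_ext
    · intro x
      rfl
    · intro x y h
      rfl
  map_comp φ ψ := by
    apply NatTrans.ext
    funext m
    apply Cat.ext
    apply actionFunctor_ext
    · intro x
      rfl
    · intro x y h
      rfl

/-! ### The functor `W̄` from bisimplicial sets to simplicial sets -/

/-- The restriction `[j] → [θ(j)]` of a map `θ : [q] → [p]`. -/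
def initMap {p q : SimplexCategory} (θ : q ⟶ p) (j : Fin (q.len + 1)) :
    ⦋(j : ℕ)⦌ ⟶ ⦋(θ.toOrderHom j : ℕ)⦌ :=
  SimplexCategory.Hom.mk
    { toFun := fun k => ⟨θ.toOrderHom ⟨k, lt_of_lt_of_le k.2 j.2⟩,
        Nat.lt_succ_of_le (θ.toOrderHom.monotone (a := ⟨k, lt_of_lt_of_le k.2 j.2⟩) (b := j)
          (Nat.le_of_lt_succ k.2))⟩
      monotone' := fun _ _ h => θ.toOrderHom.monotone h }

lemma add_lt_of_lt_sub {q j : ℕ} (hj : j < q + 1) {k : ℕ} (hk : k < q - j + 1) : j + k < q + 1 := by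
  omega

/-- The restriction `{j, …, q} → {θ(j), …, p}` of a map `θ : [q] → [p]`, viewed as a map
`[q - j] → [p - θ(j)]`. -/
def tailMap {p q : SimplexCategory} (θ : q ⟶ p) (j : Fin (q.len + 1)) :
    ⦋q.len - (j : ℕ)⦌ ⟶ ⦋p.len - (θ.toOrderHom j : ℕ)⦌ :=
  SimplexCategory.Hom.mk
    { toFun := fun k =>
        ⟨(θ.toOrderHom ⟨j + k, add_lt_of_lt_sub j.2 k.2⟩ : ℕ) - (θ.toOrderHom j : ℕ),
          Nat.lt_succ_of_le (Nat.sub_le_sub_right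
            (Nat.le_of_lt_succ (θ.toOrderHom ⟨j + k, add_lt_of_lt_sub j.2 k.2⟩).2) _)⟩
      monotone' := fun a b h => Nat.sub_le_sub_right (θ.toOrderHom.monotone
        (a := ⟨j + a, add_lt_of_lt_sub j.2 a.2⟩) (b := ⟨j + b, add_lt_of_lt_sub j.2 b.2⟩)
        (Nat.add_le_add_left (show (a : ℕ) ≤ b from h) _)) _ }

/-- For `i ≤ j`, the inclusion `[i] → [j]`, `k ↦ k`; for `j = i + 1` this is the last coface map
`∂ⁱ⁺¹`. -/
def initIncl {i j : ℕ} (h : i ≤ j) : ⦋i⦌ ⟶ ⦋j⦌ :=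
  SimplexCategory.Hom.mk
    ⟨fun k => ⟨k, lt_of_lt_of_le k.2 (Nat.succ_le_succ h)⟩, fun _ _ h => h⟩

/-- For `i ≤ j ≤ p`, the map `[p - j] → [p - i]`, `k ↦ k + (j - i)`; for `j = i + 1` this is the
coface map `∂⁰`. -/
def tailIncl {i j p : ℕ} (h : i ≤ j) (hp : j ≤ p) : ⦋p - j⦌ ⟶ ⦋p - i⦌ :=
  SimplexCategory.Hom.mk ⟨fun k => ⟨k + (j - i), by
    have hk : (k : ℕ) < p - j + 1 := k.2
    change k + (j - i) < p - i + 1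
    omega⟩, fun _ _ h => Nat.add_le_add_right h _⟩

lemma hom_ext_val {p q : SimplexCategory} {f g : p ⟶ q}
    (h : ∀ k, (f.toOrderHom k : ℕ) = g.toOrderHom k) : f = g :=
  SimplexCategory.Hom.ext _ _ (OrderHom.ext _ _ (funext fun k => Fin.ext (h k)))

/-- For a bisimplicial set `X` with `X_{i,j} = (X.obj j) i`, so that the inner simplicial direction
is the horizontal one, the operation `X_{i',j'} → X_{i,j}` given by `a : [i] → [i']` and
`b : [j] → [j']`. -/
def biMap (X : SimplexCategoryᵒᵖ ⥤ SSet.{w}) {i i' j j' : SimplexCategory} (a : i ⟶ i')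
    (b : j ⟶ j') (x : (X.obj (op j')).obj (op i')) : (X.obj (op j)).obj (op i) :=
  (X.map b.op).app (op i) ((X.obj (op j')).map a.op x)

lemma biMap_id (X : SimplexCategoryᵒᵖ ⥤ SSet.{w}) {i j : SimplexCategory}
    (x : (X.obj (op j)).obj (op i)) : biMap X (𝟙 i) (𝟙 j) x = x := by
  simp [biMap]

lemma biMap_biMap (X : SimplexCategoryᵒᵖ ⥤ SSet.{w}) {i i' i'' j j' j'' : SimplexCategory}
    (a : i ⟶ i') (b : j ⟶ j') (a' : i' ⟶ i'') (b' : j' ⟶ j'')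
    (x : (X.obj (op j'')).obj (op i'')) :
    biMap X a b (biMap X a' b' x) = biMap X (a ≫ a') (b ≫ b') x := by
  have := ConcreteCategory.congr_hom ((X.map b'.op).naturality a.op)
    ((X.obj (op j'')).map a'.op x)
  simp only [ConcreteCategory.comp_apply] at this
  simp only [biMap, op_comp, Functor.map_comp, NatTrans.comp_app, ConcreteCategory.comp_apply]
  rw [this]

lemma biMap_push {X Y : SimplexCategoryᵒᵖ ⥤ SSet.{w}} (φ : X ⟶ Y) {i i' j j' : SimplexCategory}
    (a : i ⟶ i') (b : j ⟶ j') (x : (X.obj (op j')).obj (op i')) :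
    (φ.app (op j)).app (op i) (biMap X a b x) =
      biMap Y a b ((φ.app (op j')).app (op i') x) := by
  have h1 := ConcreteCategory.congr_hom (congr_app (φ.naturality b.op) (op i))
    ((X.obj (op j')).map a.op x)
  have h2 := ConcreteCategory.congr_hom ((φ.app (op j')).naturality a.op) x
  simp only [NatTrans.comp_app, ConcreteCategory.comp_apply] at h1 h2
  simp only [biMap, h1, h2]

/-- A `p`-simplex of `W̄ X`, for a bisimplicial set `X`: a tuple of elements `xᵢ ∈ X_{i,p-i}`,
`0 ≤ i ≤ p`, with `∂₀ᵛ xᵢ = ∂ᵢ₊₁ʰ xᵢ₊₁` for `0 ≤ i < p`. -/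
@[ext]
structure WbarSimplex (X : SimplexCategoryᵒᵖ ⥤ SSet.{w}) (p : SimplexCategory) where
  /-- the component `xᵢ` -/
  x (i : Fin (p.len + 1)) : (X.obj (op ⦋p.len - (i : ℕ)⦌)).obj (op ⦋(i : ℕ)⦌)
  compat (i : ℕ) (hi : i < p.len) :
    biMap X (𝟙 ⦋i⦌) (tailIncl (Nat.le_succ i) hi) (x ⟨i, Nat.lt_succ_of_lt hi⟩) =
      biMap X (initIncl (Nat.le_succ i)) (𝟙 ⦋p.len - (i + 1)⦌) (x ⟨i + 1, Nat.succ_lt_succ hi⟩)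

namespace WbarSimplex

variable {X Y : SimplexCategoryᵒᵖ ⥤ SSet.{w}} {p q r : SimplexCategory}

lemma compat_of_le (s : WbarSimplex X p) (i j : ℕ) (h : i ≤ j) (hj : j < p.len + 1) :
    biMap X (𝟙 ⦋i⦌) (tailIncl h (Nat.le_of_lt_succ hj)) (s.x ⟨i, lt_of_le_of_lt h hj⟩) =
      biMap X (initIncl h) (𝟙 ⦋p.len - j⦌) (s.x ⟨j, hj⟩) := by
  induction j, h using Nat.le_induction with
  | base =>
    congr 1
    exact hom_ext_val fun k => by
      change (k : ℕ) + (i - i) = k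
      omega
  | succ j h ih =>
    have h1 := congrArg (biMap X (𝟙 ⦋i⦌) (tailIncl (Nat.le_succ j) (Nat.lt_succ_iff.mp hj)))
      (ih (by omega))
    have h2 := congrArg (biMap X (initIncl h) (𝟙 _)) (s.compat j (by omega))
    simp only [biMap_biMap, Category.id_comp, Category.comp_id] at h1 h2
    have e1 : tailIncl (Nat.le_succ j) (Nat.lt_succ_iff.mp hj) ≫
        tailIncl h (Nat.le_of_lt_succ (by omega)) =
        tailIncl (h.trans (Nat.le_succ j)) (Nat.lt_succ_iff.mp hj) := hom_ext_val fun k => by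
      change (k : ℕ) + (j + 1 - j) + (j - i) = k + (j + 1 - i)
      omega
    rw [e1] at h1
    exact h1.trans h2

/-- The simplicial operations on `W̄ X`: for `θ : [q] → [p]`, the `j`-th component of `θ^* x` is
the image of `x_{θ(j)}` under the restrictions `[j] → [θ(j)]` and `[q - j] → [p - θ(j)]` of `θ`.
For the face and degeneracy maps this gives
`∂ᵢ (x₀, …, x_p) = (∂ᵢᵛ x₀, …, ∂₁ᵛ xᵢ₋₁, ∂ᵢʰ xᵢ₊₁, …, ∂ᵢʰ x_p)` and
`σᵢ (x₀, …, x_p) = (σᵢᵛ x₀, …, σ₀ᵛ xᵢ, σᵢʰ xᵢ, …, σᵢʰ x_p)`. -/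
def pull (θ : q ⟶ p) (s : WbarSimplex X p) : WbarSimplex X q where
  x j := biMap X (initMap θ j) (tailMap θ j) (s.x (θ.toOrderHom j))
  compat j hj := by
    have hle : (θ.toOrderHom ⟨j, Nat.lt_succ_of_lt hj⟩ : ℕ) ≤
        (θ.toOrderHom ⟨j + 1, Nat.succ_lt_succ hj⟩ : ℕ) :=
      θ.toOrderHom.monotone (Nat.le_succ j)
    have := congrArg (biMap X (initMap θ ⟨j, Nat.lt_succ_of_lt hj⟩)
      (tailMap θ ⟨j + 1, Nat.succ_lt_succ hj⟩)) (s.compat_of_le _ _ hle (Fin.is_lt _))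
    simp only [biMap_biMap, Category.id_comp, Category.comp_id, Fin.eta] at this ⊢
    have e1 : tailIncl (Nat.le_succ j) hj ≫ tailMap θ ⟨j, Nat.lt_succ_of_lt hj⟩ =
        tailMap θ ⟨j + 1, Nat.succ_lt_succ hj⟩ ≫ tailIncl hle (Nat.le_of_lt_succ (Fin.is_lt _)) :=
      hom_ext_val fun k => by
        have hk : (k : ℕ) < q.len - (j + 1) + 1 := k.2
        have e2 : (⟨j + (k + (j + 1 - j)), by omega⟩ : Fin (q.len + 1)) =
            ⟨j + 1 + k, by omega⟩ := Fin.ext (by simp; omega)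
        have h3 : (θ.toOrderHom ⟨j + 1, Nat.succ_lt_succ hj⟩ : ℕ) ≤
            θ.toOrderHom ⟨j + 1 + k, by omega⟩ :=
          θ.toOrderHom.monotone (show j + 1 ≤ j + 1 + k by omega)
        change (θ.toOrderHom ⟨j + (k + (j + 1 - j)), _⟩ : ℕ) - θ.toOrderHom ⟨j, _⟩ =
          θ.toOrderHom ⟨j + 1 + k, _⟩ - θ.toOrderHom ⟨j + 1, _⟩ +
            (θ.toOrderHom ⟨j + 1, _⟩ - θ.toOrderHom ⟨j, _⟩)
        rw [e2]
        omega
    rw [e1]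
    exact this

lemma pull_id (s : WbarSimplex X p) : pull (𝟙 p) s = s := by
  ext j
  have h1 : tailMap (𝟙 p) j = 𝟙 ⦋p.len - (j : ℕ)⦌ := hom_ext_val fun k => by
    change (j : ℕ) + k - j = k
    omega
  exact (congrArg (fun t => biMap X (𝟙 ⦋(j : ℕ)⦌) t (s.x j)) h1).trans (biMap_id X _)

lemma pull_comp (η : r ⟶ q) (θ : q ⟶ p) (s : WbarSimplex X p) :
    pull (η ≫ θ) s = pull η (pull θ s) := by
  ext j
  have h1 : tailMap (η ≫ θ) j = tailMap η j ≫ tailMap θ (η.toOrderHom j) :=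
    hom_ext_val fun k => by
      have hk : (k : ℕ) < r.len - j + 1 := k.2
      have hj := j.2
      have h2 : (η.toOrderHom j : ℕ) ≤ η.toOrderHom ⟨j + k, by omega⟩ :=
        η.toOrderHom.monotone (show (j : ℕ) ≤ j + k by omega)
      have e2 : (⟨(η.toOrderHom j : ℕ) + (η.toOrderHom ⟨j + k, by omega⟩ - η.toOrderHom j),
          by have := (η.toOrderHom ⟨j + k, by omega⟩).2; omega⟩ : Fin (q.len + 1)) =
          η.toOrderHom ⟨j + k, by omega⟩ := Fin.ext (by simp; omega)
      change (θ.toOrderHom (η.toOrderHom ⟨j + k, _⟩) : ℕ) - θ.toOrderHom (η.toOrderHom j) =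
        θ.toOrderHom ⟨(η.toOrderHom j : ℕ) + (η.toOrderHom ⟨j + k, _⟩ - η.toOrderHom j), _⟩ -
          θ.toOrderHom (η.toOrderHom j)
      rw [e2]
  exact (congrArg (fun t => biMap X (initMap η j ≫ initMap θ (η.toOrderHom j)) t
    (s.x (θ.toOrderHom (η.toOrderHom j)))) h1).trans (biMap_biMap X _ _ _ _ _).symm

/-- The functoriality of `W̄ X` in `X`. -/
def push (φ : X ⟶ Y) (s : WbarSimplex X p) : WbarSimplex Y p where
  x i := (φ.app _).app _ (s.x i)
  compat i hi := by
    rw [← biMap_push, ← biMap_push, s.compat]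

end WbarSimplex

/-- The functor `W̄`, right adjoint to Illusie's total décalage, from bisimplicial sets to
simplicial sets. -/
def Wbar : (SimplexCategoryᵒᵖ ⥤ SSet.{w}) ⥤ SSet.{w} where
  obj X :=
    { obj := fun p => WbarSimplex X p.unop
      map := fun θ => ↾(WbarSimplex.pull θ.unop)
      map_id := fun p => by
        apply ConcreteCategory.hom_ext
        intro s
        exact WbarSimplex.pull_id s
      map_comp := fun θ η => by
        apply ConcreteCategory.hom_ext
        intro s
        exact WbarSimplex.pull_comp η.unop θ.unop s }
  map {X Y} φ :=
    { app := fun p => ↾(WbarSimplex.push φ)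
      naturality := fun p q θ => by
        apply ConcreteCategory.hom_ext
        intro s
        exact WbarSimplex.ext (funext fun j => biMap_push φ _ _ _) }
  map_id X := rfl
  map_comp φ ψ := rfl

/-- The derived Deligne nerve `W̄ [mmc(G)/G⁰]`, obtained by applying `W̄` to the bisimplicial set
given by the nerves of the groupoids `[mmc(G)_m/(G⁰)_m]`. -/
def derivedDelNerve : CsGrp.{w} ⥤ SSet.{w} :=
  derivedDel ⋙ (Functor.whiskeringRight _ _ _).obj nerveFunctor.{w, w} ⋙ Wbar

/-- The Deligne groupoid `Del(G) = [mc(G)/G⁰₀]`, with `mc(G) = mmc(G)₀`. -/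
def Del : CsGrp.{w} ⥤ Cat.{w, w} :=
  derivedDel ⋙ (evaluation _ _).obj (op ⦋0⦌)

/-- The underived Deligne nerve `B Del(G)`. -/
def delNerve : CsGrp.{w} ⥤ SSet.{w} :=
  Del ⋙ nerveFunctor.{w, w}

/-! ### Differential graded algebras and polynomial differential forms -/

/-- Differential graded-commutative `R`-algebras in non-negative chain degrees (over a base `R` of
characteristic `0`), presented as an algebra (the direct sum of all degrees) with a grading. -/
structure CDGA (R : Type u) [CommRing R] where
  /-- the underlying algebra -/
  carrier : Type u
  [ring : Ring carrier]
  [algebra : Algebra R carrier]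
  /-- the homogeneous components -/
  gr : ℕ → Submodule R carrier
  [graded : GradedAlgebra gr]
  /-- the differential, of degree `-1` -/
  d : carrier →ₗ[R] carrier
  d_mem {i : ℕ} {a : carrier} (ha : a ∈ gr (i + 1)) : d a ∈ gr i
  d_zero {a : carrier} (ha : a ∈ gr 0) : d a = 0
  d_d (a : carrier) : d (d a) = 0
  leibniz {i : ℕ} {a : carrier} (ha : a ∈ gr i) (b : carrier) :
    d (a * b) = d a * b + (-1 : ℤˣ) ^ i • (a * d b)
  comm {i j : ℕ} {a b : carrier} (ha : a ∈ gr i) (hb : b ∈ gr j) :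
    a * b = (-1 : ℤˣ) ^ (i * j) • (b * a)

attribute [instance] CDGA.ring CDGA.algebra CDGA.graded

namespace CDGA

variable {R : Type u} [CommRing R]

/-- Morphisms of differential graded algebras. -/
@[ext]
structure Hom (A B : CDGA R) where
  /-- the underlying algebra homomorphism -/
  hom : A.carrier →ₐ[R] B.carrier
  map_mem {i : ℕ} {a : A.carrier} (ha : a ∈ A.gr i) : hom a ∈ B.gr i
  map_d (a : A.carrier) : hom (A.d a) = B.d (hom a)

instance : Category (CDGA R) where
  Hom := Hom
  id A := ⟨AlgHom.id R A.carrier, fun h => h, fun _ => rfl⟩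
  comp f g := ⟨g.hom.comp f.hom, fun h => g.map_mem (f.map_mem h), fun a => by
    simp [f.map_d, g.map_d]⟩

end CDGA

section Forms

variable (R : Type u) [CommRing R]

/-- The relations between the generators `tᵢ = ι (inl i)` and `dtᵢ = ι (inr i)` of the algebra
`R[t₀, …, tₙ, dt₀, …, dtₙ] / (∑ tᵢ - 1, ∑ dtᵢ)`, in which the `tᵢ` have degree `0` and the `dtᵢ`
have degree `1`: graded commutativity (in characteristic `0`), `∑ tᵢ = 1` and `∑ dtᵢ = 0`. -/
inductive FormRel (n : SimplexCategory) :
    FreeAlgebra R (Fin (n.len + 1) ⊕ Fin (n.len + 1)) →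
    FreeAlgebra R (Fin (n.len + 1) ⊕ Fin (n.len + 1)) → Prop where
  /-- the `tᵢ` commute -/
  | t_t (i j : Fin (n.len + 1)) : FormRel n (FreeAlgebra.ι R (.inl i) * FreeAlgebra.ι R (.inl j))
      (FreeAlgebra.ι R (.inl j) * FreeAlgebra.ι R (.inl i))
  /-- the `tᵢ` and `dtⱼ` commute -/
  | t_dt (i j : Fin (n.len + 1)) : FormRel n (FreeAlgebra.ι R (.inl i) * FreeAlgebra.ι R (.inr j))
      (FreeAlgebra.ι R (.inr j) * FreeAlgebra.ι R (.inl i))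
  /-- the `dtᵢ` anticommute -/
  | dt_dt (i j : Fin (n.len + 1)) : FormRel n (FreeAlgebra.ι R (.inr i) * FreeAlgebra.ι R (.inr j))
      (-(FreeAlgebra.ι R (.inr j) * FreeAlgebra.ι R (.inr i)))
  /-- `∑ tᵢ = 1` -/
  | sum_t : FormRel n (∑ i, FreeAlgebra.ι R (.inl i)) 1
  /-- `∑ dtᵢ = 0` -/
  | sum_dt : FormRel n (∑ i, FreeAlgebra.ι R (.inr i)) 0

/-- The algebra `Ωₙ` of polynomial differential forms on the `n`-simplex with coefficients in `R`,
that is, the base change to `R` of `ℚ[t₀, …, tₙ, dt₀, …, dtₙ] / (∑ tᵢ - 1, ∑ dtᵢ)` if `R` is a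
`ℚ`-algebra. -/
def Forms (n : SimplexCategory) : Type u := RingQuot (FormRel R n)

instance (n : SimplexCategory) : Ring (Forms R n) := inferInstanceAs (Ring (RingQuot (FormRel R n)))

instance (n : SimplexCategory) : Algebra R (Forms R n) :=
  inferInstanceAs (Algebra R (RingQuot (FormRel R n)))

namespace Forms

variable {R} {n m l : SimplexCategory}

variable (R n) in
/-- The projection onto `Ωₙ`. -/
def mk : FreeAlgebra R (Fin (n.len + 1) ⊕ Fin (n.len + 1)) →ₐ[R] Forms R n :=
  RingQuot.mkAlgHom R (FormRel R n)

lemma mk_rel {x y : FreeAlgebra R (Fin (n.len + 1) ⊕ Fin (n.len + 1))} (h : FormRel R n x y) :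
    mk R n x = mk R n y :=
  RingQuot.mkAlgHom_rel R h

/-- The generators `tᵢ` and `dtᵢ`. -/
def gen (x : Fin (n.len + 1) ⊕ Fin (n.len + 1)) : Forms R n :=
  mk R n (FreeAlgebra.ι R x)

lemma t_t (i j : Fin (n.len + 1)) :
    (gen (.inl i) : Forms R n) * gen (.inl j) = gen (.inl j) * gen (.inl i) := by
  simpa only [gen, map_mul] using mk_rel (FormRel.t_t (R := R) i j)

lemma t_dt (i j : Fin (n.len + 1)) :
    (gen (.inl i) : Forms R n) * gen (.inr j) = gen (.inr j) * gen (.inl i) := by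
  simpa only [gen, map_mul] using mk_rel (FormRel.t_dt (R := R) i j)

lemma dt_dt (i j : Fin (n.len + 1)) :
    (gen (.inr i) : Forms R n) * gen (.inr j) = -(gen (.inr j) * gen (.inr i)) := by
  simpa only [gen, map_mul, map_neg] using mk_rel (FormRel.dt_dt (R := R) i j)

lemma sum_t : ∑ i, (gen (.inl i) : Forms R n) = 1 := by
  simpa only [gen, map_sum, map_one] using mk_rel (FormRel.sum_t (R := R) (n := n))

lemma sum_dt : ∑ i, (gen (.inr i) : Forms R n) = 0 := by
  simpa only [gen, map_sum, map_zero] using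
    mk_rel (FormRel.sum_dt (R := R) (n := n))

/-- The universal property of `Ωₙ`. -/
def lift {B : Type*} [Ring B] [Algebra R B] (f : Fin (n.len + 1) ⊕ Fin (n.len + 1) → B)
    (h₁ : ∀ i j, f (.inl i) * f (.inl j) = f (.inl j) * f (.inl i))
    (h₂ : ∀ i j, f (.inl i) * f (.inr j) = f (.inr j) * f (.inl i))
    (h₃ : ∀ i j, f (.inr i) * f (.inr j) = -(f (.inr j) * f (.inr i)))
    (h₄ : ∑ i, f (.inl i) = 1) (h₅ : ∑ i, f (.inr i) = 0) : Forms R n →ₐ[R] B :=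
  RingQuot.liftAlgHom R ⟨FreeAlgebra.lift R f, by
    rintro _ _ (⟨i, j⟩ | ⟨i, j⟩ | ⟨i, j⟩ | _ | _)
    · simpa using h₁ i j
    · simpa using h₂ i j
    · simpa using h₃ i j
    · simpa using h₄
    · simpa using h₅⟩

@[simp]
lemma lift_gen {B : Type*} [Ring B] [Algebra R B] (f : Fin (n.len + 1) ⊕ Fin (n.len + 1) → B)
    (h₁ h₂ h₃ h₄ h₅) (x) : lift (R := R) f h₁ h₂ h₃ h₄ h₅ (gen x) = f x := by
  exact (RingQuot.liftAlgHom_mkAlgHom_apply R _ _ _).trans (FreeAlgebra.lift_ι_apply f x)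

lemma algHom_ext {B : Type*} [Ring B] [Algebra R B] {f g : Forms R n →ₐ[R] B}
    (h : ∀ x, f (gen x) = g (gen x)) : f = g := by
  apply RingQuot.ringQuot_ext'
  apply FreeAlgebra.hom_ext
  funext x
  exact h x

/-- The degree in `Ωₙ` of a word in the generators: the number of letters `dtᵢ`. -/
def wordDeg (l : List (Fin (n.len + 1) ⊕ Fin (n.len + 1))) : ℕ := l.countP Sum.isRight

variable (R n) in
/-- The `k`-forms: the span of the products of generators with exactly `k` factors `dtᵢ`. -/
def gr (k : ℕ) : Submodule R (Forms R n) :=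
  Submodule.span R {x | ∃ l : List (Fin (n.len + 1) ⊕ Fin (n.len + 1)),
    wordDeg l = k ∧ (l.map gen).prod = x}

lemma word_mem (l : List (Fin (n.len + 1) ⊕ Fin (n.len + 1))) :
    ((l.map gen).prod : Forms R n) ∈ gr R n (wordDeg l) :=
  Submodule.subset_span ⟨l, rfl, rfl⟩

lemma t_mem (i) : (gen (.inl i) : Forms R n) ∈ gr R n 0 := by
  simpa [wordDeg] using word_mem (R := R) [Sum.inl i]

lemma dt_mem (i) : (gen (.inr i) : Forms R n) ∈ gr R n 1 := by
  simpa [wordDeg] using word_mem (R := R) [Sum.inr i]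

instance : SetLike.GradedMonoid (gr R n) where
  one_mem := by simpa [wordDeg] using word_mem (R := R) (n := n) []
  mul_mem i j x y hx hy := by
    have : gr R n i * gr R n j ≤ gr R n (i + j) := by
      rw [gr, gr, Submodule.span_mul_span, Submodule.span_le]
      rintro _ ⟨_, ⟨l, rfl, rfl⟩, _, ⟨l', rfl, rfl⟩, rfl⟩
      have := word_mem (R := R) (l ++ l')
      simpa [wordDeg] using this
    exact this (Submodule.mul_mem_mul hx hy)

/-- The class of a homogeneous element in the direct sum of the homogeneous components. -/
def ofGr {k : ℕ} (x : Forms R n) (hx : x ∈ gr R n k) : DirectSum ℕ fun k => gr R n k :=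
  DirectSum.of (fun k => gr R n k) k ⟨x, hx⟩

lemma ofGr_mul {i j k : ℕ} (h : i + j = k) {x y : Forms R n} (hx : x ∈ gr R n i)
    (hy : y ∈ gr R n j) :
    ofGr x hx * ofGr y hy = ofGr (k := k) (x * y) (h ▸ SetLike.mul_mem_graded hx hy) := by
  subst h
  exact DirectSum.of_mul_of _ _

lemma ofGr_congr {k : ℕ} {x y : Forms R n} (h : x = y) (hx : x ∈ gr R n k) :
    ofGr x hx = ofGr y (h ▸ hx) := by
  subst h; rfl

/-- The decomposition of a form into its homogeneous components. -/
def toSum : Forms R n →ₐ[R] DirectSum ℕ fun k => gr R n k :=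
  lift (R := R) (n := n) (Sum.elim (fun i => ofGr (gen (R := R) (n := n) (.inl i)) (t_mem i))
      fun i => ofGr (gen (R := R) (n := n) (.inr i)) (dt_mem i))
    (fun i j => by
      simp only [Sum.elim_inl]
      rw [ofGr_mul (zero_add 0), ofGr_mul (zero_add 0)]
      exact ofGr_congr (t_t i j) _)
    (fun i j => by
      simp only [Sum.elim_inl, Sum.elim_inr]
      rw [ofGr_mul (zero_add 1), ofGr_mul (add_zero 1)]
      exact ofGr_congr (t_dt i j) _)
    (fun i j => by
      simp only [Sum.elim_inr]
      rw [ofGr_mul (k := 2) rfl, ofGr_mul (k := 2) rfl, ofGr_congr (dt_dt i j)]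
      exact map_neg (DirectSum.of (fun k => gr R n k) 2) ⟨_, _⟩)
    (by
      simp only [Sum.elim_inl, ofGr]
      rw [← map_sum]
      refine congrArg (DirectSum.of (fun k => gr R n k) 0) (Subtype.ext ?_)
      simp [sum_t])
    (by
      simp only [Sum.elim_inr, ofGr]
      rw [← map_sum, ← map_zero (DirectSum.of (fun k => gr R n k) 1)]
      refine congrArg (DirectSum.of (fun k => gr R n k) 1) (Subtype.ext ?_)
      simp [sum_dt])

lemma toSum_word (l : List (Fin (n.len + 1) ⊕ Fin (n.len + 1))) :
    toSum ((l.map gen).prod : Forms R n) = ofGr (l.map gen).prod (word_mem l) := by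
  induction l with
  | nil => simp [ofGr]; rfl
  | cons a l ih =>
    obtain i | i := a
    · have : toSum (gen (.inl i) : Forms R n) = ofGr (gen (.inl i)) (t_mem i) := by simp [toSum]
      simp only [List.map_cons, List.prod_cons, map_mul, ih, this]
      exact ofGr_mul (by simp [wordDeg]) _ _
    · have : toSum (gen (.inr i) : Forms R n) = ofGr (gen (.inr i)) (dt_mem i) := by simp [toSum]
      simp only [List.map_cons, List.prod_cons, map_mul, ih, this]
      exact ofGr_mul (by simp [wordDeg, List.countP_cons, add_comm]) _ _

instance : GradedAlgebra (gr R n) :=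
  GradedAlgebra.ofAlgHom _ toSum
    (algHom_ext fun x => by
      obtain i | i := x <;> simp [toSum, ofGr])
    (fun k x => by
      obtain ⟨x, hx⟩ := x
      change toSum x = ofGr x hx
      refine Submodule.span_induction (p := fun x hx => toSum x = ofGr x hx) ?_ ?_ ?_ ?_ hx
      · rintro _ ⟨l, rfl, rfl⟩
        exact toSum_word l
      · simp only [map_zero, ofGr]
        exact (map_zero (DirectSum.of (fun k => gr R n k) k)).symm
      · intro x y hx hy h h'
        rw [map_add, h, h']
        exact (map_add (DirectSum.of (fun k => gr R n k) k) ⟨x, hx⟩ ⟨y, hy⟩).symm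
      · intro r x hx h
        rw [map_smul, h]
        exact (map_smul (DirectSum.lof R ℕ (fun k => gr R n k) k) r ⟨x, hx⟩).symm)

/-! #### The de Rham differential -/

lemma mul_upper {B : Type*} [Ring B] (a b c a' b' c' : B) :
    !![a, b; 0, c] * !![a', b'; 0, c'] = !![a * a', a * b' + b * c'; 0, c * c'] := by
  simp

variable (R n) in
/-- The algebra homomorphism `ω ↦ [(-1)ᵏ ω, dω; 0, ω]` (for `ω` of degree `k`) which encodes the
derivation `d` with `d(tᵢ) = dtᵢ` and `d(dtᵢ) = 0`. -/
def jet : Forms R n →ₐ[R] Matrix (Fin 2) (Fin 2) (Forms R n) :=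
  lift (R := R) (n := n)
    (Sum.elim (fun i => !![gen (.inl i), gen (.inr i); 0, gen (.inl i)])
      fun i => !![-gen (.inr i), 0; 0, gen (.inr i)])
    (fun i j => by
      simp only [Sum.elim_inl, mul_upper, t_t (R := R) i j, t_dt (R := R) i j, ← t_dt (R := R) j i,
        add_comm])
    (fun i j => by
      simp only [Sum.elim_inl, Sum.elim_inr, mul_upper, t_dt (R := R) i j, dt_dt (R := R) i j]
      simp [t_dt (R := R) i j])
    (fun i j => by
      simp only [Sum.elim_inr, mul_upper, dt_dt (R := R) i j]
      ext a b
      fin_cases a <;> fin_cases b <;> simp [dt_dt (R := R) i j])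
    (by
      have := sum_t (R := R) (n := n)
      have h' := sum_dt (R := R) (n := n)
      ext a b
      fin_cases a <;> fin_cases b <;> simp [Matrix.sum_apply, this, h'])
    (by
      have h' := sum_dt (R := R) (n := n)
      ext a b
      fin_cases a <;> fin_cases b <;> simp [Matrix.sum_apply, h'])

variable (R n) in
/-- The de Rham differential on `Ωₙ`. -/
def dform : Forms R n →ₗ[R] Forms R n where
  toFun ω := jet R n ω 0 1
  map_add' := by simp
  map_smul' := by simp

lemma jet_word (l : List (Fin (n.len + 1) ⊕ Fin (n.len + 1))) :
    jet R n (l.map gen).prod = !![(-1 : ℤˣ) ^ wordDeg l • (l.map gen).prod,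
      dform R n (l.map gen).prod; 0, (l.map gen).prod] := by
  suffices h : jet R n (l.map gen).prod 0 0 = (-1 : ℤˣ) ^ wordDeg l • (l.map gen).prod ∧
      jet R n (l.map gen).prod 1 0 = 0 ∧ jet R n (l.map gen).prod 1 1 = (l.map gen).prod by
    ext a b
    fin_cases a <;> fin_cases b <;> simp [h, dform]
  induction l with
  | nil => simp [wordDeg]
  | cons x l ih =>
    obtain ⟨h₁, h₂, h₃⟩ := ih
    simp only [List.map_cons, List.prod_cons, map_mul, Matrix.mul_apply, Fin.sum_univ_two, h₁, h₂,
      h₃]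
    obtain i | i := x
    · simp [jet, wordDeg, mul_smul_comm]
    · simp [jet, wordDeg, List.countP_cons, pow_succ, mul_smul_comm]

lemma jet_of_mem {k : ℕ} {ω : Forms R n} (hω : ω ∈ gr R n k) :
    jet R n ω = !![(-1 : ℤˣ) ^ k • ω, dform R n ω; 0, ω] := by
  refine Submodule.span_induction (p := fun ω _ =>
    jet R n ω = !![(-1 : ℤˣ) ^ k • ω, dform R n ω; 0, ω]) ?_ ?_ ?_ ?_ hω
  · rintro _ ⟨l, rfl, rfl⟩
    exact jet_word l
  · ext a b
    fin_cases a <;> fin_cases b <;> simp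
  · intro x y _ _ hx hy
    rw [map_add, hx, hy]
    ext a b
    fin_cases a <;> fin_cases b <;> simp
  · intro r x _ hx
    rw [map_smul, hx]
    ext a b
    fin_cases a <;> fin_cases b <;> simp [smul_comm r]

lemma jet_one_one (ω : Forms R n) : jet R n ω 1 1 = ω := by
  classical
  rw [← DirectSum.sum_support_decompose (gr R n) ω]
  simp only [map_sum, Matrix.sum_apply]
  exact Finset.sum_congr rfl fun k _ => by
    rw [jet_of_mem (SetLike.coe_mem (DirectSum.decompose (gr R n) ω k))]
    rfl

lemma dform_gen_inl (i) : dform R n (gen (.inl i)) = gen (.inr i) := by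
  simp [dform, jet]

lemma dform_gen_inr (i) : dform R n (gen (.inr i)) = 0 := by
  simp [dform, jet]

lemma dform_mul {k : ℕ} {ω : Forms R n} (hω : ω ∈ gr R n k) (η : Forms R n) :
    dform R n (ω * η) = dform R n ω * η + (-1 : ℤˣ) ^ k • (ω * dform R n η) := by
  have : jet R n (ω * η) 0 1 = (jet R n ω * jet R n η) 0 1 := by rw [map_mul]
  rw [Matrix.mul_apply, Fin.sum_univ_two, jet_one_one, jet_of_mem hω] at this
  change jet R n (ω * η) 0 1 = dform R n ω * η + (-1 : ℤˣ) ^ k • (ω * jet R n η 0 1)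
  rw [this, add_comm]
  simp [smul_mul_assoc]

lemma dform_word_mem (l : List (Fin (n.len + 1) ⊕ Fin (n.len + 1))) :
    dform R n (l.map gen).prod ∈ gr R n (wordDeg l + 1) := by
  induction l with
  | nil => simp [dform]
  | cons x l ih =>
    simp only [List.map_cons, List.prod_cons]
    obtain i | i := x
    · have e : wordDeg (Sum.inl i :: l) = wordDeg l := by simp [wordDeg]
      rw [dform_mul (t_mem i), dform_gen_inl, e, pow_zero, one_smul]
      refine add_mem ?_ ?_
      · rw [add_comm]
        exact SetLike.mul_mem_graded (dt_mem i) (word_mem l)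
      · have := SetLike.mul_mem_graded (t_mem i) ih
        rwa [zero_add] at this
    · have e : wordDeg (Sum.inr i :: l) = 1 + wordDeg l := by
        simp [wordDeg, List.countP_cons, add_comm]
      rw [dform_mul (dt_mem i), dform_gen_inr, e, pow_one, zero_mul, zero_add, add_assoc]
      have := SetLike.mul_mem_graded (dt_mem i) ih
      simpa using this

lemma dform_mem {k : ℕ} {ω : Forms R n} (hω : ω ∈ gr R n k) : dform R n ω ∈ gr R n (k + 1) := by
  refine Submodule.span_induction (p := fun ω _ => dform R n ω ∈ gr R n (k + 1)) ?_ ?_ ?_ ?_ hω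
  · rintro _ ⟨l, rfl, rfl⟩
    exact dform_word_mem l
  · simp
  · intro x y _ _ hx hy
    rw [map_add]
    exact add_mem hx hy
  · intro r x _ hx
    rw [map_smul]
    exact Submodule.smul_mem _ r hx

lemma gen_word_comm (x : Fin (n.len + 1) ⊕ Fin (n.len + 1))
    (l : List (Fin (n.len + 1) ⊕ Fin (n.len + 1))) :
    (gen x : Forms R n) * (l.map gen).prod =
      (-1 : ℤˣ) ^ (wordDeg [x] * wordDeg l) • ((l.map gen).prod * gen x) := by
  have h (y : Fin (n.len + 1) ⊕ Fin (n.len + 1)) : (gen x : Forms R n) * gen y =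
      (-1 : ℤˣ) ^ (wordDeg [x] * wordDeg [y]) • (gen y * gen x) := by
    obtain i | i := x <;> obtain j | j := y
    · simp [wordDeg, t_t i j]
    · simp [wordDeg, t_dt i j]
    · simp [wordDeg, t_dt j i]
    · simp [wordDeg, dt_dt i j]
  induction l with
  | nil => simp [wordDeg]
  | cons y l ih =>
    have e : wordDeg (y :: l) = wordDeg [y] + wordDeg l := by
      simp [wordDeg, List.countP_cons, add_comm]
    rw [List.map_cons, List.prod_cons, ← mul_assoc, h, smul_mul_assoc, mul_assoc, ih,
      mul_smul_comm, smul_smul, e, mul_add, pow_add, mul_assoc]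

lemma word_word_comm (l l' : List (Fin (n.len + 1) ⊕ Fin (n.len + 1))) :
    ((l.map gen).prod : Forms R n) * (l'.map gen).prod =
      (-1 : ℤˣ) ^ (wordDeg l * wordDeg l') • ((l'.map gen).prod * (l.map gen).prod) := by
  induction l with
  | nil => simp [wordDeg]
  | cons y l ih =>
    have e : wordDeg (y :: l) = wordDeg [y] + wordDeg l := by
      simp [wordDeg, List.countP_cons, add_comm]
    rw [List.map_cons, List.prod_cons, mul_assoc, ih, mul_smul_comm, ← mul_assoc, gen_word_comm,
      smul_mul_assoc, smul_smul, e, add_mul, pow_add, mul_assoc, mul_comm ((-1 : ℤˣ) ^ _)]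

lemma gr_comm {i j : ℕ} {ω η : Forms R n} (hω : ω ∈ gr R n i) (hη : η ∈ gr R n j) :
    ω * η = (-1 : ℤˣ) ^ (i * j) • (η * ω) := by
  refine Submodule.span_induction₂
    (p := fun ω η _ _ => ω * η = (-1 : ℤˣ) ^ (i * j) • (η * ω)) ?_ ?_ ?_ ?_ ?_ ?_ ?_ hω hη
  · rintro _ _ ⟨l, rfl, rfl⟩ ⟨l', rfl, rfl⟩
    exact word_word_comm l l'
  · simp
  · simp
  · intro x y z _ _ _ h h'
    rw [add_mul, mul_add, smul_add, h, h']
  · intro x y z _ _ _ h h'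
    rw [add_mul, mul_add, smul_add, h, h']
  · intro r x y _ _ h
    rw [smul_mul_assoc, mul_smul_comm, h, smul_comm]
  · intro r x y _ _ h
    rw [smul_mul_assoc, mul_smul_comm, h, smul_comm]

/-! #### Functoriality in the simplex -/

/-- The restriction of forms along a map `[m] → [n]`: the algebra homomorphism with
`tᵢ ↦ ∑_{θ(j) = i} tⱼ` and `dtᵢ ↦ ∑_{θ(j) = i} dtⱼ`. -/
def pull (θ : m ⟶ n) : Forms R n →ₐ[R] Forms R m :=
  lift (R := R) (n := n)
    (Sum.elim (fun i => ∑ j with θ.toOrderHom j = i, gen (.inl j))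
      fun i => ∑ j with θ.toOrderHom j = i, gen (.inr j))
    (fun i j => by
      simp only [Sum.elim_inl, Finset.sum_mul_sum]
      rw [Finset.sum_comm]
      exact Finset.sum_congr rfl fun _ _ => Finset.sum_congr rfl fun _ _ => t_t _ _)
    (fun i j => by
      simp only [Sum.elim_inl, Sum.elim_inr, Finset.sum_mul_sum]
      rw [Finset.sum_comm]
      exact Finset.sum_congr rfl fun _ _ => Finset.sum_congr rfl fun _ _ => t_dt _ _)
    (fun i j => by
      simp only [Sum.elim_inr, Finset.sum_mul_sum, ← Finset.sum_neg_distrib]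
      rw [Finset.sum_comm]
      exact Finset.sum_congr rfl fun _ _ => Finset.sum_congr rfl fun _ _ => dt_dt _ _)
    (by
      simp only [Sum.elim_inl]
      rw [Finset.sum_fiberwise, sum_t])
    (by
      simp only [Sum.elim_inr]
      rw [Finset.sum_fiberwise, sum_dt])

lemma pull_gen_inl (θ : m ⟶ n) (i) :
    pull (R := R) θ (gen (.inl i)) = ∑ j with θ.toOrderHom j = i, gen (.inl j) := by
  simp [pull]

lemma pull_gen_inr (θ : m ⟶ n) (i) :
    pull (R := R) θ (gen (.inr i)) = ∑ j with θ.toOrderHom j = i, gen (.inr j) := by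
  simp [pull]

lemma pull_id : pull (R := R) (𝟙 n) = AlgHom.id R _ := by
  refine algHom_ext fun x => ?_
  obtain i | i := x
  · rw [pull_gen_inl]
    simp [Finset.filter_eq']
  · rw [pull_gen_inr]
    simp [Finset.filter_eq']

lemma pull_comp (η : l ⟶ m) (θ : m ⟶ n) :
    pull (R := R) (η ≫ θ) = (pull η).comp (pull θ) := by
  have h {X : Type u} [AddCommMonoid X] (f : Fin (l.len + 1) → X) (i : Fin (n.len + 1)) :
      ∑ j with (η ≫ θ).toOrderHom j = i, f j =
        ∑ k with θ.toOrderHom k = i, ∑ j with η.toOrderHom j = k, f j := by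
    rw [← Finset.sum_fiberwise_of_maps_to (g := η.toOrderHom)
      (t := Finset.univ.filter fun k => θ.toOrderHom k = i) (by simp)]
    refine Finset.sum_congr rfl fun k hk => Finset.sum_congr ?_ fun _ _ => rfl
    ext j
    simp only [Finset.mem_filter, Finset.mem_univ, true_and] at hk ⊢
    refine ⟨fun h => h.2, fun h => ⟨?_, h⟩⟩
    rw [← hk, ← h]
    rfl
  refine algHom_ext fun x => ?_
  obtain i | i := x
  · simp only [AlgHom.comp_apply, pull_gen_inl, map_sum, h]
  · simp only [AlgHom.comp_apply, pull_gen_inr, map_sum, h]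

lemma pull_dform (θ : m ⟶ n) (ω : Forms R n) :
    pull θ (dform R n ω) = dform R m (pull θ ω) := by
  have : (pull (R := R) θ).mapMatrix.comp (jet R n) = (jet R m).comp (pull θ) := by
    refine algHom_ext fun x => ?_
    obtain i | i := x
    · ext a b
      fin_cases a <;> fin_cases b <;> simp [jet, pull, Matrix.sum_apply]
    · ext a b
      fin_cases a <;> fin_cases b <;> simp [jet, pull, Matrix.sum_apply]
  exact congrFun (congrFun (DFunLike.congr_fun this ω) 0) 1

lemma pull_mem (θ : m ⟶ n) {k : ℕ} {ω : Forms R n} (hω : ω ∈ gr R n k) :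
    pull θ ω ∈ gr R m k := by
  refine Submodule.span_induction (p := fun ω _ => pull θ ω ∈ gr R m k) ?_ ?_ ?_ ?_ hω
  · rintro _ ⟨l, rfl, rfl⟩
    clear hω
    induction l with
    | nil => simpa [wordDeg] using word_mem (R := R) (n := m) []
    | cons x l ih =>
      rw [List.map_cons, List.prod_cons, map_mul]
      obtain i | i := x
      · have e : wordDeg (Sum.inl i :: l) = 0 + wordDeg l := by simp [wordDeg]
        rw [e, pull_gen_inl]
        exact SetLike.mul_mem_graded (sum_mem fun j _ => t_mem j) ih
      · have e : wordDeg (Sum.inr i :: l) = 1 + wordDeg l := by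
          simp [wordDeg, List.countP_cons, add_comm]
        rw [e, pull_gen_inr]
        exact SetLike.mul_mem_graded (sum_mem fun j _ => dt_mem j) ih
  · simp
  · intro x y _ _ hx hy
    rw [map_add]
    exact add_mem hx hy
  · intro r x _ hx
    rw [map_smul]
    exact Submodule.smul_mem _ r hx

end Forms
end Forms

/-! ### The simplicial algebra of degree `0` elements of `A^{Δⁿ}` -/

namespace CDGA

open TensorProduct GradedTensorProduct

variable {R : Type u} [CommRing R]

/-- The sign involution `a ↦ (-1)ⁱ a` for `a` homogeneous of degree `i`. -/
def sgn (A : CDGA R) : A.carrier →ₗ[R] A.carrier :=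
  DirectSum.toModule R ℕ A.carrier (fun i => (-1 : ℤˣ) ^ i • (A.gr i).subtype) ∘ₗ
    (DirectSum.decomposeLinearEquiv A.gr).toLinearMap

lemma sgn_of_mem (A : CDGA R) {i : ℕ} {a : A.carrier} (ha : a ∈ A.gr i) :
    A.sgn a = (-1 : ℤˣ) ^ i • a := by
  lift a to A.gr i using ha
  simp [sgn]

/-- The graded-commutative algebra `A ⊗ Ωₙ`, in which the elements of `Aᵢ ⊗ Ωₙʲ` have chain degree
`i - j`. The tensor product over `R` of `A` with the forms with coefficients in `R` is the same as
the tensor product over `ℚ` of `A` with the forms with coefficients in `ℚ`. -/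
abbrev TensorForms (A : CDGA R) (n : SimplexCategory) := A.gr ᵍ⊗[R] (Forms.gr R n)

/-- The differential `a ⊗ ω ↦ da ⊗ ω + (-1)ⁱ a ⊗ dω`, for `a` of degree `i`, of `A ⊗ Ωₙ`. -/
def tensorD (A : CDGA R) (n : SimplexCategory) : A.TensorForms n →ₗ[R] A.TensorForms n :=
  (of R A.gr (Forms.gr R n)).toLinearMap ∘ₗ
    (TensorProduct.map A.d LinearMap.id + TensorProduct.map A.sgn (Forms.dform R n)) ∘ₗ
    (of R A.gr (Forms.gr R n)).symm.toLinearMap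

/-- The elements of degree `0` of `A ⊗ Ωₙ`: the sum of the submodules `Aᵢ ⊗ Ωₙⁱ`. -/
def tensorZero (A : CDGA R) (n : SimplexCategory) : Submodule R (A.TensorForms n) :=
  Submodule.span R {x | ∃ i, ∃ a ∈ A.gr i, ∃ ω ∈ Forms.gr R n i, a ᵍ⊗ₜ[R] ω = x}

variable (A : CDGA R) {n m l : SimplexCategory}

lemma map_sign {M N : Type*} [AddCommGroup M] [AddCommGroup N] {F : Type*} [FunLike F M N]
    [AddMonoidHomClass F M N] (f : F) (s : ℤˣ) (x : M) : f (s • x) = s • f x := by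
  obtain rfl | rfl := Int.units_eq_one_or s <;> simp

lemma tmul_mul_tmul {i j : ℕ} (a : A.carrier) {ω : Forms R n} (hω : ω ∈ Forms.gr R n j)
    {b : A.carrier} (hb : b ∈ A.gr i) (η : Forms R n) :
    (a ᵍ⊗ₜ[R] ω * b ᵍ⊗ₜ[R] η : A.TensorForms n) =
      (-1 : ℤˣ) ^ (j * i) • ((a * b) ᵍ⊗ₜ[R] (ω * η)) :=
  tmul_coe_mul_coe_tmul A.gr (Forms.gr R n) a ⟨ω, hω⟩ ⟨b, hb⟩ η

lemma tmul_smul' (s : ℤˣ) (a : A.carrier) (ω : Forms R n) :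
    (a ᵍ⊗ₜ[R] (s • ω) : A.TensorForms n) = s • (a ᵍ⊗ₜ[R] ω) := by
  obtain rfl | rfl := Int.units_eq_one_or s
  · simp
  · simp [GradedTensorProduct.tmul, TensorProduct.tmul_neg]

lemma smul_tmul_sign (s : ℤˣ) (a : A.carrier) (ω : Forms R n) :
    ((s • a) ᵍ⊗ₜ[R] ω : A.TensorForms n) = s • (a ᵍ⊗ₜ[R] ω) := by
  obtain rfl | rfl := Int.units_eq_one_or s
  · simp
  · simp [GradedTensorProduct.tmul, TensorProduct.neg_tmul]

lemma tensorD_tmul {i : ℕ} {a : A.carrier} (ha : a ∈ A.gr i) (ω : Forms R n) :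
    A.tensorD n (a ᵍ⊗ₜ[R] ω) =
      A.d a ᵍ⊗ₜ[R] ω + (-1 : ℤˣ) ^ i • (a ᵍ⊗ₜ[R] Forms.dform R n ω) := by
  rw [← smul_tmul_sign, ← A.sgn_of_mem ha]
  rfl

lemma tensorD_mul {x y : A.TensorForms n} (hx : x ∈ A.tensorZero n) (hy : y ∈ A.tensorZero n) :
    A.tensorD n (x * y) = A.tensorD n x * y + x * A.tensorD n y := by
  refine Submodule.span_induction₂
    (p := fun x y _ _ => A.tensorD n (x * y) = A.tensorD n x * y + x * A.tensorD n y)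
    ?_ ?_ ?_ ?_ ?_ ?_ ?_ hx hy
  · rintro _ _ ⟨i, a, ha, ω, hω, rfl⟩ ⟨j, b, hb, η, hη, rfl⟩
    have hab : a * b ∈ A.gr (i + j) := SetLike.mul_mem_graded ha hb
    have e : (a ᵍ⊗ₜ[R] ω * A.d b ᵍ⊗ₜ[R] η : A.TensorForms n) =
        (-1 : ℤˣ) ^ (i * j) • (-1 : ℤˣ) ^ i • ((a * A.d b) ᵍ⊗ₜ[R] (ω * η)) := by
      obtain _ | j := j
      · simp [A.d_zero hb, GradedTensorProduct.tmul]
      · rw [tmul_mul_tmul A a hω (A.d_mem hb), smul_smul, mul_add, pow_add, mul_assoc, mul_one,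
          Int.units_mul_self, mul_one]
    rw [tmul_mul_tmul A a hω hb, map_sign, A.tensorD_tmul hab, A.tensorD_tmul ha,
      A.tensorD_tmul hb, A.leibniz ha, Forms.dform_mul hω, add_mul, mul_add, smul_mul_assoc,
      mul_smul_comm, tmul_mul_tmul A (A.d a) hω hb, tmul_mul_tmul A a (Forms.dform_mem hω) hb,
      tmul_mul_tmul A a hω hb, e, add_mul, pow_add, pow_add, one_mul]
    generalize A.d a * b = p
    generalize a * A.d b = q
    generalize Forms.dform R n ω * η = r
    generalize ω * Forms.dform R n η = t
    simp only [GradedTensorProduct.tmul, TensorProduct.add_tmul, TensorProduct.tmul_add, map_add]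
    change _ • ((p ᵍ⊗ₜ[R] (ω * η)) + (_ • q) ᵍ⊗ₜ[R] (ω * η) +
      _ • (((a * b) ᵍ⊗ₜ[R] r) + (a * b) ᵍ⊗ₜ[R] (_ • t))) = _
    rw [smul_tmul_sign, tmul_smul']
    obtain h | h := Int.units_eq_one_or ((-1 : ℤˣ) ^ (i * j)) <;>
    obtain h' | h' := Int.units_eq_one_or ((-1 : ℤˣ) ^ i) <;>
    obtain h'' | h'' := Int.units_eq_one_or ((-1 : ℤˣ) ^ j) <;>
    rw [h, h', h''] <;> simp [GradedTensorProduct.tmul] <;> abel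
  · simp
  · simp
  · intro x y z _ _ _ h h'
    rw [add_mul, map_add, map_add, add_mul, add_mul, h, h']
    abel
  · intro x y z _ _ _ h h'
    rw [mul_add, map_add, map_add, mul_add, mul_add, h, h']
    abel
  · intro r x y _ _ h
    rw [smul_mul_assoc, map_smul, map_smul, h, smul_add, smul_mul_assoc, smul_mul_assoc]
  · intro r x y _ _ h
    rw [mul_smul_comm, map_smul, map_smul, h, smul_add, mul_smul_comm, mul_smul_comm]

lemma tensorZero_comm {x y : A.TensorForms n} (hx : x ∈ A.tensorZero n)
    (hy : y ∈ A.tensorZero n) : x * y = y * x := by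
  refine Submodule.span_induction₂ (p := fun x y _ _ => x * y = y * x)
    ?_ ?_ ?_ ?_ ?_ ?_ ?_ hx hy
  · rintro _ _ ⟨i, a, ha, ω, hω, rfl⟩ ⟨j, b, hb, η, hη, rfl⟩
    rw [tmul_mul_tmul A a hω hb, tmul_mul_tmul A b hη ha, A.comm ha hb, Forms.gr_comm hω hη,
      smul_tmul_sign, tmul_smul', mul_comm j i, smul_smul, smul_smul, Int.units_mul_self, one_mul]
  · simp
  · simp
  · intro x y z _ _ _ h h'
    rw [add_mul, mul_add, h, h']
  · intro x y z _ _ _ h h'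
    rw [add_mul, mul_add, h, h']
  · intro r x y _ _ h
    rw [smul_mul_assoc, mul_smul_comm, h]
  · intro r x y _ _ h
    rw [smul_mul_assoc, mul_smul_comm, h]

lemma tensorZero_one : (1 : A.TensorForms n) ∈ A.tensorZero n :=
  Submodule.subset_span ⟨0, 1, SetLike.one_mem_graded _, 1, SetLike.one_mem_graded _, rfl⟩

lemma tensorZero_mul {x y : A.TensorForms n} (hx : x ∈ A.tensorZero n)
    (hy : y ∈ A.tensorZero n) : x * y ∈ A.tensorZero n := by
  have : A.tensorZero n * A.tensorZero n ≤ A.tensorZero n := by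
    rw [tensorZero, Submodule.span_mul_span, Submodule.span_le]
    rintro _ ⟨_, ⟨i, a, ha, ω, hω, rfl⟩, _, ⟨j, b, hb, η, hη, rfl⟩, rfl⟩
    dsimp only
    rw [tmul_mul_tmul A a hω hb, ← tmul_smul']
    refine Submodule.subset_span ⟨i + j, a * b, SetLike.mul_mem_graded ha hb, _, ?_, rfl⟩
    obtain h | h := Int.units_eq_one_or ((-1 : ℤˣ) ^ (i * j))
    · rw [h, one_smul]
      exact SetLike.mul_mem_graded hω hη
    · rw [h, Units.neg_smul, one_smul]
      exact neg_mem (SetLike.mul_mem_graded hω hη)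
  exact this (Submodule.mul_mem_mul hx hy)

/-- The ring `(A^{Δⁿ})₀`, where `A^{Δⁿ} = τ_{≥ 0}(A ⊗ Ωₙ)` is the good truncation: the cycles of
degree `0` in `A ⊗ Ωₙ`. -/
def pathZero (A : CDGA R) (n : SimplexCategory) : Subalgebra R (A.TensorForms n) where
  carrier := {x | x ∈ A.tensorZero n ∧ A.tensorD n x = 0}
  mul_mem' hx hy := ⟨A.tensorZero_mul hx.1 hy.1, by
    rw [A.tensorD_mul hx.1 hy.1, hx.2, hy.2]
    simp⟩
  add_mem' hx hy := ⟨add_mem hx.1 hy.1, by rw [map_add, hx.2, hy.2, add_zero]⟩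
  algebraMap_mem' r := by
    rw [Algebra.algebraMap_eq_smul_one]
    refine ⟨Submodule.smul_mem _ r A.tensorZero_one, ?_⟩
    have h := A.tensorD_mul (n := n) A.tensorZero_one A.tensorZero_one
    rw [mul_one, mul_one, one_mul, left_eq_add] at h
    rw [map_smul, h, smul_zero]

instance : CommRing (A.pathZero n) where
  mul_comm x y := Subtype.ext (A.tensorZero_comm x.2.1 y.2.1)

variable {A} {B C : CDGA R}

/-- The algebra homomorphism `A ⊗ Ωₙ → B ⊗ Ωₘ` induced by `A ⟶ B` and `m ⟶ n`. -/
def tensorMap (f : A ⟶ B) (θ : m ⟶ n) : A.TensorForms n →ₐ[R] B.TensorForms m :=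
  GradedTensorProduct.lift A.gr (Forms.gr R n)
    ((includeLeft B.gr (Forms.gr R m)).comp f.hom)
    ((includeRight B.gr (Forms.gr R m)).comp (Forms.pull θ))
    (fun i j a b => by
      have h := tmul_mul_tmul B 1 (Forms.pull_mem θ b.2) (f.map_mem a.2) 1
      have h' := tmul_one_mul_one_tmul B.gr (Forms.gr R m) (f.hom a) (Forms.pull θ b)
      rw [one_mul, mul_one] at h
      change (f.hom a ᵍ⊗ₜ[R] (1 : Forms R m) * (1 : B.carrier) ᵍ⊗ₜ[R] Forms.pull θ b :
        B.TensorForms m) = (-1 : ℤˣ) ^ (j * i) •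
          ((1 : B.carrier) ᵍ⊗ₜ[R] Forms.pull θ b * f.hom a ᵍ⊗ₜ[R] (1 : Forms R m))
      rw [h, h', smul_smul, Int.units_mul_self, one_smul])

lemma tensorMap_tmul (f : A ⟶ B) (θ : m ⟶ n) (a : A.carrier) (ω : Forms R n) :
    tensorMap f θ (a ᵍ⊗ₜ[R] ω) = f.hom a ᵍ⊗ₜ[R] Forms.pull θ ω :=
  tmul_one_mul_one_tmul B.gr (Forms.gr R m) (f.hom a) (Forms.pull θ ω)

lemma tensorMap_mem (f : A ⟶ B) (θ : m ⟶ n) {x : A.TensorForms n} (hx : x ∈ A.pathZero n) :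
    tensorMap f θ x ∈ B.pathZero m := by
  have h : tensorMap f θ x ∈ B.tensorZero m ∧
      B.tensorD m (tensorMap f θ x) = tensorMap f θ (A.tensorD n x) := by
    refine Submodule.span_induction (p := fun x _ => tensorMap f θ x ∈ B.tensorZero m ∧
      B.tensorD m (tensorMap f θ x) = tensorMap f θ (A.tensorD n x)) ?_ ?_ ?_ ?_ hx.1
    · rintro _ ⟨i, a, ha, ω, hω, rfl⟩
      rw [tensorMap_tmul, B.tensorD_tmul (f.map_mem ha), A.tensorD_tmul ha, map_add,
        map_sign, tensorMap_tmul, tensorMap_tmul, f.map_d, Forms.pull_dform]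
      exact ⟨Submodule.subset_span ⟨i, _, f.map_mem ha, _, Forms.pull_mem θ hω, rfl⟩, rfl⟩
    · simp
    · intro x y _ _ hx hy
      simp only [map_add, hx.2, hy.2, and_true]
      exact add_mem hx.1 hy.1
    · intro r x _ hx
      simp only [map_smul, hx.2, and_true]
      exact Submodule.smul_mem _ r hx.1
  exact ⟨h.1, by rw [h.2, hx.2, map_zero]⟩

/-- The ring homomorphism `(A^{Δⁿ})₀ → (B^{Δᵐ})₀` induced by `A ⟶ B` and `m ⟶ n`. -/
def pathMap (f : A ⟶ B) (θ : m ⟶ n) : A.pathZero n →ₐ[R] B.pathZero m :=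
  ((tensorMap f θ).comp (A.pathZero n).val).codRestrict (B.pathZero m)
    fun x => tensorMap_mem f θ x.2

lemma tensorMap_id : tensorMap (𝟙 A) (𝟙 n) = AlgHom.id R (A.TensorForms n) := by
  refine GradedTensorProduct.algHom_ext _ _ (AlgHom.ext fun a => ?_) (AlgHom.ext fun ω => ?_)
  · refine (tensorMap_tmul _ _ _ _).trans ?_
    rw [map_one]
    rfl
  · refine (tensorMap_tmul _ _ _ _).trans ?_
    rw [map_one, Forms.pull_id]
    rfl

lemma tensorMap_comp (f : A ⟶ B) (g : B ⟶ C) (θ : m ⟶ n) (η : l ⟶ m) :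
    tensorMap (f ≫ g) (η ≫ θ) = (tensorMap g η).comp (tensorMap f θ) := by
  refine GradedTensorProduct.algHom_ext _ _ (AlgHom.ext fun a => ?_) (AlgHom.ext fun ω => ?_)
  · refine (tensorMap_tmul _ _ _ _).trans (Eq.trans ?_
      (congrArg (tensorMap g η) (tensorMap_tmul _ _ _ _)).symm)
    rw [tensorMap_tmul, map_one, map_one, map_one]
    rfl
  · refine (tensorMap_tmul _ _ _ _).trans (Eq.trans ?_
      (congrArg (tensorMap g η) (tensorMap_tmul _ _ _ _)).symm)
    rw [tensorMap_tmul, map_one, map_one, map_one, Forms.pull_comp]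
    rfl

lemma pathMap_id : pathMap (𝟙 A) (𝟙 n) = AlgHom.id R (A.pathZero n) :=
  AlgHom.ext fun x => Subtype.ext (DFunLike.congr_fun tensorMap_id x.1)

lemma pathMap_comp (f : A ⟶ B) (g : B ⟶ C) (θ : m ⟶ n) (η : l ⟶ m) :
    pathMap (f ≫ g) (η ≫ θ) = (pathMap g η).comp (pathMap f θ) :=
  AlgHom.ext fun x => Subtype.ext (DFunLike.congr_fun (tensorMap_comp f g θ η) x.1)

variable (R) in
/-- The functor sending `A` to the simplicial commutative algebra `n ↦ (A^{Δⁿ})₀`. -/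
def path : CDGA R ⥤ SimplexCategoryᵒᵖ ⥤ CommAlgCat.{u} R where
  obj A :=
    { obj := fun n => CommAlgCat.of R (A.pathZero n.unop)
      map := fun θ => CommAlgCat.ofHom (pathMap (𝟙 A) θ.unop)
      map_id := fun n => congrArg CommAlgCat.ofHom pathMap_id
      map_comp := fun θ η => by
        have := pathMap_comp (𝟙 A) (𝟙 A) θ.unop η.unop
        rw [Category.comp_id] at this
        exact congrArg CommAlgCat.ofHom this }
  map {A B} f :=
    { app := fun n => CommAlgCat.ofHom (pathMap f (𝟙 n.unop))
      naturality := fun n m θ => by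
        have h := pathMap_comp (𝟙 A) f θ.unop (𝟙 m.unop)
        have h' := pathMap_comp f (𝟙 B) (𝟙 n.unop) θ.unop
        rw [Category.id_comp, Category.id_comp] at h
        rw [Category.comp_id, Category.comp_id] at h'
        exact congrArg CommAlgCat.ofHom (h.symm.trans h') }
  map_id A := by
    apply NatTrans.ext
    funext n
    exact congrArg CommAlgCat.ofHom pathMap_id
  map_comp {A B C} f g := by
    apply NatTrans.ext
    funext n
    have h := pathMap_comp f g (𝟙 n.unop) (𝟙 n.unop)
    rw [Category.comp_id] at h
    exact congrArg CommAlgCat.ofHom h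

end CDGA

/-! ### The categories `s𝒩♭` and `dg₊𝒩♭` -/

/-- A square-zero extension of commutative algebras: a surjection whose kernel has square zero. -/
def sqZero (R : Type u) [CommRing R] : MorphismProperty (CommAlgCat.{u} R) := fun _ _ f =>
  Function.Surjective f ∧ ∀ x y, f x = 0 → f y = 0 → x * y = 0

namespace SAlg

variable {R : Type u} [CommRing R]

/-- The kernel of `A → π₀ A` in level `k`: the ideal of the elements whose image under a map
`A_k → A₀` lies in the ideal of `A₀` generated by the elements `∂₀ a - ∂₁ a`, for `a` in `A₁`. -/
def pi0Ker (A : SimplexCategoryᵒᵖ ⥤ CommAlgCat.{u} R) (k : SimplexCategory) :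
    Ideal (A.obj (op k)) :=
  (Ideal.span (Set.range fun a : A.obj (op ⦋1⦌) =>
      A.map (SimplexCategory.δ (0 : Fin 2)).op a - A.map (SimplexCategory.δ (1 : Fin 2)).op a)).comap
    (A.map (SimplexCategory.const ⦋0⦌ k 0).op).hom

/-- Membership of `a ∈ Aₙ` in the normalisation `Nₙ A`: the faces `∂ⱼ a` vanish for `j > 0`. -/
def IsNormalized (A : SimplexCategoryᵒᵖ ⥤ CommAlgCat.{u} R) {n : ℕ} (a : A.obj (op ⦋n⦌)) : Prop :=
  match n, a with
  | 0, _ => True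
  | n + 1, a => ∀ j : Fin (n + 1), A.map (SimplexCategory.δ j.succ).op a = 0

variable (R) in
/-- The simplicial algebras `A` for which the kernel of `A → π₀ A` is nilpotent and `Nᵢ A = 0` for
all `i ≫ 0`. -/
def nilpFlat : ObjectProperty (SimplexCategoryᵒᵖ ⥤ CommAlgCat.{u} R) := fun A =>
  (∃ n : ℕ, ∀ k, pi0Ker A k ^ n = ⊥) ∧
    ∃ n : ℕ, ∀ i, n < i → ∀ a : A.obj (op ⦋i⦌), IsNormalized A a → a = 0

variable (R) in
/-- Square-zero extensions in `s𝒩♭`. -/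
def sqZero : MorphismProperty (nilpFlat R).FullSubcategory := fun _ _ f =>
  ∀ k, DerivedDeligne.sqZero R (f.hom.app k)

variable (R) in
/-- Tiny acyclic extensions in `s𝒩♭`: surjections with kernel `K` such that `I_A · K = 0`, where
`I_A` is the kernel of `A → π₀ A`, and such that `NK` is of the form `cone(M)[-r]`. That is, `NK` is
concentrated in degrees `r` and `r + 1`, with an isomorphism as its only differential
(then `M = N_r K`, a module over `π₀ A` because `I_A · K = 0`). -/
def tinyAcyclic : MorphismProperty (nilpFlat R).FullSubcategory := fun A _ f =>
  (∀ k, Function.Surjective (f.hom.app k)) ∧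
  (∀ k, ∀ a ∈ pi0Ker A.obj k, ∀ x, f.hom.app (op k) x = 0 → a * x = 0) ∧
  ∃ r : ℕ,
    (∀ i, i ≠ r → i ≠ r + 1 → ∀ x : A.obj.obj (op ⦋i⦌), IsNormalized A.obj x →
      f.hom.app (op ⦋i⦌) x = 0 → x = 0) ∧
    Set.BijOn (A.obj.map (SimplexCategory.δ (0 : Fin (r + 2))).op)
      {x | IsNormalized A.obj x ∧ f.hom.app (op ⦋r + 1⦌) x = 0}
      {x | IsNormalized A.obj x ∧ f.hom.app (op ⦋r⦌) x = 0}

end SAlg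

namespace CDGA

variable {R : Type u} [CommRing R]

/-- The kernel of `A → H₀ A`: the elements whose component of degree `0` is a boundary. -/
def h0Ker (A : CDGA R) : Submodule R A.carrier :=
  ((A.gr 1).map A.d).comap (GradedAlgebra.proj A.gr 0)

variable (R) in
/-- The differential graded algebras `A` for which the kernel of `A → H₀ A` is nilpotent and
`Aᵢ = 0` for all `i ≫ 0`. -/
def nilpFlat : ObjectProperty (CDGA R) := fun A =>
  (∃ n : ℕ, A.h0Ker ^ n = ⊥) ∧ ∃ n : ℕ, ∀ i, n < i → A.gr i = ⊥

variable (R) in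
/-- Square-zero extensions in `dg₊𝒩♭`. -/
def sqZero : MorphismProperty (nilpFlat R).FullSubcategory := fun _ _ f =>
  Function.Surjective f.hom.hom ∧ ∀ x y, f.hom.hom x = 0 → f.hom.hom y = 0 → x * y = 0

variable (R) in
/-- Tiny acyclic extensions in `dg₊𝒩♭`: surjections with kernel `K` such that `I_A · K = 0`, where
`I_A` is the kernel of `A → H₀ A`, and such that `K` is of the form `cone(M)[-r]`. That is, `K` is
concentrated in degrees `r` and `r + 1`, with an isomorphism as its only differential
(then `M = K_r`, a module over `H₀ A` because `I_A · K = 0`). -/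
def tinyAcyclic : MorphismProperty (nilpFlat R).FullSubcategory := fun A _ f =>
  Function.Surjective f.hom.hom ∧
  (∀ a ∈ A.obj.h0Ker, ∀ x, f.hom.hom x = 0 → a * x = 0) ∧
  ∃ r : ℕ,
    (∀ i, i ≠ r → i ≠ r + 1 → ∀ x ∈ A.obj.gr i, f.hom.hom x = 0 → x = 0) ∧
    Set.BijOn A.obj.d {x | x ∈ A.obj.gr (r + 1) ∧ f.hom.hom x = 0}
      {x | x ∈ A.obj.gr r ∧ f.hom.hom x = 0}

end CDGA

/-! ### Properties of functors -/

section Properties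

variable {C : Type*} [Category C] {D : Type*} [Category D]

/-- Homogeneous functors `F`: for every square-zero extension `A → B` and every `C → B`, the map
`F(A ×_B C) → F(A) ×_{F(B)} F(C)` is an isomorphism. -/
def Homogeneous (sqz : MorphismProperty C) (F : C ⥤ D) : Prop :=
  ∀ ⦃P A B C' : C⦄ (p : P ⟶ A) (q : P ⟶ C') (f : A ⟶ B) (g : C' ⟶ B), sqz f →
    IsPullback p q f g → IsPullback (F.map p) (F.map q) (F.map f) (F.map g)

/-- Kan fibrations: the maps with the right lifting property with respect to the horn inclusions. -/
def KanFibration : MorphismProperty SSet.{w} := SSet.modelCategoryQuillen.J.rlp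

/-- Trivial Kan fibrations: the maps with the right lifting property with respect to the inclusions
`∂Δⁿ → Δⁿ`. -/
def TrivialKanFibration : MorphismProperty SSet.{w} := SSet.modelCategoryQuillen.I.rlp

/-- Homotopic functors: tiny acyclic extensions are mapped to trivial fibrations. -/
def Homotopic (tiny : MorphismProperty C) (F : C ⥤ SSet.{w}) : Prop :=
  ∀ ⦃A B : C⦄ (f : A ⟶ B), tiny f → TrivialKanFibration (F.map f)

/-- Pre-homotopic functors: tiny acyclic extensions are mapped to surjective fibrations. -/
def PreHomotopic (tiny : MorphismProperty C) (F : C ⥤ SSet.{w}) : Prop :=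
  ∀ ⦃A B : C⦄ (f : A ⟶ B), tiny f →
    KanFibration (F.map f) ∧ ∀ n, Function.Surjective ((F.map f).app n)

/-- Formally quasi-presmooth functors: square-zero extensions are mapped to fibrations. -/
def FormallyQuasiPresmooth (sqz : MorphismProperty C) (F : C ⥤ SSet.{w}) : Prop :=
  ∀ ⦃A B : C⦄ (f : A ⟶ B), sqz f → KanFibration (F.map f)

/-- Formally quasi-smooth functors: formally quasi-presmooth and homotopic. -/
def FormallyQuasiSmooth (sqz tiny : MorphismProperty C) (F : C ⥤ SSet.{w}) : Prop :=
  FormallyQuasiPresmooth sqz F ∧ Homotopic tiny F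

end Properties

/-! ### The functors `G̲` -/

section Uline

variable {R : Type u} [CommRing R]

/-- The cosimplicial simplicial group `(m, k) ↦ Gᵐ(A_k)` of a simplicial algebra `A`. -/
def levelwise (G : CommAlgCat.{u} R ⥤ CosimplicialObject GrpCat.{w}) :
    (SimplexCategoryᵒᵖ ⥤ CommAlgCat.{u} R) ⥤ CsGrp.{w} :=
  (Functor.whiskeringRight _ _ _).obj G ⋙ flipFunctor _ _ _

/-- The functor `G̲` on `s𝒩♭`, `G̲(A)ᵐ_k = Gᵐ((A^{Δᵏ})₀)`. Here `(A^{Δᵏ})_n = Hom(Δᵏ × Δⁿ, A)`, so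
that `(A^{Δᵏ})₀ = A_k`. -/
def sUline (G : CommAlgCat.{u} R ⥤ CosimplicialObject GrpCat.{w}) :
    (SAlg.nilpFlat R).FullSubcategory ⥤ CsGrp.{w} :=
  (SAlg.nilpFlat R).ι ⋙ levelwise G

/-- The functor `G̲` on `dg₊𝒩♭`, `G̲(A)ᵐ_k = Gᵐ((A^{Δᵏ})₀)`. -/
def dgUline (G : CommAlgCat.{u} R ⥤ CosimplicialObject GrpCat.{w}) :
    (CDGA.nilpFlat R).FullSubcategory ⥤ CsGrp.{w} :=
  (CDGA.nilpFlat R).ι ⋙ CDGA.path R ⋙ levelwise G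

end Uline

end

end DerivedDeligne

open DerivedDeligne

/-! Both nerves are homotopy quotients. A simplex of `W̄[M/Γ]`, for a simplicial group `Γ` acting on
a simplicial set `M`, amounts to a simplex of `M` together with a simplex of `W̄ Γ`, the latter
being a cocycle with values in `Γ` (`bijective_wbarToBorel`; `bijective_nerveToBorel` for the level
`0` groupoid, where `Γ` and `M` are constant). An equivariant map then has a lifting property as
soon as the maps on `M` and on `W̄ Γ` have it: lift the cocycle, use it to untwist the remaining
data, and lift in `M` (`liftsAlong_borelMap`).

On the group side, a levelwise surjection of simplicial groups is a Kan fibration by Moore's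
argument of correcting faces one at a time, and `W̄` inherits this because `W̄_{n+1} = Γ_n × W̄_n`.
If the kernel is acyclic, boundaries can be filled as well as horns, and the fibrations are trivial.

On the Maurer–Cartan side, `ω_n` is a map `Δⁿ × Δᵖ → Gⁿ⁺¹` whose restriction to `∂Δⁿ × Δᵖ` and whose
codegeneracies are dictated by the components of lower degree. A lift is built degree by degree
(`IsLiftBelow.exists_step`): extend from `∂Δⁿ × Δᵖ ∪ Δⁿ × A` by the lifting property of the
surjection of groups against a pushout-product, then repair the codegeneracies by a natural formula
which changes nothing where they are already right. In the underived nerve only level `0` survives.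
Maps of discrete simplicial sets are always Kan fibrations, and surjectivity comes from the vertices
of the Maurer–Cartan space. The constant group in level `0` does not see the acyclicity of the
kernel, so triviality is not obtained there.

It remains to know, for the simplicial algebra `n ↦ (A^{Δⁿ})₀`, that square-zero extensions and
their pullbacks remain so levelwise, and that tiny acyclic extensions become square-zero extensions
with acyclic kernel (`deligneNerve_properties`). Formal smoothness and homogeneity of `Gᵐ` then give
surjections and pullbacks of groups. Acyclicity of the kernel passes to groups
(`acyclicKernel_whiskerRight`): a group element with trivial faces comes from the trivial extension
`R ⊕ Z` by the ideal `Z` of cycles, acyclicity makes `R ⊕ N → R ⊕ Z` a square-zero extension, where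
`N` is the ideal of kernel elements one dimension higher with only the `0`-th face free, and formal
smoothness lifts along it.

For simplicial algebras these facts are read off from normalised chains. For dg algebras,
surjectivity on degree `0` cycles is a Poincaré lemma, by contraction with an Euler vector field
(`pathMap_surjective`). Pullbacks use flatness of forms over a `ℚ`-algebra (`setPullback_pathMap`).
Acyclicity combines the contraction of the kernel with an explicit extension of forms from a face
(`exists_filler`). -/

namespace DerivedDeligne

noncomputable section

/-! ### Lifting properties in terms of simplices -/

section Lifting

open MonoidalCategory

variable {X Y : SSet.{w}} (f : X ⟶ Y)

/-- A subcomplex of `Δ[p]`, as a predicate on the maps `[k] → [p]`. -/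
def memHom {p : ℕ} (A : (Δ[p] : SSet.{w}).Subcomplex) {k : SimplexCategory} (b : k ⟶ ⦋p⦌) : Prop :=
  SSet.stdSimplex.objEquiv.{w}.symm b ∈ A.obj (op k)

lemma memHom.comp {p : ℕ} {A : (Δ[p] : SSet.{w}).Subcomplex} {k l : SimplexCategory}
    {b : k ⟶ ⦋p⦌} (hb : memHom A b) (g : l ⟶ k) : memHom A (g ≫ b) :=
  A.map g.op hb

lemma memHom_boundary {p : ℕ} {k : SimplexCategory} (b : k ⟶ ⦋p⦌) :
    memHom (SSet.boundary.{w} p) b ↔ ¬ Function.Surjective b.toOrderHom := Iff.rfl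

lemma memHom_horn {p : ℕ} (i : Fin (p + 1)) {k : SimplexCategory} (b : k ⟶ ⦋p⦌) :
    memHom (SSet.horn.{w} p i) b ↔ Set.range b.toOrderHom ∪ {i} ≠ Set.univ := Iff.rfl

/-- The lifting property of `f` with respect to the inclusion of the subcomplex `A` of `Δ[p]`. -/
def LiftsAlong {p : ℕ} (A : (Δ[p] : SSet.{w}).Subcomplex) : Prop :=
  ∀ (u : ∀ {k : SimplexCategory} (b : k ⟶ ⦋p⦌), memHom A b → X.obj (op k))
    (_ : ∀ {k l : SimplexCategory} (b : k ⟶ ⦋p⦌) (hb : memHom A b) (g : l ⟶ k),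
      X.map g.op (u b hb) = u (g ≫ b) (hb.comp g))
    (y : Y.obj (op ⦋p⦌))
    (_ : ∀ {k : SimplexCategory} (b : k ⟶ ⦋p⦌) (hb : memHom A b),
      f.app (op k) (u b hb) = Y.map b.op y),
    ∃ x : X.obj (op ⦋p⦌), f.app _ x = y ∧
      ∀ {k : SimplexCategory} (b : k ⟶ ⦋p⦌) (hb : memHom A b), X.map b.op x = u b hb

variable {f}

lemma LiftsAlong.hasLiftingProperty {p : ℕ} {A : (Δ[p] : SSet.{w}).Subcomplex}
    (h : LiftsAlong f A) : HasLiftingProperty A.ι f where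
  sq_hasLift {t b} sq := by
    obtain ⟨x, hx, hx'⟩ := h (fun {k} b hb => t.app (op k) ⟨SSet.stdSimplex.objEquiv.symm b, hb⟩)
      (fun {k l} b hb g => by
        have := ConcreteCategory.congr_hom (t.naturality g.op)
          (⟨SSet.stdSimplex.objEquiv.symm b, hb⟩ : (A : SSet).obj (op k))
        exact this.symm)
      (SSet.yonedaEquiv b)
      (fun {k} c hc => by
        have h1 := ConcreteCategory.congr_hom (congr_app sq.w (op k))
          (⟨SSet.stdSimplex.objEquiv.symm c, hc⟩ : (A : SSet).obj (op k))
        refine h1.trans ?_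
        have h2 := SSet.yonedaEquiv_symm_app_objEquiv_symm (SSet.yonedaEquiv b) (m := op k) c
        rw [Equiv.symm_apply_apply] at h2
        exact h2)
    refine ⟨⟨⟨SSet.yonedaEquiv.symm x, ?_, ?_⟩⟩⟩
    · apply NatTrans.ext
      funext k
      apply ConcreteCategory.hom_ext
      rintro ⟨c, hc⟩
      obtain ⟨c, rfl⟩ := SSet.stdSimplex.objEquiv.symm.surjective c
      exact (SSet.yonedaEquiv_symm_app_objEquiv_symm x c).trans (hx' c hc)
    · rw [SSet.yonedaEquiv_symm_comp, hx, Equiv.symm_apply_apply]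

/-- Yoneda: a map out of `Δ[p]` is a simplex, and a map out of a subcomplex is a compatible family
of simplices indexed by the maps `[k] → [p]` lying in it. -/
lemma hasLiftingProperty_iff_liftsAlong {p : ℕ} {A : (Δ[p] : SSet.{w}).Subcomplex} :
    HasLiftingProperty A.ι f ↔ LiftsAlong f A := by
  refine ⟨fun h u hu y hy => ?_, fun h => h.hasLiftingProperty⟩
  let t : (A : SSet) ⟶ X :=
    { app := fun k => ↾(fun e => u (SSet.stdSimplex.objEquiv e.1) e.2)
      naturality := fun k l g => by
        apply ConcreteCategory.hom_ext
        rintro ⟨c, hc⟩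
        exact (hu (k := k.unop) (l := l.unop) (SSet.stdSimplex.objEquiv c) hc g.unop).symm }
  have sq : CommSq t A.ι f (SSet.yonedaEquiv.symm y) := ⟨by
    apply NatTrans.ext
    funext k
    apply ConcreteCategory.hom_ext
    rintro ⟨c, hc⟩
    exact hy (SSet.stdSimplex.objEquiv c) hc⟩
  refine ⟨SSet.yonedaEquiv sq.lift, ?_, fun {k} b hb => ?_⟩
  · have := congrArg SSet.yonedaEquiv sq.fac_right
    rwa [Equiv.apply_symm_apply] at this
  · have h1 := ConcreteCategory.congr_hom (congr_app sq.fac_left (op k))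
      (⟨SSet.stdSimplex.objEquiv.symm b, hb⟩ : (A : SSet).obj (op k))
    have h2 := SSet.yonedaEquiv_symm_app_objEquiv_symm (SSet.yonedaEquiv sq.lift) (m := op k) b
    rw [Equiv.symm_apply_apply] at h2
    exact h2.symm.trans h1

lemma kanFibration_iff : KanFibration f ↔
    ∀ (n : ℕ) (i : Fin (n + 2)), LiftsAlong f (SSet.horn (n + 1) i) := by
  refine ⟨fun h n i => hasLiftingProperty_iff_liftsAlong.1 (h _ (SSet.modelCategoryQuillen.horn_ι_mem_J _ i)), fun h => ?_⟩
  rintro _ _ _ hj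
  simp only [SSet.modelCategoryQuillen.J, MorphismProperty.iSup_iff] at hj
  obtain ⟨n, ⟨i⟩⟩ := hj
  exact (h n i).hasLiftingProperty

lemma trivialKanFibration_iff : TrivialKanFibration f ↔
    ∀ n : ℕ, LiftsAlong f (SSet.boundary n) := by
  refine ⟨fun h n => hasLiftingProperty_iff_liftsAlong.1 (h _ (SSet.modelCategoryQuillen.boundary_ι_mem_I _)), fun h => ?_⟩
  rintro _ _ _ ⟨n⟩
  exact (h n).hasLiftingProperty

/-- An extension of simplices `u` on a subcomplex to a product of simplices, along `f`. -/
lemma exists_lift_prod {n p : ℕ} (A : (Δ[p] : SSet.{w}).Subcomplex)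
    [HasLiftingProperty ((SSet.boundary.{w} n).unionProd A).ι f]
    (u : ∀ {k : SimplexCategory} (_ : k ⟶ ⦋n⦌) (_ : k ⟶ ⦋p⦌), X.obj (op k))
    (hu : ∀ {k l : SimplexCategory} (a : k ⟶ ⦋n⦌) (b : k ⟶ ⦋p⦌) (g : l ⟶ k),
      (¬ Function.Surjective a.toOrderHom ∨ memHom A b) → X.map g.op (u a b) = u (g ≫ a) (g ≫ b))
    (y : ∀ {k : SimplexCategory} (_ : k ⟶ ⦋n⦌) (_ : k ⟶ ⦋p⦌), Y.obj (op k))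
    (hy : ∀ {k l : SimplexCategory} (a : k ⟶ ⦋n⦌) (b : k ⟶ ⦋p⦌) (g : l ⟶ k),
      Y.map g.op (y a b) = y (g ≫ a) (g ≫ b))
    (huy : ∀ {k : SimplexCategory} (a : k ⟶ ⦋n⦌) (b : k ⟶ ⦋p⦌),
      (¬ Function.Surjective a.toOrderHom ∨ memHom A b) → f.app (op k) (u a b) = y a b) :
    ∃ v : ∀ {k : SimplexCategory} (_ : k ⟶ ⦋n⦌) (_ : k ⟶ ⦋p⦌), X.obj (op k),
      (∀ {k l : SimplexCategory} (a : k ⟶ ⦋n⦌) (b : k ⟶ ⦋p⦌) (g : l ⟶ k),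
        X.map g.op (v a b) = v (g ≫ a) (g ≫ b)) ∧
      (∀ {k : SimplexCategory} (a : k ⟶ ⦋n⦌) (b : k ⟶ ⦋p⦌), f.app (op k) (v a b) = y a b) ∧
      ∀ {k : SimplexCategory} (a : k ⟶ ⦋n⦌) (b : k ⟶ ⦋p⦌),
        (¬ Function.Surjective a.toOrderHom ∨ memHom A b) → v a b = u a b := by
  have hmem {k : SimplexCategoryᵒᵖ} (e : (Δ[n] ⊗ Δ[p] : SSet.{w}).obj k)
      (he : e ∈ ((SSet.boundary.{w} n).unionProd A).obj k) :
      ¬ Function.Surjective (SSet.stdSimplex.objEquiv e.1).toOrderHom ∨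
        memHom A (SSet.stdSimplex.objEquiv e.2) :=
    ((SSet.Subcomplex.mem_unionProd_iff _ _ e).1 he).symm
  let t : ((SSet.boundary.{w} n).unionProd A : SSet) ⟶ X :=
    { app := fun k => ↾(fun e => u (SSet.stdSimplex.objEquiv e.1.1) (SSet.stdSimplex.objEquiv e.1.2))
      naturality := fun k l g => by
        apply ConcreteCategory.hom_ext
        rintro ⟨e, he⟩
        exact (hu (k := k.unop) (l := l.unop) (SSet.stdSimplex.objEquiv e.1)
          (SSet.stdSimplex.objEquiv e.2) g.unop (hmem e he)).symm }
  let s : (Δ[n] ⊗ Δ[p] : SSet.{w}) ⟶ Y :=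
    { app := fun k => ↾(fun e => y (SSet.stdSimplex.objEquiv e.1) (SSet.stdSimplex.objEquiv e.2))
      naturality := fun k l g => by
        apply ConcreteCategory.hom_ext
        intro e
        exact (hy (k := k.unop) (l := l.unop) (SSet.stdSimplex.objEquiv e.1)
          (SSet.stdSimplex.objEquiv e.2) g.unop).symm }
  have sq : CommSq t ((SSet.boundary.{w} n).unionProd A).ι f s := ⟨by
    apply NatTrans.ext
    funext k
    apply ConcreteCategory.hom_ext
    rintro ⟨e, he⟩
    exact huy (SSet.stdSimplex.objEquiv e.1) (SSet.stdSimplex.objEquiv e.2) (hmem e he)⟩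
  refine ⟨fun {k} a b => sq.lift.app (op k)
    (SSet.stdSimplex.objEquiv.symm a, SSet.stdSimplex.objEquiv.symm b),
    fun {k l} a b g => ?_, fun {k} a b => ?_, fun {k} a b h => ?_⟩
  · exact (ConcreteCategory.congr_hom (sq.lift.naturality g.op)
      ((SSet.stdSimplex.objEquiv.symm a, SSet.stdSimplex.objEquiv.symm b) :
        (Δ[n] ⊗ Δ[p] : SSet.{w}).obj (op k))).symm
  · exact ConcreteCategory.congr_hom (congr_app sq.fac_right (op k))
      ((SSet.stdSimplex.objEquiv.symm a, SSet.stdSimplex.objEquiv.symm b) :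
        (Δ[n] ⊗ Δ[p] : SSet.{w}).obj (op k))
  · exact ConcreteCategory.congr_hom (congr_app sq.fac_left (op k))
      (⟨(SSet.stdSimplex.objEquiv.symm a, SSet.stdSimplex.objEquiv.symm b),
        (SSet.Subcomplex.mem_unionProd_iff _ _ _).2 h.symm⟩ :
          ((SSet.boundary.{w} n).unionProd A : SSet).obj (op k))

end Lifting

/-! ### Fibrations of simplicial groups -/

section SimplicialGroups

variable {N P : SimplexCategoryᵒᵖ ⥤ GrpCat.{w}} (φ : N ⟶ P)

lemma app_map {k l : SimplexCategory} (α : l ⟶ k) (x : N.obj (op k)) :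
    φ.app (op l) (N.map α.op x) = P.map α.op (φ.app (op k) x) :=
  ConcreteCategory.congr_hom (φ.naturality α.op) x

lemma map_map_op {k l m : SimplexCategory} (α : m ⟶ l) (β : l ⟶ k) (x : N.obj (op k)) :
    N.map α.op (N.map β.op x) = N.map (α ≫ β).op x := by
  rw [op_comp, N.map_comp]; rfl

lemma map_id_op {k : SimplexCategory} (x : N.obj (op k)) : N.map (𝟙 k).op x = x := by
  rw [op_id, N.map_id]; rfl

/-- Compatibility, for `i ∈ T`, of a family of simplices `e i`, as `i`-th faces of a simplex. -/
def FaceCompat (N : SimplexCategoryᵒᵖ ⥤ GrpCat.{w}) {n : ℕ} (T : Fin (n + 2) → Prop)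
    (e : Fin (n + 2) → N.obj (op ⦋n⦌)) : Prop :=
  ∀ i j, T i → T j → ∀ {q : SimplexCategory} (α β : q ⟶ ⦋n⦌),
    α ≫ SimplexCategory.δ i = β ≫ SimplexCategory.δ j → N.map α.op (e i) = N.map β.op (e j)

variable {φ}

/-- Multiplying `z` by the degeneracy along `σ s` of its error on the `r`-th face corrects that
face, because `δ r ≫ σ s = 𝟙`. Faces in `D` are undisturbed: `σ s ≫ δ r` fixes every vertex but `r`,
and moves `r` outside `D`. Hence on a face in `D` the error is evaluated on an iterated face where
`z` already agrees with the family. -/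
lemma exists_fill_step {n : ℕ} {T D : Fin (n + 2) → Prop} {e : Fin (n + 2) → N.obj (op ⦋n⦌)}
    (he : FaceCompat N T e) (hφ : ∀ i, T i → φ.app _ (e i) = 1) (hD : ∀ i, D i → T i)
    {z : N.obj (op ⦋n + 1⦌)} (hz : φ.app _ z = 1)
    (hz' : ∀ i, D i → N.map (SimplexCategory.δ i).op z = e i) {r : Fin (n + 2)} (hr : T r)
    (s : Fin (n + 1)) (hs : SimplexCategory.δ r ≫ SimplexCategory.σ s = 𝟙 _)
    (hs' : ∀ y, y ≠ r → r.succAbove (s.predAbove y) = y)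
    (hs'' : ¬ D (r.succAbove (s.predAbove r))) :
    ∃ z' : N.obj (op ⦋n + 1⦌), φ.app _ z' = 1 ∧
      ∀ i, D i ∨ i = r → N.map (SimplexCategory.δ i).op z' = e i := by
  refine ⟨z * N.map (SimplexCategory.σ s).op ((N.map (SimplexCategory.δ r).op z)⁻¹ * e r), ?_, ?_⟩
  · rw [map_mul, hz, app_map, map_mul, map_inv, app_map, hz, hφ r hr]
    simp
  · intro i hi
    by_cases hir : i = r
    · subst hir
      rw [map_mul, map_map_op, hs, map_id_op]
      simp
    · replace hi := hi.resolve_right hir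
      obtain ⟨γ, hγ⟩ := SimplexCategory.eq_comp_δ_of_not_surjective'
        ((SimplexCategory.δ i ≫ SimplexCategory.σ s) ≫ SimplexCategory.δ r) i (by
          intro x hx
          change r.succAbove (s.predAbove (i.succAbove x)) = i at hx
          by_cases h : i.succAbove x = r
          · rw [h] at hx
            exact hs'' (hx ▸ hi)
          · rw [hs' _ h] at hx
            exact Fin.succAbove_ne _ _ hx)
      rw [map_mul, hz' i hi, map_map_op, map_mul, map_inv, map_map_op, hγ, ← map_map_op, hz' i hi,
        he i r (hD i hi) hr _ _ hγ.symm]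
      simp

/-- Moore's theorem: horns can be filled in the kernel of a homomorphism of simplicial groups. -/
lemma exists_fill_horn {n : ℕ} (k : Fin (n + 2)) {e : Fin (n + 2) → N.obj (op ⦋n⦌)}
    (he : FaceCompat N (· ≠ k) e) (hφ : ∀ i, i ≠ k → φ.app _ (e i) = 1) :
    ∃ z : N.obj (op ⦋n + 1⦌), φ.app _ z = 1 ∧
      ∀ i, i ≠ k → N.map (SimplexCategory.δ i).op z = e i := by
  -- The faces below `k` are corrected in increasing order. With `r = s.castSucc`, the vertex `r` is
  -- moved to `r + 1`, which has not been corrected yet.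
  have h1 : ∀ r : ℕ, r ≤ k → ∃ z : N.obj (op ⦋n + 1⦌), φ.app _ z = 1 ∧
      ∀ i : Fin (n + 2), (i : ℕ) < r → N.map (SimplexCategory.δ i).op z = e i := by
    intro r
    induction r with
    | zero => exact fun _ => ⟨1, map_one _, fun i hi => absurd hi (by omega)⟩
    | succ r ih =>
      intro hr
      obtain ⟨z, hz, hz'⟩ := ih (by omega)
      have hrn : r < n + 1 := by omega
      obtain ⟨z', h, h'⟩ := exists_fill_step (T := (· ≠ k)) (D := fun i => (i : ℕ) < r) he hφ
        (fun i hi h => by subst h; omega) hz hz' (r := (⟨r, hrn⟩ : Fin (n + 1)).castSucc)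
        (by rintro rfl; simp at hr) ⟨r, hrn⟩ SimplexCategory.δ_comp_σ_self
        (fun y hy => Fin.succAbove_predAbove hy)
        (by rw [Fin.predAbove_castSucc_self, Fin.succAbove_castSucc_self]; simp)
      refine ⟨z', h, fun i hi => h' i ?_⟩
      obtain hi | hi := Nat.lt_succ_iff_lt_or_eq.1 hi
      · exact Or.inl hi
      · exact Or.inr (Fin.ext hi)
  -- The faces above `k` are corrected in decreasing order, `r` counting those already done. With `s
  -- + r = n` the next face is `s + 1`, and its vertex is moved to `s ≥ k`, which is outside `D`.
  have h2 : ∀ r : ℕ, (k : ℕ) + r ≤ n + 1 → ∃ z : N.obj (op ⦋n + 1⦌), φ.app _ z = 1 ∧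
      ∀ i : Fin (n + 2), (i : ℕ) < k ∨ n + 1 < i + r → N.map (SimplexCategory.δ i).op z = e i := by
    intro r
    induction r with
    | zero =>
      obtain ⟨z, hz, hz'⟩ := h1 k le_rfl
      exact fun _ => ⟨z, hz, fun i hi => hz' i (by omega)⟩
    | succ r ih =>
      intro hr
      obtain ⟨z, hz, hz'⟩ := ih (by omega)
      obtain ⟨s, hs⟩ : ∃ s : ℕ, s + r = n := ⟨n - r, by omega⟩
      have hsn : s < n + 1 := by omega
      obtain ⟨z', h, h'⟩ := exists_fill_step (T := (· ≠ k))
        (D := fun i => (i : ℕ) < k ∨ n + 1 < i + r) he hφ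
        (fun i hi h => by subst h; omega) hz hz' (r := (⟨s, hsn⟩ : Fin (n + 1)).succ)
        (by rintro rfl; simp at hr; omega) ⟨s, hsn⟩ SimplexCategory.δ_comp_σ_succ
        (fun y hy => Fin.succ_succAbove_predAbove hy)
        (by rw [Fin.predAbove_succ_self, Fin.succAbove_succ_self]; simp; omega)
      refine ⟨z', h, fun i hi => h' i ?_⟩
      by_cases hi' : (i : ℕ) = s + 1
      · exact Or.inr (Fin.ext hi')
      · exact Or.inl (by omega)
  obtain ⟨z, hz, hz'⟩ := h2 (n + 1 - k) (by omega)
  refine ⟨z, hz, fun i hi => hz' i ?_⟩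
  have : (i : ℕ) ≠ k := fun h => hi (Fin.ext h)
  omega

variable (φ) in
/-- The kernel of `φ` is acyclic: each of its simplices with trivial faces is the `0`-th face of
a simplex whose other faces are trivial. -/
def AcyclicKernel : Prop :=
  ∀ (n : ℕ) (x : N.obj (op ⦋n⦌)), φ.app _ x = 1 →
    (∀ {q : SimplexCategory} (α : q ⟶ ⦋n⦌), ¬ Function.Surjective α.toOrderHom →
      N.map α.op x = 1) →
    ∃ y : N.obj (op ⦋n + 1⦌), φ.app _ y = 1 ∧ N.map (SimplexCategory.δ 0).op y = x ∧
      ∀ i : Fin (n + 1), N.map (SimplexCategory.δ i.succ).op y = 1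

/-- Fill the horn without the `0`-th face by Moore's theorem. The error on the `0`-th face has
trivial faces by compatibility, so acyclicity gives a simplex having the error as its `0`-th face
and trivial other faces; multiplication by it completes the filling. -/
lemma exists_fill_boundary (h : AcyclicKernel φ) {n : ℕ} {e : Fin (n + 2) → N.obj (op ⦋n⦌)}
    (he : FaceCompat N (fun _ => True) e) (hφ : ∀ i, φ.app _ (e i) = 1) :
    ∃ z : N.obj (op ⦋n + 1⦌), φ.app _ z = 1 ∧
      ∀ i, N.map (SimplexCategory.δ i).op z = e i := by
  obtain ⟨z, hz, hz'⟩ := exists_fill_horn (φ := φ) 0 (e := e)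
    (fun i j _ _ => he i j trivial trivial) (fun i _ => hφ i)
  obtain ⟨y, hy, hy', hy''⟩ := h n ((N.map (SimplexCategory.δ 0).op z)⁻¹ * e 0)
    (by rw [map_mul, map_inv, app_map, hz, hφ]; simp) (by
      intro q α hα
      obtain ⟨i, hi⟩ := not_forall.1 hα
      obtain ⟨γ, hγ⟩ := SimplexCategory.eq_comp_δ_of_not_surjective'
        (α ≫ SimplexCategory.δ (0 : Fin (n + 2))) i.succ (by
          intro x hx
          exact hi ⟨x, Fin.succ_injective _ hx⟩)
      rw [map_mul, map_inv, map_map_op, hγ, ← map_map_op, hz' _ (Fin.succ_ne_zero i),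
        he _ _ trivial trivial _ _ hγ.symm]
      simp)
  refine ⟨z * y, by rw [map_mul, hz, hy, one_mul], fun i => ?_⟩
  rw [map_mul]
  obtain rfl | ⟨i, rfl⟩ := Fin.eq_zero_or_eq_succ i
  · rw [hy']
    simp
  · rw [hy'', hz' _ (Fin.succ_ne_zero i), mul_one]

variable (φ) in
/-- The map of simplicial sets underlying a homomorphism of simplicial groups. -/
abbrev toSSetHom : (N ⋙ forget GrpCat.{w} : SSet.{w}) ⟶ P ⋙ forget GrpCat.{w} :=
  Functor.whiskerRight φ (forget GrpCat.{w})

/-- Surjectivity provides some preimage `w` of `y`. Dividing the family by the faces of `w` moves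
the problem into the kernel. -/
lemma exists_fill {n : ℕ} (hφ : ∀ k, Function.Surjective (φ.app k)) {T : Fin (n + 2) → Prop}
    (hT : ∀ e : Fin (n + 2) → N.obj (op ⦋n⦌), FaceCompat N T e → (∀ i, T i → φ.app _ (e i) = 1) →
      ∃ z : N.obj (op ⦋n + 1⦌), φ.app _ z = 1 ∧ ∀ i, T i → N.map (SimplexCategory.δ i).op z = e i)
    (e : Fin (n + 2) → N.obj (op ⦋n⦌)) (he : FaceCompat N T e) (y : P.obj (op ⦋n + 1⦌))
    (hy : ∀ i, T i → φ.app _ (e i) = P.map (SimplexCategory.δ i).op y) :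
    ∃ x : N.obj (op ⦋n + 1⦌), φ.app _ x = y ∧
      ∀ i, T i → N.map (SimplexCategory.δ i).op x = e i := by
  obtain ⟨w, rfl⟩ := hφ _ y
  obtain ⟨z, hz, hz'⟩ := hT (fun i => (N.map (SimplexCategory.δ i).op w)⁻¹ * e i)
    (fun i j hi hj q α β h => by
      rw [map_mul, map_mul, map_inv, map_inv, map_map_op, map_map_op, h, he i j hi hj α β h])
    (fun i hi => by
      rw [map_mul, map_inv, hy i hi, app_map]
      simp)
  refine ⟨w * z, by rw [map_mul, hz, mul_one], fun i hi => ?_⟩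
  rw [map_mul, hz' i hi]
  simp

lemma exists_fill_horn_lift {n : ℕ} (hφ : ∀ k, Function.Surjective (φ.app k)) (k : Fin (n + 2))
    (e : Fin (n + 2) → N.obj (op ⦋n⦌)) (he : FaceCompat N (· ≠ k) e) (y : P.obj (op ⦋n + 1⦌))
    (hy : ∀ i, i ≠ k → φ.app _ (e i) = P.map (SimplexCategory.δ i).op y) :
    ∃ x : N.obj (op ⦋n + 1⦌), φ.app _ x = y ∧
      ∀ i, i ≠ k → N.map (SimplexCategory.δ i).op x = e i :=
  exists_fill hφ (fun _ he' h => exists_fill_horn k he' h) e he y hy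

lemma exists_fill_boundary_lift {n : ℕ} (hφ : ∀ k, Function.Surjective (φ.app k))
    (h : AcyclicKernel φ)
    (e : Fin (n + 2) → N.obj (op ⦋n⦌)) (he : FaceCompat N (fun _ => True) e)
    (y : P.obj (op ⦋n + 1⦌)) (hy : ∀ i, φ.app _ (e i) = P.map (SimplexCategory.δ i).op y) :
    ∃ x : N.obj (op ⦋n + 1⦌), φ.app _ x = y ∧
      ∀ i, N.map (SimplexCategory.δ i).op x = e i := by
  obtain ⟨x, hx, hx'⟩ := exists_fill hφ (T := fun _ => True)
    (fun e he h' => by simpa using exists_fill_boundary h he (fun i => h' i trivial))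
    e he y (fun i _ => hy i)
  exact ⟨x, hx, fun i => hx' i trivial⟩

lemma memHom_horn_iff {n : ℕ} {k : Fin (n + 2)} {q : SimplexCategory} {b : q ⟶ ⦋n + 1⦌} :
    memHom (SSet.horn.{w} (n + 1) k) b ↔
      ∃ (i : Fin (n + 2)) (θ : q ⟶ ⦋n⦌), i ≠ k ∧ b = θ ≫ SimplexCategory.δ i := by
  rw [memHom_horn]
  constructor
  · intro h
    obtain ⟨i, hi⟩ := (Set.ne_univ_iff_exists_notMem _).1 h
    simp only [Set.union_singleton, Set.mem_insert_iff, Set.mem_range, not_or, not_exists] at hi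
    obtain ⟨θ, hθ⟩ := SimplexCategory.eq_comp_δ_of_not_surjective' b i hi.2
    exact ⟨i, θ, hi.1, hθ⟩
  · rintro ⟨i, θ, hi, rfl⟩
    refine (Set.ne_univ_iff_exists_notMem _).2 ⟨i, ?_⟩
    simp only [Set.union_singleton, Set.mem_insert_iff, Set.mem_range, not_or, not_exists]
    exact ⟨hi, fun x hx => Fin.succAbove_ne _ _ hx⟩

lemma memHom_boundary_iff {n : ℕ} {q : SimplexCategory} {b : q ⟶ ⦋n + 1⦌} :
    memHom (SSet.boundary.{w} (n + 1)) b ↔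
      ∃ (i : Fin (n + 2)) (θ : q ⟶ ⦋n⦌), b = θ ≫ SimplexCategory.δ i := by
  rw [memHom_boundary]
  constructor
  · exact SimplexCategory.eq_comp_δ_of_not_surjective b
  · rintro ⟨i, θ, rfl⟩ h
    obtain ⟨x, hx⟩ := h i
    exact Fin.succAbove_ne _ _ hx

/-- A subcomplex of `Δ[n + 1]` is generated by the faces `i` with `T i`. -/
def GeneratedBy {n : ℕ} (A : (Δ[n + 1] : SSet.{w}).Subcomplex) (T : Fin (n + 2) → Prop) : Prop :=
  ∀ {q : SimplexCategory} (b : q ⟶ ⦋n + 1⦌), memHom A b ↔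
    ∃ (i : Fin (n + 2)) (θ : q ⟶ ⦋n⦌), T i ∧ b = θ ≫ SimplexCategory.δ i

lemma generatedBy_horn {n : ℕ} (k : Fin (n + 2)) :
    GeneratedBy (SSet.horn.{w} (n + 1) k) (· ≠ k) := fun _ => memHom_horn_iff

lemma generatedBy_boundary {n : ℕ} :
    GeneratedBy (SSet.boundary.{w} (n + 1)) (fun _ => True) := fun _ => by
  rw [memHom_boundary_iff]
  simp

lemma GeneratedBy.mem_δ {n : ℕ} {A : (Δ[n + 1] : SSet.{w}).Subcomplex} {T : Fin (n + 2) → Prop}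
    (hA : GeneratedBy A T) {i : Fin (n + 2)} (hi : T i) : memHom A (SimplexCategory.δ i) :=
  (hA _).2 ⟨i, 𝟙 _, hi, (Category.id_comp _).symm⟩

/-- For a subcomplex generated by faces, it suffices to lift families of faces. -/
lemma GeneratedBy.liftsAlong {X Y : SSet.{w}} {f : X ⟶ Y} {n : ℕ}
    {A : (Δ[n + 1] : SSet.{w}).Subcomplex}
    {T : Fin (n + 2) → Prop} (hA : GeneratedBy A T)
    (h : ∀ (e : ∀ i, T i → X.obj (op ⦋n⦌))
      (_ : ∀ i j (hi : T i) (hj : T j), ∀ {q : SimplexCategory} (α β : q ⟶ ⦋n⦌),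
        α ≫ SimplexCategory.δ i = β ≫ SimplexCategory.δ j →
          X.map α.op (e i hi) = X.map β.op (e j hj))
      (y : Y.obj (op ⦋n + 1⦌))
      (_ : ∀ i (hi : T i), f.app _ (e i hi) = Y.map (SimplexCategory.δ i).op y),
      ∃ x : X.obj (op ⦋n + 1⦌), f.app _ x = y ∧
        ∀ i (hi : T i), X.map (SimplexCategory.δ i).op x = e i hi) : LiftsAlong f A := by
  intro u hu y hy
  obtain ⟨x, hx, hx'⟩ := h (fun i hi => u (SimplexCategory.δ i) (hA.mem_δ hi))
    (fun i j hi hj q α β hαβ => by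
      rw [hu, hu]
      congr 1) y
    (fun i hi => hy _ _)
  refine ⟨x, hx, fun {q} b hb => ?_⟩
  obtain ⟨i, θ, hi, rfl⟩ := (hA b).1 hb
  rw [op_comp, X.map_comp, ConcreteCategory.comp_apply, hx' i hi, hu]

theorem kanFibration_toSSetHom (hφ : ∀ k, Function.Surjective (φ.app k)) :
    KanFibration (toSSetHom φ) := by
  classical
  rw [kanFibration_iff]
  intro n k
  refine GeneratedBy.liftsAlong (generatedBy_horn k) fun e he y hy => ?_
  -- The value `1` at `k` is arbitrary: compatibility is only required away from `k`.
  let e' : Fin (n + 2) → N.obj (op ⦋n⦌) := fun i => if hi : i ≠ k then e i hi else 1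
  have he' (i) (hi : i ≠ k) : e' i = e i hi := dif_pos hi
  obtain ⟨x, hx, hx'⟩ := exists_fill_horn_lift hφ k e'
    (fun i j hi hj q α β h => by
      rw [he' i hi, he' j hj]
      exact he i j hi hj α β h) y
    (fun i hi => by
      rw [he' i hi]
      exact hy i hi)
  exact ⟨x, hx, fun i hi => (hx' i hi).trans (he' i hi)⟩

theorem trivialKanFibration_toSSetHom (hφ : ∀ k, Function.Surjective (φ.app k))
    (h : AcyclicKernel φ) : TrivialKanFibration (toSSetHom φ) := by
  rw [trivialKanFibration_iff]
  rintro (_ | n)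
  · intro u hu y hy
    obtain ⟨x, hx⟩ := hφ _ y
    -- The boundary of `Δ[0]` is empty, since every map to `[0]` is surjective.
    exact ⟨x, hx, fun b hb => (hb fun y => ⟨0, Subsingleton.elim (α := Fin 1) _ _⟩).elim⟩
  · refine GeneratedBy.liftsAlong generatedBy_boundary fun e he y hy => ?_
    obtain ⟨x, hx, hx'⟩ := exists_fill_boundary_lift hφ h (fun i => e i trivial)
      (fun i j hi hj q α β h => he i j hi hj α β h) y (fun i => hy i trivial)
    exact ⟨x, hx, fun i _ => hx' i⟩

end SimplicialGroups

/-! ### The classifying space of a simplicial group, in terms of cocycles -/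

/-- A `p`-simplex of `W̄ Γ`, given as a trivialised `Γ`-torsor on `Δᵖ`: a family of elements
`c(θ) ∈ Γ_q`, for `θ : [q] → [p]`, which is compatible with the maps preserving the initial vertex,
and trivial if `θ` preserves the initial vertex. -/
@[ext]
structure WB (Γ : SimplexCategoryᵒᵖ ⥤ GrpCat.{w}) (p : SimplexCategory) where
  /-- the element `c(θ)` -/
  c {q : SimplexCategory} (θ : q ⟶ p) : Γ.obj (op q)
  c_zero {q : SimplexCategory} (θ : q ⟶ p) (h : θ.toOrderHom 0 = 0) : c θ = 1
  c_comp {q r : SimplexCategory} (η : r ⟶ q) (θ : q ⟶ p) (h : η.toOrderHom 0 = 0) :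
    c (η ≫ θ) = Γ.map η.op (c θ)

namespace WB

variable {Γ Γ' : SimplexCategoryᵒᵖ ⥤ GrpCat.{w}} {p q r : SimplexCategory}

/-- The simplicial structure of `W̄ Γ`. -/
def pull (θ : q ⟶ p) (x : WB Γ p) : WB Γ q where
  c η := x.c (η ≫ θ) * (Γ.map η.op (x.c θ))⁻¹
  c_zero η h := by rw [x.c_comp η θ h, mul_inv_cancel]
  c_comp ζ η h := by
    rw [Category.assoc, x.c_comp ζ _ h, map_mul, map_inv, map_map_op]

lemma pull_c (θ : q ⟶ p) (x : WB Γ p) {r : SimplexCategory} (η : r ⟶ q) :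
    (x.pull θ).c η = x.c (η ≫ θ) * (Γ.map η.op (x.c θ))⁻¹ := rfl

lemma c_id (x : WB Γ p) : x.c (𝟙 p) = 1 := x.c_zero _ rfl

lemma pull_id (x : WB Γ p) : x.pull (𝟙 p) = x := by
  ext q θ
  rw [pull_c, c_id, map_one, inv_one, mul_one, Category.comp_id]

lemma pull_comp (η : r ⟶ q) (θ : q ⟶ p) (x : WB Γ p) : x.pull (η ≫ θ) = (x.pull θ).pull η := by
  ext s ζ
  simp only [pull_c, map_mul, map_inv, map_map_op, Category.assoc]
  group

/-- The functoriality of `W̄ Γ` in `Γ`. -/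
def push (φ : Γ ⟶ Γ') (x : WB Γ p) : WB Γ' p where
  c θ := φ.app _ (x.c θ)
  c_zero θ h := by rw [x.c_zero θ h, map_one]
  c_comp η θ h := by rw [x.c_comp η θ h, app_map]

lemma push_c (φ : Γ ⟶ Γ') (x : WB Γ p) (θ : q ⟶ p) : (x.push φ).c θ = φ.app _ (x.c θ) := rfl

lemma pull_push (φ : Γ ⟶ Γ') (x : WB Γ p) (θ : q ⟶ p) :
    (x.push φ).pull θ = (x.pull θ).push φ := by
  ext r η
  simp only [pull_c, push_c, map_mul, map_inv, app_map]

variable (Γ) in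
/-- The simplicial set `W̄ Γ`. -/
def sset : SSet.{w} where
  obj p := WB Γ p.unop
  map θ := ↾(pull θ.unop)
  map_id p := by
    apply ConcreteCategory.hom_ext
    exact pull_id
  map_comp θ η := by
    apply ConcreteCategory.hom_ext
    exact pull_comp η.unop θ.unop

/-- The map `W̄ Γ → W̄ Γ'` induced by a homomorphism. -/
def ssetMap (φ : Γ ⟶ Γ') : sset Γ ⟶ sset Γ' where
  app p := ↾(push φ)
  naturality p q θ := by
    apply ConcreteCategory.hom_ext
    intro x
    exact (pull_push φ x θ.unop).symm

lemma ext_of_ne {x y : WB Γ p} (h : ∀ {q : SimplexCategory} (θ : q ⟶ p), θ.toOrderHom 0 ≠ 0 →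
    x.c θ = y.c θ) : x = y := by
  ext q θ
  by_cases h0 : θ.toOrderHom 0 = 0
  · rw [x.c_zero θ h0, y.c_zero θ h0]
  · exact h θ h0

instance : Subsingleton (WB Γ ⦋0⦌) where
  allEq _ _ := ext_of_ne fun _ h => (h (Subsingleton.elim (α := Fin 1) _ _)).elim

lemma pull_c_of_zero (θ : q ⟶ p) (hθ : θ.toOrderHom 0 = 0) (x : WB Γ p) (η : r ⟶ q) :
    (x.pull θ).c η = x.c (η ≫ θ) := by
  rw [pull_c, x.c_zero θ hθ, map_one, inv_one, mul_one]

/-- The map `[q + 1] → [p]` with `0 ↦ 0` and `i + 1 ↦ α i`. -/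
def prependZero {n : ℕ} (α : ⦋n⦌ ⟶ p) : ⦋n + 1⦌ ⟶ p :=
  SimplexCategory.Hom.mk
    { toFun := Fin.cases 0 α.toOrderHom
      monotone' := by
        intro i j h
        induction i using Fin.cases with
        | zero => exact Fin.zero_le _
        | succ i =>
          induction j using Fin.cases with
          | zero => exact absurd h (by simp)
          | succ j => exact α.toOrderHom.monotone (Fin.succ_le_succ_iff.1 h) }

lemma δ_prependZero {n : ℕ} (α : ⦋n⦌ ⟶ p) : SimplexCategory.δ 0 ≫ prependZero α = α := by
  ext i : 3
  rfl

lemma prependZero_comp {n : ℕ} (α : ⦋n⦌ ⟶ p) (f : p ⟶ q) (hf : f.toOrderHom 0 = 0) :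
    prependZero α ≫ f = prependZero (α ≫ f) := by
  ext i : 3
  induction i using Fin.cases with
  | zero => exact hf
  | succ i => rfl

lemma pull_prependZero_c {n : ℕ} (α : ⦋n⦌ ⟶ p) (x : WB Γ p) :
    (x.pull (prependZero α)).c (SimplexCategory.δ 0) = x.c α := by
  rw [pull_c_of_zero _ rfl, δ_prependZero]

/-- Simplicial operations on `W̄` renormalise a cocycle, so an equality of pulled back simplices is
not at once an equality of values. Prepending the initial vertex removes the renormalisation: `c(α)`
is the value at `δ 0` of the pullback along `prependZero α`. As `f` and `g` preserve the initial
vertex, the relation between `α` and `β` survives prepending. -/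
lemma c_eq_c {s : SimplexCategory} {f : q ⟶ s} {g : r ⟶ s} (hf : f.toOrderHom 0 = 0)
    (hg : g.toOrderHom 0 = 0) {x : WB Γ q} {y : WB Γ r}
    (h : ∀ {t : SimplexCategory} (α : t ⟶ q) (β : t ⟶ r), α ≫ f = β ≫ g → x.pull α = y.pull β)
    {t : SimplexCategory} (α : t ⟶ q) (β : t ⟶ r) (hαβ : α ≫ f = β ≫ g) : x.c α = y.c β := by
  induction t using SimplexCategory.rec with | _ n
  rw [← pull_prependZero_c α, ← pull_prependZero_c β, h]
  rw [prependZero_comp _ _ hf, prependZero_comp _ _ hg, hαβ]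

lemma comp_σ_comp_δ {n : ℕ} (θ : q ⟶ ⦋n + 1⦌) (h : θ.toOrderHom 0 ≠ 0) :
    (θ ≫ SimplexCategory.σ 0) ≫ SimplexCategory.δ 0 = θ := by
  ext i : 3
  exact Fin.succAbove_predAbove (p := 0) fun h' =>
    h (le_antisymm ((θ.toOrderHom.monotone (Fin.zero_le i)).trans h'.le) (Fin.zero_le _))

/-- The `n + 1`-simplex of `W̄ Γ` with `c(δ₀) = g` and `0`-th face `d`. -/
def cons {n : ℕ} (g : Γ.obj (op ⦋n⦌)) (d : WB Γ ⦋n⦌) : WB Γ ⦋n + 1⦌ where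
  c {q} θ := if θ.toOrderHom 0 = 0 then 1 else
    d.c (θ ≫ SimplexCategory.σ 0) * Γ.map (θ ≫ SimplexCategory.σ 0).op g
  c_zero θ h := if_pos h
  c_comp {q r} η θ h := by
    have : (η ≫ θ).toOrderHom 0 = θ.toOrderHom 0 := congrArg θ.toOrderHom h
    rw [this]
    split_ifs
    · rw [map_one]
    · rw [Category.assoc, d.c_comp _ _ h, map_mul, map_map_op]

lemma cons_c_comp_δ {n : ℕ} (g : Γ.obj (op ⦋n⦌)) (d : WB Γ ⦋n⦌) (θ : q ⟶ ⦋n⦌) :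
    (cons g d).c (θ ≫ SimplexCategory.δ 0) = d.c θ * Γ.map θ.op g := by
  have h : (θ ≫ SimplexCategory.δ (0 : Fin (n + 2))).toOrderHom 0 ≠ 0 :=
    Fin.succAbove_ne 0 (θ.toOrderHom 0)
  have h' : (θ ≫ SimplexCategory.δ (0 : Fin (n + 2))) ≫ SimplexCategory.σ 0 = θ := by
    rw [Category.assoc]
    exact (congrArg (θ ≫ ·) (SimplexCategory.δ_comp_σ_self (i := 0))).trans (Category.comp_id _)
  have h'' : (cons g d).c (θ ≫ SimplexCategory.δ 0) =
      d.c ((θ ≫ SimplexCategory.δ (0 : Fin (n + 2))) ≫ SimplexCategory.σ 0) *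
        Γ.map ((θ ≫ SimplexCategory.δ (0 : Fin (n + 2))) ≫ SimplexCategory.σ 0).op g :=
    if_neg (t := (1 : Γ.obj (op q))) h
  rw [h'', h']

lemma cons_c_δ {n : ℕ} (g : Γ.obj (op ⦋n⦌)) (d : WB Γ ⦋n⦌) :
    (cons g d).c (SimplexCategory.δ 0) = g := by
  have := cons_c_comp_δ g d (𝟙 _)
  rwa [Category.id_comp, c_id, one_mul, map_id_op] at this

lemma c_comp_δ {n : ℕ} (x : WB Γ ⦋n + 1⦌) (θ : q ⟶ ⦋n⦌) :
    x.c (θ ≫ SimplexCategory.δ 0) = (x.pull (SimplexCategory.δ 0)).c θ *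
      Γ.map θ.op (x.c (SimplexCategory.δ 0)) := by
  rw [pull_c, inv_mul_cancel_right]

/-- A map which does not send `0` to `0` factors through `δ 0`, and there the cocycle is determined
by the `0`-th face and by `c(δ₀)`. Together with `cons` this is the decomposition `W̄_{n+1} = Γ_n ×
W̄_n`. -/
lemma ext_cons {n : ℕ} {x y : WB Γ ⦋n + 1⦌}
    (h : x.pull (SimplexCategory.δ 0) = y.pull (SimplexCategory.δ 0))
    (h' : x.c (SimplexCategory.δ 0) = y.c (SimplexCategory.δ 0)) : x = y :=
  ext_of_ne fun θ hθ => by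
    rw [← comp_σ_comp_δ θ hθ, c_comp_δ, c_comp_δ, h, h']

lemma cons_pull_δ {n : ℕ} (g : Γ.obj (op ⦋n⦌)) (d : WB Γ ⦋n⦌) :
    (cons g d).pull (SimplexCategory.δ 0) = d := by
  ext q θ
  rw [pull_c, cons_c_comp_δ, cons_c_δ, mul_inv_cancel_right]

lemma δ_succ_zero {n : ℕ} (i : Fin (n + 2)) :
    (SimplexCategory.δ i.succ : ⦋n + 1⦌ ⟶ ⦋n + 2⦌).toOrderHom 0 = 0 :=
  Fin.succAbove_of_castSucc_lt i.succ 0 (by simp)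

/-! ### Fibrations of classifying spaces -/

variable {φ : Γ ⟶ Γ'}

variable (φ) in
/-- The lifting property, along a homomorphism of simplicial groups, of families of faces in `T`. -/
def FillsFaces (n : ℕ) (T : Fin (n + 2) → Prop) : Prop :=
  ∀ (e : Fin (n + 2) → Γ.obj (op ⦋n⦌)), FaceCompat Γ T e → ∀ (y : Γ'.obj (op ⦋n + 1⦌)),
    (∀ i, T i → φ.app _ (e i) = Γ'.map (SimplexCategory.δ i).op y) →
    ∃ x : Γ.obj (op ⦋n + 1⦌), φ.app _ x = y ∧ ∀ i, T i → Γ.map (SimplexCategory.δ i).op x = e i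

/-- `W̄` has a single vertex and its edges are the elements of `Γ_0`, so only surjectivity of `φ` in
level `0` is needed. -/
lemma liftsAlong_zero (hφ : ∀ k, Function.Surjective (φ.app k)) {A : (Δ[0 + 1] : SSet.{w}).Subcomplex}
    {T : Fin 2 → Prop} (hA : GeneratedBy A T) : LiftsAlong (ssetMap φ) A := by
  refine GeneratedBy.liftsAlong hA fun e he y hy => ?_
  change WB Γ' ⦋0 + 1⦌ at y
  obtain ⟨g, hg⟩ := hφ _ (y.c (SimplexCategory.δ 0))
  refine ⟨cons g ⟨fun _ => 1, fun _ _ => rfl, fun _ _ _ => (map_one _).symm⟩, ?_, fun i hi =>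
    Subsingleton.elim (α := WB Γ ⦋0⦌) _ _⟩
  refine ext_cons (Subsingleton.elim (α := WB Γ' ⦋0⦌) _ _) ?_
  exact (congrArg _ (cons_c_δ _ _)).trans hg

/-- Under `W̄_{n+2} = Γ_{n+1} × W̄_{n+1}` the second coordinate is the `0`-th face, which is given
by `h0`. The condition on the face `i + 1` becomes a condition on the `i`-th face of the remaining
group element `g`, and this is a filling problem in `Γ` one dimension lower. -/
lemma liftsAlong_succ {n : ℕ} {A : (Δ[n + 2] : SSet.{w}).Subcomplex}
    {T : Fin (n + 3) → Prop} (hA : GeneratedBy A T) (h0 : T 0)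
    (hT : FillsFaces φ n (fun i => T i.succ)) : LiftsAlong (ssetMap φ) A := by
  classical
  refine GeneratedBy.liftsAlong hA fun e he y hy => ?_
  change ∀ i, T i → WB Γ ⦋n + 1⦌ at e
  change WB Γ' ⦋n + 2⦌ at y
  replace he : ∀ i j (hi : T i) (hj : T j), ∀ {q : SimplexCategory} (α β : q ⟶ ⦋n + 1⦌),
    α ≫ SimplexCategory.δ i = β ≫ SimplexCategory.δ j → (e i hi).pull α = (e j hj).pull β := he
  replace hy : ∀ i (hi : T i), (e i hi).push φ = y.pull (SimplexCategory.δ i) := hy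
  have hδ (i : Fin (n + 2)) : SimplexCategory.δ (0 : Fin (n + 2)) ≫ SimplexCategory.δ i.succ =
      SimplexCategory.δ i ≫ SimplexCategory.δ 0 := SimplexCategory.δ_comp_δ (Fin.zero_le i)
  let d := e 0 h0
  -- These are the required faces of `g`, obtained by solving `c(δ 0 ≫ δ i.succ) = c_d(δ i) · δᵢ^*
  -- g` for the cocycle of `cons g d`; the default `1` is never used.
  let h : Fin (n + 2) → Γ.obj (op ⦋n⦌) := fun i => if hi : T i.succ then
    (d.c (SimplexCategory.δ i))⁻¹ * (e i.succ hi).c (SimplexCategory.δ 0) else 1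
  have hh (i) (hi : T i.succ) {q : SimplexCategory} (α : q ⟶ ⦋n⦌) : Γ.map α.op (h i) =
      (d.c (α ≫ SimplexCategory.δ i))⁻¹ * (e i.succ hi).c (α ≫ SimplexCategory.δ 0) := by
    have h1 := congrArg (fun x => x.c α) (he i.succ 0 hi h0 _ _ (hδ i))
    simp only [pull_c] at h1
    have h2 : h i = (d.c (SimplexCategory.δ i))⁻¹ * (e i.succ hi).c (SimplexCategory.δ 0) :=
      dif_pos hi
    rw [h2, map_mul, map_inv, ← mul_left_cancel_iff (a := d.c (α ≫ SimplexCategory.δ i)),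
      ← mul_assoc, ← h1]
    group
  obtain ⟨g, hg, hg'⟩ := hT h (fun i j hi hj q α β hαβ => by
      rw [hh i hi, hh j hj, hαβ]
      congr 1
      refine c_eq_c (δ_succ_zero i) (δ_succ_zero j) (fun α β => he _ _ hi hj α β) _ _ ?_
      rw [Category.assoc, hδ, ← Category.assoc, hαβ, Category.assoc, Category.assoc, hδ])
    (y.c (SimplexCategory.δ 0))
    (fun i hi => by
      have h2 := hh i hi (𝟙 _)
      rw [map_id_op, Category.id_comp, Category.id_comp] at h2
      have h3 : ∀ j (hj : T j) {q : SimplexCategory} (α : q ⟶ ⦋n + 1⦌),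
          φ.app _ ((e j hj).c α) = (y.pull (SimplexCategory.δ j)).c α := fun j hj q α => by
        rw [← hy j hj]; rfl
      rw [h2, map_mul, map_inv, h3, h3, pull_c, pull_c, y.c_zero _ (δ_succ_zero i), hδ, map_one]
      group)
  refine ⟨cons g d, ?_, fun i hi => ?_⟩
  · refine ext_cons (y := y) ?_ ?_
    · refine (pull_push φ _ _).trans ?_
      rw [cons_pull_δ]
      exact hy 0 h0
    · exact (congrArg _ (cons_c_δ _ _)).trans hg
  · obtain rfl | ⟨i, rfl⟩ := Fin.eq_zero_or_eq_succ i
    · exact cons_pull_δ g d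
    · refine ext_of_ne (x := (cons g d).pull (SimplexCategory.δ i.succ)) (y := e i.succ hi)
        fun θ hθ => ?_
      rw [pull_c_of_zero _ (δ_succ_zero i), ← comp_σ_comp_δ θ hθ]
      generalize θ ≫ SimplexCategory.σ 0 = η
      rw [Category.assoc, hδ, ← Category.assoc, cons_c_comp_δ, ← map_map_op, hg' i hi, hh i hi,
        mul_inv_cancel_left]

lemma comp_σ_comp_δ_one {n : ℕ} (θ : q ⟶ ⦋n + 2⦌) (h : θ.toOrderHom 0 ≠ 0)
    (h1 : θ.toOrderHom 0 ≠ 1) :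
    (θ ≫ SimplexCategory.σ 0) ≫ SimplexCategory.δ 1 = θ := by
  ext i : 3
  exact Fin.succ_succAbove_predAbove (p := 0) fun h' => by
    have h2 : (θ.toOrderHom 0 : ℕ) ≤ θ.toOrderHom i := θ.toOrderHom.monotone (Fin.zero_le i)
    have h3 : (θ.toOrderHom i : ℕ) = 1 := congrArg Fin.val h'
    have h4 : (θ.toOrderHom 0 : ℕ) ≠ 0 := fun h' => h (Fin.ext h')
    exact h1 (Fin.ext (show (θ.toOrderHom 0 : ℕ) = 1 by omega))

/-- The simplex of `W̄ Γ` used to fill a `0`-th horn. -/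
def hornZero {n : ℕ} (g : Γ.obj (op ⦋n + 1⦌)) (e : WB Γ ⦋n + 1⦌) : WB Γ ⦋n + 2⦌ where
  c {q} θ := if θ.toOrderHom 0 = 0 then 1 else if θ.toOrderHom 0 = 1 then
    Γ.map (θ ≫ SimplexCategory.σ 0).op g else e.c (θ ≫ SimplexCategory.σ 0)
  c_zero θ h := if_pos h
  c_comp {q r} η θ h := by
    have : (η ≫ θ).toOrderHom 0 = θ.toOrderHom 0 := congrArg θ.toOrderHom h
    rw [this]
    split_ifs
    · rw [map_one]
    · rw [Category.assoc, map_map_op]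
    · rw [Category.assoc, e.c_comp _ _ h]

/-- Here the `0`-th face is missing and `liftsAlong_succ` does not apply. The values `c(θ)` with
`θ(0) ≥ 2` are read off from the face `δ 1`, which misses only the vertex `1`. Those with `θ(0) = 1`
are restrictions of the single element `g = c(δ₀)`. The remaining faces prescribe the faces of `g`
other than the `0`-th, and this is a `0`-th horn in `Γ`. -/
lemma liftsAlong_horn_zero {n : ℕ} (hT : FillsFaces φ n (fun i => i ≠ 0)) :
    LiftsAlong (ssetMap φ) (SSet.horn (n + 2) 0) := by
  classical
  refine GeneratedBy.liftsAlong (generatedBy_horn 0) fun e he y hy => ?_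
  change ∀ i : Fin (n + 3), i ≠ 0 → WB Γ ⦋n + 1⦌ at e
  change WB Γ' ⦋n + 2⦌ at y
  replace he : ∀ i j (hi : i ≠ 0) (hj : j ≠ 0), ∀ {q : SimplexCategory} (α β : q ⟶ ⦋n + 1⦌),
    α ≫ SimplexCategory.δ i = β ≫ SimplexCategory.δ j → (e i hi).pull α = (e j hj).pull β := he
  replace hy : ∀ i (hi : i ≠ 0), (e i hi).push φ = y.pull (SimplexCategory.δ i) := hy
  have hδ (i : Fin (n + 2)) : SimplexCategory.δ (0 : Fin (n + 2)) ≫ SimplexCategory.δ i.succ =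
      SimplexCategory.δ i ≫ SimplexCategory.δ 0 := SimplexCategory.δ_comp_δ (Fin.zero_le i)
  have hs (i : Fin (n + 2)) : i.succ ≠ 0 := Fin.succ_ne_zero i
  have hc (i j : Fin (n + 2)) {t : SimplexCategory} (α β : t ⟶ ⦋n + 1⦌)
      (h : α ≫ SimplexCategory.δ i.succ = β ≫ SimplexCategory.δ j.succ) :
      (e i.succ (hs i)).c α = (e j.succ (hs j)).c β :=
    c_eq_c (δ_succ_zero i) (δ_succ_zero j) (fun α β => he _ _ _ _ α β) _ _ h
  have hδ0 (i : Fin (n + 2)) (hi : i ≠ 0) :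
      (SimplexCategory.δ i : ⦋n⦌ ⟶ ⦋n + 1⦌).toOrderHom 0 = 0 := by
    obtain ⟨i, rfl⟩ := Fin.exists_succ_eq_of_ne_zero hi
    exact Fin.succAbove_of_castSucc_lt i.succ 0 (by simp)
  have hhc (i : Fin (n + 2)) {q : SimplexCategory} (α : q ⟶ ⦋n⦌) :
      Γ.map α.op ((e i.succ (hs i)).c (SimplexCategory.δ 0)) =
        (((e i.succ (hs i)).pull (SimplexCategory.δ 0)).c α)⁻¹ *
          (e i.succ (hs i)).c (α ≫ SimplexCategory.δ 0) := by
    rw [pull_c]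
    group
  obtain ⟨g, hg, hg'⟩ := hT (fun i => (e i.succ (hs i)).c (SimplexCategory.δ 0))
    (fun i j hi hj q α β hαβ => by
      have h1 {t : SimplexCategory} (α β : t ⟶ ⦋n⦌)
          (h : α ≫ SimplexCategory.δ i = β ≫ SimplexCategory.δ j) :
          (α ≫ SimplexCategory.δ 0) ≫ SimplexCategory.δ i.succ =
            (β ≫ SimplexCategory.δ 0) ≫ SimplexCategory.δ j.succ := by
        rw [Category.assoc, hδ, ← Category.assoc, h, Category.assoc, Category.assoc, hδ]
      rw [hhc i, hhc j, hc _ _ _ _ (h1 _ _ hαβ),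
        c_eq_c (hδ0 i hi) (hδ0 j hj) (fun α β h => ?_) α β hαβ]
      rw [← pull_comp, ← pull_comp, he _ _ _ _ _ _ (h1 α β h)])
    (y.c (SimplexCategory.δ 0)) (fun i hi => by
      have h3 : φ.app _ ((e i.succ (hs i)).c (SimplexCategory.δ 0)) =
          (y.pull (SimplexCategory.δ i.succ)).c (SimplexCategory.δ 0) := by
        rw [← hy i.succ (hs i)]; rfl
      rw [h3, pull_c_of_zero _ (δ_succ_zero i), hδ, y.c_comp _ _ (hδ0 i hi)])
  have hσ {q : SimplexCategory} (θ : q ⟶ ⦋n + 2⦌) (h : θ.toOrderHom 0 = 1) :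
      (θ ≫ SimplexCategory.σ 0).toOrderHom 0 = 0 := by
    change Fin.predAbove 0 (θ.toOrderHom 0) = 0
    rw [h]
    rfl
  refine ⟨hornZero g (e 1 (hs 0)), ?_, fun i hi => ?_⟩
  · refine ext_of_ne (x := (hornZero g (e 1 (hs 0))).push φ) (y := y) fun {q} θ hθ => ?_
    rw [push_c]
    by_cases h1 : θ.toOrderHom 0 = 1
    · have h2 : (hornZero g (e 1 (hs 0))).c θ = Γ.map (θ ≫ SimplexCategory.σ 0).op g :=
        (if_neg hθ).trans (if_pos h1)
      rw [h2, app_map, hg, ← y.c_comp _ _ (hσ θ h1), comp_σ_comp_δ θ hθ]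
    · have h2 : (hornZero g (e 1 (hs 0))).c θ = (e 1 (hs 0)).c (θ ≫ SimplexCategory.σ 0) :=
        (if_neg hθ).trans (if_neg h1)
      rw [h2, ← push_c, hy 1 (hs 0)]
      refine (pull_c_of_zero _ (δ_succ_zero 0) y _).trans ?_
      exact congrArg y.c (comp_σ_comp_δ_one θ hθ h1)
  · obtain ⟨i, rfl⟩ := Fin.exists_succ_eq_of_ne_zero hi
    refine ext_of_ne (x := (hornZero g (e 1 (hs 0))).pull (SimplexCategory.δ i.succ))
      (y := e i.succ hi) fun {q} η hη => ?_
    rw [pull_c_of_zero _ (δ_succ_zero i)]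
    have hne : (η ≫ SimplexCategory.δ i.succ).toOrderHom 0 ≠ 0 := by
      intro h
      exact hη (Fin.succAbove_right_injective (p := i.succ)
        ((show i.succ.succAbove (η.toOrderHom 0) = 0 from h).trans (δ_succ_zero i).symm))
    by_cases h1 : (η ≫ SimplexCategory.δ i.succ).toOrderHom 0 = 1
    · have h2 : (hornZero g (e 1 (hs 0))).c (η ≫ SimplexCategory.δ i.succ) =
          Γ.map ((η ≫ SimplexCategory.δ i.succ) ≫ SimplexCategory.σ 0).op g :=
        (if_neg hne).trans (if_pos h1)
      -- The case `i = 0` is the face `δ 1`, whose image omits the vertex `1`.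
      have hi0 : i ≠ 0 := by
        rintro rfl
        exact Fin.succAbove_ne 1 (η.toOrderHom 0) h1
      have hη' : (η ≫ SimplexCategory.σ 0) ≫ SimplexCategory.δ 0 = η := comp_σ_comp_δ η hη
      have h3 : (η ≫ SimplexCategory.δ i.succ) ≫ SimplexCategory.σ 0 =
          (η ≫ SimplexCategory.σ 0) ≫ SimplexCategory.δ i := by
        have h4 : SimplexCategory.δ (0 : Fin (n + 3)) ≫ SimplexCategory.σ 0 = 𝟙 _ :=
          SimplexCategory.δ_comp_σ_self (i := 0)
        have h6 : SimplexCategory.δ (0 : Fin (n + 2)) ≫ SimplexCategory.δ i.succ ≫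
            SimplexCategory.σ 0 = SimplexCategory.δ i := by
          rw [← Category.assoc, hδ, Category.assoc, h4, Category.comp_id]
        conv_lhs => rw [← hη']
        rw [Category.assoc, Category.assoc, h6]
      have h5 : (η ≫ SimplexCategory.σ 0).toOrderHom 0 = 0 := by
        have h6 := hσ _ h1
        rw [h3] at h6
        exact Fin.succAbove_right_injective (p := i)
          ((show i.succAbove _ = 0 from h6).trans (hδ0 i hi0).symm)
      rw [h2, h3, ← map_map_op, hg' i hi0, ← (e _ _).c_comp _ _ h5, hη']
    · have h2 : (hornZero g (e 1 (hs 0))).c (η ≫ SimplexCategory.δ i.succ) =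
          (e 1 (hs 0)).c ((η ≫ SimplexCategory.δ i.succ) ≫ SimplexCategory.σ 0) :=
        (if_neg hne).trans (if_neg h1)
      rw [h2]
      exact hc 0 i _ _ (comp_σ_comp_δ_one _ hne h1)

theorem kanFibration_ssetMap (hφ : ∀ k, Function.Surjective (φ.app k)) :
    KanFibration (ssetMap φ) := by
  rw [kanFibration_iff]
  rintro (_ | n) k
  · exact liftsAlong_zero hφ (generatedBy_horn k)
  · obtain rfl | ⟨k, rfl⟩ := Fin.eq_zero_or_eq_succ k
    · exact liftsAlong_horn_zero (exists_fill_horn_lift hφ 0)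
    · refine liftsAlong_succ (generatedBy_horn k.succ) (Fin.succ_ne_zero k).symm ?_
      have h : (fun i : Fin (n + 2) => i.succ ≠ k.succ) = (· ≠ k) :=
        funext fun i => by rw [ne_eq, Fin.succ_inj]
      rw [h]
      exact exists_fill_horn_lift hφ k

theorem trivialKanFibration_ssetMap (hφ : ∀ k, Function.Surjective (φ.app k))
    (h : AcyclicKernel φ) : TrivialKanFibration (ssetMap φ) := by
  rw [trivialKanFibration_iff]
  rintro (_ | _ | n)
  · intro u hu y hy
    refine ⟨(⟨fun _ => 1, fun _ _ => rfl, fun _ _ _ => (map_one _).symm⟩ : WB Γ ⦋0⦌),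
      Subsingleton.elim (α := WB Γ' ⦋0⦌) _ _, fun b hb =>
        (hb fun y => ⟨0, Subsingleton.elim (α := Fin 1) _ _⟩).elim⟩
  · exact liftsAlong_zero hφ generatedBy_boundary
  · refine liftsAlong_succ generatedBy_boundary trivial fun e he y hy => ?_
    obtain ⟨x, hx, hx'⟩ := exists_fill_boundary_lift hφ h e he y (fun i => hy i trivial)
    exact ⟨x, hx, fun i _ => hx' i⟩

lemma push_surjective (hφ : ∀ k, Function.Surjective (φ.app k)) (p : SimplexCategory) :
    Function.Surjective (push (p := p) φ) := by
  induction p using SimplexCategory.rec with | _ n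
  induction n with
  | zero =>
    exact fun y => ⟨⟨fun _ => 1, fun _ _ => rfl, fun _ _ _ => (map_one _).symm⟩,
      Subsingleton.elim _ _⟩
  | succ n ih =>
    intro y
    obtain ⟨d, hd⟩ := ih (y.pull (SimplexCategory.δ 0))
    obtain ⟨g, hg⟩ := hφ _ (y.c (SimplexCategory.δ 0))
    refine ⟨cons g d, ext_cons ?_ ?_⟩
    · rw [pull_push, cons_pull_δ, hd]
    · rw [push_c, cons_c_δ, hg]

end WB

/-! ### Pullback squares of sets -/

/-- A commutative square of maps of sets which is a pullback. -/
structure SetPullback {P A C B : Type*} (p : P → A) (q : P → C) (f : A → B) (g : C → B) : Prop where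
  comm (x : P) : f (p x) = g (q x)
  ext {x y : P} (h : p x = p y) (h' : q x = q y) : x = y
  exists_mk {a : A} {c : C} (h : f a = g c) : ∃ x, p x = a ∧ q x = c

lemma isPullback_of_setPullback {P A B C : SSet.{w}} {p : P ⟶ A} {q : P ⟶ C} {f : A ⟶ B} {g : C ⟶ B}
    (h : ∀ k, SetPullback (p.app k) (q.app k) (f.app k) (g.app k)) : IsPullback p q f g :=
  IsPullback.of_forall_isPullback_app fun k => (Limits.Types.isPullback_iff _ _ _ _).2
    ⟨ConcreteCategory.hom_ext _ _ fun x => (h k).comm x, fun _ _ h' => (h k).ext h'.1 h'.2,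
      fun _ _ h' => (h k).exists_mk h'⟩

lemma setPullback_of_isPullback {P A B C : GrpCat.{w}} {p : P ⟶ A} {q : P ⟶ C} {f : A ⟶ B}
    {g : C ⟶ B} (h : IsPullback p q f g) : SetPullback p q f g := by
  obtain ⟨_, h1, h2⟩ := (Limits.Types.isPullback_iff _ _ _ _).1 (h.map (forget GrpCat.{w}))
  exact ⟨fun x => ConcreteCategory.congr_hom h.w x, fun h h' => h1 _ _ ⟨h, h'⟩,
    fun h => h2 _ _ h⟩

/-! ### Simplicial sets with an action of a simplicial group, and their homotopy quotients -/

/-- A simplicial set with an action of a simplicial group. -/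
structure SimplicialAction where
  /-- the simplicial group -/
  Γ : SimplexCategoryᵒᵖ ⥤ GrpCat.{w}
  /-- the simplicial set -/
  M : SSet.{w}
  [act (k : SimplexCategory) : MulAction (Γ.obj (op k)) (M.obj (op k))]
  map_smul {k l : SimplexCategory} (f : l ⟶ k) (g : Γ.obj (op k)) (x : M.obj (op k)) :
    M.map f.op (g • x) = Γ.map f.op g • M.map f.op x

namespace SimplicialAction

attribute [instance] SimplicialAction.act

/-- An equivariant map. -/
structure Hom (S S' : SimplicialAction.{w}) where
  /-- the homomorphism of simplicial groups -/
  φ : S.Γ ⟶ S'.Γ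
  /-- the map of simplicial sets -/
  ψ : S.M ⟶ S'.M
  map_smul {k : SimplexCategory} (g : S.Γ.obj (op k)) (x : S.M.obj (op k)) :
    ψ.app (op k) (g • x) = φ.app (op k) g • ψ.app (op k) x

variable (S : SimplicialAction.{w}) {S' : SimplicialAction.{w}}

/-- The simplicial operations on the homotopy quotient. -/
def borelPull {p q : SimplexCategory} (θ : q ⟶ p) (x : S.M.obj (op p) × WB S.Γ p) :
    S.M.obj (op q) × WB S.Γ q :=
  ⟨x.2.c θ • S.M.map θ.op x.1, x.2.pull θ⟩

lemma borelPull_id {p : SimplexCategory} (x : S.M.obj (op p) × WB S.Γ p) :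
    S.borelPull (𝟙 p) x = x := by
  refine Prod.ext ?_ (WB.pull_id x.2)
  change x.2.c (𝟙 p) • S.M.map (𝟙 (op p)) x.1 = x.1
  rw [WB.c_id, one_smul, S.M.map_id]
  rfl

lemma borelPull_borelPull {p q r : SimplexCategory} (θ : q ⟶ p) (η : r ⟶ q)
    (x : S.M.obj (op p) × WB S.Γ p) : S.borelPull η (S.borelPull θ x) = S.borelPull (η ≫ θ) x := by
  refine Prod.ext ?_ (WB.pull_comp η θ x.2).symm
  change (x.2.pull θ).c η • S.M.map η.op (x.2.c θ • S.M.map θ.op x.1) =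
    x.2.c (η ≫ θ) • S.M.map (θ.op ≫ η.op) x.1
  rw [S.map_smul, smul_smul, WB.pull_c, inv_mul_cancel_right, S.M.map_comp]
  rfl

/-- The homotopy quotient `M ×_Γ W Γ`, whose `p`-simplices are pairs of `p`-simplices of `M` and
`W̄ Γ`, with simplicial operations twisted by the cocycle. -/
def borel : SSet.{w} where
  obj p := S.M.obj p × WB S.Γ p.unop
  map θ := ↾(S.borelPull θ.unop)
  map_id p := ConcreteCategory.hom_ext _ _ fun x => S.borelPull_id (p := p.unop) x
  map_comp θ η := ConcreteCategory.hom_ext _ _ fun x =>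
    (S.borelPull_borelPull θ.unop η.unop x).symm

variable {S}

/-- The functoriality of the homotopy quotient. -/
def Hom.borelMap (h : S.Hom S') : S.borel ⟶ S'.borel where
  app p := ↾(fun x => ⟨h.ψ.app p x.1, x.2.push h.φ⟩)
  naturality p q θ := by
    apply ConcreteCategory.hom_ext
    intro x
    refine Prod.ext ?_ (WB.pull_push h.φ x.2 θ.unop).symm
    refine (h.map_smul (x.2.c θ.unop) (S.M.map θ x.1)).trans ?_
    exact congrArg (h.φ.app (op q.unop) (x.2.c θ.unop) • ·)
      (ConcreteCategory.congr_hom (h.ψ.naturality θ) x.1)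

/-- The cocycle part of the problem does not involve `M`, so it is lifted first, to `c`. Multiplying
the `M`-components by `c(b)⁻¹` cancels the twist in the simplicial operations and leaves an honest
lifting problem for `ψ`; its solution is twisted back by `c`. -/
lemma liftsAlong_borelMap (h : S.Hom S') {p : ℕ} {A : (Δ[p] : SSet.{w}).Subcomplex}
    (hψ : LiftsAlong h.ψ A) (hφ : LiftsAlong (WB.ssetMap h.φ) A) : LiftsAlong h.borelMap A := by
  intro u hu y hy
  change ∀ {k : SimplexCategory} (b : k ⟶ ⦋p⦌), memHom A b → S.M.obj (op k) × WB S.Γ k at u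
  change S'.M.obj (op ⦋p⦌) × WB S'.Γ ⦋p⦌ at y
  replace hu : ∀ {k l : SimplexCategory} (b : k ⟶ ⦋p⦌) (hb : memHom A b) (g : l ⟶ k),
    S.borelPull g (u b hb) = u (g ≫ b) (hb.comp g) := hu
  replace hy : ∀ {k : SimplexCategory} (b : k ⟶ ⦋p⦌) (hb : memHom A b),
    ((h.ψ.app (op k) (u b hb).1, (u b hb).2.push h.φ) : S'.M.obj (op k) × WB S'.Γ k) =
      S'.borelPull b y := hy
  obtain ⟨c, hc, hc'⟩ := hφ (fun b hb => (u b hb).2)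
    (fun b hb g => congrArg Prod.snd (hu b hb g)) y.2 (fun b hb => congrArg Prod.snd (hy b hb))
  change WB S.Γ ⦋p⦌ at c
  replace hc : c.push h.φ = y.2 := hc
  replace hc' : ∀ {k : SimplexCategory} (b : k ⟶ ⦋p⦌) (hb : memHom A b),
    c.pull b = (u b hb).2 := hc'
  have hcy {k : SimplexCategory} (b : k ⟶ ⦋p⦌) : h.φ.app (op k) (c.c b) = y.2.c b := by
    rw [← hc]; rfl
  obtain ⟨m, hm, hm'⟩ := hψ (fun b hb => (c.c b)⁻¹ • (u b hb).1)
    (fun b hb g => by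
      have h1 : (u (g ≫ b) (hb.comp g)).1 = (u b hb).2.c g • S.M.map g.op (u b hb).1 :=
        (congrArg Prod.fst (hu b hb g)).symm
      rw [S.map_smul, h1, ← hc' b hb, WB.pull_c, smul_smul, map_inv, inv_mul_cancel_left])
    y.1
    (fun b hb => by
      have h1 : h.ψ.app _ (u b hb).1 = y.2.c b • S'.M.map b.op y.1 := congrArg Prod.fst (hy b hb)
      rw [h.map_smul, h1, map_inv, hcy, inv_smul_smul])
  refine ⟨((m, c) : S.M.obj (op ⦋p⦌) × WB S.Γ ⦋p⦌), Prod.ext hm hc, fun {k} b hb =>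
    Prod.ext ?_ (hc' b hb)⟩
  change c.c b • S.M.map b.op m = (u b hb).1
  rw [hm' b hb, smul_inv_smul]

lemma kanFibration_borelMap (h : S.Hom S') (hψ : KanFibration h.ψ)
    (hφ : ∀ k, Function.Surjective (h.φ.app k)) : KanFibration h.borelMap := by
  have hφ' := WB.kanFibration_ssetMap hφ
  rw [kanFibration_iff] at hψ hφ' ⊢
  exact fun n i => liftsAlong_borelMap h (hψ n i) (hφ' n i)

lemma trivialKanFibration_borelMap (h : S.Hom S') (hψ : TrivialKanFibration h.ψ)
    (hφ : ∀ k, Function.Surjective (h.φ.app k)) (hφ' : AcyclicKernel h.φ) :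
    TrivialKanFibration h.borelMap := by
  have hφ'' := WB.trivialKanFibration_ssetMap hφ hφ'
  rw [trivialKanFibration_iff] at hψ hφ'' ⊢
  exact fun n => liftsAlong_borelMap h (hψ n) (hφ'' n)

lemma borelMap_surjective (h : S.Hom S') (hψ : ∀ k, Function.Surjective (h.ψ.app k))
    (hφ : ∀ k, Function.Surjective (h.φ.app k)) (k : SimplexCategoryᵒᵖ) :
    Function.Surjective (h.borelMap.app k) := by
  rintro ⟨m, c⟩
  obtain ⟨m, rfl⟩ := hψ k m
  obtain ⟨c, rfl⟩ := WB.push_surjective hφ _ c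
  exact ⟨⟨m, c⟩, rfl⟩

lemma setPullback_push {Γ₁ Γ₂ Γ₃ Γ₄ : SimplexCategoryᵒᵖ ⥤ GrpCat.{w}} {p : Γ₁ ⟶ Γ₂} {q : Γ₁ ⟶ Γ₃}
    {f : Γ₂ ⟶ Γ₄} {g : Γ₃ ⟶ Γ₄}
    (h : ∀ k, SetPullback (p.app k) (q.app k) (f.app k) (g.app k)) (n : SimplexCategory) :
    SetPullback (WB.push (p := n) p) (WB.push q) (WB.push f) (WB.push g) where
  comm x := by
    ext k θ
    exact (h _).comm _
  ext {x y} hp hq := by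
    ext k θ
    exact (h _).ext (congrArg (fun z => z.c θ) hp) (congrArg (fun z => z.c θ) hq)
  exists_mk {a c} hac := by
    choose e he he' using fun (k : SimplexCategory) (θ : k ⟶ n) =>
      (h (op k)).exists_mk (congrArg (fun z => z.c θ) hac)
    refine ⟨⟨fun {k} θ => e k θ, fun {k} θ hθ => ?_, fun {k l} η θ hη => ?_⟩, ?_, ?_⟩
    · refine (h _).ext ?_ ?_
      · rw [he, a.c_zero θ hθ, map_one]
      · rw [he', c.c_zero θ hθ, map_one]
    · refine (h _).ext ?_ ?_
      · rw [he, a.c_comp η θ hη, app_map, he]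
      · rw [he', c.c_comp η θ hη, app_map, he']
    · ext k θ
      exact he k θ
    · ext k θ
      exact he' k θ

lemma setPullback_borelMap {S₁ S₂ S₃ S₄ : SimplicialAction.{w}} {p : S₁.Hom S₂} {q : S₁.Hom S₃}
    {f : S₂.Hom S₄} {g : S₃.Hom S₄}
    (h : ∀ k, SetPullback (p.φ.app k) (q.φ.app k) (f.φ.app k) (g.φ.app k))
    (h' : ∀ k, SetPullback (p.ψ.app k) (q.ψ.app k) (f.ψ.app k) (g.ψ.app k)) (k) :
    SetPullback (p.borelMap.app k) (q.borelMap.app k) (f.borelMap.app k) (g.borelMap.app k) where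
  comm x := Prod.ext ((h' k).comm x.1) ((setPullback_push h k.unop).comm x.2)
  ext hp hq := Prod.ext ((h' k).ext (congrArg Prod.fst hp) (congrArg Prod.fst hq))
    ((setPullback_push h k.unop).ext (congrArg Prod.snd hp) (congrArg Prod.snd hq))
  exists_mk {a c} hac := by
    obtain ⟨m, hm, hm'⟩ := (h' k).exists_mk (congrArg Prod.fst hac)
    obtain ⟨d, hd, hd'⟩ := (setPullback_push h k.unop).exists_mk (congrArg Prod.snd hac)
    exact ⟨⟨m, d⟩, Prod.ext hm hd, Prod.ext hm' hd'⟩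

end SimplicialAction

/-! ### Twisted cosimplicial operations -/

/-- The map `[n+1] → [n'+1]` with `0 ↦ 0` and `i + 1 ↦ θ i + 1`. -/
def plusMap {n n' : ℕ} (θ : ⦋n⦌ ⟶ ⦋n'⦌) : ⦋n + 1⦌ ⟶ ⦋n' + 1⦌ :=
  SimplexCategory.Hom.mk ⟨Fin.cons 0 fun i => (θ.toOrderHom i).succ, fun i j h => by
    induction i using Fin.cases with
    | zero => exact Fin.zero_le _
    | succ i =>
      induction j using Fin.cases with
      | zero => exact absurd h (by simp)
      | succ j =>
        exact Fin.succ_le_succ_iff.2 (θ.toOrderHom.monotone (Fin.succ_le_succ_iff.1 h))⟩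

/-- The map `[n+1] → [n'+1]` with `0 ↦ 1` and `i + 1 ↦ θ i + 1`. -/
def flatMap {n n' : ℕ} (θ : ⦋n⦌ ⟶ ⦋n'⦌) : ⦋n + 1⦌ ⟶ ⦋n' + 1⦌ :=
  SimplexCategory.Hom.mk ⟨Fin.cons 1 fun i => (θ.toOrderHom i).succ, fun i j h => by
    induction i using Fin.cases with
    | zero =>
      induction j using Fin.cases with
      | zero => exact le_rfl
      | succ j => exact Fin.succ_le_succ_iff.2 (Fin.zero_le _)
    | succ i =>
      induction j using Fin.cases with
      | zero => exact absurd h (by simp)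
      | succ j =>
        exact Fin.succ_le_succ_iff.2 (θ.toOrderHom.monotone (Fin.succ_le_succ_iff.1 h))⟩

section

variable {n n' n'' : ℕ} (θ : ⦋n⦌ ⟶ ⦋n'⦌) (η : ⦋n'⦌ ⟶ ⦋n''⦌)

lemma hom_ext_succ {p : SimplexCategory} {f g : ⦋n + 1⦌ ⟶ p}
    (h0 : f.toOrderHom (0 : Fin (n + 2)) = g.toOrderHom (0 : Fin (n + 2)))
    (h : ∀ i : Fin (n + 1), f.toOrderHom i.succ = g.toOrderHom i.succ) : f = g :=
  SimplexCategory.Hom.ext _ _ (OrderHom.ext _ _ (funext fun i => by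
    induction i using Fin.cases with
    | zero => exact h0
    | succ i => exact h i))

lemma plusMap_id : plusMap (𝟙 ⦋n⦌) = 𝟙 _ := hom_ext_succ rfl fun _ => rfl

lemma plusMap_comp : plusMap (θ ≫ η) = plusMap θ ≫ plusMap η := hom_ext_succ rfl fun _ => rfl

lemma plusMap_comp_flatMap : plusMap θ ≫ flatMap η = flatMap (θ ≫ η) :=
  hom_ext_succ rfl fun _ => rfl

lemma flatMap_comp_plusMap : flatMap θ ≫ plusMap η = flatMap θ ≫ flatMap η :=
  hom_ext_succ rfl fun _ => rfl

lemma flatMap_comp_plusMap_of_zero (h : η.toOrderHom (0 : Fin (n' + 1)) = 0) :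
    flatMap θ ≫ plusMap η = flatMap (θ ≫ η) :=
  hom_ext_succ (congrArg Fin.succ h) fun _ => rfl

lemma flatMap_of_zero (h : θ.toOrderHom (0 : Fin (n + 1)) = 0) :
    flatMap θ = SimplexCategory.σ 0 ≫ θ ≫ SimplexCategory.δ 0 :=
  hom_ext_succ (congrArg Fin.succ h).symm fun _ => rfl

lemma plusMap_σ (i : Fin (n + 1)) : plusMap (SimplexCategory.σ i) = SimplexCategory.σ i.succ :=
  hom_ext_succ (Fin.predAbove_of_le_castSucc i.succ (0 : Fin (n + 3)) (Fin.zero_le _)).symm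
    fun j => (Fin.succ_predAbove_succ i j).symm

lemma plusMap_δ (i : Fin (n + 2)) : plusMap (SimplexCategory.δ i) = SimplexCategory.δ i.succ :=
  hom_ext_succ (Fin.succ_succAbove_zero i).symm fun j => (Fin.succ_succAbove_succ i j).symm

lemma flatMap_δ_zero : flatMap (SimplexCategory.δ (0 : Fin (n + 2))) = SimplexCategory.δ 0 :=
  hom_ext_succ rfl fun _ => rfl

lemma plusMap_σ_zero : plusMap θ ≫ SimplexCategory.σ 0 = flatMap θ ≫ SimplexCategory.σ 0 :=
  hom_ext_succ rfl fun _ => rfl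

end

section

variable {C D : SimplexCategory ⥤ GrpCat.{w}} (φ : C ⟶ D) {n n' n'' : ℕ}

lemma hom_app_map {p q : SimplexCategory} (f : p ⟶ q) (x : C.obj p) :
    φ.app q (C.map f x) = D.map f (φ.app p x) :=
  ConcreteCategory.congr_hom (φ.naturality f) x

lemma map_map_comp {p q r : SimplexCategory} (f : p ⟶ q) (g : q ⟶ r) (x : C.obj p) :
    C.map g (C.map f x) = C.map (f ≫ g) x :=
  (ConcreteCategory.congr_hom (C.map_comp f g) x).symm

/-- The twisted action of simplicial operations on the shifted cosimplicial group, which describes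
the simplicial operations on elements of Maurer–Cartan spaces. -/
def twist (C : SimplexCategory ⥤ GrpCat.{w}) (θ : ⦋n⦌ ⟶ ⦋n'⦌) (x : C.obj ⦋n + 1⦌) :
    C.obj ⦋n' + 1⦌ :=
  C.map (plusMap θ) x * (C.map (flatMap θ) x)⁻¹

lemma map_twist (θ : ⦋n⦌ ⟶ ⦋n'⦌) (x : C.obj ⦋n + 1⦌) :
    φ.app _ (twist C θ x) = twist D θ (φ.app _ x) := by
  rw [twist, twist, map_mul, map_inv, hom_app_map, hom_app_map]

/-- The two middle factors cancel because `flatMap θ ≫ plusMap η = flatMap θ ≫ flatMap η`.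
Composition thus holds without any normalisation of `x`; only `twist_id` needs `σ⁰ x = 1`. -/
lemma twist_twist (θ : ⦋n⦌ ⟶ ⦋n'⦌) (η : ⦋n'⦌ ⟶ ⦋n''⦌) (x : C.obj ⦋n + 1⦌) :
    twist C η (twist C θ x) = twist C (θ ≫ η) x := by
  simp only [twist, map_mul, map_inv, map_map_comp, plusMap_comp, plusMap_comp_flatMap,
    flatMap_comp_plusMap]
  group

/-- When `θ` preserves `0`, `flatMap θ` factors through `σ 0`, so the second factor of the twist
dies on normalised elements. This is why only `∂₀` has an extra factor in the Maurer–Cartan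
equations. -/
lemma twist_of_zero (θ : ⦋n⦌ ⟶ ⦋n'⦌) (h : θ.toOrderHom (0 : Fin (n + 1)) = 0)
    {x : C.obj ⦋n + 1⦌} (hx : C.map (SimplexCategory.σ 0) x = 1) :
    twist C θ x = C.map (plusMap θ) x := by
  rw [twist, flatMap_of_zero θ h, ← map_map_comp, hx, map_one, inv_one, mul_one]

lemma twist_id {x : C.obj ⦋n + 1⦌} (hx : C.map (SimplexCategory.σ 0) x = 1) :
    twist C (𝟙 _) x = x := by
  rw [twist_of_zero _ rfl hx, plusMap_id, C.map_id]
  rfl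

lemma σ_zero_twist (θ : ⦋n⦌ ⟶ ⦋n'⦌) (x : C.obj ⦋n + 1⦌) :
    C.map (SimplexCategory.σ 0) (twist C θ x) = 1 := by
  rw [twist, map_mul, map_inv, map_map_comp, map_map_comp, plusMap_σ_zero, mul_inv_cancel]

lemma σ_succ_twist (θ : ⦋n⦌ ⟶ ⦋n' + 1⦌) (i : Fin (n' + 1)) (x : C.obj ⦋n + 1⦌) :
    C.map (SimplexCategory.σ i.succ) (twist C θ x) = twist C (θ ≫ SimplexCategory.σ i) x := by
  rw [← plusMap_σ, twist, twist, map_mul, map_inv, map_map_comp, map_map_comp,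
    ← plusMap_comp, flatMap_comp_plusMap_of_zero]
  exact Fin.predAbove_of_le_castSucc i (0 : Fin (n' + 2)) (Fin.zero_le _)

/-- The successive correction of `v` to an element with prescribed codegeneracies `m`. -/
def codegenCorrect (C : SimplexCategory ⥤ GrpCat.{w}) (v : C.obj ⦋n + 1⦌)
    (m : Fin (n + 1) → C.obj ⦋n⦌) (j : ℕ) : C.obj ⦋n + 1⦌ :=
  match j with
  | 0 => v
  | j + 1 => if h : j < n + 1 then codegenCorrect C v m j *
      C.map (SimplexCategory.δ (⟨j, h⟩ : Fin (n + 1)).succ)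
        ((C.map (SimplexCategory.σ ⟨j, h⟩) (codegenCorrect C v m j))⁻¹ * m ⟨j, h⟩)
      else codegenCorrect C v m j

variable (v : C.obj ⦋n + 1⦌) (m : Fin (n + 1) → C.obj ⦋n⦌)

/-- Each correction factor is the image of an error that is trivial here. This is what keeps the
values already prescribed on a subcomplex intact. -/
lemma codegenCorrect_of_eq (h : ∀ j, C.map (SimplexCategory.σ j) v = m j) (j : ℕ) :
    codegenCorrect C v m j = v := by
  induction j with
  | zero => rfl
  | succ j ih =>
    rw [codegenCorrect]
    split_ifs with hj
    · rw [ih, h, inv_mul_cancel, map_one, mul_one]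
    · exact ih

lemma map_codegenCorrect (j : ℕ) : φ.app _ (codegenCorrect C v m j) =
    codegenCorrect D (φ.app _ v) (fun j => φ.app _ (m j)) j := by
  induction j with
  | zero => rfl
  | succ j ih =>
    rw [codegenCorrect, codegenCorrect]
    split_ifs with hj
    · rw [map_mul, hom_app_map, map_mul, map_inv, hom_app_map, ih]
    · exact ih

/-- The factor `∂ᵏ⁺¹` of the error in `σᵏ` repairs `σᵏ`, since `σᵏ ∂ᵏ⁺¹ = 1`. For `i < k` the
identity `σⁱ ∂ᵏ⁺¹ = ∂ᵏ σⁱ` reduces the effect on `σⁱ` to `σⁱ` of the error, which is trivial by the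
cosimplicial identities and the compatibility `h` of the targets. So the codegeneracies are repaired
in increasing order. -/
lemma σ_codegenCorrect {n : ℕ} (v : C.obj ⦋n + 1 + 1⦌) (m : Fin (n + 1 + 1) → C.obj ⦋n + 1⦌)
    (h : ∀ (i : Fin (n + 1)) (j : Fin (n + 1)), i ≤ j →
      C.map (SimplexCategory.σ i) (m j.succ) = C.map (SimplexCategory.σ j) (m i.castSucc))
    (k : ℕ) (i : Fin (n + 1 + 1)) (hi : (i : ℕ) < k) :
    C.map (SimplexCategory.σ i) (codegenCorrect C v m k) = m i := by
  induction k with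
  | zero => simp at hi
  | succ k ih =>
    rw [codegenCorrect]
    split_ifs with hk
    · rw [map_mul]
      obtain hi | hi := Nat.lt_succ_iff_lt_or_eq.1 hi
      · rw [ih hi]
        obtain ⟨i, rfl⟩ := Fin.eq_castSucc_of_ne_last (x := i) (by
          rintro rfl
          simp only [Fin.val_last] at hi
          omega)
        obtain ⟨j, hj⟩ := Fin.exists_succ_eq.2 (show (⟨k, hk⟩ : Fin (n + 1 + 1)) ≠ 0 by
          intro h
          have := congrArg Fin.val h
          simp at this
          omega)
        have hij : i ≤ j := by
          have := congrArg Fin.val hj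
          simp at this hi
          rw [Fin.le_def]
          omega
        have h1 : SimplexCategory.δ j.succ.succ ≫ SimplexCategory.σ i.castSucc =
            SimplexCategory.σ i ≫ SimplexCategory.δ j.succ :=
          SimplexCategory.δ_comp_σ_of_gt (Fin.castSucc_lt_succ_iff.2 hij)
        have h2 : SimplexCategory.σ j.succ ≫ SimplexCategory.σ i =
            SimplexCategory.σ i.castSucc ≫ SimplexCategory.σ j :=
          (SimplexCategory.σ_comp_σ hij).symm
        rw [← hj, map_map_comp, h1, ← map_map_comp, map_mul, map_inv, map_map_comp, h2,
          ← map_map_comp, ih hi, h i j hij, inv_mul_cancel, map_one, mul_one]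
      · have h1 : (⟨k, hk⟩ : Fin (n + 1 + 1)) = i := Fin.ext hi.symm
        have h2 (x : C.obj ⦋n + 1⦌) : C.map (SimplexCategory.σ i)
            (C.map (SimplexCategory.δ i.succ) x) = x := by
          rw [map_map_comp, SimplexCategory.δ_comp_σ_succ, C.map_id]
          rfl
        rw [h1, h2, mul_inv_cancel_left]
    · exact ih (by omega)

lemma σ_codegenCorrect_zero (v : C.obj ⦋0 + 1⦌) (m : Fin (0 + 1) → C.obj ⦋0⦌) :
    C.map (SimplexCategory.σ 0) (codegenCorrect C v m 1) = m 0 := by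
  have h2 (x : C.obj ⦋0⦌) : C.map (SimplexCategory.σ 0)
      (C.map (SimplexCategory.δ (0 : Fin 1).succ) x) = x := by
    rw [map_map_comp, SimplexCategory.δ_comp_σ_succ, C.map_id]
    rfl
  change C.map (SimplexCategory.σ 0) (v * C.map (SimplexCategory.δ (0 : Fin 1).succ)
    ((C.map (SimplexCategory.σ 0) v)⁻¹ * m 0)) = m 0
  rw [map_mul, h2, mul_inv_cancel_left]

end

/-! ### Lifting simplices of Maurer–Cartan spaces -/

namespace MC

variable {G H : CsGrp.{w}} {p q : SimplexCategory}

/-- The face and degeneracy conditions are this identity for the generating maps `δ` and `σ`;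
`twist` is multiplicative on normalised elements, so the identity extends to all of the simplex
category. It packages these two kinds of Maurer–Cartan conditions into one. -/
lemma twist_ω (x : MC G p) {n n' : ℕ} (θ : ⦋n⦌ ⟶ ⦋n'⦌) {k : SimplexCategory} (a : k ⟶ ⦋n⦌)
    (b : k ⟶ p) : x.ω n' (a ≫ θ) b = twist (G.flip.obj (op k)) θ (x.ω n a b) := by
  let W : MorphismProperty SimplexCategory := fun n n' θ => ∀ {k : SimplexCategory} (a : k ⟶ n)
    (b : k ⟶ p), x.ω n'.len (a ≫ θ) b =
      twist (n := n.len) (n' := n'.len) (G.flip.obj (op k)) θ (x.ω n.len a b)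
  have hW1 : W.IsMultiplicative :=
    { id_mem := fun n k a b => by
        rw [Category.comp_id]
        exact (twist_id (C := G.flip.obj (op k)) (x.codegeneracy_zero _ _ _)).symm
      comp_mem := fun θ η hθ hη k a b => by
        rw [← Category.assoc, hη, hθ]
        exact twist_twist _ _ _ }
  have hW : W = ⊤ := by
    refine SimplexCategory.morphismProperty_eq_top W (fun {n} i k a b => ?_) (fun {n} i k a b => ?_)
    · induction i using Fin.cases with
      | zero =>
        refine (x.face_zero n a b).trans ?_
        change _ = (G.map (plusMap (SimplexCategory.δ 0))).app (op k) (x.ω n a b) *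
          ((G.map (flatMap (SimplexCategory.δ 0))).app (op k) (x.ω n a b))⁻¹
        rw [plusMap_δ, flatMap_δ_zero]
        rfl
      | succ i =>
        refine (x.face_succ n i a b).trans (Eq.symm ((twist_of_zero _ ?_
          (x.codegeneracy_zero _ _ _)).trans ?_))
        · exact Fin.succ_succAbove_zero i
        · exact congrArg (fun f => (G.map f).app (op k) (x.ω n a b)) (plusMap_δ i.succ)
    · refine (x.degeneracy n i a b).trans (Eq.symm ((twist_of_zero _ ?_
          (x.codegeneracy_zero _ _ _)).trans ?_))
      · exact Fin.predAbove_of_le_castSucc i (0 : Fin (n + 2)) (Fin.zero_le _)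
      · exact congrArg (fun f => (G.map f).app (op k) (x.ω (n + 1) a b)) (plusMap_σ i)
  have h : W θ := by rw [hW]; trivial
  exact h a b

/-- A family satisfying the defining conditions of an element of `mmc(G)` for indices less than
`N`. -/
structure IsMCBelow (N : ℕ) (ω : ∀ (n : ℕ) (k : SimplexCategory) (_ : k ⟶ ⦋n⦌) (_ : k ⟶ p),
    (G.obj ⦋n + 1⦌).obj (op k)) : Prop where
  naturality (n : ℕ) (hn : n < N) {k l : SimplexCategory} (f : l ⟶ k) (a : k ⟶ ⦋n⦌) (b : k ⟶ p) :
    (G.obj ⦋n + 1⦌).map f.op (ω n k a b) = ω n l (f ≫ a) (f ≫ b)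
  twist {n n' : ℕ} (hn : n < N) (hn' : n' < N) (θ : ⦋n⦌ ⟶ ⦋n'⦌) {k : SimplexCategory}
    (a : k ⟶ ⦋n⦌) (b : k ⟶ p) :
    ω n' k (a ≫ θ) b = twist (G.flip.obj (op k)) θ (ω n k a b)
  codegeneracy_zero (n : ℕ) (hn : n < N) {k : SimplexCategory} (a : k ⟶ ⦋n⦌) (b : k ⟶ p) :
    (G.map (SimplexCategory.σ 0)).app (op k) (ω n k a b) = 1

/-- The element of `mmc(G)` given by a family satisfying its defining conditions. -/
def ofIsMCBelow (ω : ∀ (n : ℕ) (k : SimplexCategory) (_ : k ⟶ ⦋n⦌) (_ : k ⟶ p),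
    (G.obj ⦋n + 1⦌).obj (op k)) (h : ∀ N, IsMCBelow N ω) : MC G p where
  ω n k a b := ω n k a b
  naturality n _ _ f a b := (h (n + 1)).naturality n n.lt_succ_self f a b
  face_zero n k a b := by
    refine ((h (n + 2)).twist (by omega) (by omega) (SimplexCategory.δ 0) a b).trans ?_
    change (G.map (plusMap (SimplexCategory.δ 0))).app (op k) (ω n k a b) *
          ((G.map (flatMap (SimplexCategory.δ 0))).app (op k) (ω n k a b))⁻¹ = _
    rw [plusMap_δ, flatMap_δ_zero]
    rfl
  face_succ n i k a b := by
    refine ((h (n + 2)).twist (by omega) (by omega) (SimplexCategory.δ i.succ) a b).trans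
      ((twist_of_zero _ ?_ ((h (n + 1)).codegeneracy_zero n (by omega) _ _)).trans ?_)
    · exact Fin.succ_succAbove_zero i
    · exact congrArg (fun f => (G.map f).app (op k) (ω n k a b)) (plusMap_δ i.succ)
  degeneracy n i k a b := by
    refine ((h (n + 2)).twist (by omega) (by omega) (SimplexCategory.σ i) a b).trans
      ((twist_of_zero _ ?_ ((h (n + 2)).codegeneracy_zero (n + 1) (by omega) _ _)).trans ?_)
    · exact Fin.predAbove_of_le_castSucc i (0 : Fin (n + 2)) (Fin.zero_le _)
    · exact congrArg (fun f => (G.map f).app (op k) (ω (n + 1) k a b)) (plusMap_σ i)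
  codegeneracy_zero n _ a b := (h (n + 1)).codegeneracy_zero n n.lt_succ_self a b

/-- The Maurer–Cartan space `mmc(G)`. -/
def sset (G : CsGrp.{w}) : SSet.{w} where
  obj p := MC G p.unop
  map θ := ↾(pull θ.unop)
  map_id _ := ConcreteCategory.hom_ext _ _ fun x => pull_id x
  map_comp θ η := ConcreteCategory.hom_ext _ _ fun x => pull_comp η.unop θ.unop x

/-- The map of Maurer–Cartan spaces induced by a morphism. -/
def ssetMap (φ : G ⟶ H) : sset G ⟶ sset H where
  app _ := ↾(push φ)
  naturality _ _ _ := rfl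

/-- A non-injective map factors through a codegeneracy. So in the new degree the twist identity
needs checking only for injections into `[N]` and for surjections `[N] → [N - 1]`; everything else
is a composite with identities known in lower degrees. -/
lemma IsMCBelow.step {N : ℕ} {ω : ∀ (n : ℕ) (k : SimplexCategory) (_ : k ⟶ ⦋n⦌) (_ : k ⟶ p),
      (G.obj ⦋n + 1⦌).obj (op k)} (h : IsMCBelow N ω)
    (hnat : ∀ {k l : SimplexCategory} (f : l ⟶ k) (a : k ⟶ ⦋N⦌) (b : k ⟶ p),
      (G.obj ⦋N + 1⦌).map f.op (ω N k a b) = ω N l (f ≫ a) (f ≫ b))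
    (hcodeg : ∀ {k : SimplexCategory} (a : k ⟶ ⦋N⦌) (b : k ⟶ p),
      (G.map (SimplexCategory.σ 0)).app (op k) (ω N k a b) = 1)
    (hmono : ∀ {n : ℕ} (_ : n < N) (θ : ⦋n⦌ ⟶ ⦋N⦌) [Mono θ] {k : SimplexCategory} (a : k ⟶ ⦋n⦌)
      (b : k ⟶ p), ω N k (a ≫ θ) b = DerivedDeligne.twist (G.flip.obj (op k)) θ (ω n k a b))
    (hdeg : ∀ {n : ℕ} (_ : n + 1 = N) (σ : ⦋N⦌ ⟶ ⦋n⦌) {k : SimplexCategory} (a : k ⟶ ⦋N⦌)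
      (b : k ⟶ p), Epi σ →
        ω n k (a ≫ σ) b = DerivedDeligne.twist (G.flip.obj (op k)) σ (ω N k a b)) :
    IsMCBelow (N + 1) ω := by
  have hcomp {n n' n'' : ℕ} (θ : ⦋n⦌ ⟶ ⦋n'⦌) (η : ⦋n'⦌ ⟶ ⦋n''⦌) {k : SimplexCategory}
      (a : k ⟶ ⦋n⦌) (b : k ⟶ p)
      (h1 : ω n' k (a ≫ θ) b = DerivedDeligne.twist (G.flip.obj (op k)) θ (ω n k a b))
      (h2 : ω n'' k ((a ≫ θ) ≫ η) b =
        DerivedDeligne.twist (G.flip.obj (op k)) η (ω n' k (a ≫ θ) b)) :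
      ω n'' k (a ≫ θ ≫ η) b = DerivedDeligne.twist (G.flip.obj (op k)) (θ ≫ η) (ω n k a b) := by
    rw [← Category.assoc, h2, h1]
    exact twist_twist _ _ _
  have hlt {n : ℕ} (hn : n < N) (θ : ⦋n⦌ ⟶ ⦋N⦌) {k : SimplexCategory} (a : k ⟶ ⦋n⦌)
      (b : k ⟶ p) : ω N k (a ≫ θ) b =
        DerivedDeligne.twist (G.flip.obj (op k)) θ (ω n k a b) := by
    induction n with
    | zero =>
      have : Mono θ := SimplexCategory.mono_iff_injective.2
        (Function.injective_of_subsingleton (α := Fin 1) _)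
      exact hmono hn θ a b
    | succ n ih =>
      by_cases hθ : Function.Injective θ.toOrderHom
      · have := SimplexCategory.mono_iff_injective.2 hθ
        exact hmono hn θ a b
      · obtain ⟨i, θ', rfl⟩ := SimplexCategory.eq_σ_comp_of_not_injective θ hθ
        exact hcomp _ _ a b (h.twist hn (by omega) _ a b) (ih (by omega) θ' _)
  refine ⟨fun n hn k l f a b => ?_, fun {n n'} hn hn' θ k a b => ?_, fun n hn k a b => ?_⟩
  · obtain hn | rfl := Nat.lt_succ_iff_lt_or_eq.1 hn
    · exact h.naturality n hn f a b
    · exact hnat f a b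
  · obtain hn' | rfl := Nat.lt_succ_iff_lt_or_eq.1 hn'
    · obtain hn | rfl := Nat.lt_succ_iff_lt_or_eq.1 hn
      · exact h.twist hn hn' θ a b
      · obtain _ | n := n
        · omega
        have hθ : ¬ Function.Injective θ.toOrderHom := fun hθ => by
          have := SimplexCategory.mono_iff_injective.2 hθ
          have := SimplexCategory.le_of_mono θ
          omega
        obtain ⟨i, θ', rfl⟩ := SimplexCategory.eq_σ_comp_of_not_injective θ hθ
        exact hcomp _ _ a b (hdeg rfl _ a b inferInstance)
          (h.twist n.lt_succ_self hn' θ' _ b)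
    · obtain hn | rfl := Nat.lt_succ_iff_lt_or_eq.1 hn
      · exact hlt hn θ a b
      · by_cases hθ : Function.Injective θ.toOrderHom
        · have := SimplexCategory.mono_iff_injective.2 hθ
          obtain rfl := SimplexCategory.eq_id_of_mono θ
          rw [Category.comp_id]
          exact (twist_id (C := G.flip.obj (op k)) (hcodeg a b)).symm
        · obtain _ | n := n
          · exact (hθ (Function.injective_of_subsingleton (α := Fin 1) _)).elim
          obtain ⟨i, θ', rfl⟩ := SimplexCategory.eq_σ_comp_of_not_injective θ hθ
          exact hcomp _ _ a b (hdeg rfl _ a b inferInstance) (hlt n.lt_succ_self θ' _ b)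
  · obtain hn | rfl := Nat.lt_succ_iff_lt_or_eq.1 hn
    · exact h.codegeneracy_zero n hn a b
    · exact hcodeg a b

lemma exists_epi_mono_fac {k : SimplexCategory} {n : ℕ} (a : k ⟶ ⦋n⦌) :
    ∃ (r : ℕ) (e : k ⟶ ⦋r⦌) (s : ⦋r⦌ ⟶ k) (m : ⦋r⦌ ⟶ ⦋n⦌),
      Mono m ∧ s ≫ e = 𝟙 _ ∧ e ≫ m = a := by
  obtain ⟨F⟩ := Limits.HasStrongEpiMonoFactorisations.has_fac a
  have : Epi F.e := inferInstance
  have hs : IsSplitEpi F.e := isSplitEpi_of_epi F.e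
  exact ⟨F.I.len, F.e, section_ F.e, F.m, F.m_mono, IsSplitEpi.id F.e, F.fac⟩

lemma IsMCBelow.congr {N : ℕ} {ω ω' : ∀ (n : ℕ) (k : SimplexCategory) (_ : k ⟶ ⦋n⦌) (_ : k ⟶ p),
    (G.obj ⦋n + 1⦌).obj (op k)} (h : IsMCBelow N ω) (h' : ∀ n < N, ω' n = ω n) :
    IsMCBelow N ω' where
  naturality n hn _ _ f a b := by
    rw [h' n hn]
    exact h.naturality n hn f a b
  twist hn hn' θ _ a b := by
    rw [h' _ hn, h' _ hn']
    exact h.twist hn hn' θ a b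
  codegeneracy_zero n hn _ a b := by
    rw [h' n hn]
    exact h.codegeneracy_zero n hn a b

lemma IsMCBelow.degeneracy {N : ℕ} {ω : ∀ (n : ℕ) (k : SimplexCategory) (_ : k ⟶ ⦋n⦌) (_ : k ⟶ p),
    (G.obj ⦋n + 1⦌).obj (op k)} (h : IsMCBelow N ω) {n : ℕ} (hn : n + 1 < N) (i : Fin (n + 1))
    {k : SimplexCategory} (a : k ⟶ ⦋n + 1⦌) (b : k ⟶ p) :
    (G.map (SimplexCategory.σ i.succ)).app (op k) (ω (n + 1) k a b) =
      ω n k (a ≫ SimplexCategory.σ i) b := by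
  rw [h.twist hn (by omega) (SimplexCategory.σ i) a b]
  refine Eq.symm ((twist_of_zero _ ?_ (h.codegeneracy_zero (n + 1) hn _ _)).trans ?_)
  · exact Fin.predAbove_of_le_castSucc i (0 : Fin (n + 2)) (Fin.zero_le _)
  · exact congrArg (fun f => (G.map f).app (op k) (ω (n + 1) k a b)) (plusMap_σ i)

/-- The codegeneracies which the component in degree `N` of an element of `mmc(G)` must have, in
terms of the components of lower degree. -/
def codegenTarget (ω : ∀ (n : ℕ) (k : SimplexCategory) (_ : k ⟶ ⦋n⦌) (_ : k ⟶ p),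
    (G.obj ⦋n + 1⦌).obj (op k)) (N : ℕ) {k : SimplexCategory} (a : k ⟶ ⦋N⦌) (b : k ⟶ p) :
    Fin (N + 1) → (G.obj ⦋N⦌).obj (op k) :=
  match N with
  | 0 => fun _ => 1
  | N + 1 => Fin.cases 1 fun i => ω N k (a ≫ SimplexCategory.σ i) b

section

variable {ω : ∀ (n : ℕ) (k : SimplexCategory) (_ : k ⟶ ⦋n⦌) (_ : k ⟶ p), (G.obj ⦋n + 1⦌).obj (op k)}

lemma codegenTarget_zero {N : ℕ} {k : SimplexCategory} (a : k ⟶ ⦋N⦌) (b : k ⟶ p) :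
    codegenTarget ω N a b 0 = 1 := by
  cases N <;> rfl

lemma IsMCBelow.map_codegenTarget {N : ℕ} (h : IsMCBelow N ω) {k l : SimplexCategory} (f : l ⟶ k)
    (a : k ⟶ ⦋N⦌) (b : k ⟶ p) (j : Fin (N + 1)) :
    (G.obj ⦋N⦌).map f.op (codegenTarget ω N a b j) = codegenTarget ω N (f ≫ a) (f ≫ b) j := by
  induction j using Fin.cases with
  | zero => rw [codegenTarget_zero, codegenTarget_zero, map_one]
  | succ j =>
    obtain _ | N := N
    · exact j.elim0
    · refine (h.naturality N N.lt_succ_self f _ b).trans ?_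
      rw [← Category.assoc]
      rfl

/-- This is the compatibility needed to prescribe all codegeneracies at once. At index `0` both
sides are trivial by normalisation; at positive indices both are components of lower degree at equal
composites of degeneracies. -/
lemma IsMCBelow.σ_codegenTarget {n : ℕ} (h : IsMCBelow (n + 1) ω) {k : SimplexCategory}
    (a : k ⟶ ⦋n + 1⦌) (b : k ⟶ p) (i j : Fin (n + 1)) (hij : i ≤ j) :
    (G.map (SimplexCategory.σ i)).app (op k) (codegenTarget ω (n + 1) a b j.succ) =
      (G.map (SimplexCategory.σ j)).app (op k) (codegenTarget ω (n + 1) a b i.castSucc) := by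
  induction i using Fin.cases with
  | zero =>
    refine (h.codegeneracy_zero n n.lt_succ_self _ b).trans (Eq.symm ?_)
    exact (congrArg _ (codegenTarget_zero a b)).trans (map_one _)
  | succ i =>
    induction j using Fin.cases with
    | zero => exact absurd hij (by simp)
    | succ j =>
      obtain _ | n := n
      · exact j.elim0
      · change (G.map (SimplexCategory.σ i.succ)).app (op k)
          (ω (n + 1) k (a ≫ SimplexCategory.σ j.succ) b) =
          (G.map (SimplexCategory.σ j.succ)).app (op k)
          (ω (n + 1) k (a ≫ SimplexCategory.σ i.castSucc) b)
        rw [h.degeneracy (by omega), h.degeneracy (by omega), Category.assoc, Category.assoc,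
          SimplexCategory.σ_comp_σ (Fin.succ_le_succ_iff.1 hij)]

lemma IsMCBelow.σ_codegenCorrect {N : ℕ} (h : IsMCBelow N ω) {k : SimplexCategory}
    (a : k ⟶ ⦋N⦌) (b : k ⟶ p) (v : (G.obj ⦋N + 1⦌).obj (op k)) (j : Fin (N + 1)) :
    (G.map (SimplexCategory.σ j)).app (op k) (codegenCorrect (G.flip.obj (op k)) v
      (codegenTarget ω N a b) (N + 1)) = codegenTarget ω N a b j := by
  obtain _ | n := N
  · obtain rfl : j = 0 := Subsingleton.elim (α := Fin 1) j 0
    exact σ_codegenCorrect_zero (C := G.flip.obj (op k)) v _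
  · exact DerivedDeligne.σ_codegenCorrect (C := G.flip.obj (op k)) v _
      (h.σ_codegenTarget a b) _ j j.2

end

/-! ### Degreewise lifting of Maurer–Cartan elements -/

section

variable (φ : G ⟶ H) {p : ℕ} {A : (Δ[p] : SSet.{w}).Subcomplex}
  (x : ∀ {k : SimplexCategory} (b : k ⟶ ⦋p⦌), memHom A b → MC G k) (y : MC H ⦋p⦌)

/-- A family which is a lift of `y` to `mmc(G)` extending `x`, for indices less than `N`. -/
structure IsLiftBelow (N : ℕ) (ω : ∀ (n : ℕ) (k : SimplexCategory) (_ : k ⟶ ⦋n⦌) (_ : k ⟶ ⦋p⦌),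
    (G.obj ⦋n + 1⦌).obj (op k)) : Prop extends IsMCBelow N ω where
  lift (n : ℕ) (hn : n < N) {k : SimplexCategory} (a : k ⟶ ⦋n⦌) (b : k ⟶ ⦋p⦌) :
    (φ.app ⦋n + 1⦌).app (op k) (ω n k a b) = y.ω n a b
  extend (n : ℕ) (hn : n < N) {k : SimplexCategory} (a : k ⟶ ⦋n⦌) (b : k ⟶ ⦋p⦌)
    (hb : memHom A b) : ω n k a b = (x b hb).ω n a (𝟙 k)

variable {φ x y}

/-- The value at `(a, b)` may be prescribed in several ways: by each factorisation of `a` through a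
proper face, and by `x` when `b` lies in `A`. Each factorisation compares with the split epi-mono
factorisation `e ≫ m` of `a`, so the twist identity in lower degrees makes all prescriptions agree.
-/
lemma IsLiftBelow.exists_extend {N : ℕ} {ω : ∀ (n : ℕ) (k : SimplexCategory) (_ : k ⟶ ⦋n⦌)
    (_ : k ⟶ ⦋p⦌), (G.obj ⦋n + 1⦌).obj (op k)} (h : IsLiftBelow φ x y N ω) {k : SimplexCategory}
    (a : k ⟶ ⦋N⦌) (b : k ⟶ ⦋p⦌) :
    ∃ t : (G.obj ⦋N + 1⦌).obj (op k),
      (∀ {n : ℕ} (_ : n < N) (θ : ⦋n⦌ ⟶ ⦋N⦌) (_ : Mono θ) (a' : k ⟶ ⦋n⦌), a = a' ≫ θ →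
        t = DerivedDeligne.twist (G.flip.obj (op k)) θ (ω n k a' b)) ∧
      ∀ hb : memHom A b, t = (x b hb).ω N a (𝟙 k) := by
  classical
  obtain ⟨r, e, s, m, hm, hs, rfl⟩ := exists_epi_mono_fac a
  have key {n : ℕ} (θ : ⦋n⦌ ⟶ ⦋N⦌) (a' : k ⟶ ⦋n⦌) (ha : e ≫ m = a' ≫ θ) : (s ≫ a') ≫ θ = m := by
    rw [Category.assoc, ← ha, ← Category.assoc, hs, Category.id_comp]
  by_cases hr : r < N
  · refine ⟨DerivedDeligne.twist (G.flip.obj (op k)) m (ω r k e b), fun {n} hn θ hθ a' ha => ?_,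
      fun hb => ?_⟩
    · have h1 : a' = e ≫ s ≫ a' := by
        rw [← cancel_mono θ, Category.assoc, key θ a' ha, ha]
      rw [h1, h.twist hr hn (s ≫ a') e b]
      exact (congrArg (fun f => DerivedDeligne.twist (G.flip.obj (op k)) f _)
        (key θ a' ha).symm).trans (twist_twist (C := G.flip.obj (op k)) _ _ _).symm
    · rw [h.extend r hr e b hb, (x b hb).twist_ω]
  -- Here `a` does not factor through a proper face, so only the prescription by `x` can apply; off
  -- `A` the value `1` is arbitrary.
  · refine ⟨if hb : memHom A b then (x b hb).ω N (e ≫ m) (𝟙 k) else 1, fun {n} hn θ hθ a' ha => ?_,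
      fun hb => dif_pos hb⟩
    have h1 : Mono ((s ≫ a') ≫ θ) := by rwa [key θ a' ha]
    have := mono_of_mono (s ≫ a') θ
    have := SimplexCategory.le_of_mono (s ≫ a')
    omega

lemma exists_mono_of_not_surjective {k : SimplexCategory} {N : ℕ} (a : k ⟶ ⦋N⦌)
    (ha : ¬ Function.Surjective a.toOrderHom) :
    ∃ (n : ℕ) (_ : n < N) (θ : ⦋n⦌ ⟶ ⦋N⦌) (_ : Mono θ) (a' : k ⟶ ⦋n⦌), a = a' ≫ θ := by
  obtain _ | N := N
  · exact (ha fun y => ⟨0, Subsingleton.elim (α := Fin 1) _ _⟩).elim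
  · obtain ⟨i, a', h⟩ := SimplexCategory.eq_comp_δ_of_not_surjective a ha
    exact ⟨N, N.lt_succ_self, _, inferInstance, a', h⟩

/-- The lower components and `x` prescribe `ω_N` on `∂Δᴺ × Δᵖ ∪ Δᴺ × A`, compatibly with `y`. The
lifting property extends this to `v` on `Δᴺ × Δᵖ`, which may have wrong codegeneracies. The
correction `codegenCorrect` is natural, so it commutes with simplicial operations and with `φ`, and
it changes neither the prescribed values nor the image `y`, whose codegeneracies are already right.
-/
lemma IsLiftBelow.exists_step {N : ℕ}
    [HasLiftingProperty ((SSet.boundary.{w} N).unionProd A).ι (toSSetHom (φ.app ⦋N + 1⦌))]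
    (hx : ∀ {k l : SimplexCategory} (b : k ⟶ ⦋p⦌) (hb : memHom A b) (g : l ⟶ k),
      (x b hb).pull g = x (g ≫ b) (hb.comp g))
    (hxy : ∀ {k : SimplexCategory} (b : k ⟶ ⦋p⦌) (hb : memHom A b),
      (x b hb).push φ = y.pull b)
    {ω : ∀ (n : ℕ) (k : SimplexCategory) (_ : k ⟶ ⦋n⦌)
    (_ : k ⟶ ⦋p⦌), (G.obj ⦋n + 1⦌).obj (op k)} (h : IsLiftBelow φ x y N ω) :
    ∃ ω', IsLiftBelow φ x y (N + 1) ω' ∧ ∀ n < N, ω' n = ω n := by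
  choose u hu hu' using fun (k : SimplexCategory) (a : k ⟶ ⦋N⦌) (b : k ⟶ ⦋p⦌) =>
    h.exists_extend a b
  have hxω {k l : SimplexCategory} (b : k ⟶ ⦋p⦌) (hb : memHom A b) (g : l ⟶ k) {n : ℕ}
      (a : k ⟶ ⦋n⦌) : (G.obj ⦋n + 1⦌).map g.op ((x b hb).ω n a (𝟙 k)) =
        (x (g ≫ b) (hb.comp g)).ω n (g ≫ a) (𝟙 l) := by
    rw [(x b hb).naturality, ← hx b hb g, Category.comp_id]
    exact congrArg (fun f => (x b hb).ω n (g ≫ a) f) (Category.id_comp g).symm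
  have hxyω {k : SimplexCategory} (b : k ⟶ ⦋p⦌) (hb : memHom A b) {n : ℕ} (a : k ⟶ ⦋n⦌) :
      (φ.app ⦋n + 1⦌).app (op k) ((x b hb).ω n a (𝟙 k)) = y.ω n a b := by
    refine (congrArg (fun z : MC H k => z.ω n a (𝟙 k)) (hxy b hb)).trans ?_
    exact congrArg (fun f => y.ω n a f) (Category.id_comp b)
  -- For fixed simplicial level, `φ` is a map of cosimplicial groups; naturality of `twist` and
  -- `codegenCorrect` is applied to it.
  let φ' (k : SimplexCategory) : G.flip.obj (op k) ⟶ H.flip.obj (op k) :=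
    ((flipFunctor _ _ _).map φ).app (op k)
  obtain ⟨v, hv, hvy, hvu⟩ := exists_lift_prod (f := toSSetHom (φ.app ⦋N + 1⦌)) A
    (fun {k} a b => u k a b) (fun {k l} a b g hab => by
      change (G.obj ⦋N + 1⦌).map g.op (u k a b) = u l (g ≫ a) (g ≫ b)
      obtain ha | hb := hab
      · obtain ⟨n, hn, θ, hθ, a', rfl⟩ := exists_mono_of_not_surjective a ha
        rw [hu k _ b hn θ hθ a' rfl, hu l _ (g ≫ b) hn θ hθ (g ≫ a') (by simp),
          ← h.naturality n hn g a' b]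
        exact map_twist (G.flip.map g.op) _ _
      · rw [hu' k a b hb, hu' l _ _ (hb.comp g)]
        exact hxω b hb g a)
    (fun {k} a b => y.ω N a b) (fun a b g => y.naturality N g a b)
    (fun {k} a b hab => by
      change (φ.app ⦋N + 1⦌).app (op k) (u k a b) = y.ω N a b
      obtain ha | hb := hab
      · obtain ⟨n, hn, θ, hθ, a', rfl⟩ := exists_mono_of_not_surjective a ha
        rw [hu k _ b hn θ hθ a' rfl, y.twist_ω, ← h.lift n hn]
        exact map_twist (φ' k) _ _
      · rw [hu' k a b hb]
        exact hxyω b hb a)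
  change ∀ {k : SimplexCategory} (_ : k ⟶ ⦋N⦌) (_ : k ⟶ ⦋p⦌), (G.obj ⦋N + 1⦌).obj (op k) at v
  -- Correcting in `N + 1` stages takes care of each of the codegeneracies `σ⁰, …, σᴺ`.
  let v' (k : SimplexCategory) (a : k ⟶ ⦋N⦌) (b : k ⟶ ⦋p⦌) : (G.obj ⦋N + 1⦌).obj (op k) :=
    codegenCorrect (G.flip.obj (op k)) (v a b) (codegenTarget ω N a b) (N + 1)
  have hv' {k : SimplexCategory} (a : k ⟶ ⦋N⦌) (b : k ⟶ ⦋p⦌)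
      (hab : ¬ Function.Surjective a.toOrderHom ∨ memHom A b) : v' k a b = u k a b := by
    have h1 : v a b = u k a b := hvu a b hab
    refine (codegenCorrect_of_eq (C := G.flip.obj (op k)) (v a b) _ (fun j => ?_) _).trans h1
    rw [h1]
    change (G.map (SimplexCategory.σ j)).app (op k) (u k a b) = _
    obtain ha | hb := hab
    · obtain ⟨n, hn, θ, hθ, a', rfl⟩ := exists_mono_of_not_surjective a ha
      rw [hu k _ b hn θ hθ a' rfl]
      induction j using Fin.cases with
      | zero =>
        rw [codegenTarget_zero]
        exact σ_zero_twist (C := G.flip.obj (op k)) _ _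
      | succ j =>
        obtain _ | N := N
        · exact j.elim0
        · refine (σ_succ_twist (C := G.flip.obj (op k)) θ j _).trans ?_
          rw [← h.twist hn N.lt_succ_self, ← Category.assoc]
          rfl
    · rw [hu' k a b hb]
      induction j using Fin.cases with
      | zero =>
        rw [codegenTarget_zero]
        exact (x b hb).codegeneracy_zero _ _ _
      | succ j =>
        obtain _ | N := N
        · exact j.elim0
        · refine ((x b hb).degeneracy N j a (𝟙 k)).symm.trans ?_
          exact (h.extend N N.lt_succ_self _ b hb).symm
  -- Only the component of degree `N` is replaced, so the conditions below `N` persist.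
  obtain ⟨ω', hω', hω⟩ : ∃ ω' : ∀ (n : ℕ) (k : SimplexCategory) (_ : k ⟶ ⦋n⦌)
      (_ : k ⟶ ⦋p⦌), (G.obj ⦋n + 1⦌).obj (op k), ω' N = v' ∧ ∀ n < N, ω' n = ω n :=
    ⟨Function.update ω N v', Function.update_self _ _ _,
      fun n hn => Function.update_of_ne hn.ne _ _⟩
  have hσ {k : SimplexCategory} (a : k ⟶ ⦋N⦌) (b : k ⟶ ⦋p⦌) (j : Fin (N + 1)) :
      (G.map (SimplexCategory.σ j)).app (op k) (v' k a b) = codegenTarget ω N a b j :=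
    h.σ_codegenCorrect a b _ j
  have hσ0 {k : SimplexCategory} (a : k ⟶ ⦋N⦌) (b : k ⟶ ⦋p⦌) :
      (G.map (SimplexCategory.σ 0)).app (op k) (ω' N k a b) = 1 := by
    rw [hω', hσ, codegenTarget_zero]
  refine ⟨ω', ⟨(h.toIsMCBelow.congr hω).step (fun {k l} f a b => ?_) hσ0
    (fun {n} hn θ _ {k} a b => ?_) (fun {n} hn σ {k} a b hσ' => ?_), fun n hn k a b => ?_,
    fun n hn k a b hb => ?_⟩, hω⟩
  · rw [hω']
    refine (map_codegenCorrect (G.flip.map f.op) _ _ _).trans ?_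
    have h1 : (G.obj ⦋N + 1⦌).map f.op (v a b) = v (f ≫ a) (f ≫ b) := hv a b f
    have h2 : (fun j => (G.obj ⦋N⦌).map f.op (codegenTarget ω N a b j)) =
        codegenTarget ω N (f ≫ a) (f ≫ b) := funext fun j => h.map_codegenTarget f a b j
    change codegenCorrect (G.flip.obj (op l)) ((G.obj ⦋N + 1⦌).map f.op (v a b))
      (fun j => (G.obj ⦋N⦌).map f.op (codegenTarget ω N a b j)) (N + 1) = _
    rw [h1, h2]
  · have ha : ¬ Function.Surjective (a ≫ θ).toOrderHom := fun ha => by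
      have : Epi (a ≫ θ) := SimplexCategory.epi_iff_surjective.2 ha
      have := epi_of_epi a θ
      have := SimplexCategory.le_of_epi θ
      omega
    rw [hω', hω n hn, hv' _ b (.inl ha)]
    exact hu k _ b hn θ inferInstance a rfl
  · subst hn
    obtain ⟨i, rfl⟩ := SimplexCategory.eq_σ_of_epi σ
    rw [hω n n.lt_succ_self]
    refine Eq.symm ((twist_of_zero _ ?_ (hσ0 a b)).trans ?_)
    · exact Fin.predAbove_of_le_castSucc i (0 : Fin (n + 2)) (Fin.zero_le _)
    · rw [hω', plusMap_σ]
      exact hσ a b i.succ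
  · obtain hn | rfl := Nat.lt_succ_iff_lt_or_eq.1 hn
    · rw [hω n hn]
      exact h.lift n hn a b
    · rw [hω']
      refine (map_codegenCorrect (φ' k) _ _ _).trans ?_
      have h1 : (φ.app ⦋n + 1⦌).app (op k) (v a b) = y.ω n a b := hvy a b
      have h2 (j : Fin (n + 1)) : (φ.app ⦋n⦌).app (op k) (codegenTarget ω n a b j) =
          (H.map (SimplexCategory.σ j)).app (op k) (y.ω n a b) := by
        induction j using Fin.cases with
        | zero => rw [codegenTarget_zero, map_one, y.codegeneracy_zero]
        | succ j =>
          obtain _ | n := n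
          · exact j.elim0
          · rw [← y.degeneracy, ← h.lift n n.lt_succ_self]
            rfl
      refine Eq.trans ?_ (codegenCorrect_of_eq (C := H.flip.obj (op k)) (y.ω n a b)
        (fun j => (φ.app ⦋n⦌).app (op k) (codegenTarget ω n a b j)) (fun j => (h2 j).symm) (n + 1))
      rw [← h1]
      rfl
  · obtain hn | rfl := Nat.lt_succ_iff_lt_or_eq.1 hn
    · rw [hω n hn]
      exact h.extend n hn a b hb
    · rw [hω', hv' _ _ (.inr hb), hu' k a b hb]

end

/-- Each step leaves the lower components alone, so the successive partial lifts stabilise in every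
degree, and the stable components form the lift. -/
theorem liftsAlong_ssetMap (φ : G ⟶ H) {p : ℕ} {A : (Δ[p] : SSet.{w}).Subcomplex}
    (hφ : ∀ N, HasLiftingProperty ((SSet.boundary.{w} N).unionProd A).ι
      (toSSetHom (φ.app ⦋N + 1⦌))) : LiftsAlong (ssetMap φ) A := by
  intro x hx y hxy
  change ∀ {k : SimplexCategory} (b : k ⟶ ⦋p⦌), memHom A b → MC G k at x
  change MC H ⦋p⦌ at y
  have step (N : ℕ) (ω : {ω // IsLiftBelow φ x y N ω}) :
      ∃ ω' : {ω // IsLiftBelow φ x y (N + 1) ω}, ∀ n < N, ω'.1 n = ω.1 n := by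
    obtain ⟨ω', h, h'⟩ := IsLiftBelow.exists_step hx hxy ω.2
    exact ⟨⟨ω', h⟩, h'⟩
  choose next hnext using step
  -- Below `0` all conditions are vacuous, so the recursion can start from any family.
  let F (N : ℕ) : {ω // IsLiftBelow φ x y N ω} :=
    N.rec ⟨fun _ _ _ _ => 1, ⟨⟨fun _ h => absurd h (Nat.not_lt_zero _), fun h =>
      absurd h (Nat.not_lt_zero _), fun _ h => absurd h (Nat.not_lt_zero _)⟩,
      fun _ h => absurd h (Nat.not_lt_zero _), fun _ h => absurd h (Nat.not_lt_zero _)⟩⟩ next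
  have hF (n : ℕ) (N : ℕ) (h : n + 1 ≤ N) : (F N).1 n = (F (n + 1)).1 n := by
    induction N, h using Nat.le_induction with
    | base => rfl
    | succ N hN ih => exact (hnext N (F N) n hN).trans ih
  have hF' (N : ℕ) (n : ℕ) (h : n < N) : (F (n + 1)).1 n = (F N).1 n := (hF n N h).symm
  refine ⟨ofIsMCBelow (fun n => (F (n + 1)).1 n) fun N =>
    (F N).2.toIsMCBelow.congr fun n hn => hF' N n hn, ?_, fun {k} b hb => ?_⟩
  · apply MC.ext
    funext n k a b
    exact (F (n + 1)).2.lift n n.lt_succ_self a b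
  · apply MC.ext
    funext n l a c
    change (F (n + 1)).1 n l a (c ≫ b) = (x b hb).ω n a c
    rw [(F (n + 1)).2.extend n n.lt_succ_self a _ (hb.comp c)]
    refine (congrArg (fun z : MC G l => z.ω n a (𝟙 l)) (hx b hb c).symm).trans ?_
    exact congrArg (fun f => (x b hb).ω n a f) (Category.id_comp c)

/-- The pushout-product of a boundary inclusion with a horn inclusion is anodyne, and a surjection
of simplicial groups is a Kan fibration. -/
theorem kanFibration_ssetMap (φ : G ⟶ H)
    (hφ : ∀ n k, Function.Surjective ((φ.app n).app k)) : KanFibration (ssetMap φ) := by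
  rw [kanFibration_iff]
  intro n i
  refine liftsAlong_ssetMap φ fun N => ?_
  exact SSet.anodyneExtensions_unionProd_ι _ _ (SSet.anodyneExtensions.horn_ι i) _
    (kanFibration_toSSetHom (φ := φ.app ⦋N + 1⦌) fun k => hφ _ k)

/-- With acyclic kernels the maps of groups are trivial fibrations, which lift against every
monomorphism, in particular against the pushout-product of two boundary inclusions. -/
theorem trivialKanFibration_ssetMap (φ : G ⟶ H)
    (hφ : ∀ n k, Function.Surjective ((φ.app n).app k)) (hφ' : ∀ n, AcyclicKernel (φ.app n)) :
    TrivialKanFibration (ssetMap φ) := by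
  rw [trivialKanFibration_iff]
  intro n
  refine liftsAlong_ssetMap φ fun N => ?_
  have h1 := trivialKanFibration_toSSetHom (φ := φ.app ⦋N + 1⦌) (fun k => hφ _ k) (hφ' _)
  rw [TrivialKanFibration, ← SSet.rlp_monomorphisms] at h1
  exact h1 _ (inferInstanceAs (Mono _))

end MC

/-! ### Nerves of translation groupoids -/

section Chain

variable {Γ X : Type w} [Group Γ] [MulAction Γ X] {n : ℕ}

/-- The `k`-th vertex of a chain of morphisms in a translation groupoid. -/
def vtx (F : ComposableArrows (ActionCategory Γ X) n) (k : Fin (n + 1)) : X := (F.obj k).back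

/-- The group element underlying the morphism from the `k`-th to the `l`-th vertex of a chain. -/
def arr (F : ComposableArrows (ActionCategory Γ X) n) {k l : Fin (n + 1)} (h : k ≤ l) : Γ :=
  (F.map (homOfLE h)).1

lemma arr_smul (F : ComposableArrows (ActionCategory Γ X) n) {k l : Fin (n + 1)} (h : k ≤ l) :
    arr F h • vtx F k = vtx F l := (F.map (homOfLE h)).2

lemma arr_self (F : ComposableArrows (ActionCategory Γ X) n) (k : Fin (n + 1)) :
    arr F (le_refl k) = 1 :=
  (congrArg Subtype.val (F.map_id k)).trans (ActionCategory.id_val _)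

lemma arr_mul (F : ComposableArrows (ActionCategory Γ X) n) {k l m : Fin (n + 1)} (h : k ≤ l)
    (h' : l ≤ m) : arr F h' * arr F h = arr F (h.trans h') :=
  ((congrArg Subtype.val (F.map_comp (homOfLE h) (homOfLE h'))).trans
    (ActionCategory.comp_val _ _)).symm

/-- In a translation groupoid the arrows out of the initial vertex determine all vertices by the
action, and all other arrows by division. -/
lemma chain_ext {F F' : ComposableArrows (ActionCategory Γ X) n} (h0 : vtx F 0 = vtx F' 0)
    (h : ∀ k : Fin (n + 1), arr F (Fin.zero_le k) = arr F' (Fin.zero_le k)) : F = F' := by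
  have hv (k : Fin (n + 1)) : vtx F k = vtx F' k := by
    rw [← arr_smul F (Fin.zero_le k), ← arr_smul F' (Fin.zero_le k), h0, h]
  have ho (k : Fin (n + 1)) : F.obj k = F'.obj k := Sigma.ext rfl (heq_of_eq (hv k))
  refine CategoryTheory.Functor.ext ho fun k l f => ?_
  have key : ∀ {z z' : ActionCategory Γ X} (e : z = z'), ((eqToHom e).1 : Γ) = 1 := by
    intro z z' e
    subst e
    rfl
  have ha : arr F (leOfHom f) = arr F' (leOfHom f) := by
    rw [← mul_left_inj (arr F (Fin.zero_le k)), arr_mul, h k, arr_mul, h l]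
  apply Subtype.ext
  rw [ActionCategory.comp_val, ActionCategory.comp_val, key, key]
  have h2 : ∀ n : Γ, n = 1 * n * 1 := by simp
  exact Eq.trans ha (h2 _)

/-- The chain with vertices `h k • x`. -/
def mkChain (x : X) (h : Fin (n + 1) → Γ) : ComposableArrows (ActionCategory Γ X) n where
  obj k := ⟨(), (h k • x : X)⟩
  map {k l} _ := ⟨h l * (h k)⁻¹, by
    change (h l * (h k)⁻¹) • h k • x = h l • x
    rw [smul_smul, inv_mul_cancel_right]⟩
  map_id k := Subtype.ext (mul_inv_cancel (h k))
  map_comp {k l m} _ _ := Subtype.ext (by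
    change h m * (h k)⁻¹ = h m * (h l)⁻¹ * (h l * (h k)⁻¹)
    group)

end Chain

/-! ### Homotopy quotients as nerves -/

namespace SimplicialAction

/-- The action of the constant simplicial group on a constant simplicial set. -/
def const (Γ : GrpCat.{w}) (X : Type w) [MulAction Γ X] : SimplicialAction.{w} where
  Γ := (Functor.const _).obj Γ
  M := (Functor.const _).obj X
  act _ := inferInstanceAs (MulAction Γ X)
  map_smul _ _ _ := rfl

/-- The map from the nerve of a translation groupoid to the corresponding homotopy quotient. -/
def nerveToBorel (Γ : GrpCat.{w}) (X : Type w) [MulAction Γ X] :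
    nerve (ActionCategory Γ X) ⟶ (const Γ X).borel where
  app p := ↾(fun F : ComposableArrows (ActionCategory Γ X) p.unop.len =>
    (⟨vtx F 0, ⟨fun θ => arr (Γ := Γ) F (Fin.zero_le (θ.toOrderHom 0)), fun {q} θ h => by
        have : ∀ i : Fin (p.unop.len + 1), i = 0 → arr F (Fin.zero_le i) = 1 := by
          rintro _ rfl
          exact arr_self F 0
        exact this _ h, fun {q r} η θ h => by
        have : ∀ i : Fin (q.len + 1), i = 0 → arr F (Fin.zero_le (θ.toOrderHom i)) =
            arr F (Fin.zero_le (θ.toOrderHom 0)) := by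
          rintro _ rfl
          rfl
        exact this _ h⟩⟩ : X × WB ((Functor.const _).obj Γ) p.unop))
  naturality p q θ := by
    apply ConcreteCategory.hom_ext
    intro F
    change ComposableArrows (ActionCategory Γ X) p.unop.len at F
    refine Prod.ext (arr_smul F (Fin.zero_le (θ.unop.toOrderHom 0))).symm ?_
    apply WB.ext
    funext r η
    refine eq_mul_inv_of_mul_eq ?_
    exact arr_mul F (Fin.zero_le (θ.unop.toOrderHom 0))
      (θ.unop.toOrderHom.monotone (Fin.zero_le (η.toOrderHom 0)))

/-- For a constant group, `c(θ)` depends only on the vertex `θ(0)`. A cocycle is then a tuple of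
group elements `h_k` with `h_0 = 1`, and with a point `x` it gives the chain with vertices `h_k •
x`. -/
lemma bijective_nerveToBorel (Γ : GrpCat.{w}) (X : Type w) [MulAction Γ X]
    (p : SimplexCategoryᵒᵖ) : Function.Bijective ((nerveToBorel Γ X).app p) := by
  constructor
  · intro F F' h
    refine chain_ext (congrArg Prod.fst h) fun k => ?_
    exact congrArg (fun z : X × WB ((Functor.const _).obj Γ) p.unop =>
      z.2.c (SimplexCategory.const ⦋0⦌ p.unop k)) h
  · rintro ⟨m, c⟩
    change X at m
    change WB ((Functor.const _).obj Γ) p.unop at c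
    have h1 : c.c (SimplexCategory.const ⦋0⦌ p.unop 0) = 1 := c.c_zero _ rfl
    let c' (k : Fin (p.unop.len + 1)) : Γ := c.c (SimplexCategory.const ⦋0⦌ p.unop k)
    refine ⟨(mkChain m c' : ComposableArrows (ActionCategory Γ X) p.unop.len), Prod.ext ?_ (WB.ext ?_)⟩
    · have h1' : c' 0 = (1 : Γ) := h1
      exact (congrArg (· • m) h1').trans (one_smul Γ m)
    · funext q θ
      have h2 : c.c (SimplexCategory.const ⦋0⦌ p.unop (θ.toOrderHom 0)) = c.c θ :=
        c.c_comp (SimplexCategory.const ⦋0⦌ q 0) θ rfl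
      change c.c (SimplexCategory.const ⦋0⦌ p.unop (θ.toOrderHom 0)) *
        (c.c (SimplexCategory.const ⦋0⦌ p.unop 0))⁻¹ = c.c θ
      rw [h1, h2, inv_one, mul_one]

/-- A horn of positive dimension is nonempty and connected: every vertex is joined to the vertex `i`
by an edge in the horn. A map from it to a discrete simplicial set is therefore constant, and its
value is the lift. -/
lemma kanFibration_const {X Y : Type w} (f : X ⟶ Y) :
    KanFibration ((Functor.const SimplexCategoryᵒᵖ).map f) := by
  rw [kanFibration_iff]
  intro n i u hu y hy
  change ∀ {k : SimplexCategory} (b : k ⟶ ⦋n + 1⦌), memHom (SSet.horn (n + 1) i) b → X at u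
  replace hu : ∀ {k l : SimplexCategory} (b : k ⟶ ⦋n + 1⦌) (hb : memHom (SSet.horn (n + 1) i) b)
    (g : l ⟶ k), u b hb = u (g ≫ b) (hb.comp g) := hu
  have hi : memHom (SSet.horn (n + 1) i) (SimplexCategory.const ⦋0⦌ ⦋n + 1⦌ i) := by
    rw [memHom_horn]
    intro h
    have h1 : i.succAbove 0 ∈ Set.range (SimplexCategory.const ⦋0⦌ ⦋n + 1⦌ i).toOrderHom ∪ {i} :=
      h ▸ Set.mem_univ _
    obtain ⟨_, h1⟩ | h1 := h1
    · exact Fin.succAbove_ne i 0 h1.symm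
    · exact Fin.succAbove_ne i 0 h1
  have key {k : SimplexCategory} (b : k ⟶ ⦋n + 1⦌) (hb : memHom (SSet.horn (n + 1) i) b) :
      u b hb = u _ hi := by
    have h0 : u b hb = u (SimplexCategory.const ⦋0⦌ ⦋n + 1⦌ (b.toOrderHom 0))
      (hb.comp (SimplexCategory.const ⦋0⦌ k 0)) := hu b hb (SimplexCategory.const ⦋0⦌ k 0)
    rw [h0]
    -- An edge with ends among `i` and `b(0)` covers, together with `i`, no more vertices than `b`
    -- does together with `i`; so it lies in the horn because `b` does.
    have hmem {e : ⦋1⦌ ⟶ ⦋n + 1⦌}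
        (he : ∀ x, e.toOrderHom x = i ∨ e.toOrderHom x = b.toOrderHom 0) :
        memHom (SSet.horn (n + 1) i) e := by
      rw [memHom_horn] at hb ⊢
      intro h
      refine hb (Set.eq_univ_of_univ_subset (h ▸ ?_))
      rintro _ (⟨x, rfl⟩ | h)
      · obtain h | h := he x
        · exact .inr h
        · exact .inl ⟨0, h.symm⟩
      · exact .inr h
    obtain h | h := le_total i (b.toOrderHom 0)
    · have he : memHom (SSet.horn (n + 1) i) (SimplexCategory.mkOfLe i (b.toOrderHom 0) h) :=
        hmem fun x => by
          fin_cases x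
          · exact .inl rfl
          · exact .inr rfl
      exact (hu _ he (SimplexCategory.const ⦋0⦌ ⦋1⦌ 1)).symm.trans
        (hu _ he (SimplexCategory.const ⦋0⦌ ⦋1⦌ 0))
    · have he : memHom (SSet.horn (n + 1) i) (SimplexCategory.mkOfLe (b.toOrderHom 0) i h) :=
        hmem fun x => by
          fin_cases x
          · exact .inr rfl
          · exact .inl rfl
      exact (hu _ he (SimplexCategory.const ⦋0⦌ ⦋1⦌ 0)).symm.trans
        (hu _ he (SimplexCategory.const ⦋0⦌ ⦋1⦌ 1))
  refine ⟨u _ hi, ?_, fun {k} b hb => (key b hb).symm⟩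
  exact hy _ hi

variable (S S' : SimplicialAction.{w})

/-- The simplicial translation groupoid of an action. -/
def groupoid : SimplexCategoryᵒᵖ ⥤ Cat.{w, w} where
  obj m := Cat.of (ActionCategory (S.Γ.obj (op m.unop)) (S.M.obj (op m.unop)))
  map f := (actionFunctor (S.Γ.map f.unop.op).hom (S.M.map f.unop.op)
    (S.map_smul f.unop)).toCatHom
  map_id m := by
    apply Cat.ext
    apply actionFunctor_ext
    · intro x
      exact ConcreteCategory.congr_hom (S.M.map_id m) x.back
    · intro x y f
      exact ConcreteCategory.congr_hom (S.Γ.map_id m) f.1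
  map_comp f g := by
    apply Cat.ext
    apply actionFunctor_ext
    · intro x
      exact ConcreteCategory.congr_hom (S.M.map_comp f g) x.back
    · intro x y h
      exact ConcreteCategory.congr_hom (S.Γ.map_comp f g) h.1

/-- The bisimplicial nerve of the simplicial translation groupoid. -/
abbrev biNerve : SimplexCategoryᵒᵖ ⥤ SSet.{w} :=
  S.groupoid ⋙ nerveFunctor.{w, w}

variable {S}

lemma vtx_biMap {i i' j j' : ℕ} (a : ⦋i⦌ ⟶ ⦋i'⦌) (b : ⦋j⦌ ⟶ ⦋j'⦌)
    (x : ComposableArrows (ActionCategory (S.Γ.obj (op ⦋j'⦌)) (S.M.obj (op ⦋j'⦌))) i')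
    (k : Fin (i + 1)) :
    vtx (Γ := S.Γ.obj (op ⦋j⦌)) (X := S.M.obj (op ⦋j⦌)) (n := i) (biMap S.biNerve a b x) k =
      S.M.map b.op (vtx x (a.toOrderHom k)) := rfl

lemma arr_biMap {i i' j j' : ℕ} (a : ⦋i⦌ ⟶ ⦋i'⦌) (b : ⦋j⦌ ⟶ ⦋j'⦌)
    (x : ComposableArrows (ActionCategory (S.Γ.obj (op ⦋j'⦌)) (S.M.obj (op ⦋j'⦌))) i')
    {k l : Fin (i + 1)} (h : k ≤ l) :
    arr (Γ := S.Γ.obj (op ⦋j⦌)) (X := S.M.obj (op ⦋j⦌)) (n := i) (biMap S.biNerve a b x) h =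
      S.Γ.map b.op (arr x (a.toOrderHom.monotone h)) := rfl

end SimplicialAction

/-- For `θ : [q] → [p]`, the map `[q] → [p - i]` with `k ↦ θ k - i`. -/
def subMap {p q : SimplexCategory} (θ : q ⟶ p) (i : ℕ) : q ⟶ ⦋p.len - i⦌ :=
  SimplexCategory.Hom.mk ⟨fun k => ⟨(θ.toOrderHom k : ℕ) - i, by
    have := (θ.toOrderHom k).2
    change (θ.toOrderHom k : ℕ) - i < p.len - i + 1
    omega⟩, fun _ _ h => Nat.sub_le_sub_right (θ.toOrderHom.monotone h) _⟩

/-- The map `[p - i] → [p]` with `k ↦ k + i`. -/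
def shiftMap (p : SimplexCategory) (i : ℕ) (hi : i ≤ p.len) : ⦋p.len - i⦌ ⟶ p :=
  SimplexCategory.Hom.mk ⟨fun k => ⟨k + i, by
    have hk : (k : ℕ) < p.len - i + 1 := k.2
    omega⟩, fun _ _ h => Nat.add_le_add_right h _⟩

lemma tailIncl_shiftMap {i j : ℕ} (h : i ≤ j) {p : SimplexCategory} (hj : j ≤ p.len) :
    tailIncl h hj ≫ shiftMap p i (h.trans hj) = shiftMap p j hj := hom_ext_val fun k => by
  change (k : ℕ) + (j - i) + i = k + j
  omega

lemma tailIncl_tailIncl {i j k p : ℕ} (h : i ≤ j) (h' : j ≤ k) (hk : k ≤ p) :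
    tailIncl h' hk ≫ tailIncl h (h'.trans hk) = tailIncl (h.trans h') hk := hom_ext_val fun l => by
  change (l : ℕ) + (k - j) + (j - i) = l + (k - i)
  omega

lemma toOrderHom_zero_le {p q : SimplexCategory} (θ : q ⟶ p) (k : Fin (q.len + 1)) :
    (θ.toOrderHom 0 : ℕ) ≤ θ.toOrderHom k := θ.toOrderHom.monotone (Fin.zero_le k)

/-! ### Comparison of `W̄` of a translation groupoid with the homotopy quotient -/

namespace SimplicialAction

variable {S S' : SimplicialAction.{w}} {p q : SimplexCategory}

/-- The `i`-th component of a simplex of `W̄`, as a chain in a translation groupoid. -/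
def wbarChain (s : WbarSimplex S.biNerve p) (i : Fin (p.len + 1)) :
    ComposableArrows (ActionCategory (S.Γ.obj (op ⦋p.len - (i : ℕ)⦌))
      (S.M.obj (op ⦋p.len - (i : ℕ)⦌))) i := s.x i

lemma map_vtx_wbarChain (s : WbarSimplex S.biNerve p) {i j : Fin (p.len + 1)} (h : i ≤ j)
    (k : Fin (i + 1)) :
    S.M.map (tailIncl h (Nat.le_of_lt_succ j.2)).op (vtx (wbarChain s i) k) =
      vtx (wbarChain s j) ((initIncl h).toOrderHom k) := by
  refine (congrArg (fun F => vtx (Γ := S.Γ.obj (op ⦋p.len - (j : ℕ)⦌))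
    (X := S.M.obj (op ⦋p.len - (j : ℕ)⦌)) (n := i) F k) (s.compat_of_le i j h j.2)).trans ?_
  refine (vtx_biMap (initIncl h) (𝟙 ⦋p.len - (j : ℕ)⦌) (wbarChain s j) k).trans ?_
  exact ConcreteCategory.congr_hom (S.M.map_id (op ⦋p.len - (j : ℕ)⦌)) _

lemma map_arr_wbarChain (s : WbarSimplex S.biNerve p) {i j : Fin (p.len + 1)} (h : i ≤ j)
    {k l : Fin (i + 1)} (hkl : k ≤ l) :
    S.Γ.map (tailIncl h (Nat.le_of_lt_succ j.2)).op (arr (wbarChain s i) hkl) =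
      arr (wbarChain s j) ((initIncl h).toOrderHom.monotone hkl) := by
  refine (congrArg (fun F => arr (Γ := S.Γ.obj (op ⦋p.len - (j : ℕ)⦌))
    (X := S.M.obj (op ⦋p.len - (j : ℕ)⦌)) (n := i) F hkl) (s.compat_of_le i j h j.2)).trans ?_
  refine (arr_biMap (initIncl h) (𝟙 ⦋p.len - (j : ℕ)⦌) (wbarChain s j) hkl).trans ?_
  exact map_id_op _

/-- The group element underlying the composite of the `i`-th component of a simplex of `W̄`. -/
def wbarEdge (s : WbarSimplex S.biNerve p) (i : Fin (p.len + 1)) :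
    S.Γ.obj (op ⦋p.len - (i : ℕ)⦌) :=
  arr (wbarChain s i) (Fin.zero_le (Fin.last (i : ℕ)))

/-- The cocycle underlying a simplex of `W̄` of the simplicial translation groupoid. -/
def wbarCocycle (s : WbarSimplex S.biNerve p) : WB S.Γ p where
  c θ := S.Γ.map (subMap θ (θ.toOrderHom 0)).op (wbarEdge s (θ.toOrderHom 0))
  c_zero {q} θ h := by
    have (i : Fin (p.len + 1)) (hi : i = 0) : S.Γ.map (subMap θ i).op (wbarEdge s i) = 1 := by
      subst hi
      exact (congrArg _ (arr_self (wbarChain s 0) 0)).trans (map_one _)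
    exact this _ h
  c_comp {q r} η θ h := by
    have (j : Fin (q.len + 1)) (hj : j = 0) :
        S.Γ.map (subMap (η ≫ θ) (θ.toOrderHom j)).op (wbarEdge s (θ.toOrderHom j)) =
          S.Γ.map η.op (S.Γ.map (subMap θ (θ.toOrderHom 0)).op (wbarEdge s (θ.toOrderHom 0))) := by
      subst hj
      rw [map_map_op]
      rfl
    exact this _ h

lemma wbarCocycle_c (s : WbarSimplex S.biNerve p) (θ : q ⟶ p) {i : Fin (p.len + 1)}
    (h : θ.toOrderHom 0 = i) :
    (wbarCocycle s).c θ = S.Γ.map (subMap θ i).op (wbarEdge s i) := by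
  subst h
  rfl

/-- The initial vertex of a simplex of `W̄` of the simplicial translation groupoid. -/
def wbarVtx (s : WbarSimplex S.biNerve p) : S.M.obj (op p) :=
  S.M.map (subMap (𝟙 p) ((0 : Fin (p.len + 1)) : ℕ)).op (vtx (wbarChain s 0) 0)

lemma sset_map_map (X : SSet.{w}) {k l m : SimplexCategory} (α : m ⟶ l) (β : l ⟶ k)
    (x : X.obj (op k)) : X.map α.op (X.map β.op x) = X.map (α ≫ β).op x := by
  rw [op_comp, X.map_comp]
  rfl

lemma vtx_wbarChain_zero (s : WbarSimplex S.biNerve p) (i : Fin (p.len + 1)) :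
    vtx (wbarChain s i) 0 = S.M.map (shiftMap p i (Nat.le_of_lt_succ i.2)).op (wbarVtx s) := by
  rw [wbarVtx, sset_map_map]
  exact (map_vtx_wbarChain s (Fin.zero_le i) 0).symm

/-- The group elements on the `i`-th component of a simplex of `W̄` with given cocycle. -/
def edgeOfCocycle (c : WB S.Γ p) {k i : ℕ} (hk : k ≤ i) (hi : i ≤ p.len) :
    S.Γ.obj (op ⦋p.len - i⦌) :=
  S.Γ.map (tailIncl hk hi).op (c.c (shiftMap p k (hk.trans hi)))

lemma edgeOfCocycle_zero (c : WB S.Γ p) {i : ℕ} (hi : i ≤ p.len) :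
    edgeOfCocycle c (Nat.zero_le i) hi = 1 := by
  rw [edgeOfCocycle, c.c_zero (shiftMap p 0 _) rfl, map_one]

lemma map_edgeOfCocycle (c : WB S.Γ p) {k i j : ℕ} (hk : k ≤ i) (hi : i ≤ j) (hj : j ≤ p.len) :
    S.Γ.map (tailIncl hi hj).op (edgeOfCocycle c hk (hi.trans hj)) =
      edgeOfCocycle c (hk.trans hi) hj := by
  rw [edgeOfCocycle, map_map_op, tailIncl_tailIncl]
  rfl

/-- The compatibilities identify the arrow `0 → k` of the `i`-th component with a restriction of the
full composite of the `k`-th component, which is a value of the cocycle. Every component is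
therefore recovered from the cocycle and the initial vertex. -/
lemma arr_wbarChain (s : WbarSimplex S.biNerve p) (i : Fin (p.len + 1)) (k : Fin ((i : ℕ) + 1)) :
    arr (wbarChain s i) (Fin.zero_le k) = edgeOfCocycle (wbarCocycle s)
      (Nat.le_of_lt_succ k.2) (Nat.le_of_lt_succ i.2) := by
  rw [edgeOfCocycle, wbarCocycle_c s (shiftMap p k _)
    (i := ⟨k, lt_of_lt_of_le k.2 i.2⟩) (Fin.ext (Nat.zero_add _))]
  have h1 : subMap (shiftMap p k ((Nat.le_of_lt_succ k.2).trans (Nat.le_of_lt_succ i.2))) k =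
      𝟙 _ := hom_ext_val fun l => Nat.add_sub_cancel (n := (l : ℕ)) (m := k)
  change _ = S.Γ.map _ (S.Γ.map (subMap (shiftMap p k _) k).op
    (wbarEdge s ⟨k, lt_of_lt_of_le k.2 i.2⟩))
  rw [h1, map_id_op]
  exact (map_arr_wbarChain s (i := ⟨k, lt_of_lt_of_le k.2 i.2⟩) (j := i) (Nat.le_of_lt_succ k.2)
    (Fin.zero_le (Fin.last (k : ℕ)))).symm

variable (S) in
/-- The map from `W̄` of the simplicial translation groupoid to the homotopy quotient. -/
def wbarToBorel : Wbar.obj S.biNerve ⟶ S.borel where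
  app p := ↾(fun s : WbarSimplex S.biNerve p.unop =>
    ((wbarVtx s, wbarCocycle s) : S.M.obj (op p.unop) × WB S.Γ p.unop))
  naturality p q θ := by
    apply ConcreteCategory.hom_ext
    intro s
    change WbarSimplex S.biNerve p.unop at s
    obtain ⟨θ, rfl⟩ : ∃ θ' : q.unop ⟶ p.unop, θ = θ'.op := ⟨θ.unop, rfl⟩
    refine Prod.ext ?_ (WB.ext ?_)
    · change S.M.map (subMap (𝟙 q.unop) ((0 : Fin (q.unop.len + 1)) : ℕ)).op (S.M.map (tailMap θ 0).op
        (vtx (wbarChain s (θ.toOrderHom 0)) (Fin.last _))) =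
          (wbarCocycle s).c θ • S.M.map θ.op (wbarVtx s)
      rw [← arr_smul _ (Fin.zero_le (Fin.last (θ.toOrderHom 0 : ℕ))), sset_map_map]
      have h1 : subMap (𝟙 q.unop) ((0 : Fin (q.unop.len + 1)) : ℕ) ≫ tailMap θ 0 = subMap θ (θ.toOrderHom 0) :=
        hom_ext_val fun k => by
          have h2 : (⟨0 + ((k : ℕ) - 0), by omega⟩ : Fin (q.unop.len + 1)) = k :=
            Fin.ext (by simp)
          change (θ.toOrderHom ⟨0 + ((k : ℕ) - 0), _⟩ : ℕ) - θ.toOrderHom 0 =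
            θ.toOrderHom k - θ.toOrderHom 0
          rw [h2]
      have h3 : subMap θ (θ.toOrderHom 0) ≫ shiftMap _ (θ.toOrderHom 0) (Nat.le_of_lt_succ (θ.toOrderHom 0).2) = θ :=
        hom_ext_val fun k => Nat.sub_add_cancel (toOrderHom_zero_le θ k)
      rw [vtx_wbarChain_zero, h1, S.map_smul, sset_map_map, h3]
      rfl
    · funext r η
      refine eq_mul_inv_of_mul_eq ?_
      -- The cocycle equation is a composition of arrows. The two factors are transported to the
      -- component with index `θ(η(0))`, where they are restrictions of the arrows `0 → θ(0)` and
      -- `θ(0) → θ(η(0))`.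
      have hle : θ.toOrderHom 0 ≤ θ.toOrderHom (η.toOrderHom 0) :=
        θ.toOrderHom.monotone (Fin.zero_le _)
      change S.Γ.map (subMap η (η.toOrderHom 0)).op (S.Γ.map (tailMap θ (η.toOrderHom 0)).op
          (arr (wbarChain s (θ.toOrderHom (η.toOrderHom 0)))
            ((initMap θ (η.toOrderHom 0)).toOrderHom.monotone (Fin.zero_le (Fin.last _))))) *
          S.Γ.map η.op (S.Γ.map (subMap θ (θ.toOrderHom 0)).op (wbarEdge s (θ.toOrderHom 0))) =
        S.Γ.map (subMap (η ≫ θ) (θ.toOrderHom (η.toOrderHom 0))).op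
          (wbarEdge s (θ.toOrderHom (η.toOrderHom 0)))
      have h1 : subMap η (η.toOrderHom 0) ≫ tailMap θ (η.toOrderHom 0) =
          subMap (η ≫ θ) (θ.toOrderHom (η.toOrderHom 0)) := hom_ext_val fun k => by
        have h2 := toOrderHom_zero_le η k
        have h3 : (⟨η.toOrderHom 0 + ((η.toOrderHom k : ℕ) - η.toOrderHom 0), by
            have := (η.toOrderHom k).2; omega⟩ : Fin (q.unop.len + 1)) = η.toOrderHom k :=
          Fin.ext (by simp; omega)
        change (θ.toOrderHom ⟨η.toOrderHom 0 + ((η.toOrderHom k : ℕ) - η.toOrderHom 0), _⟩ : ℕ) -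
            θ.toOrderHom (η.toOrderHom 0) =
          θ.toOrderHom (η.toOrderHom k) - θ.toOrderHom (η.toOrderHom 0)
        rw [h3]
      have h4 : η ≫ subMap θ (θ.toOrderHom 0) =
          subMap (η ≫ θ) (θ.toOrderHom (η.toOrderHom 0)) ≫
            tailIncl hle (Nat.le_of_lt_succ (θ.toOrderHom (η.toOrderHom 0)).2) :=
        hom_ext_val fun k => by
          have h5 : (θ.toOrderHom (η.toOrderHom 0) : ℕ) ≤ θ.toOrderHom (η.toOrderHom k) :=
            θ.toOrderHom.monotone (toOrderHom_zero_le η k)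
          have h6 : (θ.toOrderHom 0 : ℕ) ≤ θ.toOrderHom (η.toOrderHom 0) := hle
          change (θ.toOrderHom (η.toOrderHom k) : ℕ) - θ.toOrderHom 0 =
            θ.toOrderHom (η.toOrderHom k) - θ.toOrderHom (η.toOrderHom 0) +
              (θ.toOrderHom (η.toOrderHom 0) - θ.toOrderHom 0)
          omega
      rw [map_map_op, map_map_op, h1, h4, ← map_map_op, wbarEdge, map_arr_wbarChain, ← map_mul]
      refine congrArg _ ?_
      exact arr_mul (wbarChain s (θ.toOrderHom (η.toOrderHom 0))) _ _

/-- The simplex of `W̄` of the simplicial translation groupoid with given initial vertex and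
cocycle. -/
def borelToWbar (m : S.M.obj (op p)) (c : WB S.Γ p) : WbarSimplex S.biNerve p where
  x i := (mkChain (S.M.map (shiftMap p i (Nat.le_of_lt_succ i.2)).op m) fun k : Fin ((i : ℕ) + 1) =>
      edgeOfCocycle c (Nat.le_of_lt_succ k.2) (Nat.le_of_lt_succ i.2) :
    ComposableArrows (ActionCategory (S.Γ.obj (op ⦋p.len - (i : ℕ)⦌))
      (S.M.obj (op ⦋p.len - (i : ℕ)⦌))) i)
  compat i hi := by
    refine chain_ext (Γ := S.Γ.obj (op ⦋p.len - (i + 1)⦌)) (X := S.M.obj (op ⦋p.len - (i + 1)⦌))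
      (n := i) ?_ fun k => ?_
    · change S.M.map (tailIncl (Nat.le_succ i) hi).op (edgeOfCocycle c (Nat.zero_le i) hi.le •
          S.M.map (shiftMap p i hi.le).op m) =
        S.M.map (𝟙 ⦋p.len - (i + 1)⦌).op (edgeOfCocycle c (Nat.zero_le (i + 1)) hi •
          S.M.map (shiftMap p (i + 1) hi).op m)
      rw [edgeOfCocycle_zero, edgeOfCocycle_zero, one_smul, one_smul, sset_map_map,
        sset_map_map, tailIncl_shiftMap, Category.id_comp]
    · have hk := Nat.le_of_lt_succ k.2
      change S.Γ.map (tailIncl (Nat.le_succ i) hi).op (edgeOfCocycle c hk hi.le *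
          (edgeOfCocycle c (Nat.zero_le i) hi.le)⁻¹) =
        S.Γ.map (𝟙 ⦋p.len - (i + 1)⦌).op (edgeOfCocycle c (hk.trans (Nat.le_succ i)) hi *
          (edgeOfCocycle c (Nat.zero_le (i + 1)) hi)⁻¹)
      rw [edgeOfCocycle_zero, edgeOfCocycle_zero, inv_one, mul_one, inv_one, mul_one,
        map_edgeOfCocycle, map_id_op]

/-- The `i`-th component of a simplex of `W̄` is a chain starting at a restriction of the initial
vertex, and its arrows from the start are restrictions of cocycle values. So the pair determines the
simplex, and conversely `borelToWbar` defines one from any pair. -/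
lemma bijective_wbarToBorel (p : SimplexCategoryᵒᵖ) :
    Function.Bijective ((wbarToBorel S).app p) := by
  constructor
  · intro s s' h
    change WbarSimplex S.biNerve p.unop at s s'
    have h1 : wbarVtx s = wbarVtx s' := congrArg Prod.fst h
    have h2 : wbarCocycle s = wbarCocycle s' := congrArg Prod.snd h
    refine WbarSimplex.ext (funext fun i => ?_)
    refine chain_ext (F := wbarChain s i) (F' := wbarChain s' i) ?_ fun k => ?_
    · rw [vtx_wbarChain_zero, vtx_wbarChain_zero, h1]
    · rw [arr_wbarChain, arr_wbarChain, h2]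
  · rintro ⟨m, c⟩
    change S.M.obj (op p.unop) at m
    change WB S.Γ p.unop at c
    refine ⟨borelToWbar m c, Prod.ext ?_ (WB.ext ?_)⟩
    · change S.M.map (subMap (𝟙 p.unop) 0).op
        (edgeOfCocycle c le_rfl (Nat.zero_le _) • S.M.map (shiftMap p.unop 0 (Nat.zero_le _)).op m) = m
      rw [edgeOfCocycle_zero, one_smul, sset_map_map]
      exact ConcreteCategory.congr_hom (S.M.map_id p) m
    · funext q θ
      have hθ := Nat.le_of_lt_succ (θ.toOrderHom 0).2
      change S.Γ.map (subMap θ (θ.toOrderHom 0)).op (edgeOfCocycle c le_rfl hθ *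
        (edgeOfCocycle c (Nat.zero_le _) hθ)⁻¹) = c.c θ
      rw [edgeOfCocycle_zero, inv_one, mul_one, edgeOfCocycle, map_map_op, ← c.c_comp]
      · congr 1
        exact hom_ext_val fun k => by
          have := toOrderHom_zero_le θ k
          change (θ.toOrderHom k : ℕ) - θ.toOrderHom 0 + (θ.toOrderHom 0 - θ.toOrderHom 0) +
            θ.toOrderHom 0 = θ.toOrderHom k
          omega
      · apply Fin.ext
        change (θ.toOrderHom 0 : ℕ) - θ.toOrderHom 0 + (θ.toOrderHom 0 - θ.toOrderHom 0) = 0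
        omega

end SimplicialAction

/-! ### Fibrations and pullbacks of Deligne nerves -/

/-- Maurer–Cartan simplices are families in the groups cut out by equations natural in `G`.
Components glue uniquely, and each equation can be checked after both projections. -/
lemma MC.setPullback_push {G₁ G₂ G₃ G₄ : CsGrp.{w}} {p : G₁ ⟶ G₂} {q : G₁ ⟶ G₃}
    {f : G₂ ⟶ G₄} {g : G₃ ⟶ G₄}
    (h : ∀ n k, SetPullback ((p.app n).app k) ((q.app n).app k) ((f.app n).app k)
      ((g.app n).app k)) (m : SimplexCategory) :
    SetPullback (MC.push (m := m) p) (MC.push q) (MC.push f) (MC.push g) where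
  comm x := by
    ext n k a b
    exact (h _ _).comm _
  ext {x y} hp hq := by
    ext n k a b
    exact (h _ _).ext (congrArg (fun z => z.ω n a b) hp) (congrArg (fun z => z.ω n a b) hq)
  exists_mk {x y} hxy := by
    choose e he he' using fun (n : ℕ) (k : SimplexCategory) (a : k ⟶ ⦋n⦌) (b : k ⟶ m) =>
      (h ⦋n + 1⦌ (op k)).exists_mk (congrArg (fun z => z.ω n a b) hxy)
    have nat {G H : CsGrp.{w}} (φ : G ⟶ H) (n : SimplexCategory) {k l : SimplexCategory}
        (f : l ⟶ k) (x : (G.obj n).obj (op k)) :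
        (φ.app n).app (op l) ((G.obj n).map f.op x) = (H.obj n).map f.op ((φ.app n).app (op k) x) :=
      app_map (φ.app n) f x
    have nat' {G H : CsGrp.{w}} (φ : G ⟶ H) {n n' : SimplexCategory} (f : n ⟶ n')
        (k : SimplexCategory) (x : (G.obj n).obj (op k)) :
        (φ.app n').app (op k) ((G.map f).app (op k) x) =
          (H.map f).app (op k) ((φ.app n).app (op k) x) :=
      ConcreteCategory.congr_hom (congr_app (φ.naturality f) (op k)) x
    refine ⟨⟨fun n k a b => e n k a b, fun n k l f a b => (h _ _).ext ?_ ?_,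
      fun n k a b => (h _ _).ext ?_ ?_, fun n i k a b => (h _ _).ext ?_ ?_,
      fun n i k a b => (h _ _).ext ?_ ?_, fun n k a b => (h _ _).ext ?_ ?_⟩, ?_, ?_⟩
    · rw [nat, he, he, x.naturality]
    · rw [nat, he', he', y.naturality]
    · rw [map_mul, map_inv, nat', nat', he, he, x.face_zero]
    · rw [map_mul, map_inv, nat', nat', he', he', y.face_zero]
    · rw [nat', he, he, x.face_succ]
    · rw [nat', he', he', y.face_succ]
    · rw [nat', he, he, x.degeneracy]
    · rw [nat', he', he', y.degeneracy]
    · rw [nat', he, x.codegeneracy_zero, map_one]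
    · rw [nat', he', y.codegeneracy_zero, map_one]
    · ext n k a b
      exact he n k a b
    · ext n k a b
      exact he' n k a b

/-- The gauge action on the Maurer–Cartan space. -/
def mcAction (G : CsGrp.{w}) : SimplicialAction.{w} where
  Γ := G.obj ⦋0⦌
  M := MC.sset G
  act k := inferInstanceAs (MulAction ((G.obj ⦋0⦌).obj (op k)) (MC G k))
  map_smul f g x := MC.pull_smul f g x

/-- The equivariant map of Maurer–Cartan spaces induced by a morphism. -/
def mcHom {G H : CsGrp.{w}} (φ : G ⟶ H) : (mcAction G).Hom (mcAction H) where
  φ := φ.app ⦋0⦌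
  ψ := MC.ssetMap φ
  map_smul g x := MC.push_smul φ g x

/-- The gauge action in level `0`. -/
def mcActionConst (G : CsGrp.{w}) : SimplicialAction.{w} :=
  .const ((G.obj ⦋0⦌).obj (op ⦋0⦌)) (MC G ⦋0⦌)

/-- The equivariant map in level `0` induced by a morphism. -/
def mcHomConst {G H : CsGrp.{w}} (φ : G ⟶ H) : (mcActionConst G).Hom (mcActionConst H) where
  φ := (Functor.const _).map ((φ.app ⦋0⦌).app (op ⦋0⦌))
  ψ := (Functor.const _).map (↾(MC.push φ))
  map_smul g x := MC.push_smul φ g x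

lemma isIso_of_bijective {X Y : SSet.{w}} (f : X ⟶ Y) (h : ∀ k, Function.Bijective (f.app k)) :
    IsIso f := by
  have (k : SimplexCategoryᵒᵖ) : IsIso (f.app k) := (isIso_iff_bijective _).2 (h k)
  exact NatIso.isIso_of_isIso_app f

instance (S : SimplicialAction.{w}) : IsIso S.wbarToBorel :=
  isIso_of_bijective _ SimplicialAction.bijective_wbarToBorel

instance (Γ : GrpCat.{w}) (X : Type w) [MulAction Γ X] :
    IsIso (SimplicialAction.nerveToBorel Γ X) :=
  isIso_of_bijective _ (SimplicialAction.bijective_nerveToBorel Γ X)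

/-- The derived Deligne nerve as a homotopy quotient. -/
def derivedDelNerveIso (G : CsGrp.{w}) : derivedDelNerve.obj G ≅ (mcAction G).borel :=
  (asIso (mcAction G).wbarToBorel :)

/-- The Deligne nerve as a homotopy quotient. -/
def delNerveIso (G : CsGrp.{w}) : delNerve.obj G ≅ (mcActionConst G).borel :=
  (asIso (SimplicialAction.nerveToBorel ((G.obj ⦋0⦌).obj (op ⦋0⦌)) (MC G ⦋0⦌)) :)

variable {G H : CsGrp.{w}} (φ : G ⟶ H)

lemma derivedDelNerveIso_naturality : (derivedDelNerveIso G).hom ≫ (mcHom φ).borelMap =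
    derivedDelNerve.map φ ≫ (derivedDelNerveIso H).hom := by
  apply NatTrans.ext
  funext p
  apply ConcreteCategory.hom_ext
  intro s
  change WbarSimplex (mcAction G).biNerve p.unop at s
  refine Prod.ext rfl (WB.ext ?_)
  funext q θ
  exact app_map (φ.app ⦋0⦌) (subMap θ (θ.toOrderHom 0)) (SimplicialAction.wbarEdge s _)

lemma delNerveIso_naturality : (delNerveIso G).hom ≫ (mcHomConst φ).borelMap =
    delNerve.map φ ≫ (delNerveIso H).hom := rfl

/-- The derived Deligne nerve of a morphism as a map of homotopy quotients. -/
def derivedDelNerveArrowIso : Arrow.mk (derivedDelNerve.map φ) ≅ Arrow.mk (mcHom φ).borelMap :=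
  Arrow.isoMk (derivedDelNerveIso G) (derivedDelNerveIso H) (derivedDelNerveIso_naturality φ)

/-- The Deligne nerve of a morphism as a map of homotopy quotients. -/
def delNerveArrowIso : Arrow.mk (delNerve.map φ) ≅ Arrow.mk (mcHomConst φ).borelMap :=
  Arrow.isoMk (delNerveIso G) (delNerveIso H) (delNerveIso_naturality φ)

variable {φ}

theorem kanFibration_derivedDelNerve_map
    (hφ : ∀ n k, Function.Surjective ((φ.app n).app k)) :
     KanFibration (derivedDelNerve.map φ) :=
  (MorphismProperty.arrow_mk_iso_iff (SSet.modelCategoryQuillen.J.rlp)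
    (derivedDelNerveArrowIso φ)).2
    (SimplicialAction.kanFibration_borelMap (mcHom φ) (MC.kanFibration_ssetMap φ hφ) (hφ _))

/-- Level `0` of the Maurer–Cartan space is a discrete simplicial set, where every map is a
fibration; surjectivity is needed only for the group. -/
theorem kanFibration_delNerve_map
    (hφ : ∀ n k, Function.Surjective ((φ.app n).app k)) :
     KanFibration (delNerve.map φ) :=
  (MorphismProperty.arrow_mk_iso_iff (SSet.modelCategoryQuillen.J.rlp)
    (delNerveArrowIso φ)).2
    (SimplicialAction.kanFibration_borelMap (mcHomConst φ) (SimplicialAction.kanFibration_const _)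
      fun _ => hφ _ _)

theorem trivialKanFibration_derivedDelNerve_map
    (hφ : ∀ n k, Function.Surjective ((φ.app n).app k))
    (hφ' : ∀ n, AcyclicKernel (φ.app n)) :
     TrivialKanFibration (derivedDelNerve.map φ) :=
  (MorphismProperty.arrow_mk_iso_iff (SSet.modelCategoryQuillen.I.rlp)
    (derivedDelNerveArrowIso φ)).2
    (SimplicialAction.trivialKanFibration_borelMap (mcHom φ) (MC.trivialKanFibration_ssetMap φ hφ hφ') (hφ _)
      (hφ' _))

/-- The boundary of `Δ[0]` is empty, so a trivial fibration of Maurer–Cartan spaces is surjective on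
vertices. This and surjectivity on `G⁰₀` are all that the homotopy quotient in level `0` requires.
-/
theorem surjective_delNerve_map
    (hφ : ∀ n k, Function.Surjective ((φ.app n).app k))
    (hφ' : ∀ n, AcyclicKernel (φ.app n)) (k) :
     Function.Surjective ((delNerve.map φ).app k) := by
  have h1 : Function.Surjective (MC.push (m := ⦋0⦌) φ) := by
    intro y
    obtain ⟨x, hx, -⟩ := trivialKanFibration_iff.1 (MC.trivialKanFibration_ssetMap φ hφ hφ') 0
      (fun b hb => (hb fun y => ⟨0, Subsingleton.elim (α := Fin 1) _ _⟩).elim)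
      (fun b hb => (hb fun y => ⟨0, Subsingleton.elim (α := Fin 1) _ _⟩).elim) y
      (fun b hb => (hb fun y => ⟨0, Subsingleton.elim (α := Fin 1) _ _⟩).elim)
    exact ⟨x, hx⟩
  intro y
  obtain ⟨x, hx⟩ := SimplicialAction.borelMap_surjective (mcHomConst φ) (fun _ => h1) (fun _ => hφ _ _) k
    ((delNerveIso H).hom.app k y)
  obtain ⟨x, rfl⟩ := (SimplicialAction.bijective_nerveToBorel _ _ k).2 x
  refine ⟨x, (SimplicialAction.bijective_nerveToBorel _ _ k).1 ?_⟩
  exact (ConcreteCategory.congr_hom (congr_app (delNerveIso_naturality φ) k) x).symm.trans hx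

variable {G₁ G₂ G₃ G₄ : CsGrp.{w}} {p : G₁ ⟶ G₂} {q : G₁ ⟶ G₃} {f : G₂ ⟶ G₄} {g : G₃ ⟶ G₄}

theorem isPullback_derivedDelNerve_map (h : ∀ n k, SetPullback ((p.app n).app k) ((q.app n).app k)
    ((f.app n).app k) ((g.app n).app k)) :
    IsPullback (derivedDelNerve.map p) (derivedDelNerve.map q)
      (derivedDelNerve.map f) (derivedDelNerve.map g) :=
  have hi {G H : CsGrp.{w}} (φ : G ⟶ H) := (derivedDelNerveArrowIso φ).inv.w
  (isPullback_of_setPullback (SimplicialAction.setPullback_borelMap (p := mcHom p) (q := mcHom q)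
    (f := mcHom f) (g := mcHom g) (h _) fun k => MC.setPullback_push h k.unop)).of_iso
    (derivedDelNerveIso _).symm (derivedDelNerveIso _).symm (derivedDelNerveIso _).symm
    (derivedDelNerveIso _).symm (hi p).symm (hi q).symm (hi f).symm (hi g).symm

theorem isPullback_delNerve_map (h : ∀ n k, SetPullback ((p.app n).app k) ((q.app n).app k)
    ((f.app n).app k) ((g.app n).app k)) :
    IsPullback (delNerve.map p) (delNerve.map q) (delNerve.map f) (delNerve.map g) :=
  have hi {G H : CsGrp.{w}} (φ : G ⟶ H) := (delNerveArrowIso φ).inv.w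
  (isPullback_of_setPullback (SimplicialAction.setPullback_borelMap (p := mcHomConst p)
    (q := mcHomConst q) (f := mcHomConst f) (g := mcHomConst g) (fun _ => h _ _)
    fun _ => MC.setPullback_push h ⦋0⦌)).of_iso
    (delNerveIso _).symm (delNerveIso _).symm (delNerveIso _).symm (delNerveIso _).symm
    (hi p).symm (hi q).symm (hi f).symm (hi g).symm

/-! ### Homogeneous and formally smooth functors -/

section Homogeneous

variable {R : Type u} [CommRing R]

lemma isPullback_of_setPullback_commAlgCat {P A B C : CommAlgCat.{u} R} {p : P ⟶ A} {q : P ⟶ C}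
    {f : A ⟶ B} {g : C ⟶ B} (h : SetPullback p q f g) : IsPullback p q f g := by
  have w : p ≫ f = q ≫ g := by
    ext x
    exact h.comm x
  refine ⟨⟨w⟩, ⟨Limits.PullbackCone.IsLimit.mk w (fun s => ?_) (fun s => ?_) (fun s => ?_)
    (fun s m hm hm' => ?_)⟩⟩
  · have hs (x : s.pt) : f (s.fst x) = g (s.snd x) := ConcreteCategory.congr_hom s.condition x
    let e (x : s.pt) : P := (h.exists_mk (hs x)).choose
    have he (x : s.pt) : p (e x) = s.fst x := (h.exists_mk (hs x)).choose_spec.1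
    have he' (x : s.pt) : q (e x) = s.snd x := (h.exists_mk (hs x)).choose_spec.2
    exact CommAlgCat.ofHom
      { toFun := e
        map_one' := h.ext (by rw [he, map_one, map_one]) (by rw [he', map_one, map_one])
        map_zero' := h.ext (by rw [he, map_zero, map_zero]) (by rw [he', map_zero, map_zero])
        map_mul' := fun x y => h.ext (by rw [he, map_mul, map_mul, he, he])
          (by rw [he', map_mul, map_mul, he', he'])
        map_add' := fun x y => h.ext (by rw [he, map_add, map_add, he, he])
          (by rw [he', map_add, map_add, he', he'])
        commutes' := fun r => by
          refine h.ext ?_ ?_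
          · rw [he]
            exact (s.fst.hom.commutes r).trans (p.hom.commutes r).symm
          · rw [he']
            exact (s.snd.hom.commutes r).trans (q.hom.commutes r).symm }
  · ext x
    have hs : f (s.fst x) = g (s.snd x) := ConcreteCategory.congr_hom s.condition x
    exact (h.exists_mk hs).choose_spec.1
  · ext x
    have hs : f (s.fst x) = g (s.snd x) := ConcreteCategory.congr_hom s.condition x
    exact (h.exists_mk hs).choose_spec.2
  · ext x
    have hs : f (s.fst x) = g (s.snd x) := ConcreteCategory.congr_hom s.condition x
    refine h.ext ?_ ?_
    · exact (ConcreteCategory.congr_hom hm x).trans (h.exists_mk hs).choose_spec.1.symm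
    · exact (ConcreteCategory.congr_hom hm' x).trans (h.exists_mk hs).choose_spec.2.symm

/-- The fibre product of commutative algebras. -/
def fibreProd {A B C : CommAlgCat.{u} R} (f : A ⟶ B) (g : C ⟶ B) : CommAlgCat.{u} R :=
  .of R (AlgHom.equalizer (f.hom.comp (AlgHom.fst R A C)) (g.hom.comp (AlgHom.snd R A C)))

namespace fibreProd

variable {A B C D : CommAlgCat.{u} R} (f : A ⟶ B) (g : C ⟶ B)

/-- The first projection. -/
def fst : fibreProd f g ⟶ A := CommAlgCat.ofHom ((AlgHom.fst R A C).comp (Subalgebra.val _))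

/-- The second projection. -/
def snd : fibreProd f g ⟶ C := CommAlgCat.ofHom ((AlgHom.snd R A C).comp (Subalgebra.val _))

lemma setPullback : SetPullback (fst f g) (snd f g) f g where
  comm x := x.2
  ext h h' := Subtype.ext (Prod.ext h h')
  exists_mk {a c} h := ⟨⟨(a, c), h⟩, rfl, rfl⟩

/-- The map into a fibre product given by its components. -/
def lift (a : D ⟶ A) (c : D ⟶ C) (h : ∀ x, f (a x) = g (c x)) : D ⟶ fibreProd f g :=
  CommAlgCat.ofHom ((a.hom.prod c.hom).codRestrict _ h)

end fibreProd

/-- Homogeneous and formally smooth functors from algebras to groups. -/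
structure IsFormallySmooth (H : CommAlgCat.{u} R ⥤ GrpCat.{w}) : Prop where
  setPullback {P A B C : CommAlgCat.{u} R} {p : P ⟶ A} {q : P ⟶ C} {f : A ⟶ B} {g : C ⟶ B}
    (hf : sqZero R f) (h : SetPullback p q f g) :
    SetPullback (H.map p) (H.map q) (H.map f) (H.map g)
  surjective {A B : CommAlgCat.{u} R} {f : A ⟶ B} (hf : sqZero R f) : Function.Surjective (H.map f)

lemma isFormallySmooth_evaluation (G : CommAlgCat.{u} R ⥤ CosimplicialObject GrpCat.{w})
    (hG : Homogeneous (sqZero R) G)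
    (hG' : ∀ (n : SimplexCategory) ⦃A B : CommAlgCat.{u} R⦄ (f : A ⟶ B), sqZero R f →
      Function.Surjective ((G.map f).app n)) (n : SimplexCategory) :
    IsFormallySmooth (G ⋙ (evaluation _ _).obj n) where
  setPullback hf h := setPullback_of_isPullback
    ((hG _ _ _ _ hf (isPullback_of_setPullback_commAlgCat h)).map ((evaluation _ _).obj n))
  surjective hf := hG' n _ hf

variable {H : CommAlgCat.{u} R ⥤ GrpCat.{w}}

lemma grp_map_map {A B C : CommAlgCat.{u} R} (f : A ⟶ B) (g : B ⟶ C) (x : H.obj A) :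
    H.map g (H.map f x) = H.map (f ≫ g) x :=
  (ConcreteCategory.congr_hom (H.map_comp f g) x).symm

lemma map_eq_one_of_factors {A B C : CommAlgCat.{u} R} {f : A ⟶ B} {g : A ⟶ C} (v : B ⟶ C)
    (hv : f ≫ v = g) {x : H.obj A} (hx : H.map f x = 1) : H.map g x = 1 := by
  rw [← hv, ← grp_map_map, hx, map_one]

/-- The quotient map by an ideal. -/
def mkQ {A : CommAlgCat.{u} R} (I : Ideal A) : A ⟶ .of R (A ⧸ I) :=
  CommAlgCat.ofHom (Ideal.Quotient.mkₐ R I)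

lemma map_mkQ_eq_one {A B : CommAlgCat.{u} R} (f : A ⟶ B) (hf : Function.Surjective f) (I : Ideal A)
    (hI : ∀ a, f a = 0 → a ∈ I) {x : H.obj A} (hx : H.map f x = 1) : H.map (mkQ I) x = 1 := by
  have hle : RingHom.ker f.hom ≤ I := fun a ha => hI a ha
  refine map_eq_one_of_factors (CommAlgCat.ofHom ((Ideal.Quotient.factorₐ R hle).comp
    (Ideal.quotientKerAlgEquivOfSurjective hf).symm.toAlgHom)) ?_ hx
  ext a
  change Ideal.Quotient.factorₐ R hle ((Ideal.quotientKerAlgEquivOfSurjective hf).symm (f.hom a)) =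
    Ideal.Quotient.mk I a
  have h1 : (Ideal.quotientKerAlgEquivOfSurjective hf).symm (f.hom a) =
      Ideal.Quotient.mk _ a := by
    rw [AlgEquiv.symm_apply_eq]
    rfl
  rw [h1]
  rfl

lemma sqZero_factor {A : CommAlgCat.{u} R} {I J : Ideal A} (h : I ≤ J)
    (hJ : ∀ x ∈ J, ∀ y ∈ J, x * y ∈ I) :
    sqZero R (CommAlgCat.ofHom (Ideal.Quotient.factorₐ R h) :
      CommAlgCat.of R (A ⧸ I) ⟶ CommAlgCat.of R (A ⧸ J)) := by
  refine ⟨Ideal.Quotient.factor_surjective h, fun x y hx hy => ?_⟩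
  obtain ⟨x, rfl⟩ := Ideal.Quotient.mk_surjective x
  obtain ⟨y, rfl⟩ := Ideal.Quotient.mk_surjective y
  exact Ideal.Quotient.eq_zero_iff_mem.2 (hJ x (Ideal.Quotient.eq_zero_iff_mem.1 hx) y
    (Ideal.Quotient.eq_zero_iff_mem.1 hy))

lemma setPullback_factor {A : CommAlgCat.{u} R} (I J : Ideal A) :
    SetPullback (Ideal.Quotient.factorₐ R (inf_le_left : I ⊓ J ≤ I))
      (Ideal.Quotient.factorₐ R (inf_le_right : I ⊓ J ≤ J))
      (Ideal.Quotient.factorₐ R (le_sup_left : I ≤ I ⊔ J))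
      (Ideal.Quotient.factorₐ R (le_sup_right : J ≤ I ⊔ J)) where
  comm x := by
    obtain ⟨x, rfl⟩ := Ideal.Quotient.mk_surjective x
    rfl
  ext {x y} h h' := by
    obtain ⟨x, rfl⟩ := Ideal.Quotient.mk_surjective x
    obtain ⟨y, rfl⟩ := Ideal.Quotient.mk_surjective y
    exact Ideal.Quotient.eq.2 ⟨Ideal.Quotient.eq.1 h, Ideal.Quotient.eq.1 h'⟩
  exists_mk {x y} h := by
    obtain ⟨x, rfl⟩ := Ideal.Quotient.mk_surjective x
    obtain ⟨y, rfl⟩ := Ideal.Quotient.mk_surjective y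
    obtain ⟨i, hi, j, hj, hij⟩ := Submodule.mem_sup.1 (Ideal.Quotient.eq.1 h)
    refine ⟨Ideal.Quotient.mk _ (x - i), ?_, ?_⟩
    · exact Ideal.Quotient.eq.2 (by simpa using hi)
    · refine Ideal.Quotient.eq.2 ?_
      have : x - i - y = j := by rw [sub_right_comm, ← hij, add_sub_cancel_left]
      rwa [this]

/-- The ideal of the elements killed by `f` and by the maps in a finite set. -/
def commonKer {A B A' : CommAlgCat.{u} R} (f : A ⟶ B) {ι : Type*} (d : ι → (A ⟶ A'))
    (S : Finset ι) : Ideal A :=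
  RingHom.ker f.hom ⊓ S.inf fun i => RingHom.ker (d i).hom

lemma mem_commonKer {A B A' : CommAlgCat.{u} R} {f : A ⟶ B} {ι : Type*} {d : ι → (A ⟶ A')}
    {S : Finset ι} {a : A} : a ∈ commonKer f d S ↔ f a = 0 ∧ ∀ i ∈ S, d i a = 0 := by
  rw [commonKer, Ideal.mem_inf, Submodule.mem_finsetInf]
  rfl

/-- Each `d j` is treated alone first: by `hd` the algebra `A` surjects onto `A' ×_{B'} B`, with
kernel the elements killed by `f` and `d j`, and homogeneity along `f'` detects triviality there.
The conditions are then combined through `A/(I ∩ J) = A/I ×_{A/(I + J)} A/J`, to which homogeneity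
applies because `I + J` lies in the square-zero kernel of `f`. -/
lemma map_mkQ_commonKer (hH : IsFormallySmooth H) {A B A' B' : CommAlgCat.{u} R} {f : A ⟶ B} {f' : A' ⟶ B'}
    (hf : sqZero R f) (hf' : sqZero R f') {ι : Type*} {d : ι → (A ⟶ A')} {e : ι → (B ⟶ B')}
    (hde : ∀ i a, f' (d i a) = e i (f a))
    (hd : ∀ i b a', f' a' = e i b → ∃ a, f a = b ∧ d i a = a') (S : Finset ι) {x : H.obj A}
    (hx : H.map f x = 1) (hx' : ∀ i ∈ S, H.map (d i) x = 1) :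
    H.map (mkQ (commonKer f d S)) x = 1 := by
  classical
  induction S using Finset.induction_on with
  | empty => exact map_mkQ_eq_one f hf.1 _ (fun a ha => mem_commonKer.2 ⟨ha, by simp⟩) hx
  | insert j S hj ih =>
    let I := commonKer f d S
    let J := commonKer f d {j}
    have hIJ : commonKer f d (insert j S) = I ⊓ J := by
      ext a
      simp only [I, J, Ideal.mem_inf, mem_commonKer, Finset.mem_insert, Finset.mem_singleton,
        forall_eq_or_imp, forall_eq]
      tauto
    rw [hIJ]
    have hI : H.map (mkQ I) x = 1 := ih fun i hi => hx' i (Finset.mem_insert_of_mem hi)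
    have hJ : H.map (mkQ J) x = 1 := by
      let u := fibreProd.lift f' (e j) (d j) f (hde j)
      refine map_mkQ_eq_one u ?_ J ?_ ?_
      · intro y
        obtain ⟨a, ha, ha'⟩ := hd j y.1.2 y.1.1 y.2
        exact ⟨a, Subtype.ext (Prod.ext ha' ha)⟩
      · intro a ha
        have h1 : (d j a, f a) = (0 : A' × B) := congrArg Subtype.val ha
        refine mem_commonKer.2 ⟨congrArg Prod.snd h1, ?_⟩
        simpa using congrArg Prod.fst h1
      · refine (hH.setPullback hf' (fibreProd.setPullback f' (e j))).ext ?_ ?_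
        · rw [grp_map_map, map_one]
          exact hx' j (Finset.mem_insert_self _ _)
        · rw [grp_map_map, map_one]
          exact hx
    have hsq := sqZero_factor (A := A) (I := I) (J := I ⊔ J) le_sup_left (by
      have h1 : ∀ a ∈ I ⊔ J, f a = 0 := fun a ha => by
        have : I ⊔ J ≤ RingHom.ker f.hom := sup_le inf_le_left inf_le_left
        exact this ha
      intro x hx y hy
      rw [hf.2 x y (h1 x hx) (h1 y hy)]
      exact I.zero_mem)
    refine (hH.setPullback (p := CommAlgCat.ofHom _) (q := CommAlgCat.ofHom _)
      (g := CommAlgCat.ofHom _) hsq (setPullback_factor I J)).ext ?_ ?_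
    · rw [grp_map_map, map_one]
      exact hI
    · rw [grp_map_map, map_one]
      exact hJ

/-- The trivial square-zero extension of the base ring by an ideal `I` of square zero, as the algebra
of the pairs `(a, r)` with `a - r ∈ I`. -/
abbrev trivExt {A : CommAlgCat.{u} R} (I : Ideal A) : CommAlgCat.{u} R :=
  fibreProd (mkQ I) (CommAlgCat.ofHom (Algebra.ofId R (A ⧸ I)) : CommAlgCat.of R R ⟶ _)

lemma trivExt_mem {A : CommAlgCat.{u} R} {I : Ideal A} (x : trivExt I) :
    x.1.1 - algebraMap R A x.1.2 ∈ I := Ideal.Quotient.eq.1 x.2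

/-- A map killing `I` agrees on `trivExt I` with the augmentation to `R` followed by the structure
map, so an element with trivial augmentation is sent to `1`. -/
lemma trivExt_fst_comp {A B : CommAlgCat.{u} R} {I : Ideal A} (g : A ⟶ B)
    (h : ∀ a ∈ I, g a = 0) {x : H.obj (trivExt I)} (hx : H.map (fibreProd.snd _ _) x = 1) :
    H.map g (H.map (fibreProd.fst _ _) x) = 1 := by
  rw [grp_map_map]
  refine map_eq_one_of_factors (CommAlgCat.ofHom (Algebra.ofId R B)) ?_ hx
  ext x
  have h1 := h _ (trivExt_mem x)
  rw [map_sub, sub_eq_zero] at h1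
  exact (h1.trans (g.hom.commutes _)).symm

lemma exists_σ {n : ℕ} (i : Fin (n + 2)) :
    ∃ j : Fin (n + 1), SimplexCategory.δ i ≫ SimplexCategory.σ j = 𝟙 _ := by
  induction i using Fin.lastCases with
  | last => exact ⟨Fin.last n, SimplexCategory.δ_comp_σ_succ⟩
  | cast j => exact ⟨j, SimplexCategory.δ_comp_σ_self⟩

/-! ### Acyclic kernels under formally smooth functors -/

variable {A B : SimplexCategoryᵒᵖ ⥤ CommAlgCat.{u} R} (f : A ⟶ B)

lemma alg_map_map (A : SimplexCategoryᵒᵖ ⥤ CommAlgCat.{u} R) {k l m : SimplexCategory}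
    (α : m ⟶ l) (β : l ⟶ k) (x : A.obj (op k)) :
    A.map α.op (A.map β.op x) = A.map (α ≫ β).op x := by
  rw [op_comp, A.map_comp]
  rfl

lemma alg_app_map {k l : SimplexCategory} (α : l ⟶ k) (x : A.obj (op k)) :
    f.app (op l) (A.map α.op x) = B.map α.op (f.app (op k) x) :=
  ConcreteCategory.congr_hom (f.naturality α.op) x

/-- The kernel of a homomorphism of simplicial algebras is acyclic. -/
def AlgAcyclicKernel : Prop :=
  ∀ (n : ℕ) (x : A.obj (op ⦋n⦌)), f.app _ x = 0 →
    (∀ {q : SimplexCategory} (α : q ⟶ ⦋n⦌), ¬ Function.Surjective α.toOrderHom →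
      A.map α.op x = 0) →
    ∃ y : A.obj (op ⦋n + 1⦌), f.app _ y = 0 ∧ A.map (SimplexCategory.δ 0).op y = x ∧
      ∀ i : Fin (n + 1), A.map (SimplexCategory.δ i.succ).op y = 0

variable {f}

/-- The ideal `Z` consists of the cycles of the kernel of `f`. In positive dimension it is the
common kernel of `f` and the face maps, so the triviality of the faces of `x` adds up to triviality
of `x` modulo `Z`; in dimension `0` there are no face conditions. -/
lemma exists_ideal_map_mkQ (hH : IsFormallySmooth H) (hf : ∀ k, sqZero R (f.app k)) {n : ℕ}
    {x : H.obj (A.obj (op ⦋n⦌))} (hx : H.map (f.app _) x = 1)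
    (hx' : ∀ {q : SimplexCategory} (α : q ⟶ ⦋n⦌), ¬ Function.Surjective α.toOrderHom →
      H.map (A.map α.op) x = 1) :
    ∃ Z : Ideal (A.obj (op ⦋n⦌)), (∀ z, z ∈ Z ↔ f.app _ z = 0 ∧ ∀ {q : SimplexCategory}
      (α : q ⟶ ⦋n⦌), ¬ Function.Surjective α.toOrderHom → A.map α.op z = 0) ∧
      H.map (mkQ Z) x = 1 := by
  obtain _ | n := n
  · refine ⟨RingHom.ker (f.app (op ⦋0⦌)).hom, fun z => ?_, map_mkQ_eq_one _ (hf _).1 _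
      (fun a ha => ha) hx⟩
    exact ⟨fun h => ⟨h, fun α hα => (hα fun y =>
      ⟨0, Subsingleton.elim (α := Fin 1) _ _⟩).elim⟩, fun h => h.1⟩
  · refine ⟨commonKer (f.app (op ⦋n + 1⦌))
      (fun i : Fin (n + 2) => A.map (SimplexCategory.δ i).op) Finset.univ, fun z => ?_,
      map_mkQ_commonKer hH (hf _) (hf (op ⦋n⦌)) (e := fun i => B.map (SimplexCategory.δ i).op)
        (fun i a => alg_app_map f _ a) (fun i b a' h => ?_) _ hx fun i _ => hx' _ fun h => ?_⟩
    · rw [mem_commonKer]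
      refine and_congr_right fun _ => ⟨fun h q α hα => ?_, fun h i _ => h _ fun h' => ?_⟩
      · obtain ⟨i, α, rfl⟩ := SimplexCategory.eq_comp_δ_of_not_surjective α hα
        rw [← alg_map_map, h i (Finset.mem_univ _), map_zero]
      · obtain ⟨y, hy⟩ := h' i
        exact Fin.succAbove_ne i y hy
    · obtain ⟨a, ha⟩ := (hf _).1 b
      obtain ⟨j, hj⟩ := exists_σ i
      -- A lift `a` of `b` is adjusted on its `i`-th face by a degeneracy of the error. The error
      -- lies in the kernel of `f`, so the image in `B` does not change.
      refine ⟨a - A.map (SimplexCategory.σ j).op (A.map (SimplexCategory.δ i).op a - a'), ?_, ?_⟩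
      · rw [map_sub, alg_app_map, map_sub, alg_app_map, ha, h, sub_self, map_zero, sub_zero]
      · rw [map_sub, alg_map_map, hj]
        have h1 (x : A.obj (op ⦋n⦌)) : A.map (𝟙 ⦋n⦌).op x = x :=
          ConcreteCategory.congr_hom (A.map_id (op ⦋n⦌)) x
        rw [h1, sub_sub_cancel]
    · obtain ⟨y, hy⟩ := h i
      exact Fin.succAbove_ne i y hy

/-- A homogeneous formally smooth functor preserves acyclicity of kernels. -/
theorem acyclicKernel_whiskerRight (hH : IsFormallySmooth H) (hf : ∀ k, sqZero R (f.app k))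
    (h : AlgAcyclicKernel f) : AcyclicKernel (Functor.whiskerRight f H) := by
  intro n x hx hx'
  change H.obj (A.obj (op ⦋n⦌)) at x
  -- The element `x` is trivial modulo the ideal `Z` of cycles, so homogeneity along the square-zero
  -- extension `A → A/Z` will place it in `H (trivExt Z)`.
  obtain ⟨Z, hZ, hxZ⟩ := exists_ideal_map_mkQ hH hf hx hx'
  let N : Ideal (A.obj (op ⦋n + 1⦌)) := commonKer (f.app (op ⦋n + 1⦌))
    (fun i : Fin (n + 1) => A.map (SimplexCategory.δ i.succ).op) Finset.univ
  have hN (z : A.obj (op ⦋n + 1⦌)) : z ∈ N ↔ f.app _ z = 0 ∧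
      ∀ i : Fin (n + 1), A.map (SimplexCategory.δ i.succ).op z = 0 := by
    rw [mem_commonKer]
    simp
  have hsq : sqZero R (mkQ Z) := by
    refine ⟨Ideal.Quotient.mk_surjective, fun a b ha hb => ?_⟩
    exact (hf _).2 a b ((hZ a).1 (Ideal.Quotient.eq_zero_iff_mem.1 ha)).1
      ((hZ b).1 (Ideal.Quotient.eq_zero_iff_mem.1 hb)).1
  -- `trivExt Z` is the fibre product of `A` and `R` over `A/Z`; the pair of `x` and the unit of
  -- `H(R)` therefore comes from a unique `x'`.
  obtain ⟨x', hx1, hx2⟩ := (hH.setPullback hsq (fibreProd.setPullback (mkQ Z)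
    (CommAlgCat.ofHom (Algebra.ofId R _) : CommAlgCat.of R R ⟶ _))).exists_mk (a := x) (c := 1)
    (by rw [hxZ, map_one])
  have hd0 (z : A.obj (op ⦋n + 1⦌)) (hz : z ∈ N) : A.map (SimplexCategory.δ 0).op z ∈ Z := by
    rw [hN] at hz
    rw [hZ]
    refine ⟨by rw [alg_app_map, hz.1, map_zero], fun {q} α hα => ?_⟩
    obtain _ | n := n
    · exact (hα fun y => ⟨0, Subsingleton.elim (α := Fin 1) _ _⟩).elim
    obtain ⟨i, α, rfl⟩ := SimplexCategory.eq_comp_δ_of_not_surjective α hα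
    have h1 : SimplexCategory.δ i ≫ SimplexCategory.δ 0 =
        SimplexCategory.δ 0 ≫ SimplexCategory.δ i.succ :=
      (SimplexCategory.δ_comp_δ (Fin.zero_le i)).symm
    rw [alg_map_map, Category.assoc, h1, ← alg_map_map, ← alg_map_map, hz.2, map_zero, map_zero]
  -- `N` consists of the elements of the kernel all of whose faces except the `0`-th vanish, so `∂₀`
  -- maps it to `Z` and induces a map of trivial extensions over `R`.
  let T : trivExt N ⟶ trivExt Z := fibreProd.lift _ _
    (fibreProd.fst _ _ ≫ A.map (SimplexCategory.δ 0).op) (fibreProd.snd _ _) fun a => by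
      refine Ideal.Quotient.eq.2 ?_
      have h1 := hd0 _ (trivExt_mem a)
      have h2 : A.map (SimplexCategory.δ 0).op (algebraMap R (A.obj (op ⦋n + 1⦌)) a.1.2) =
        algebraMap R (A.obj (op ⦋n⦌)) a.1.2 := (A.map (SimplexCategory.δ 0).op).hom.commutes _
      rw [map_sub, h2] at h1
      exact h1
  -- Surjectivity is the acyclicity of the kernel of `f`: every cycle in `Z` is `∂₀` of an element
  -- of `N`. The square of the kernel vanishes because it lies over `0` in `R` and in the kernel of
  -- `f`.
  have hT : sqZero R T := by
    refine ⟨fun z => ?_, fun a b ha hb => ?_⟩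
    · have hz := (hZ _).1 (trivExt_mem z)
      obtain ⟨y, hy, hy', hy''⟩ := h n _ hz.1 hz.2
      have hyN : y ∈ N := (hN y).2 ⟨hy, hy''⟩
      refine ⟨⟨(y + algebraMap R _ z.1.2, z.1.2), Ideal.Quotient.eq.2 (by simpa using hyN)⟩,
        Subtype.ext (Prod.ext ?_ rfl)⟩
      change A.map (SimplexCategory.δ 0).op (y + algebraMap R _ z.1.2) = z.1.1
      rw [map_add, hy']
      refine (congrArg _ ((A.map (SimplexCategory.δ 0).op).hom.commutes _)).trans ?_
      exact sub_add_cancel _ _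
    · have key (a : trivExt N) (ha : T a = 0) : a.1.2 = 0 ∧ f.app _ a.1.1 = 0 := by
        have h1 : a.1.2 = 0 := congrArg (fun z : trivExt Z => z.1.2) ha
        have h2 := ((hN _).1 (trivExt_mem a)).1
        rw [h1, map_zero, sub_zero] at h2
        exact ⟨h1, h2⟩
      obtain ⟨ha1, ha2⟩ := key a ha
      obtain ⟨hb1, hb2⟩ := key b hb
      refine Subtype.ext (Prod.ext ((hf _).2 _ _ ha2 hb2) ?_)
      change a.1.2 * b.1.2 = 0
      rw [ha1, zero_mul]
  -- Formal smoothness lifts `x'` along `T`. The lift still has trivial augmentation, so it becomes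
  -- trivial under `f` and under the faces other than the `0`-th, all of which kill `N`.
  obtain ⟨y, rfl⟩ := hH.surjective hT x'
  have hy : H.map (fibreProd.snd _ _) y = 1 := by
    rw [← hx2, grp_map_map]
    rfl
  refine ⟨H.map (fibreProd.fst _ _) y, ?_, ?_, fun i => ?_⟩
  · exact trivExt_fst_comp (f.app _) (fun a ha => ((hN a).1 ha).1) hy
  · rw [← hx1]
    refine (grp_map_map _ _ _).trans ?_
    rw [grp_map_map]
    rfl
  · exact trivExt_fst_comp _ (fun a ha => ((hN a).1 ha).2 i) hy

end Homogeneous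

/-! ### Reduction to simplicial algebras -/

section Reduction

variable {R : Type u} [CommRing R] {C : Type*} [Category C]

/-- The properties of the Deligne nerves of a homogeneous formally smooth functor, in terms of the
simplicial algebras to which it is applied. -/
theorem deligneNerve_properties (G : CommAlgCat.{u} R ⥤ CosimplicialObject GrpCat.{w})
    (hG : ∀ n, IsFormallySmooth (G ⋙ (evaluation _ _).obj n))
    (F : C ⥤ SimplexCategoryᵒᵖ ⥤ CommAlgCat.{u} R) (sqz tiny : MorphismProperty C)
    (hsqz : ∀ ⦃A B : C⦄ (f : A ⟶ B), sqz f → ∀ k, sqZero R ((F.map f).app k))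
    (hpull : ∀ ⦃P A B C' : C⦄ (p : P ⟶ A) (q : P ⟶ C') (f : A ⟶ B) (g : C' ⟶ B), sqz f →
      IsPullback p q f g → ∀ k, SetPullback ((F.map p).app k) ((F.map q).app k)
        ((F.map f).app k) ((F.map g).app k))
    (htiny : ∀ ⦃A B : C⦄ (f : A ⟶ B), tiny f →
      (∀ k, sqZero R ((F.map f).app k)) ∧ AlgAcyclicKernel (F.map f)) :
    Homogeneous sqz (F ⋙ levelwise G ⋙ derivedDelNerve) ∧
      FormallyQuasiSmooth sqz tiny (F ⋙ levelwise G ⋙ derivedDelNerve) ∧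
      Homogeneous sqz (F ⋙ levelwise G ⋙ delNerve) ∧
      PreHomotopic tiny (F ⋙ levelwise G ⋙ delNerve) ∧
      FormallyQuasiPresmooth sqz (F ⋙ levelwise G ⋙ delNerve) := by
  have hsurj ⦃A B : C⦄ (f : A ⟶ B) (hf : ∀ k, sqZero R ((F.map f).app k)) (n : SimplexCategory)
      (k : SimplexCategoryᵒᵖ) :
      Function.Surjective ((((F ⋙ levelwise G).map f).app n).app k) :=
    (hG n).surjective (hf k)
  have hacyc ⦃A B : C⦄ (f : A ⟶ B) (hf : tiny f) (n : SimplexCategory) :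
      AcyclicKernel (((F ⋙ levelwise G).map f).app n) :=
    acyclicKernel_whiskerRight (hG n) (htiny f hf).1 (htiny f hf).2
  have hset ⦃P A B C' : C⦄ (p : P ⟶ A) (q : P ⟶ C') (f : A ⟶ B) (g : C' ⟶ B) (hf : sqz f)
      (h : IsPullback p q f g) (n : SimplexCategory) (k : SimplexCategoryᵒᵖ) :
      SetPullback ((((F ⋙ levelwise G).map p).app n).app k)
        ((((F ⋙ levelwise G).map q).app n).app k) ((((F ⋙ levelwise G).map f).app n).app k)
        ((((F ⋙ levelwise G).map g).app n).app k) :=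
    (hG n).setPullback (hsqz f hf k) (hpull p q f g hf h k)
  refine ⟨fun P A B C' p q f g hf h => isPullback_derivedDelNerve_map (hset p q f g hf h),
    ⟨fun A B f hf => kanFibration_derivedDelNerve_map (hsurj f (hsqz f hf)),
      fun A B f hf => trivialKanFibration_derivedDelNerve_map (hsurj f (htiny f hf).1)
        (hacyc f hf)⟩,
    fun P A B C' p q f g hf h => isPullback_delNerve_map (hset p q f g hf h),
    fun A B f hf => ⟨kanFibration_delNerve_map (hsurj f (htiny f hf).1),
      surjective_delNerve_map (hsurj f (htiny f hf).1) (hacyc f hf)⟩,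
    fun A B f hf => kanFibration_delNerve_map (hsurj f (hsqz f hf))⟩

lemma setPullback_of_iso {P P' A B C : CommAlgCat.{u} R} {p : P ⟶ A} {q : P ⟶ C} {p' : P' ⟶ A}
    {q' : P' ⟶ C} {f : A ⟶ B} {g : C ⟶ B} (e : P ≅ P') (hp : e.hom ≫ p' = p)
    (hq : e.hom ≫ q' = q) (h : SetPullback p' q' f g) : SetPullback p q f g where
  comm x := by
    rw [← hp, ← hq]
    exact h.comm (e.hom x)
  ext {x y} h1 h2 := by
    rw [← hp] at h1
    rw [← hq] at h2
    have h3 := congrArg e.inv (h.ext (x := e.hom x) (y := e.hom y) h1 h2)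
    have h4 (z : P) : e.inv (e.hom z) = z := ConcreteCategory.congr_hom e.hom_inv_id z
    rwa [h4, h4] at h3
  exists_mk h1 := by
    obtain ⟨x, hx, hx'⟩ := h.exists_mk h1
    have h4 : e.hom (e.inv x) = x := ConcreteCategory.congr_hom e.inv_hom_id x
    refine ⟨e.inv x, ?_, ?_⟩
    · rw [← hp]
      exact (congrArg p' h4).trans hx
    · rw [← hq]
      exact (congrArg q' h4).trans hx'

end Reduction

/-! ### Simplicial algebras -/

namespace SAlg

variable {R : Type u} [CommRing R] {A B C : SimplexCategoryᵒᵖ ⥤ CommAlgCat.{u} R}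

lemma map_mem_pi0Ker (f : A ⟶ B) {k : SimplexCategory} {a : A.obj (op k)} (ha : a ∈ pi0Ker A k) :
    f.app (op k) a ∈ pi0Ker B k := by
  have h1 := Ideal.mem_map_of_mem (f.app (op ⦋0⦌)).hom (Ideal.mem_comap.1 ha)
  rw [Ideal.map_span] at h1
  refine Ideal.mem_comap.2 ?_
  have h2 : (B.map (SimplexCategory.const ⦋0⦌ k 0).op).hom (f.app (op k) a) =
      (f.app (op ⦋0⦌)).hom ((A.map (SimplexCategory.const ⦋0⦌ k 0).op).hom a) :=
    (alg_app_map f _ a).symm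
  change (B.map (SimplexCategory.const ⦋0⦌ k 0).op).hom (f.app (op k) a) ∈ _
  rw [h2]
  refine Ideal.span_mono ?_ h1
  rintro _ ⟨_, ⟨a, rfl⟩, rfl⟩
  refine ⟨f.app (op ⦋1⦌) a, ?_⟩
  dsimp only
  rw [← alg_app_map, ← alg_app_map]
  exact (map_sub _ _ _).symm

lemma IsNormalized.map (f : A ⟶ B) {n : ℕ} {a : A.obj (op ⦋n⦌)} (ha : IsNormalized A a) :
    IsNormalized B (f.app _ a) := by
  obtain _ | n := n
  · trivial
  · intro j
    rw [← alg_app_map, ha j, map_zero]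

lemma map_mem_pow_eq_zero (f : A ⟶ B) {k : SimplexCategory} {m n : ℕ} (h : pi0Ker B k ^ m = ⊥)
    (hmn : m ≤ n) {a : A.obj (op k)} (ha : a ∈ pi0Ker A k ^ n) : f.app (op k) a = 0 := by
  have h1 := Ideal.mem_map_of_mem (f.app (op k)).hom ha
  rw [Ideal.map_pow] at h1
  have h2 : Ideal.map (f.app (op k)).hom (pi0Ker A k) ≤ pi0Ker B k :=
    Ideal.map_le_iff_le_comap.2 fun a ha => map_mem_pi0Ker f ha
  have h3 := Ideal.pow_le_pow_right hmn (Ideal.pow_right_mono h2 n h1)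
  rwa [h, Ideal.mem_bot] at h3

/-- The fibre product of simplicial algebras. -/
def fibre (f : A ⟶ B) (g : C ⟶ B) : SimplexCategoryᵒᵖ ⥤ CommAlgCat.{u} R where
  obj k := fibreProd (f.app k) (g.app k)
  map {k l} α := fibreProd.lift _ _ (fibreProd.fst _ _ ≫ A.map α) (fibreProd.snd _ _ ≫ C.map α)
    fun x => by
      have h1 : f.app l (A.map α x.1.1) = B.map α (f.app k x.1.1) :=
        ConcreteCategory.congr_hom (f.naturality α) x.1.1
      have h2 : g.app l (C.map α x.1.2) = B.map α (g.app k x.1.2) :=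
        ConcreteCategory.congr_hom (g.naturality α) x.1.2
      have h3 : f.app k x.1.1 = g.app k x.1.2 := x.2
      exact h1.trans ((congrArg (B.map α) h3).trans h2.symm)
  map_id k := by
    ext x
    exact Subtype.ext (Prod.ext (ConcreteCategory.congr_hom (A.map_id k) x.1.1)
      (ConcreteCategory.congr_hom (C.map_id k) x.1.2))
  map_comp α β := by
    ext x
    exact Subtype.ext (Prod.ext (ConcreteCategory.congr_hom (A.map_comp α β) x.1.1)
      (ConcreteCategory.congr_hom (C.map_comp α β) x.1.2))

/-- The first projection. -/
def fibreFst (f : A ⟶ B) (g : C ⟶ B) : fibre f g ⟶ A where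
  app _ := fibreProd.fst _ _
  naturality _ _ _ := rfl

/-- The second projection. -/
def fibreSnd (f : A ⟶ B) (g : C ⟶ B) : fibre f g ⟶ C where
  app _ := fibreProd.snd _ _
  naturality _ _ _ := rfl

/-- An element of the fibre product vanishes when both components do, and both projections preserve
the kernel of `A → π₀ A` and normalised elements. So the larger of the two bounds works. -/
lemma nilpFlat_fibre (f : A ⟶ B) (g : C ⟶ B) (hA : nilpFlat R A) (hC : nilpFlat R C) :
    nilpFlat R (fibre f g) := by
  obtain ⟨⟨n, hn⟩, n', hn'⟩ := hA
  obtain ⟨⟨m, hm⟩, m', hm'⟩ := hC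
  refine ⟨⟨max n m, fun k => ?_⟩, max n' m', fun i hi a ha => ?_⟩
  · rw [eq_bot_iff]
    intro a ha
    exact Subtype.ext (Prod.ext
      (map_mem_pow_eq_zero (fibreFst f g) (hn k) (le_max_left _ _) ha)
      (map_mem_pow_eq_zero (fibreSnd f g) (hm k) (le_max_right _ _) ha))
  · exact Subtype.ext (Prod.ext
      (hn' i (lt_of_le_of_lt (le_max_left _ _) hi) _ (ha.map (fibreFst f g)))
      (hm' i (lt_of_le_of_lt (le_max_right _ _) hi) _ (ha.map (fibreSnd f g))))

/-- The full subcategory contains the levelwise fibre product, so an abstract pullback in it is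
isomorphic to that one. -/
lemma setPullback_of_isPullback {P A B C : (nilpFlat R).FullSubcategory} {p : P ⟶ A} {q : P ⟶ C}
    {f : A ⟶ B} {g : C ⟶ B} (h : IsPullback p q f g) (k : SimplexCategoryᵒᵖ) :
    SetPullback (p.hom.app k) (q.hom.app k) (f.hom.app k) (g.hom.app k) := by
  let P' : (nilpFlat R).FullSubcategory :=
    ⟨fibre f.hom g.hom, nilpFlat_fibre f.hom g.hom A.property C.property⟩
  let p' : P' ⟶ A := ⟨fibreFst f.hom g.hom⟩
  let q' : P' ⟶ C := ⟨fibreSnd f.hom g.hom⟩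
  have h' : IsPullback p' q' f g := by
    refine IsPullback.of_map (nilpFlat R).ι ?_ ?_
    · apply InducedCategory.hom_ext
      apply NatTrans.ext
      funext k
      ext x
      exact x.2
    · exact IsPullback.of_forall_isPullback_app fun k =>
        isPullback_of_setPullback_commAlgCat (fibreProd.setPullback (f.hom.app k) (g.hom.app k))
  let e := h.isoIsPullback _ _ h'
  have hp : e.hom ≫ p' = p := h.isoIsPullback_hom_fst _ _ h'
  have hq : e.hom ≫ q' = q := h.isoIsPullback_hom_snd _ _ h'
  refine setPullback_of_iso (((nilpFlat R).ι.mapIso e).app k) ?_ ?_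
    (fibreProd.setPullback (f.hom.app k) (g.hom.app k))
  · exact congrArg (fun t : P ⟶ A => t.hom.app k) hp
  · exact congrArg (fun t : P ⟶ C => t.hom.app k) hq

/-- The kernel `K` lies in `I_A`, whence `K · K ⊆ I_A · K = 0`. Indeed an element of `K` in level
`0` is a boundary `∂₀ a` with `∂₁ a = 0` if `r = 0`, and is zero if `r > 0`. -/
lemma sqZero_of_tinyAcyclic {A B : (nilpFlat R).FullSubcategory} {f : A ⟶ B}
    (hf : tinyAcyclic R f) (k : SimplexCategoryᵒᵖ) : DerivedDeligne.sqZero R (f.hom.app k) := by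
  obtain ⟨h1, h2, r, h3, h4⟩ := hf
  refine ⟨h1 k, fun x y hx hy => h2 k.unop x (Ideal.mem_comap.2 ?_) y hy⟩
  obtain ⟨z, hz⟩ : ∃ z, z = A.obj.map (SimplexCategory.const ⦋0⦌ k.unop 0).op x := ⟨_, rfl⟩
  have hz' : f.hom.app (op ⦋0⦌) z = 0 := by
    rw [hz, alg_app_map]
    exact (congrArg _ hx).trans (map_zero _)
  change A.obj.map (SimplexCategory.const ⦋0⦌ k.unop 0).op x ∈ _
  rw [← hz]
  obtain _ | r := r
  · obtain ⟨a, ⟨ha, -⟩, rfl⟩ := h4.surjOn (show z ∈ _ from ⟨trivial, hz'⟩)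
    refine Ideal.subset_span ⟨a, ?_⟩
    have h5 : A.obj.map (SimplexCategory.δ (1 : Fin 2)).op a = 0 := ha 0
    change A.obj.map _ a - A.obj.map _ a = _
    rw [h5, sub_zero]
  · rw [h3 0 (by omega) (by omega) z trivial hz']
    exact Ideal.zero_mem _

/-- A simplex of the kernel with trivial faces is a normalised cycle. In degree `r` the differential
hits it, in degree `r + 1` it vanishes by injectivity of the differential, and in the other degrees
there is nothing. -/
lemma acyclicKernel_of_tinyAcyclic {A B : (nilpFlat R).FullSubcategory} {f : A ⟶ B}
    (hf : tinyAcyclic R f) : AlgAcyclicKernel f.hom := by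
  obtain ⟨h1, h2, r, h3, h4⟩ := hf
  intro n x hx hx'
  have hface (m : ℕ) (x : A.obj.obj (op ⦋m + 1⦌))
      (hx' : ∀ {q : SimplexCategory} (α : q ⟶ ⦋m + 1⦌), ¬ Function.Surjective α.toOrderHom →
        A.obj.map α.op x = 0) (i : Fin (m + 2)) : A.obj.map (SimplexCategory.δ i).op x = 0 :=
    hx' _ fun h => by
      obtain ⟨y, hy⟩ := h i
      exact Fin.succAbove_ne i y hy
  have hnorm : IsNormalized A.obj x := by
    obtain _ | n := n
    · trivial
    · exact fun j => hface n x hx' j.succ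
  have hzero (h0 : x = 0) : ∃ y : A.obj.obj (op ⦋n + 1⦌), f.hom.app _ y = 0 ∧
      A.obj.map (SimplexCategory.δ 0).op y = x ∧
      ∀ i : Fin (n + 1), A.obj.map (SimplexCategory.δ i.succ).op y = 0 :=
    ⟨0, map_zero _, by rw [h0, map_zero], fun _ => map_zero _⟩
  by_cases hr : n = r
  · subst hr
    obtain ⟨y, ⟨hy, hy'⟩, rfl⟩ := h4.surjOn (show x ∈ _ from ⟨hnorm, hx⟩)
    exact ⟨y, hy', rfl, hy⟩
  · by_cases hr' : n = r + 1
    · subst hr'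
      refine hzero (h4.injOn ⟨hnorm, hx⟩ ⟨fun j => map_zero _, map_zero _⟩ ?_)
      rw [hface r x hx' 0, map_zero]
    · exact hzero (h3 n hr hr' x hnorm hx)

end SAlg

/-! ### Contraction of polynomial forms -/

namespace Forms

variable {R : Type u} [CommRing R] {n : SimplexCategory}

lemma word_induction {p : Forms R n → Prop} (ω : Forms R n)
    (word : ∀ l : List (Fin (n.len + 1) ⊕ Fin (n.len + 1)), p (l.map gen).prod)
    (add : ∀ ω η, p ω → p η → p (ω + η)) (smul : ∀ (r : R) ω, p ω → p (r • ω)) : p ω := by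
  classical
  have zero : p 0 := by
    rw [← zero_smul R (1 : Forms R n)]
    exact smul _ _ (word [])
  rw [← DirectSum.sum_support_decompose (gr R n) ω]
  refine Finset.sum_induction _ p add zero fun k _ => ?_
  refine Submodule.span_induction (p := fun ω _ => p ω) ?_ zero (fun _ _ _ _ => add _ _)
    (fun r _ _ => smul r _) (SetLike.coe_mem (DirectSum.decompose (gr R n) ω k))
  rintro _ ⟨l, -, rfl⟩
  exact word l

lemma dform_dform (ω : Forms R n) : dform R n (dform R n ω) = 0 := by
  induction ω using word_induction with
  | word l =>
    induction l with
    | nil => simp [dform]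
    | cons x l ih =>
      rw [List.map_cons, List.prod_cons]
      obtain i | i := x
      · rw [dform_mul (t_mem i), map_add, dform_gen_inl, dform_mul (dt_mem i), dform_gen_inr,
          pow_zero, one_smul, dform_mul (t_mem i), dform_gen_inl, ih]
        simp
      · rw [dform_mul (dt_mem i), dform_gen_inr, zero_mul, zero_add, pow_one, Units.neg_smul,
          one_smul, map_neg, dform_mul (dt_mem i), dform_gen_inr, ih]
        simp
  | add ω η h h' => rw [map_add, map_add, h, h', add_zero]
  | smul r ω h => rw [map_smul, map_smul, h, smul_zero]

variable (R n) in
/-- The coefficients of the Euler vector field centred at the vertex `0`. -/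
def euler (i : Fin (n.len + 1)) : Forms R n := gen (.inl i) - if i = 0 then 1 else 0

lemma euler_zero_mem (i : Fin (n.len + 1)) : euler R n i ∈ gr R n 0 := by
  refine sub_mem (t_mem i) ?_
  split_ifs
  · exact SetLike.one_mem_graded _
  · exact zero_mem _

lemma euler_t (i j : Fin (n.len + 1)) :
    euler R n i * gen (.inl j) = gen (.inl j) * euler R n i := by
  rw [euler, sub_mul, mul_sub, t_t]
  split_ifs <;> simp

lemma euler_dt (i j : Fin (n.len + 1)) :
    euler R n i * gen (.inr j) = gen (.inr j) * euler R n i := by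
  rw [euler, sub_mul, mul_sub, t_dt]
  split_ifs <;> simp

lemma sum_euler : ∑ i, euler R n i = 0 := by
  simp [euler, sum_t]

variable (R n) in
/-- The algebra homomorphism `ω ↦ [(-1)ᵏ ω, ι ω; 0, ω]` (for `ω` of degree `k`) which encodes the
contraction `ι` with the Euler vector field. -/
def contractJet : Forms R n →ₐ[R] Matrix (Fin 2) (Fin 2) (Forms R n) :=
  lift (R := R) (n := n)
    (Sum.elim (fun i => !![gen (.inl i), 0; 0, gen (.inl i)])
      fun i => !![-gen (.inr i), euler R n i; 0, gen (.inr i)])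
    (fun i j => by
      simp only [Sum.elim_inl, mul_upper, t_t (R := R) i j, mul_zero, zero_mul])
    (fun i j => by
      simp only [Sum.elim_inl, Sum.elim_inr, mul_upper, t_dt (R := R) i j, euler_t, mul_zero,
        zero_mul, add_zero, zero_add, mul_neg, neg_mul])
    (fun i j => by
      simp only [Sum.elim_inr, mul_upper, dt_dt (R := R) i j, euler_dt]
      ext a b
      fin_cases a <;> fin_cases b <;> simp [dt_dt (R := R) i j])
    (by
      have := sum_t (R := R) (n := n)
      ext a b
      fin_cases a <;> fin_cases b <;> simp [Matrix.sum_apply, this])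
    (by
      have h' := sum_dt (R := R) (n := n)
      ext a b
      fin_cases a <;> fin_cases b <;> simp [Matrix.sum_apply, h', sum_euler])

variable (R n) in
/-- The contraction of forms with the Euler vector field. -/
def contract : Forms R n →ₗ[R] Forms R n where
  toFun ω := contractJet R n ω 0 1
  map_add' := by simp
  map_smul' := by simp

lemma contractJet_word_one_one (l : List (Fin (n.len + 1) ⊕ Fin (n.len + 1))) :
    contractJet R n (l.map gen).prod 1 1 = (l.map gen).prod ∧
      contractJet R n (l.map gen).prod 1 0 = 0 := by
  induction l with
  | nil => simp
  | cons x l ih =>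
    obtain ⟨h₂, h₃⟩ := ih
    simp only [List.map_cons, List.prod_cons, map_mul, Matrix.mul_apply, Fin.sum_univ_two, h₂, h₃]
    obtain i | i := x <;> simp [contractJet]

lemma contractJet_one_one (ω : Forms R n) : contractJet R n ω 1 1 = ω := by
  induction ω using word_induction with
  | word l => exact (contractJet_word_one_one l).1
  | add ω η h h' => rw [map_add, Matrix.add_apply, h, h']
  | smul r ω h => rw [map_smul, Matrix.smul_apply, h]

lemma contract_t_mul (i : Fin (n.len + 1)) (ω : Forms R n) :
    contract R n (gen (.inl i) * ω) = gen (.inl i) * contract R n ω := by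
  change contractJet R n (gen (.inl i) * ω) 0 1 = gen (.inl i) * contractJet R n ω 0 1
  rw [map_mul, Matrix.mul_apply, Fin.sum_univ_two]
  simp [contractJet]

lemma contract_dt_mul (i : Fin (n.len + 1)) (ω : Forms R n) :
    contract R n (gen (.inr i) * ω) = euler R n i * ω - gen (.inr i) * contract R n ω := by
  change contractJet R n (gen (.inr i) * ω) 0 1 =
    euler R n i * ω - gen (.inr i) * contractJet R n ω 0 1
  rw [map_mul, Matrix.mul_apply, Fin.sum_univ_two, contractJet_one_one]
  simp only [contractJet, lift_gen]
  simp
  abel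

lemma contract_one : contract R n 1 = 0 := by
  simp [contract]

lemma contract_eq_zero {ω : Forms R n} (hω : ω ∈ gr R n 0) : contract R n ω = 0 := by
  refine Submodule.span_induction (p := fun ω _ => contract R n ω = 0) ?_ (map_zero _) ?_ ?_ hω
  · rintro _ ⟨l, hl, rfl⟩
    clear hω
    induction l with
    | nil => exact contract_one
    | cons x l ih =>
      obtain i | i := x
      · rw [List.map_cons, List.prod_cons, contract_t_mul, ih (by simpa [wordDeg] using hl),
          mul_zero]
      · simp [wordDeg] at hl
  · intro x y _ _ hx hy
    rw [map_add, hx, hy, add_zero]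
  · intro r x _ hx
    rw [map_smul, hx, smul_zero]

lemma contract_mem {k : ℕ} {ω : Forms R n} (hω : ω ∈ gr R n (k + 1)) :
    contract R n ω ∈ gr R n k := by
  refine Submodule.span_induction (p := fun ω _ => contract R n ω ∈ gr R n k) ?_ ?_ ?_ ?_ hω
  · rintro _ ⟨l, hl, rfl⟩
    clear hω
    induction l generalizing k with
    | nil => simp [wordDeg] at hl
    | cons x l ih =>
      rw [List.map_cons, List.prod_cons]
      obtain i | i := x
      · have hl' : wordDeg l = k + 1 := by simpa [wordDeg] using hl
        rw [contract_t_mul]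
        have := SetLike.mul_mem_graded (t_mem (R := R) i) (ih hl')
        rwa [zero_add] at this
      · have hl' : wordDeg l = k := by simpa [wordDeg, List.countP_cons] using hl
        rw [contract_dt_mul]
        refine sub_mem ?_ ?_
        · have := SetLike.mul_mem_graded (euler_zero_mem (R := R) i) (word_mem (R := R) l)
          rwa [zero_add, hl'] at this
        · obtain _ | k := k
          · rw [contract_eq_zero (hl' ▸ word_mem l), mul_zero]
            exact zero_mem _
          · have := SetLike.mul_mem_graded (dt_mem (R := R) i) (ih hl')
            rwa [add_comm] at this
  · simp
  · intro x y _ _ hx hy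
    rw [map_add]
    exact add_mem hx hy
  · intro r x _ hx
    rw [map_smul]
    exact Submodule.smul_mem _ r hx

variable (R n) in
/-- The Lie derivative along the Euler vector field. -/
def lie : Forms R n →ₗ[R] Forms R n :=
  dform R n ∘ₗ contract R n + contract R n ∘ₗ dform R n

lemma lie_apply (ω : Forms R n) :
    lie R n ω = dform R n (contract R n ω) + contract R n (dform R n ω) := rfl

lemma dform_lie (ω : Forms R n) : dform R n (lie R n ω) = lie R n (dform R n ω) := by
  rw [lie_apply, lie_apply, map_add, dform_dform, dform_dform, map_zero, zero_add, add_zero]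

lemma dform_euler (i : Fin (n.len + 1)) : dform R n (euler R n i) = gen (.inr i) := by
  have : dform R n 1 = 0 := by simp [dform]
  rw [euler, map_sub, dform_gen_inl]
  split_ifs <;> simp [this]

lemma lie_t_mul (i : Fin (n.len + 1)) (ω : Forms R n) :
    lie R n (gen (.inl i) * ω) = euler R n i * ω + gen (.inl i) * lie R n ω := by
  rw [lie_apply, contract_t_mul, dform_mul (t_mem i), dform_mul (t_mem i), dform_gen_inl, map_add,
    contract_dt_mul, pow_zero, one_smul, one_smul, contract_t_mul, lie_apply, mul_add]
  abel

lemma lie_dt_mul (i : Fin (n.len + 1)) (ω : Forms R n) :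
    lie R n (gen (.inr i) * ω) = gen (.inr i) * ω + gen (.inr i) * lie R n ω := by
  rw [lie_apply, contract_dt_mul, map_sub, dform_mul (euler_zero_mem i), dform_mul (dt_mem i),
    dform_mul (dt_mem i), dform_gen_inr, dform_euler, pow_zero, pow_one, one_smul, zero_mul,
    zero_mul, zero_add, zero_add, Units.neg_smul, one_smul, Units.neg_smul, one_smul, map_neg, contract_dt_mul, lie_apply, mul_add]
  abel

/-! #### Reduced words -/

/-- The generators `tᵢ` and `dtᵢ` for `i > 0`. -/
def redGen (x : Fin n.len ⊕ Fin n.len) : Forms R n := gen (x.map Fin.succ Fin.succ)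

/-- The field is centred at the vertex `0`, where the coordinates `tᵢ` with `i > 0` vanish, so each
letter `tᵢ` or `dtᵢ` has weight one for the Lie derivative. -/
lemma lie_redWord (l : List (Fin n.len ⊕ Fin n.len)) :
    lie R n (l.map redGen).prod = (l.length : R) • (l.map redGen).prod := by
  induction l with
  | nil =>
    have : dform R n 1 = 0 := by simp [dform]
    simp [lie_apply, contract_one, this]
  | cons x l ih =>
    rw [List.map_cons, List.prod_cons]
    obtain i | i := x
    · have : euler R n i.succ = gen (.inl i.succ) := by simp [euler, Fin.succ_ne_zero]
      simp only [redGen, Sum.map_inl]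
      rw [lie_t_mul, this]
      change _ + _ * lie R n (l.map redGen).prod = _
      rw [ih, mul_smul_comm, List.length_cons, Nat.cast_succ, add_smul, one_smul, add_comm]
    · simp only [redGen, Sum.map_inr]
      rw [lie_dt_mul]
      rw [ih, mul_smul_comm, List.length_cons, Nat.cast_succ, add_smul, one_smul, add_comm]

variable (R n) in
/-- The span of the words of degree `k` in the generators `tᵢ` and `dtᵢ` for `i > 0`. -/
def redGr (k : ℕ) : Submodule R (Forms R n) :=
  Submodule.span R {x | ∃ l : List (Fin n.len ⊕ Fin n.len),
    l.countP Sum.isRight = k ∧ (l.map redGen).prod = x}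

lemma redGen_inl_mul_mem (i : Fin n.len) {k : ℕ} {ω : Forms R n} (hω : ω ∈ redGr R n k) :
    redGen (.inl i) * ω ∈ redGr R n k := by
  refine Submodule.span_induction (p := fun ω _ => redGen (.inl i) * ω ∈ redGr R n k)
    ?_ (by simp) (fun x y _ _ h h' => by rw [mul_add]; exact add_mem h h')
    (fun r x _ h => by rw [mul_smul_comm]; exact Submodule.smul_mem _ r h) hω
  rintro _ ⟨l, hl, rfl⟩
  exact Submodule.subset_span ⟨.inl i :: l, by simpa using hl, by simp⟩

lemma redGen_inr_mul_mem (i : Fin n.len) {k : ℕ} {ω : Forms R n} (hω : ω ∈ redGr R n k) :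
    redGen (.inr i) * ω ∈ redGr R n (k + 1) := by
  refine Submodule.span_induction (p := fun ω _ => redGen (.inr i) * ω ∈ redGr R n (k + 1))
    ?_ (by simp) (fun x y _ _ h h' => by rw [mul_add]; exact add_mem h h')
    (fun r x _ h => by rw [mul_smul_comm]; exact Submodule.smul_mem _ r h) hω
  rintro _ ⟨l, hl, rfl⟩
  exact Submodule.subset_span ⟨.inr i :: l, by simpa [List.countP_cons] using hl, by simp⟩

/-- The relations `∑ tᵢ = 1` and `∑ dtᵢ = 0` eliminate `t₀` and `dt₀` without changing the form
degree. -/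
lemma gr_le_redGr (k : ℕ) : gr R n k ≤ redGr R n k := by
  rw [gr, Submodule.span_le]
  rintro _ ⟨l, rfl, rfl⟩
  induction l with
  | nil => exact Submodule.subset_span ⟨[], rfl, rfl⟩
  | cons x l ih =>
    rw [List.map_cons, List.prod_cons]
    obtain i | i := x
    · have e : wordDeg (Sum.inl i :: l) = wordDeg l := by simp [wordDeg]
      rw [e]
      refine Fin.cases ?_ (fun i => redGen_inl_mul_mem i ih) i
      have h := sum_t (R := R) (n := n)
      rw [Fin.sum_univ_succ] at h
      rw [eq_sub_of_add_eq h, sub_mul, one_mul, Finset.sum_mul]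
      exact sub_mem ih (sum_mem fun i _ => redGen_inl_mul_mem i ih)
    · have e : wordDeg (Sum.inr i :: l) = wordDeg l + 1 := by simp [wordDeg, List.countP_cons]
      rw [e]
      refine Fin.cases ?_ (fun i => redGen_inr_mul_mem i ih) i
      have h := sum_dt (R := R) (n := n)
      rw [Fin.sum_univ_succ] at h
      rw [eq_neg_of_add_eq_zero_left h, neg_mul, Finset.sum_mul]
      exact neg_mem (sum_mem fun i _ => redGen_inr_mul_mem i ih)

lemma redGr_le_gr (k : ℕ) : redGr R n k ≤ gr R n k := by
  rw [redGr, Submodule.span_le]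
  rintro _ ⟨l, rfl, rfl⟩
  have := word_mem (R := R) (l.map (Sum.map Fin.succ (Fin.succ (n := n.len))))
  have e : wordDeg (l.map (Sum.map Fin.succ (Fin.succ (n := n.len)))) = l.countP Sum.isRight := by
    simp only [wordDeg, List.countP_map]
    congr 1
    funext x
    obtain i | i := x <;> rfl
  rw [List.map_map, e] at this
  exact this

/-- A partial inverse of the Lie derivative. -/
lemma exists_lie_inverse [Algebra ℚ R] (N : ℕ) : ∃ h : Forms R n →ₗ[R] Forms R n,
    (∀ ω, dform R n (h ω) = h (dform R n ω)) ∧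
    (∀ k, ∀ ω ∈ gr R n k, h ω ∈ gr R n k) ∧
    ∀ l : List (Fin n.len ⊕ Fin n.len), 1 ≤ l.length → l.length ≤ N →
      lie R n (h (l.map redGen).prod) = (l.map redGen).prod := by
  -- The operator is built as a polynomial in `lie`. It then commutes with `d` and acts on a reduced
  -- word by a scalar depending on its length, with no need for the reduced words to be independent.
  suffices ∃ (h : Forms R n →ₗ[R] Forms R n) (c : ℕ → R),
      (∀ ω, dform R n (h ω) = h (dform R n ω)) ∧
      (∀ l : List (Fin n.len ⊕ Fin n.len), h (l.map redGen).prod =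
        c l.length • (l.map redGen).prod) ∧ ∀ m, 1 ≤ m → m ≤ N → m * c m = 1 by
    obtain ⟨h, c, h1, h2, h3⟩ := this
    refine ⟨h, h1, fun k ω hω => ?_, fun l hl hl' => ?_⟩
    · refine Submodule.span_induction (p := fun ω _ => h ω ∈ gr R n k)
        ?_ (by simp) (fun x y _ _ h h' => by rw [map_add]; exact add_mem h h')
        (fun r x _ h => by rw [map_smul]; exact Submodule.smul_mem _ r h) (gr_le_redGr k hω)
      rintro _ ⟨l, hl, rfl⟩
      rw [h2]
      exact Submodule.smul_mem _ _ (redGr_le_gr k (Submodule.subset_span ⟨l, hl, rfl⟩))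
    · rw [h2, map_smul, lie_redWord, smul_smul, mul_comm, h3 _ hl hl', one_smul]
  induction N with
  | zero => exact ⟨0, fun _ => 0, by simp, by simp, fun m h h' => by omega⟩
  | succ N ih =>
    obtain ⟨h, c, h1, h2, h3⟩ := ih
    let r : R := algebraMap ℚ R ((N + 1 : ℚ)⁻¹)
    have hr : ((N + 1 : ℕ) : R) * r = 1 := by
      have : ((N + 1 : ℕ) : R) = algebraMap ℚ R (N + 1 : ℚ) := by simp
      rw [this, ← map_mul, mul_inv_cancel₀ (by positivity), map_one]
    -- Adding `r (1 - lie ∘ h)` with `r = 1/(N + 1)` makes the scalar right in length `N + 1`; on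
    -- lengths where `h` already inverts `lie` the added term is zero.
    refine ⟨h + r • (LinearMap.id - lie R n ∘ₗ h), fun m => c m + r * (1 - m * c m),
      fun ω => ?_, fun l => ?_, fun m hm hm' => ?_⟩
    · simp only [LinearMap.add_apply, LinearMap.smul_apply, LinearMap.sub_apply, LinearMap.id_apply,
        LinearMap.comp_apply, map_add, map_smul, map_sub, h1, dform_lie]
    · simp only [LinearMap.add_apply, LinearMap.smul_apply, LinearMap.sub_apply, LinearMap.id_apply,
        LinearMap.comp_apply, map_smul, h2, lie_redWord]
      module
    · obtain rfl | hm'' := Nat.eq_or_lt_of_le hm'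
      · linear_combination (1 - ((N + 1 : ℕ) : R) * c (N + 1)) * hr
      · linear_combination (1 - (m : R) * r) * h3 m hm (by omega)

/-! #### Freeness -/

/-- The forms with coefficients in `R` are obtained from those with coefficients in `ℚ` by base
change, hence are free over `R`. -/
instance free [Algebra ℚ R] : Module.Free R (Forms R n) := by
  let _ : Algebra ℚ (Forms R n) := Algebra.compHom _ (algebraMap ℚ R)
  have : IsScalarTower ℚ R (Forms R n) := IsScalarTower.of_algebraMap_eq fun _ => rfl
  let φ : Forms ℚ n →ₐ[ℚ] Forms R n := lift gen t_t t_dt dt_dt sum_t sum_dt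
  let Φ : TensorProduct ℚ R (Forms ℚ n) →ₐ[R] Forms R n :=
    Algebra.TensorProduct.lift (Algebra.ofId R _) φ fun r ω => Algebra.commutes r (φ ω)
  let ι : Forms ℚ n →ₐ[ℚ] TensorProduct ℚ R (Forms ℚ n) := Algebra.TensorProduct.includeRight
  let Ψ : Forms R n →ₐ[R] TensorProduct ℚ R (Forms ℚ n) :=
    lift (fun x => ι (gen x))
      (fun i j => by rw [← map_mul, ← map_mul, t_t])
      (fun i j => by rw [← map_mul, ← map_mul, t_dt])
      (fun i j => by rw [← map_mul, ← map_mul, dt_dt, map_neg])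
      (by rw [← map_sum, sum_t, map_one])
      (by rw [← map_sum, sum_dt, map_zero])
  have hΦ (x) : Φ (ι (gen x)) = gen x := by
    refine (Algebra.TensorProduct.lift_tmul _ _ _ _ _).trans ?_
    rw [map_one, one_mul]
    exact lift_gen _ _ _ _ _ _ _
  have hΨ (x) : Ψ (gen x) = ι (gen x) := lift_gen _ _ _ _ _ _ _
  have h1 : Φ.comp Ψ = AlgHom.id R _ := algHom_ext fun x => (congrArg Φ (hΨ x)).trans (hΦ x)
  have h2 : Ψ.comp Φ = AlgHom.id R _ := by
    apply Algebra.TensorProduct.ext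
    · ext
    · refine algHom_ext fun x => ?_
      exact (congrArg Ψ (hΦ x)).trans (hΨ x)
  exact Module.Free.of_equiv (AlgEquiv.ofAlgHom Φ Ψ h1 h2).toLinearEquiv

end Forms

/-! ### Forms with coefficients in a module -/

section FormsWithCoefficients

open TensorProduct

variable {R : Type u} [CommRing R] {n m : SimplexCategory}
  {M : Type*} [AddCommGroup M] [Module R M] {N : Type*} [AddCommGroup N] [Module R N]

/-- The total differential on `M ⊗ Ωₙ`, for a differential `d` and a sign involution `s` on `M`. -/
def formD (d s : M →ₗ[R] M) (n : SimplexCategory) : M ⊗[R] Forms R n →ₗ[R] M ⊗[R] Forms R n :=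
  TensorProduct.map d LinearMap.id + TensorProduct.map s (Forms.dform R n)

lemma formD_tmul (d s : M →ₗ[R] M) (x : M) (ω : Forms R n) :
    formD d s n (x ⊗ₜ ω) = d x ⊗ₜ ω + s x ⊗ₜ Forms.dform R n ω := rfl

/-- Functoriality of forms with coefficients. -/
def formMap (g : M →ₗ[R] N) (θ : m ⟶ n) : M ⊗[R] Forms R n →ₗ[R] N ⊗[R] Forms R m :=
  TensorProduct.map g (Forms.pull θ).toLinearMap

lemma formMap_tmul (g : M →ₗ[R] N) (θ : m ⟶ n) (x : M) (ω : Forms R n) :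
    formMap g θ (x ⊗ₜ ω) = g x ⊗ₜ Forms.pull θ ω := rfl

lemma formMap_formMap {P : Type*} [AddCommGroup P] [Module R P] {l : SimplexCategory}
    (g : M →ₗ[R] N) (g' : N →ₗ[R] P) (θ : m ⟶ n) (η : l ⟶ m) (x : M ⊗[R] Forms R n) :
    formMap g' η (formMap g θ x) = formMap (g' ∘ₗ g) (η ≫ θ) x := by
  induction x using TensorProduct.induction_on with
  | zero => simp
  | tmul x ω => simp only [formMap_tmul, Forms.pull_comp]; rfl
  | add x y h h' => simp only [map_add, h, h']

lemma formMap_id_eq (g : M →ₗ[R] N) (x : M ⊗[R] Forms R n) :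
    formMap g (𝟙 n) x = LinearMap.rTensor (Forms R n) g x := by
  rw [formMap, Forms.pull_id]
  rfl

lemma formMap_id_id (x : M ⊗[R] Forms R n) : formMap LinearMap.id (𝟙 n) x = x := by
  rw [formMap_id_eq, LinearMap.rTensor_id]
  rfl

lemma formMap_zero (θ : m ⟶ n) (x : M ⊗[R] Forms R n) : formMap (0 : M →ₗ[R] N) θ x = 0 := by
  rw [formMap, TensorProduct.map_zero_left]
  rfl

lemma formMap_formD {d s : M →ₗ[R] M} {d' s' : N →ₗ[R] N} {g : M →ₗ[R] N}
    (hd : ∀ x, g (d x) = d' (g x)) (hs : ∀ x, g (s x) = s' (g x)) (θ : m ⟶ n)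
    (x : M ⊗[R] Forms R n) : formMap g θ (formD d s n x) = formD d' s' m (formMap g θ x) := by
  induction x using TensorProduct.induction_on with
  | zero => simp
  | tmul x ω =>
    rw [formD_tmul, map_add, formMap_tmul, formMap_tmul, formMap_tmul, formD_tmul, hd, hs,
      Forms.pull_dform]
  | add x y h h' => simp only [map_add, h, h']

lemma formD_formD {d s : M →ₗ[R] M} (hd : ∀ x, d (d x) = 0) (hds : ∀ x, d (s x) = -s (d x))
    (x : M ⊗[R] Forms R n) : formD d s n (formD d s n x) = 0 := by
  induction x using TensorProduct.induction_on with
  | zero => simp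
  | tmul x ω =>
    rw [formD_tmul, map_add, formD_tmul, formD_tmul, hd, hds, Forms.dform_dform, zero_tmul,
      tmul_zero, neg_tmul]
    abel
  | add x y h h' => simp only [map_add, h, h', add_zero]

/-- Cartan's formula for forms with coefficients: `s` carries the Koszul sign. Since `d`
anticommutes with `s`, the terms with the differential of `M` cancel, and `s² = 1` leaves the Lie
derivative in the form variable, composed with `h`. -/
lemma formD_homotopy {d s : M →ₗ[R] M} (hs : ∀ x, s (s x) = x) (hds : ∀ x, d (s x) = -s (d x))
    {h : Forms R n →ₗ[R] Forms R n} (hh : ∀ ω, Forms.dform R n (h ω) = h (Forms.dform R n ω))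
    (x : M ⊗[R] Forms R n) :
    formD d s n (TensorProduct.map s (Forms.contract R n ∘ₗ h) x) +
      TensorProduct.map s (Forms.contract R n ∘ₗ h) (formD d s n x) =
    LinearMap.lTensor M (Forms.lie R n ∘ₗ h) x := by
  induction x using TensorProduct.induction_on with
  | zero => simp
  | tmul x ω =>
    rw [formD_tmul, map_add, TensorProduct.map_tmul, TensorProduct.map_tmul, TensorProduct.map_tmul,
      formD_tmul, hds, hs, neg_tmul, LinearMap.lTensor_tmul]
    simp only [LinearMap.comp_apply, Forms.lie_apply, tmul_add, hh]
    abel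
  | add x y h h' =>
    simp only [map_add, ← h, ← h']
    abel

/-- The sum of the components of bidegree `(i, i)`, for `i < N`. -/
def formTrunc (p : ℕ → M →ₗ[R] M) (n : SimplexCategory) (N : ℕ) :
    M ⊗[R] Forms R n →ₗ[R] M ⊗[R] Forms R n :=
  ∑ i ∈ Finset.range N, TensorProduct.map (p i) (GradedAlgebra.proj (Forms.gr R n) i)

lemma formMap_formTrunc {p : ℕ → M →ₗ[R] M} {q : ℕ → N →ₗ[R] N} {g : M →ₗ[R] N}
    (hg : ∀ i x, g (p i x) = q i (g x)) (k : ℕ) (x : M ⊗[R] Forms R n) :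
    formMap g (𝟙 n) (formTrunc p n k x) = formTrunc q n k (formMap g (𝟙 n) x) := by
  simp only [formTrunc, LinearMap.sum_apply, map_sum]
  refine Finset.sum_congr rfl fun i _ => ?_
  induction x using TensorProduct.induction_on with
  | zero => simp
  | tmul x ω =>
    simp only [TensorProduct.map_tmul, formMap_tmul, hg, Forms.pull_id]
    rfl
  | add x y h h' => simp only [map_add, h, h']

/-- Forms over a `ℚ`-algebra are free, hence flat. -/
lemma formMap_injective [Algebra ℚ R] {g : M →ₗ[R] N} (hg : Function.Injective g) :
    Function.Injective (formMap g (𝟙 n)) := by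
  have : ⇑(formMap g (𝟙 n)) = LinearMap.rTensor (Forms R n) g := funext (formMap_id_eq g)
  rw [this]
  exact Module.Flat.rTensor_preserves_injective_linearMap g hg

end FormsWithCoefficients

namespace CDGA

open TensorProduct GradedTensorProduct

variable {R : Type u} [CommRing R] {A B C : CDGA R} {n m : SimplexCategory}

section Signs

lemma map_proj (f : A ⟶ B) (i : ℕ) (a : A.carrier) :
    f.hom (GradedAlgebra.proj A.gr i a) = GradedAlgebra.proj B.gr i (f.hom a) := by
  simp only [GradedAlgebra.proj_apply]
  induction a using DirectSum.Decomposition.inductionOn A.gr with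
  | zero => simp
  | @homogeneous j a =>
    by_cases h : j = i
    · subst h
      rw [DirectSum.decompose_of_mem_same _ a.2, DirectSum.decompose_of_mem_same _ (f.map_mem a.2)]
    · rw [DirectSum.decompose_of_mem_ne _ a.2 h, DirectSum.decompose_of_mem_ne _ (f.map_mem a.2) h,
        map_zero]
  | add a b h h' => simp only [map_add, DirectSum.decompose_add, DirectSum.add_apply,
      Submodule.coe_add, h, h']

lemma map_sgn (f : A ⟶ B) (a : A.carrier) : f.hom (A.sgn a) = B.sgn (f.hom a) := by
  induction a using DirectSum.Decomposition.inductionOn A.gr with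
  | zero => simp
  | homogeneous a => rw [A.sgn_of_mem a.2, B.sgn_of_mem (f.map_mem a.2), map_sign]
  | add a b h h' => simp only [map_add, h, h']

lemma sgn_sgn (a : A.carrier) : A.sgn (A.sgn a) = a := by
  induction a using DirectSum.Decomposition.inductionOn A.gr with
  | zero => simp
  | homogeneous a =>
    rw [A.sgn_of_mem a.2, map_sign, A.sgn_of_mem a.2, smul_smul, Int.units_mul_self, one_smul]
  | add a b h h' => simp only [map_add, h, h']

lemma d_sgn (a : A.carrier) : A.d (A.sgn a) = -A.sgn (A.d a) := by
  induction a using DirectSum.Decomposition.inductionOn A.gr with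
  | zero => simp
  | @homogeneous i a =>
    rw [A.sgn_of_mem a.2, map_sign]
    obtain _ | i := i
    · simp [A.d_zero a.2]
    · rw [A.sgn_of_mem (A.d_mem a.2), pow_succ, mul_neg, mul_one, Units.neg_smul]
  | add a b h h' =>
    simp only [map_add, h, h']
    abel

end Signs

/-- The span of the elements of bidegree `(i, i + k)` in `A ⊗ Ωₙ`. -/
def diagonal (A : CDGA R) (n : SimplexCategory) (k : ℕ) : Submodule R (A.carrier ⊗[R] Forms R n) :=
  Submodule.span R {x | ∃ i, ∃ a ∈ A.gr i, ∃ ω ∈ Forms.gr R n (i + k), a ⊗ₜ[R] ω = x}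

lemma of_mem_pathZero_iff {x : A.carrier ⊗[R] Forms R n} :
    of R A.gr (Forms.gr R n) x ∈ A.pathZero n ↔ x ∈ A.diagonal n 0 ∧ formD A.d A.sgn n x = 0 :=
  Iff.rfl

lemma tensorMap_of (f : A ⟶ B) (θ : m ⟶ n) (x : A.carrier ⊗[R] Forms R n) :
    tensorMap f θ (of R A.gr (Forms.gr R n) x) =
      of R B.gr (Forms.gr R m) (formMap f.hom.toLinearMap θ x) := by
  induction x using TensorProduct.induction_on with
  | zero => simp
  | tmul x ω => exact tensorMap_tmul f θ x ω
  | add x y h h' => simp only [map_add, h, h']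

lemma tmul_mem_diagonal {i j k : ℕ} {a : A.carrier} (ha : a ∈ A.gr i) {ω : Forms R n}
    (hω : ω ∈ Forms.gr R n j) (hij : i + k = j) : a ⊗ₜ[R] ω ∈ A.diagonal n k :=
  Submodule.subset_span ⟨i, a, ha, ω, hij ▸ hω, rfl⟩

lemma sgn_mem {i : ℕ} {a : A.carrier} (ha : a ∈ A.gr i) : A.sgn a ∈ A.gr i := by
  rw [A.sgn_of_mem ha]
  obtain h | h := Int.units_eq_one_or ((-1 : ℤˣ) ^ i)
  · rwa [h, one_smul]
  · rw [h, Units.neg_smul, one_smul]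
    exact neg_mem ha

lemma proj_mem (i : ℕ) (a : A.carrier) : GradedAlgebra.proj A.gr i a ∈ A.gr i := by
  rw [GradedAlgebra.proj_apply]
  exact SetLike.coe_mem _

lemma formTrunc_mem (N : ℕ) (x : A.carrier ⊗[R] Forms R n) :
    formTrunc (GradedAlgebra.proj A.gr) n N x ∈ A.diagonal n 0 := by
  rw [formTrunc, LinearMap.sum_apply]
  refine sum_mem fun i _ => ?_
  induction x using TensorProduct.induction_on with
  | zero => simp
  | tmul x ω =>
    refine tmul_mem_diagonal (proj_mem i x) (j := i) ?_ rfl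
    rw [GradedAlgebra.proj_apply]
    exact SetLike.coe_mem _
  | add x y h h' =>
    rw [map_add]
    exact add_mem h h'

/-- Membership in the diagonal is a span condition, which injections do not obviously reflect.
Rewritten as the fixed point equation of a natural operator, it can be tested after an injective
map. -/
lemma exists_formTrunc_eq {x : A.carrier ⊗[R] Forms R n} (hx : x ∈ A.diagonal n 0) :
    ∃ N, ∀ k, N ≤ k → formTrunc (GradedAlgebra.proj A.gr) n k x = x := by
  refine Submodule.span_induction (p := fun x _ => ∃ N, ∀ k, N ≤ k →
    formTrunc (GradedAlgebra.proj A.gr) n k x = x) ?_ ⟨0, by simp⟩ ?_ ?_ hx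
  · rintro _ ⟨i, a, ha, ω, hω, rfl⟩
    have hω' : ω ∈ Forms.gr R n i := hω
    refine ⟨i + 1, fun k hk => ?_⟩
    rw [formTrunc, LinearMap.sum_apply, Finset.sum_eq_single i]
    · rw [TensorProduct.map_tmul, GradedAlgebra.proj_apply, GradedAlgebra.proj_apply,
        DirectSum.decompose_of_mem_same _ ha, DirectSum.decompose_of_mem_same (Forms.gr R n) hω']
    · intro j _ hj
      rw [TensorProduct.map_tmul, GradedAlgebra.proj_apply,
        DirectSum.decompose_of_mem_ne _ ha hj.symm, zero_tmul]
    · intro h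
      exact absurd (Finset.mem_range.2 hk) h
  · rintro x y _ _ ⟨N, h⟩ ⟨N', h'⟩
    exact ⟨max N N', fun k hk => by
      rw [map_add, h k (le_of_max_le_left hk), h' k (le_of_max_le_right hk)]⟩
  · rintro r x _ ⟨N, h⟩
    exact ⟨N, fun k hk => by rw [map_smul, h k hk]⟩

lemma formD_mem_diagonal {x : A.carrier ⊗[R] Forms R n} (hx : x ∈ A.diagonal n 0) :
    formD A.d A.sgn n x ∈ A.diagonal n 1 := by
  refine Submodule.span_induction (p := fun x _ => formD A.d A.sgn n x ∈ A.diagonal n 1)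
    ?_ (by simp) (fun x y _ _ h h' => by rw [map_add]; exact add_mem h h')
    (fun r x _ h => by rw [map_smul]; exact Submodule.smul_mem _ r h) hx
  rintro _ ⟨i, a, ha, ω, hω, rfl⟩
  rw [formD_tmul]
  refine add_mem ?_ (tmul_mem_diagonal (sgn_mem ha) (Forms.dform_mem hω) rfl)
  obtain _ | i := i
  · rw [A.d_zero ha, zero_tmul]
    exact zero_mem _
  · exact tmul_mem_diagonal (A.d_mem ha) hω rfl

/-! #### Surjectivity -/

lemma map_contract_mem_diagonal {h : Forms R n →ₗ[R] Forms R n}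
    (hh : ∀ k, ∀ ω ∈ Forms.gr R n k, h ω ∈ Forms.gr R n k) {x : A.carrier ⊗[R] Forms R n}
    (hx : x ∈ A.diagonal n 1) :
    TensorProduct.map A.sgn (Forms.contract R n ∘ₗ h) x ∈ A.diagonal n 0 := by
  refine Submodule.span_induction (p := fun x _ =>
    TensorProduct.map A.sgn (Forms.contract R n ∘ₗ h) x ∈ A.diagonal n 0)
    ?_ (by simp) (fun x y _ _ h h' => by rw [map_add]; exact add_mem h h')
    (fun r x _ h => by rw [map_smul]; exact Submodule.smul_mem _ r h) hx
  rintro _ ⟨i, a, ha, ω, hω, rfl⟩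
  exact tmul_mem_diagonal (sgn_mem ha) (Forms.contract_mem (hh _ _ hω)) rfl

/-- Elements of bidegree `(i, i + 1)` have positive form degree, so `x` involves finitely many
reduced words, all nonempty; `N` bounds their lengths. -/
lemma exists_lTensor_eq_self {x : A.carrier ⊗[R] Forms R n} (hx : x ∈ A.diagonal n 1) :
    ∃ N : ℕ, ∀ e : Forms R n →ₗ[R] Forms R n, (∀ l : List (Fin n.len ⊕ Fin n.len), 1 ≤ l.length →
      l.length ≤ N → e (l.map Forms.redGen).prod = (l.map Forms.redGen).prod) →
      LinearMap.lTensor A.carrier e x = x := by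
  refine Submodule.span_induction (p := fun x _ => ∃ N : ℕ, ∀ e : Forms R n →ₗ[R] Forms R n,
    (∀ l : List (Fin n.len ⊕ Fin n.len), 1 ≤ l.length → l.length ≤ N →
      e (l.map Forms.redGen).prod = (l.map Forms.redGen).prod) →
      LinearMap.lTensor A.carrier e x = x) ?_ ⟨0, by simp⟩ ?_ ?_ hx
  · rintro _ ⟨i, a, -, ω, hω, rfl⟩
    suffices ∃ N : ℕ, ∀ e : Forms R n →ₗ[R] Forms R n,
        (∀ l : List (Fin n.len ⊕ Fin n.len), 1 ≤ l.length → l.length ≤ N →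
          e (l.map Forms.redGen).prod = (l.map Forms.redGen).prod) → e ω = ω by
      obtain ⟨N, h⟩ := this
      exact ⟨N, fun e he => by rw [LinearMap.lTensor_tmul, h e he]⟩
    refine Submodule.span_induction (p := fun ω _ => ∃ N : ℕ, ∀ e : Forms R n →ₗ[R] Forms R n,
      (∀ l : List (Fin n.len ⊕ Fin n.len), 1 ≤ l.length → l.length ≤ N →
        e (l.map Forms.redGen).prod = (l.map Forms.redGen).prod) → e ω = ω)
      ?_ ⟨0, by simp⟩ ?_ ?_ (Forms.gr_le_redGr _ hω)
    · rintro _ ⟨l, hl, rfl⟩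
      have : l.countP Sum.isRight ≤ l.length := List.countP_le_length
      exact ⟨l.length, fun e he => he l (by omega) le_rfl⟩
    · rintro x y _ _ ⟨N, h⟩ ⟨N', h'⟩
      exact ⟨max N N', fun e he => by
        rw [map_add, h e fun l hl hl' => he l hl (hl'.trans (le_max_left _ _)),
          h' e fun l hl hl' => he l hl (hl'.trans (le_max_right _ _))]⟩
    · rintro r x _ ⟨N, h⟩
      exact ⟨N, fun e he => by rw [map_smul, h e he]⟩
  · rintro x y _ _ ⟨N, h⟩ ⟨N', h'⟩
    exact ⟨max N N', fun e he => by
      rw [map_add, h e fun l hl hl' => he l hl (hl'.trans (le_max_left _ _)),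
        h' e fun l hl hl' => he l hl (hl'.trans (le_max_right _ _))]⟩
  · rintro r x _ ⟨N, h⟩
    exact ⟨N, fun e he => by rw [map_smul, h e he]⟩

lemma exists_mem_diagonal_map_eq {f : A ⟶ B} (hf : Function.Surjective f.hom)
    {y : B.carrier ⊗[R] Forms R n} (hy : y ∈ B.diagonal n 0) :
    ∃ x ∈ A.diagonal n 0, formMap f.hom.toLinearMap (𝟙 n) x = y := by
  refine Submodule.span_induction (p := fun y _ => ∃ x ∈ A.diagonal n 0,
    formMap f.hom.toLinearMap (𝟙 n) x = y) ?_ ⟨0, zero_mem _, map_zero _⟩ ?_ ?_ hy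
  · rintro _ ⟨i, b, hb, ω, hω, rfl⟩
    obtain ⟨a, rfl⟩ := hf b
    refine ⟨_, tmul_mem_diagonal (proj_mem i a) hω rfl, ?_⟩
    rw [formMap_tmul, Forms.pull_id]
    change f.hom (GradedAlgebra.proj A.gr i a) ⊗ₜ[R] ω = _
    rw [map_proj, GradedAlgebra.proj_apply, DirectSum.decompose_of_mem_same _ hb]
  · rintro _ _ _ _ ⟨x, hx, rfl⟩ ⟨y, hy, rfl⟩
    exact ⟨x + y, add_mem hx hy, map_add _ _ _⟩
  · rintro r _ _ ⟨x, hx, rfl⟩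
    exact ⟨r • x, Submodule.smul_mem _ r hx, map_smul _ _ _⟩

/-- Lift a cycle `y` to some diagonal `x`, perhaps not closed. With `κ = s ⊗ ι h`, Cartan's formula
and `D² = 0` give `D κ D x = D x`, since `D x` has positive form degree; so `x - κ D x` is closed.
As `κ` is natural, `κ D x` maps to `κ D y = 0`, and the corrected element still lifts `y`. -/
lemma pathMap_surjective [Algebra ℚ R] {f : A ⟶ B} (hf : Function.Surjective f.hom) :
    Function.Surjective (pathMap f (𝟙 n)) := by
  rintro ⟨y, hy⟩
  obtain ⟨y, rfl⟩ := (of R B.gr (Forms.gr R n)).surjective y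
  obtain ⟨hy, hy'⟩ := of_mem_pathZero_iff.1 hy
  obtain ⟨x, hx, rfl⟩ := exists_mem_diagonal_map_eq hf hy
  have hc := formD_mem_diagonal hx
  obtain ⟨N, hN⟩ := exists_lTensor_eq_self hc
  obtain ⟨h, h1, h2, h3⟩ := Forms.exists_lie_inverse (R := R) (n := n) N
  have h4 := formD_homotopy (sgn_sgn (A := A)) d_sgn h1 (formD A.d A.sgn n x)
  rw [formD_formD A.d_d d_sgn, map_zero, add_zero, hN _ h3] at h4
  refine ⟨⟨of R A.gr (Forms.gr R n) (x - TensorProduct.map A.sgn (Forms.contract R n ∘ₗ h)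
    (formD A.d A.sgn n x)), of_mem_pathZero_iff.2
      ⟨sub_mem hx (map_contract_mem_diagonal h2 hc), ?_⟩⟩, Subtype.ext ?_⟩
  · rw [map_sub, h4, sub_self]
  · refine (tensorMap_of f (𝟙 n) (x - TensorProduct.map A.sgn (Forms.contract R n ∘ₗ h)
      (formD A.d A.sgn n x))).trans (congrArg _ ?_)
    have h5 (z : A.carrier ⊗[R] Forms R n) :
        formMap f.hom.toLinearMap (𝟙 n) (TensorProduct.map A.sgn (Forms.contract R n ∘ₗ h) z) =
        TensorProduct.map B.sgn (Forms.contract R n ∘ₗ h)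
          (formMap f.hom.toLinearMap (𝟙 n) z) := by
      induction z using TensorProduct.induction_on with
      | zero => simp
      | tmul z ω =>
        simp only [TensorProduct.map_tmul, formMap_tmul, Forms.pull_id]
        exact congrArg₂ _ (map_sgn f z) rfl
      | add x y h h' => simp only [map_add, h, h']
    rw [map_sub, h5, formMap_formD (d' := B.d) (s' := B.sgn) f.map_d (map_sgn f), hy', map_zero,
      sub_zero]

/-! #### Kernels -/

lemma exists_of_formMap_eq_zero {M N : Type*} [AddCommGroup M] [Module R M] [AddCommGroup N]
    [Module R N] {g : M →ₗ[R] N} (hg : Function.Surjective g) {x : M ⊗[R] Forms R n}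
    (hx : formMap g (𝟙 n) x = 0) :
    ∃ z : LinearMap.ker g ⊗[R] Forms R n, formMap (LinearMap.ker g).subtype (𝟙 n) z = x := by
  rw [formMap_id_eq] at hx
  obtain ⟨z, hz⟩ := (rTensor_exact (Forms R n) (LinearMap.exact_subtype_ker_map g) hg x).1 hx
  exact ⟨z, by rw [formMap_id_eq, hz]⟩

/-- By right exactness the kernel of the map on tensors is the image of `K ⊗ Ω`. As `K` is graded,
it is spanned by tensors `a ⊗ ω` with homogeneous `a ∈ K`, whose products contain a product of two
elements of `K`. -/
lemma mul_eq_zero_of_tensorMap_eq_zero {f : A ⟶ B} (hf : Function.Surjective f.hom)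
    (hK : ∀ x y, f.hom x = 0 → f.hom y = 0 → x * y = 0) {x y : A.TensorForms n}
    (hx : tensorMap f (𝟙 n) x = 0) (hy : tensorMap f (𝟙 n) y = 0) : x * y = 0 := by
  classical
  let S : Set (A.TensorForms n) := {x | ∃ i, ∃ a ∈ A.gr i, f.hom a = 0 ∧
    ∃ j, ∃ ω ∈ Forms.gr R n j, a ᵍ⊗ₜ[R] ω = x}
  have key (x : A.TensorForms n) (hx : tensorMap f (𝟙 n) x = 0) : x ∈ Submodule.span R S := by
    obtain ⟨x, rfl⟩ := (of R A.gr (Forms.gr R n)).surjective x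
    rw [tensorMap_of, LinearEquiv.map_eq_zero_iff] at hx
    obtain ⟨z, rfl⟩ := exists_of_formMap_eq_zero (g := f.hom.toLinearMap) hf hx
    clear hx
    induction z using TensorProduct.induction_on with
    | zero => simp
    | tmul k ω =>
      obtain ⟨k, hk⟩ := k
      rw [formMap_tmul, Forms.pull_id]
      change of R A.gr (Forms.gr R n) (k ⊗ₜ[R] ω) ∈ _
      rw [← DirectSum.sum_support_decompose A.gr k, sum_tmul, map_sum]
      refine sum_mem fun i _ => ?_
      rw [← DirectSum.sum_support_decompose (Forms.gr R n) ω, tmul_sum, map_sum]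
      refine sum_mem fun j _ => Submodule.subset_span ⟨i, _, SetLike.coe_mem _, ?_, j, _,
        SetLike.coe_mem _, rfl⟩
      have h := map_proj f i k
      rw [GradedAlgebra.proj_apply] at h
      rw [h, show f.hom k = 0 from hk, map_zero]
    | add x y h h' =>
      rw [map_add, map_add]
      exact add_mem h h'
  refine Submodule.span_induction₂ (p := fun x y _ _ => x * y = 0) ?_ ?_ ?_ ?_ ?_ ?_ ?_
    (key x hx) (key y hy)
  · rintro _ _ ⟨i, a, ha, ha', j, ω, hω, rfl⟩ ⟨i', b, hb, hb', j', η, hη, rfl⟩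
    rw [tmul_mul_tmul A a hω hb, hK a b ha' hb']
    simp [GradedTensorProduct.tmul]
  · simp
  · simp
  · intro x y z _ _ _ h h'
    rw [add_mul, h, h', add_zero]
  · intro x y z _ _ _ h h'
    rw [mul_add, h, h', add_zero]
  · intro r x y _ _ h
    rw [smul_mul_assoc, h, smul_zero]
  · intro r x y _ _ h
    rw [mul_smul_comm, h, smul_zero]

lemma sqZero_path_map [Algebra ℚ R] {f : A ⟶ B} (hf : Function.Surjective f.hom)
    (hK : ∀ x y, f.hom x = 0 → f.hom y = 0 → x * y = 0) (k : SimplexCategoryᵒᵖ) :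
    DerivedDeligne.sqZero R (((path R).map f).app k) :=
  ⟨pathMap_surjective hf, fun _ _ hx hy => Subtype.ext
    (mul_eq_zero_of_tensorMap_eq_zero hf hK (congrArg Subtype.val hx) (congrArg Subtype.val hy))⟩

end CDGA

/-! ### Fibre products of differential graded algebras -/

namespace CDGA

open TensorProduct GradedTensorProduct

variable {R : Type u} [CommRing R] {A B C : CDGA R}

section FibreProduct

variable (f : A ⟶ B) (g : C ⟶ B)

/-- The underlying algebra of the fibre product. -/
abbrev fibreAlg : Subalgebra R (A.carrier × C.carrier) :=
  AlgHom.equalizer (f.hom.comp (AlgHom.fst R A.carrier C.carrier))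
    (g.hom.comp (AlgHom.snd R A.carrier C.carrier))

/-- The first projection. -/
def fibreAlgFst : fibreAlg f g →ₐ[R] A.carrier := (AlgHom.fst R _ _).comp (fibreAlg f g).val

/-- The second projection. -/
def fibreAlgSnd : fibreAlg f g →ₐ[R] C.carrier := (AlgHom.snd R _ _).comp (fibreAlg f g).val

variable {f g}

lemma fibreAlg_ext {x y : fibreAlg f g} (h : fibreAlgFst f g x = fibreAlgFst f g y)
    (h' : fibreAlgSnd f g x = fibreAlgSnd f g y) : x = y :=
  Subtype.ext (Prod.ext h h')

lemma fibreAlg_comm (x : fibreAlg f g) :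
    f.hom (fibreAlgFst f g x) = g.hom (fibreAlgSnd f g x) := x.2

/-- The linear endomorphism of the fibre product induced by compatible endomorphisms. -/
def fibreAlgMap (φ : A.carrier →ₗ[R] A.carrier) (ψ : B.carrier →ₗ[R] B.carrier)
    (χ : C.carrier →ₗ[R] C.carrier) (hφ : ∀ a, f.hom (φ a) = ψ (f.hom a))
    (hχ : ∀ c, g.hom (χ c) = ψ (g.hom c)) : fibreAlg f g →ₗ[R] fibreAlg f g where
  toFun x := ⟨(φ (fibreAlgFst f g x), χ (fibreAlgSnd f g x)), by
    change f.hom (φ _) = g.hom (χ _)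
    rw [hφ, hχ, fibreAlg_comm]⟩
  map_add' x y := fibreAlg_ext (map_add φ _ _) (map_add χ _ _)
  map_smul' r x := fibreAlg_ext (map_smul φ _ _) (map_smul χ _ _)

variable (f g) in
/-- The homogeneous components of the fibre product. -/
def fibreGr (i : ℕ) : Submodule R (fibreAlg f g) :=
  (A.gr i).comap (fibreAlgFst f g).toLinearMap ⊓ (C.gr i).comap (fibreAlgSnd f g).toLinearMap

instance : SetLike.GradedMonoid (fibreGr f g) where
  one_mem := ⟨SetLike.one_mem_graded A.gr, SetLike.one_mem_graded C.gr⟩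
  mul_mem _ _ _ _ hx hy :=
    ⟨SetLike.GradedMul.mul_mem (A := A.gr) hx.1 hy.1,
      SetLike.GradedMul.mul_mem (A := C.gr) hx.2 hy.2⟩

variable (f g) in
/-- The projections onto the homogeneous components of the fibre product. -/
def fibreProj (i : ℕ) : fibreAlg f g →ₗ[R] fibreAlg f g :=
  fibreAlgMap (GradedAlgebra.proj A.gr i) (GradedAlgebra.proj B.gr i) (GradedAlgebra.proj C.gr i)
    (map_proj f i) (map_proj g i)

lemma proj_of_mem {i : ℕ} {a : A.carrier} (ha : a ∈ A.gr i) (j : ℕ) :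
    GradedAlgebra.proj A.gr j a = if i = j then a else 0 := by
  rw [GradedAlgebra.proj_apply]
  split_ifs with h
  · subst h
    exact DirectSum.decompose_of_mem_same _ ha
  · exact DirectSum.decompose_of_mem_ne _ ha h

lemma fibreProj_of_mem {i : ℕ} {x : fibreAlg f g} (hx : x ∈ fibreGr f g i) (j : ℕ) :
    fibreProj f g j x = if i = j then x else 0 := by
  refine fibreAlg_ext ((proj_of_mem hx.1 j).trans ?_) ((proj_of_mem hx.2 j).trans ?_) <;>
  split_ifs <;> simp

/-- The projections of `A` and `C` onto their components agree over `B`, so they define projections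
of the fibre product that recover each component. -/
lemma isInternal_fibreGr : DirectSum.IsInternal (fibreGr f g) := by
  classical
  refine ⟨fun y y' hy => ?_, fun x => ?_⟩
  · have key (y : DirectSum ℕ fun i => fibreGr f g i) (j : ℕ) :
        fibreProj f g j (DirectSum.coeAddMonoidHom (fibreGr f g) y) = y j := by
      induction y using DirectSum.induction_on with
      | zero => simp
      | of i z =>
        rw [DirectSum.coeAddMonoidHom_of, fibreProj_of_mem z.2, DirectSum.of_apply]
        split_ifs with h
        · subst h
          rfl
        · rfl
      | add x y h h' => rw [map_add, map_add, h, h']; rfl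
    refine DFinsupp.ext fun j => Subtype.ext ?_
    rw [← key, hy, key]
  · have hmem (i : ℕ) : fibreProj f g i x ∈ fibreGr f g i := ⟨proj_mem i _, proj_mem i _⟩
    let s := (DirectSum.decompose A.gr (fibreAlgFst f g x)).support ∪
      (DirectSum.decompose C.gr (fibreAlgSnd f g x)).support
    refine ⟨∑ i ∈ s, DirectSum.of (fun i => fibreGr f g i) i ⟨_, hmem i⟩, ?_⟩
    rw [map_sum]
    simp only [DirectSum.coeAddMonoidHom_of]
    have hsum {D : CDGA R} (d : D.carrier) {s : Finset ℕ}
        (hs : (DirectSum.decompose D.gr d).support ⊆ s) :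
        ∑ i ∈ s, GradedAlgebra.proj D.gr i d = d := by
      conv_rhs => rw [← DirectSum.sum_support_decompose D.gr d]
      refine (Finset.sum_subset hs fun i _ hi => ?_).symm
      rw [GradedAlgebra.proj_apply, DFinsupp.notMem_support_iff.1 hi]
      rfl
    refine fibreAlg_ext ?_ ?_
    · rw [map_sum]
      exact hsum _ Finset.subset_union_left
    · rw [map_sum]
      exact hsum _ Finset.subset_union_right

instance : GradedAlgebra (fibreGr f g) :=
  { (inferInstance : SetLike.GradedMonoid (fibreGr f g)),
    isInternal_fibreGr.chooseDecomposition with }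

variable (f g) in
/-- The fibre product of differential graded algebras. -/
def fibre : CDGA R where
  carrier := fibreAlg f g
  gr := fibreGr f g
  d := fibreAlgMap A.d B.d C.d f.map_d g.map_d
  d_mem ha := ⟨A.d_mem ha.1, C.d_mem ha.2⟩
  d_zero ha := fibreAlg_ext (A.d_zero ha.1) (C.d_zero ha.2)
  d_d a := fibreAlg_ext (A.d_d _) (C.d_d _)
  leibniz ha b := by
    refine fibreAlg_ext ?_ ?_
    · rw [map_add, map_sign, map_mul (fibreAlgFst f g), map_mul (fibreAlgFst f g)]
      exact A.leibniz ha.1 _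
    · rw [map_add, map_sign, map_mul (fibreAlgSnd f g), map_mul (fibreAlgSnd f g)]
      exact C.leibniz ha.2 _
  comm ha hb := by
    refine fibreAlg_ext ?_ ?_
    · rw [map_sign, map_mul, map_mul]
      exact A.comm ha.1 hb.1
    · rw [map_sign, map_mul, map_mul]
      exact C.comm ha.2 hb.2

variable (f g) in
/-- The first projection. -/
def fibreFst : fibre f g ⟶ A where
  hom := fibreAlgFst f g
  map_mem ha := ha.1
  map_d _ := rfl

variable (f g) in
/-- The second projection. -/
def fibreSnd : fibre f g ⟶ C where
  hom := fibreAlgSnd f g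
  map_mem ha := ha.2
  map_d _ := rfl

lemma map_mem_h0Ker (f : A ⟶ B) {a : A.carrier} (ha : a ∈ A.h0Ker) : f.hom a ∈ B.h0Ker := by
  obtain ⟨b, hb, hb'⟩ := ha
  exact ⟨f.hom b, f.map_mem hb, by rw [← f.map_d, hb', map_proj]⟩

lemma map_eq_zero_of_mem_h0Ker_pow (f : A ⟶ B) {m n : ℕ} (h : B.h0Ker ^ m = ⊥) (hmn : m ≤ n)
    {a : A.carrier} (ha : a ∈ A.h0Ker ^ n) : f.hom a = 0 := by
  have h1 : f.hom a ∈ (A.h0Ker ^ n).map f.hom.toLinearMap := Submodule.mem_map_of_mem ha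
  rw [Submodule.map_pow] at h1
  have h2 : A.h0Ker.map f.hom.toLinearMap ≤ B.h0Ker :=
    Submodule.map_le_iff_le_comap.2 fun a ha => map_mem_h0Ker f ha
  have h3 : B.h0Ker ^ n = ⊥ := by
    rw [← Nat.sub_add_cancel hmn, pow_add, h, Submodule.mul_bot]
  have h4 := pow_le_pow_left' h2 n h1
  rwa [h3] at h4

lemma nilpFlat_fibre (hA : nilpFlat R A) (hC : nilpFlat R C) : nilpFlat R (fibre f g) := by
  obtain ⟨⟨n, hn⟩, n', hn'⟩ := hA
  obtain ⟨⟨m, hm⟩, m', hm'⟩ := hC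
  refine ⟨⟨max n m, ?_⟩, max n' m', fun i hi => ?_⟩
  · rw [eq_bot_iff]
    exact fun a ha => fibreAlg_ext
      (map_eq_zero_of_mem_h0Ker_pow (fibreFst f g) hn (le_max_left _ _) ha)
      (map_eq_zero_of_mem_h0Ker_pow (fibreSnd f g) hm (le_max_right _ _) ha)
  · rw [eq_bot_iff]
    intro a ha
    have h1 := (fibreFst f g).map_mem ha
    rw [hn' i (lt_of_le_of_lt (le_max_left _ _) hi)] at h1
    have h2 := (fibreSnd f g).map_mem ha
    rw [hm' i (lt_of_le_of_lt (le_max_right _ _) hi)] at h2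
    exact fibreAlg_ext h1 h2

end FibreProduct

/-- The fibre product in `dg₊𝒩♭`. -/
def nilpFibre {A B C : (nilpFlat R).FullSubcategory} (f : A ⟶ B) (g : C ⟶ B) :
    (nilpFlat R).FullSubcategory :=
  ⟨fibre f.hom g.hom, nilpFlat_fibre A.property C.property⟩

/-- The first projection. -/
def nilpFibreFst {A B C : (nilpFlat R).FullSubcategory} (f : A ⟶ B) (g : C ⟶ B) :
    nilpFibre f g ⟶ A := ⟨fibreFst f.hom g.hom⟩

/-- The second projection. -/
def nilpFibreSnd {A B C : (nilpFlat R).FullSubcategory} (f : A ⟶ B) (g : C ⟶ B) :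
    nilpFibre f g ⟶ C := ⟨fibreSnd f.hom g.hom⟩

lemma nilpFibre_condition {A B C : (nilpFlat R).FullSubcategory} (f : A ⟶ B) (g : C ⟶ B) :
    nilpFibreFst f g ≫ f = nilpFibreSnd f g ≫ g :=
  InducedCategory.hom_ext (Hom.ext (AlgHom.ext fun x => x.2))

lemma isPullback_nilpFibre {A B C : (nilpFlat R).FullSubcategory} (f : A ⟶ B) (g : C ⟶ B) :
    IsPullback (nilpFibreFst f g) (nilpFibreSnd f g) f g := by
  refine ⟨⟨nilpFibre_condition f g⟩, ⟨Limits.PullbackCone.IsLimit.mk _ (fun s => ⟨{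
    hom := (s.fst.hom.hom.prod s.snd.hom.hom).codRestrict (fibreAlg f.hom g.hom) fun x =>
      DFunLike.congr_fun (congrArg (fun t : s.pt ⟶ B => t.hom.hom) s.condition) x
    map_mem := fun ha => ⟨s.fst.hom.map_mem ha, s.snd.hom.map_mem ha⟩
    map_d := fun a => fibreAlg_ext (s.fst.hom.map_d a) (s.snd.hom.map_d a) }⟩)
    (fun s => ?_) (fun s => ?_) (fun s m hm hm' => ?_)⟩⟩
  · rfl
  · rfl
  · exact InducedCategory.hom_ext (Hom.ext (AlgHom.ext fun x => fibreAlg_ext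
      (DFunLike.congr_fun (congrArg (fun t : s.pt ⟶ A => t.hom.hom) hm) x)
      (DFunLike.congr_fun (congrArg (fun t : s.pt ⟶ C => t.hom.hom) hm') x)))

/-- The fibre product is the kernel of the difference map `A × C → B`, and tensoring with the flat
module of forms preserves exactness. -/
lemma setPullback_formMap [Algebra ℚ R] {n : SimplexCategory} (f : A ⟶ B) (g : C ⟶ B)
    {x : A.carrier ⊗[R] Forms R n} {y : C.carrier ⊗[R] Forms R n}
    (h : formMap f.hom.toLinearMap (𝟙 n) x = formMap g.hom.toLinearMap (𝟙 n) y) :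
    ∃ z : fibreAlg f g ⊗[R] Forms R n, formMap (fibreAlgFst f g).toLinearMap (𝟙 n) z = x ∧
      formMap (fibreAlgSnd f g).toLinearMap (𝟙 n) z = y := by
  let φ : fibreAlg f g →ₗ[R] A.carrier × C.carrier := (fibreAlg f g).val.toLinearMap
  let ψ : A.carrier × C.carrier →ₗ[R] B.carrier := f.hom.toLinearMap ∘ₗ LinearMap.fst R _ _ -
    g.hom.toLinearMap ∘ₗ LinearMap.snd R _ _
  have hex : Function.Exact φ ψ := fun z => by
    refine ⟨fun hz => ⟨⟨z, sub_eq_zero.1 hz⟩, rfl⟩, ?_⟩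
    rintro ⟨z, rfl⟩
    exact sub_eq_zero.2 z.2
  have hcomp {M : Type u} [AddCommGroup M] [Module R M] {N : Type u} [AddCommGroup N] [Module R N]
      {L : Type u} [AddCommGroup L] [Module R L] (α : M →ₗ[R] N) (β : N →ₗ[R] L)
      (z : M ⊗[R] Forms R n) : formMap β (𝟙 n) (formMap α (𝟙 n) z) = formMap (β ∘ₗ α) (𝟙 n) z := by
    rw [formMap_formMap, Category.comp_id]
  let u : (A.carrier × C.carrier) ⊗[R] Forms R n :=
    formMap (LinearMap.inl R _ _) (𝟙 n) x + formMap (LinearMap.inr R _ _) (𝟙 n) y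
  have hu : formMap ψ (𝟙 n) u = 0 := by
    have h1 : ψ ∘ₗ LinearMap.inl R _ _ = f.hom.toLinearMap := by ext; simp [ψ]
    have h2 : ψ ∘ₗ LinearMap.inr R _ _ = (-1 : R) • g.hom.toLinearMap := by ext; simp [ψ]
    rw [map_add, hcomp, hcomp, h1, h2, h]
    simp [formMap, TensorProduct.map_smul_left]
  rw [formMap_id_eq] at hu
  obtain ⟨z, hz⟩ := (Module.Flat.rTensor_exact (Forms R n) hex u).1 hu
  rw [← formMap_id_eq] at hz
  have h1 : LinearMap.fst R A.carrier C.carrier ∘ₗ LinearMap.inl R _ _ = LinearMap.id := by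
    ext; simp
  have h2 : LinearMap.fst R A.carrier C.carrier ∘ₗ LinearMap.inr R _ _ = 0 := by ext; simp
  have h3 : LinearMap.snd R A.carrier C.carrier ∘ₗ LinearMap.inl R _ _ = 0 := by ext; simp
  have h4 : LinearMap.snd R A.carrier C.carrier ∘ₗ LinearMap.inr R _ _ = LinearMap.id := by
    ext; simp
  refine ⟨z, ?_, ?_⟩
  · have := congrArg (formMap (LinearMap.fst R _ _) (𝟙 n)) hz
    rwa [hcomp, map_add, hcomp, hcomp, h1, h2, formMap_id_id, formMap_zero, add_zero] at this
  · have := congrArg (formMap (LinearMap.snd R _ _) (𝟙 n)) hz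
    rwa [hcomp, map_add, hcomp, hcomp, h3, h4, formMap_id_id, formMap_zero, zero_add] at this

/-- By flatness the inclusion of the fibre product into `A × C` stays injective on forms, and there
an element is the sum of its two components. -/
lemma formMap_fibre_ext [Algebra ℚ R] {n : SimplexCategory} (f : A ⟶ B) (g : C ⟶ B)
    {x y : fibreAlg f g ⊗[R] Forms R n}
    (h : formMap (fibreAlgFst f g).toLinearMap (𝟙 n) x =
      formMap (fibreAlgFst f g).toLinearMap (𝟙 n) y)
    (h' : formMap (fibreAlgSnd f g).toLinearMap (𝟙 n) x =
      formMap (fibreAlgSnd f g).toLinearMap (𝟙 n) y) : x = y := by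
  refine formMap_injective (g := (fibreAlg f g).val.toLinearMap) Subtype.val_injective ?_
  have key : (fibreAlg f g).val.toLinearMap =
      LinearMap.inl R _ _ ∘ₗ (fibreAlgFst f g).toLinearMap +
        LinearMap.inr R _ _ ∘ₗ (fibreAlgSnd f g).toLinearMap := by
    ext x <;> simp [fibreAlgFst, fibreAlgSnd]
  have h1 (z : fibreAlg f g ⊗[R] Forms R n) : formMap (fibreAlg f g).val.toLinearMap (𝟙 n) z =
      formMap (LinearMap.inl R _ _) (𝟙 n) (formMap (fibreAlgFst f g).toLinearMap (𝟙 n) z) +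
      formMap (LinearMap.inr R _ _) (𝟙 n) (formMap (fibreAlgSnd f g).toLinearMap (𝟙 n) z) := by
    rw [formMap_formMap, formMap_formMap, Category.comp_id, key]
    simp [formMap, TensorProduct.map_add_left]
  rw [h1, h1, h, h']

/-- On underlying tensors this is flatness. Both defining conditions of a degree `0` cycle are
equations between natural operators, the diagonal one through `formTrunc`, so they hold on the fibre
product once they hold on both projections. -/
lemma setPullback_pathMap [Algebra ℚ R] {n : SimplexCategory} (f : A ⟶ B) (g : C ⟶ B) :
    SetPullback (pathMap (n := n) (fibreFst f g) (𝟙 n)) (pathMap (fibreSnd f g) (𝟙 n))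
      (pathMap f (𝟙 n)) (pathMap g (𝟙 n)) where
  comm x := by
    have h : fibreFst f g ≫ f = fibreSnd f g ≫ g := Hom.ext (AlgHom.ext fun x => x.2)
    have h1 := pathMap_comp (fibreFst f g) f (𝟙 n) (𝟙 n)
    rw [h, pathMap_comp] at h1
    exact (DFunLike.congr_fun h1 x).symm
  ext {x y} h h' := by
    obtain ⟨x, hx⟩ := x
    obtain ⟨y, hy⟩ := y
    have h1 := (tensorMap_of (fibreFst f g) (𝟙 n) x).symm.trans
      ((congrArg Subtype.val h).trans (tensorMap_of (fibreFst f g) (𝟙 n) y))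
    have h2 := (tensorMap_of (fibreSnd f g) (𝟙 n) x).symm.trans
      ((congrArg Subtype.val h').trans (tensorMap_of (fibreSnd f g) (𝟙 n) y))
    exact Subtype.ext (formMap_fibre_ext f g h1 h2)
  exists_mk {x y} h := by
    obtain ⟨x, hx⟩ := x
    obtain ⟨y, hy⟩ := y
    obtain ⟨x, rfl⟩ := (of R A.gr (Forms.gr R n)).surjective x
    obtain ⟨y, rfl⟩ := (of R C.gr (Forms.gr R n)).surjective y
    obtain ⟨hx1, hx2⟩ := of_mem_pathZero_iff.1 hx
    obtain ⟨hy1, hy2⟩ := of_mem_pathZero_iff.1 hy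
    have h1 := (tensorMap_of f (𝟙 n) x).symm.trans
      ((congrArg Subtype.val h).trans (tensorMap_of g (𝟙 n) y))
    obtain ⟨z, hzx, hzy⟩ := setPullback_formMap f g h1
    change (fibre f g).carrier ⊗[R] Forms R n at z
    change formMap (fibreFst f g).hom.toLinearMap (𝟙 n) z = x at hzx
    change formMap (fibreSnd f g).hom.toLinearMap (𝟙 n) z = y at hzy
    obtain ⟨N, hN⟩ := exists_formTrunc_eq hx1
    obtain ⟨N', hN'⟩ := exists_formTrunc_eq hy1
    have hz1 : formTrunc (GradedAlgebra.proj (fibre f g).gr) n (max N N') z = z := by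
      refine formMap_fibre_ext f g ?_ ?_
      · refine (formMap_formTrunc (map_proj (fibreFst f g)) _ z).trans ?_
        change formTrunc _ n _ (formMap (fibreFst f g).hom.toLinearMap (𝟙 n) z) =
          formMap (fibreFst f g).hom.toLinearMap (𝟙 n) z
        rw [hzx, hN _ (le_max_left _ _)]
      · refine (formMap_formTrunc (map_proj (fibreSnd f g)) _ z).trans ?_
        change formTrunc _ n _ (formMap (fibreSnd f g).hom.toLinearMap (𝟙 n) z) =
          formMap (fibreSnd f g).hom.toLinearMap (𝟙 n) z
        rw [hzy, hN' _ (le_max_right _ _)]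
    have hz2 : formD (fibre f g).d (fibre f g).sgn n z = 0 := by
      refine formMap_fibre_ext f g ?_ ?_
      · refine Eq.trans ?_ (map_zero _).symm
        refine (formMap_formD (d' := A.d) (s' := A.sgn) (fibreFst f g).map_d
          (map_sgn (fibreFst f g)) (𝟙 n) z).trans ?_
        change formD _ _ n (formMap (fibreFst f g).hom.toLinearMap (𝟙 n) z) = 0
        rw [hzx, hx2]
      · refine Eq.trans ?_ (map_zero _).symm
        refine (formMap_formD (d' := C.d) (s' := C.sgn) (fibreSnd f g).map_d
          (map_sgn (fibreSnd f g)) (𝟙 n) z).trans ?_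
        change formD _ _ n (formMap (fibreSnd f g).hom.toLinearMap (𝟙 n) z) = 0
        rw [hzy, hy2]
    refine ⟨⟨of R (fibre f g).gr (Forms.gr R n) z, of_mem_pathZero_iff.2
      ⟨hz1 ▸ formTrunc_mem _ z, hz2⟩⟩, Subtype.ext ?_, Subtype.ext ?_⟩
    · exact (tensorMap_of (fibreFst f g) (𝟙 n) z).trans (congrArg _ hzx)
    · exact (tensorMap_of (fibreSnd f g) (𝟙 n) z).trans (congrArg _ hzy)

lemma setPullback_of_isPullback [Algebra ℚ R] {P A B C : (nilpFlat R).FullSubcategory}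
    {p : P ⟶ A} {q : P ⟶ C} {f : A ⟶ B} {g : C ⟶ B} (h : IsPullback p q f g)
    (k : SimplexCategoryᵒᵖ) :
    SetPullback (((path R).map p.hom).app k) (((path R).map q.hom).app k)
      (((path R).map f.hom).app k) (((path R).map g.hom).app k) := by
  let F := (nilpFlat R).ι ⋙ path R
  let e := h.isoIsPullback _ _ (isPullback_nilpFibre f g)
  refine setPullback_of_iso ((F.mapIso e).app k) ?_ ?_ (setPullback_pathMap f.hom g.hom)
  · exact congrArg (fun t => t.app k) ((F.map_comp _ _).symm.trans
      (congrArg F.map (h.isoIsPullback_hom_fst _ _ (isPullback_nilpFibre f g))))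
  · exact congrArg (fun t => t.app k) ((F.map_comp _ _).symm.trans
      (congrArg F.map (h.isoIsPullback_hom_snd _ _ (isPullback_nilpFibre f g))))

end CDGA

/-! ### Extension of forms from a face -/

section Extension

open TensorProduct

variable {R : Type u} [CommRing R] {n : ℕ}

namespace Forms

variable (R) in
/-- The function `∑_{k > i} t_k`. -/
def tailSum (i : Fin (n + 1)) : Forms R ⦋n + 1⦌ :=
  ∑ k : Fin (n + 2) with i.castSucc < k, gen (n := ⦋n + 1⦌) (.inl k)

variable (R n) in
/-- The operator which extends a form vanishing on the boundary of the `n`-simplex to a form on the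
`(n + 1)`-simplex, regarded as a form on the face opposite to the vertex `0`, by a form vanishing on
the other faces. -/
def extend : Forms R ⦋n⦌ →ₗ[R] Forms R ⦋n + 1⦌ :=
  ∑ i : Fin (n + 1), (-1 : R) ^ (i : ℕ) • (LinearMap.mulLeft R (tailSum R i) ∘ₗ
    (pull (SimplexCategory.σ i)).toLinearMap)

lemma extend_mem {k : ℕ} {ω : Forms R ⦋n⦌} (hω : ω ∈ gr R ⦋n⦌ k) :
    extend R n ω ∈ gr R ⦋n + 1⦌ k := by
  rw [extend, LinearMap.sum_apply]
  refine sum_mem fun i _ => Submodule.smul_mem _ _ ?_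
  have h1 : tailSum R i ∈ gr R ⦋n + 1⦌ 0 := sum_mem fun k _ => t_mem k
  have h2 := SetLike.mul_mem_graded h1 (pull_mem (SimplexCategory.σ i) hω)
  rwa [zero_add] at h2

lemma pull_δ_tailSum (j : Fin (n + 2)) (i : Fin (n + 1)) :
    pull (SimplexCategory.δ j) (tailSum R i) =
      ∑ l : Fin (n + 1) with i.castSucc < j.succAbove l, gen (n := ⦋n⦌) (.inl l) := by
  rw [tailSum, map_sum]
  simp only [pull_gen_inl]
  rw [Finset.sum_comm' (t' := Finset.univ.filter fun l : Fin (n + 1) => i.castSucc < j.succAbove l)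
    (s' := fun l => {j.succAbove l})]
  · simp only [Finset.sum_singleton]
  · intro k l
    simp only [Finset.mem_filter, Finset.mem_univ, true_and, Finset.mem_singleton]
    constructor
    · rintro ⟨h, h'⟩
      have h' : j.succAbove l = k := h'
      exact ⟨h'.symm, h' ▸ h⟩
    · rintro ⟨rfl, h⟩
      exact ⟨h, rfl⟩

lemma pull_δ_castSucc_tailSum (i : Fin (n + 1)) :
    pull (SimplexCategory.δ i.castSucc) (tailSum R i) =
      ∑ l : Fin (n + 1) with i ≤ l, gen (n := ⦋n⦌) (.inl l) := by
  rw [pull_δ_tailSum]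
  refine Finset.sum_congr (Finset.filter_congr fun l _ => ?_) fun _ _ => rfl
  rw [Fin.lt_succAbove_iff_le_castSucc, Fin.castSucc_le_castSucc_iff]

lemma pull_δ_succ_tailSum (i : Fin (n + 1)) :
    pull (SimplexCategory.δ i.succ) (tailSum R i) =
      ∑ l : Fin (n + 1) with i < l, gen (n := ⦋n⦌) (.inl l) := by
  rw [pull_δ_tailSum]
  refine Finset.sum_congr (Finset.filter_congr fun l _ => ?_) fun _ _ => rfl
  constructor
  · intro h
    by_contra h'
    rw [Fin.succAbove_of_castSucc_lt _ _ (Fin.castSucc_lt_succ_iff.2 (not_lt.1 h'))] at h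
    exact h' (Fin.castSucc_lt_castSucc_iff.1 h)
  · intro h
    rw [Fin.succAbove_of_le_castSucc _ _ (Fin.succ_le_castSucc_iff.2 h)]
    exact Fin.castSucc_lt_succ_iff.2 h.le

end Forms

/-- A surjective endomorphism of a finite set would be injective, but both vertices collapsed by `σ
i` lie in the image of `δ j`. -/
lemma not_surjective_δ_comp_σ {j : Fin (n + 2)} {i : Fin (n + 1)} (h : j ≠ i.castSucc)
    (h' : j ≠ i.succ) :
    ¬ Function.Surjective (SimplexCategory.δ j ≫ SimplexCategory.σ i).toOrderHom := by
  intro hs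
  have hi : Function.Injective fun l : Fin (n + 1) => i.predAbove (j.succAbove l) :=
    Finite.injective_iff_surjective.2 hs
  obtain ⟨l, hl⟩ := Fin.exists_succAbove_eq h.symm
  obtain ⟨l', hl'⟩ := Fin.exists_succAbove_eq h'.symm
  have e : l = l' := hi (by
    change i.predAbove (j.succAbove l) = i.predAbove (j.succAbove l')
    rw [hl, hl', Fin.predAbove_castSucc_self, Fin.predAbove_succ_self])
  rw [← e, hl] at hl'
  exact (Fin.castSucc_lt_succ (i := i)).ne hl'

variable {M : Type*} [AddCommGroup M] [Module R M]

/-- In the `j`-th face of the `i`-th summand, `x` is pulled back along `δ j ≫ σ i`. This is the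
identity for `j = i` and `j = i + 1`; otherwise it is not surjective, and `x` dies because it
vanishes on proper faces. -/
lemma formMap_δ_extend {x : M ⊗[R] Forms R ⦋n⦌}
    (hx : ∀ {q : SimplexCategory} (α : q ⟶ ⦋n⦌), ¬ Function.Surjective α.toOrderHom →
      formMap (LinearMap.id (R := R) (M := M)) α x = 0) (j : Fin (n + 2)) :
    formMap LinearMap.id (SimplexCategory.δ j) (LinearMap.lTensor M (Forms.extend R n) x) =
      ∑ i : Fin (n + 1), (-1 : R) ^ (i : ℕ) • if j = i.castSucc ∨ j = i.succ then
        LinearMap.lTensor M (LinearMap.mulLeft R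
          (Forms.pull (SimplexCategory.δ j) (Forms.tailSum R i))) x else 0 := by
  have key (i : Fin (n + 1)) (x : M ⊗[R] Forms R ⦋n⦌) :
      formMap LinearMap.id (SimplexCategory.δ j) (LinearMap.lTensor M
        (LinearMap.mulLeft R (Forms.tailSum R i) ∘ₗ
          (Forms.pull (SimplexCategory.σ i)).toLinearMap) x) =
      LinearMap.lTensor M (LinearMap.mulLeft R
        (Forms.pull (SimplexCategory.δ j) (Forms.tailSum R i)))
        (formMap LinearMap.id (SimplexCategory.δ j ≫ SimplexCategory.σ i) x) := by
    induction x using TensorProduct.induction_on with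
    | zero => simp
    | tmul x ω =>
      rw [LinearMap.lTensor_tmul, formMap_tmul, formMap_tmul, LinearMap.lTensor_tmul,
        Forms.pull_comp]
      exact congrArg _ (map_mul (Forms.pull (R := R) (SimplexCategory.δ j)) _ _)
    | add x y h h' => simp only [map_add, h, h']
  have hsum : LinearMap.lTensor M (Forms.extend R n) x = ∑ i : Fin (n + 1), (-1 : R) ^ (i : ℕ) •
      LinearMap.lTensor M (LinearMap.mulLeft R (Forms.tailSum R i) ∘ₗ
        (Forms.pull (SimplexCategory.σ i)).toLinearMap) x := by
    change LinearMap.lTensorHom M _ x = _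
    rw [Forms.extend, map_sum, LinearMap.sum_apply]
    refine Finset.sum_congr rfl fun i _ => ?_
    rw [map_smul]
    rfl
  rw [hsum, map_sum]
  refine Finset.sum_congr rfl fun i _ => ?_
  rw [map_smul, key]
  congr 1
  split_ifs with h
  · have e : SimplexCategory.δ j ≫ SimplexCategory.σ i = 𝟙 _ := by
      obtain rfl | rfl := h
      · exact SimplexCategory.δ_comp_σ_self
      · exact SimplexCategory.δ_comp_σ_succ
    rw [e, formMap_id_id]
  · rw [not_or] at h
    rw [hx _ (not_surjective_δ_comp_σ h.1 h.2), map_zero]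

/-- Only the summand `i = 0` survives, and its coefficient restricts to the sum of all barycentric
coordinates, which is `1`. -/
lemma formMap_δ_zero_extend {x : M ⊗[R] Forms R ⦋n⦌}
    (hx : ∀ {q : SimplexCategory} (α : q ⟶ ⦋n⦌), ¬ Function.Surjective α.toOrderHom →
      formMap (LinearMap.id (R := R) (M := M)) α x = 0) :
    formMap LinearMap.id (SimplexCategory.δ 0) (LinearMap.lTensor M (Forms.extend R n) x) = x := by
  rw [formMap_δ_extend hx, Finset.sum_eq_single 0]
  · have e := Forms.pull_δ_castSucc_tailSum (R := R) (0 : Fin (n + 1))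
    simp only [Fin.zero_le, Finset.filter_true] at e
    have e' : Forms.pull (SimplexCategory.δ 0) (Forms.tailSum R (0 : Fin (n + 1))) = 1 :=
      e.trans (Forms.sum_t (R := R) (n := ⦋n⦌))
    rw [if_pos (Or.inl Fin.castSucc_zero.symm), e', LinearMap.mulLeft_one, LinearMap.lTensor_id]
    simp
  · intro i _ hi
    rw [if_neg, smul_zero]
    rintro (h | h)
    · exact hi (Fin.castSucc_injective _ h.symm)
    · exact Fin.succ_ne_zero i h.symm
  · simp

/-- On the face `k + 1` the summands `k` and `k + 1` survive with opposite signs, and both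
coefficients restrict to `∑_{l > k} t_l`, so they cancel. On the last face there is one summand, and
its coefficient is an empty sum. -/
lemma formMap_δ_succ_extend {x : M ⊗[R] Forms R ⦋n⦌}
    (hx : ∀ {q : SimplexCategory} (α : q ⟶ ⦋n⦌), ¬ Function.Surjective α.toOrderHom →
      formMap (LinearMap.id (R := R) (M := M)) α x = 0) (k : Fin (n + 1)) :
    formMap LinearMap.id (SimplexCategory.δ k.succ)
      (LinearMap.lTensor M (Forms.extend R n) x) = 0 := by
  rw [formMap_δ_extend hx]
  obtain _ | n := n
  · obtain rfl : k = 0 := Subsingleton.elim (α := Fin 1) _ _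
    have e : Forms.pull (SimplexCategory.δ 1) (Forms.tailSum R (0 : Fin 1)) = 0 := by
      refine (Forms.pull_δ_succ_tailSum (R := R) (0 : Fin 1)).trans ?_
      refine Finset.sum_eq_zero fun l hl => absurd (Finset.mem_filter.1 hl).2 ?_
      rw [Subsingleton.elim (α := Fin 1) l 0]
      exact lt_irrefl _
    simp [e]
  induction k using Fin.lastCases with
  | last =>
    rw [Finset.sum_eq_single (Fin.last (n + 1))]
    · have e := Forms.pull_δ_succ_tailSum (R := R) (Fin.last (n + 1))
      simp only [(Fin.le_last _).not_gt, Finset.filter_false, Finset.sum_empty] at e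
      rw [if_pos (Or.inr rfl), e]
      simp
    · intro i _ hi
      rw [if_neg, smul_zero]
      rintro (h | h)
      · exact (Fin.castSucc_lt_last i).ne h.symm
      · exact hi (Fin.succ_injective _ h.symm)
    · simp
  | cast k =>
    have e1 := Forms.pull_δ_castSucc_tailSum (R := R) k.succ
    have e2 := Forms.pull_δ_succ_tailSum (R := R) k.castSucc
    rw [← Fin.succ_castSucc] at e1
    have e3 : Forms.pull (SimplexCategory.δ k.castSucc.succ) (Forms.tailSum R k.succ) =
        Forms.pull (SimplexCategory.δ k.castSucc.succ) (Forms.tailSum R k.castSucc) := by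
      rw [e1, e2]
      refine Finset.sum_congr (Finset.filter_congr fun l _ => ?_) fun _ _ => rfl
      exact Fin.castSucc_lt_iff_succ_le.symm
    rw [Finset.sum_eq_add k.castSucc k.succ (Fin.castSucc_lt_succ (i := k)).ne]
    · rw [if_pos (Or.inr rfl), if_pos (Or.inl (Fin.succ_castSucc k)), e3, Fin.val_succ,
        Fin.val_castSucc, pow_succ, mul_neg, mul_one, neg_smul, add_neg_cancel]
    · intro i _ hi
      rw [if_neg, smul_zero]
      rintro (h | h)
      · rw [Fin.succ_castSucc] at h
        exact hi.2 (Fin.castSucc_injective _ h.symm)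
      · exact hi.1 (Fin.succ_injective _ h.symm)
    · simp
    · simp

/-- Because `h` anticommutes with the sign involution, the terms involving the de Rham differential
cancel, and a contraction of `M` contracts all forms with coefficients in `M`. -/
lemma formD_contraction {m : SimplexCategory} {d s h : M →ₗ[R] M} (hdh : ∀ x, d (h x) + h (d x) = x)
    (hhs : ∀ x, h (s x) = -s (h x)) (x : M ⊗[R] Forms R m) :
    formD d s m (LinearMap.rTensor _ h x) + LinearMap.rTensor _ h (formD d s m x) = x := by
  induction x using TensorProduct.induction_on with
  | zero => simp
  | tmul x ω =>
    rw [formD_tmul, map_add, LinearMap.rTensor_tmul, LinearMap.rTensor_tmul,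
      LinearMap.rTensor_tmul, formD_tmul, hhs, neg_tmul]
    conv_rhs => rw [← hdh x, add_tmul]
    abel
  | add x y h h' =>
    simp only [map_add]
    rw [add_add_add_comm, h, h']

end Extension

/-! ### Tiny acyclic extensions of differential graded algebras -/

namespace CDGA

open TensorProduct GradedTensorProduct

variable {R : Type u} [CommRing R]

lemma d_proj {A : CDGA R} (i : ℕ) (a : A.carrier) :
    A.d (GradedAlgebra.proj A.gr (i + 1) a) = GradedAlgebra.proj A.gr i (A.d a) := by
  induction a using DirectSum.Decomposition.inductionOn A.gr with
  | zero => simp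
  | @homogeneous j a =>
    rw [proj_of_mem a.2]
    obtain _ | j := j
    · rw [A.d_zero a.2, map_zero, if_neg (by omega), map_zero]
    · rw [proj_of_mem (A.d_mem a.2)]
      simp only [Nat.add_right_cancel_iff]
      split_ifs <;> simp
  | add a b h h' => simp only [map_add, h, h']

lemma proj_sgn {A : CDGA R} (i : ℕ) (a : A.carrier) :
    GradedAlgebra.proj A.gr i (A.sgn a) = (-1 : ℤˣ) ^ i • GradedAlgebra.proj A.gr i a := by
  induction a using DirectSum.Decomposition.inductionOn A.gr with
  | zero => simp
  | @homogeneous j a =>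
    rw [A.sgn_of_mem a.2, map_sign, proj_of_mem a.2]
    split_ifs with h
    · subst h
      rfl
    · simp
  | add a b h h' => simp only [map_add, h, h', smul_add]

/-- The kernel of a morphism. -/
abbrev ker {A B : CDGA R} (f : A ⟶ B) : Submodule R A.carrier := LinearMap.ker f.hom.toLinearMap

section Kernel

variable {A B : CDGA R} (f : A ⟶ B)

/-- The differential of the kernel. -/
def kerD : ker f →ₗ[R] ker f :=
  A.d.restrict fun x hx => by
    change f.hom (A.d x) = 0
    rw [f.map_d, show f.hom x = 0 from hx, map_zero]

/-- The sign involution of the kernel. -/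
def kerSgn : ker f →ₗ[R] ker f :=
  A.sgn.restrict fun x hx => by
    change f.hom (A.sgn x) = 0
    rw [map_sgn, show f.hom x = 0 from hx, map_zero]

/-- The projections onto the homogeneous components of the kernel. -/
def kerProj (i : ℕ) : ker f →ₗ[R] ker f :=
  (GradedAlgebra.proj A.gr i).restrict fun x hx => by
    change f.hom (GradedAlgebra.proj A.gr i x) = 0
    rw [map_proj, show f.hom x = 0 from hx, map_zero]

variable {f}

/-- The contraction of the kernel of a tiny acyclic extension. -/
lemma exists_contraction {r : ℕ}
    (h1 : ∀ i, i ≠ r → i ≠ r + 1 → ∀ x ∈ A.gr i, f.hom x = 0 → x = 0)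
    (h2 : Set.BijOn A.d {x | x ∈ A.gr (r + 1) ∧ f.hom x = 0} {x | x ∈ A.gr r ∧ f.hom x = 0}) :
    ∃ s : ker f →ₗ[R] ker f, (∀ x, kerD f (s x) + s (kerD f x) = x) ∧
      (∀ x, s (kerSgn f x) = -kerSgn f (s x)) ∧
      ∀ i (x : ker f), x.1 ∈ A.gr i → (s x).1 ∈ A.gr (i + 1) := by
  classical
  have hproj (x : ker f) : GradedAlgebra.proj A.gr r x.1 ∈ {x | x ∈ A.gr r ∧ f.hom x = 0} :=
    ⟨proj_mem r _, (kerProj f r x).2⟩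
  -- `t x` is the preimage under `d`, in degree `r + 1`, of the component of `x` of degree `r`.
  -- Injectivity of `d` there makes it unique, hence linear and compatible with signs.
  choose t ht htd using fun x : ker f => h2.surjOn (hproj x)
  have huniq (x : ker f) (y : A.carrier) (hy : y ∈ A.gr (r + 1)) (hy' : f.hom y = 0)
      (hd : A.d y = GradedAlgebra.proj A.gr r x.1) : t x = y :=
    h2.injOn (ht x) ⟨hy, hy'⟩ ((htd x).trans hd.symm)
  let s : ker f →ₗ[R] ker f :=
    { toFun x := ⟨t x, (ht x).2⟩
      map_add' x y := Subtype.ext (huniq _ (t x + t y) (add_mem (ht x).1 (ht y).1)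
        (by rw [map_add, (ht x).2, (ht y).2, add_zero])
        (by rw [map_add, htd, htd, Submodule.coe_add, map_add]))
      map_smul' c x := Subtype.ext (huniq _ (c • t x) (Submodule.smul_mem _ c (ht x).1)
        (by rw [map_smul, (ht x).2, smul_zero])
        (by rw [map_smul, htd, Submodule.coe_smul, map_smul])) }
  refine ⟨s, fun x => Subtype.ext ?_, fun x => Subtype.ext ?_, fun i x hx => ?_⟩
  · have h3 : t (kerD f x) = GradedAlgebra.proj A.gr (r + 1) x.1 :=
      huniq _ _ (proj_mem _ _) (kerProj f (r + 1) x).2 (d_proj r x.1)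
    change A.d (t x) + t (kerD f x) = x.1
    rw [htd, h3]
    -- By now `ds + sd` is the projection to degrees `r` and `r + 1`; the other components of an
    -- element of the kernel vanish.
    have h4 : x.1 = ∑ i ∈ (DirectSum.decompose A.gr x.1).support ∪ {r, r + 1},
        GradedAlgebra.proj A.gr i x.1 := by
      conv_lhs => rw [← DirectSum.sum_support_decompose A.gr x.1]
      refine Finset.sum_subset Finset.subset_union_left fun i _ hi => ?_
      rw [DFinsupp.notMem_support_iff.1 hi]
      rfl
    conv_rhs => rw [h4]
    rw [← Finset.sum_subset (s₁ := {r, r + 1}) Finset.subset_union_right, Finset.sum_pair (by omega)]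
    intro i _ hi
    simp only [Finset.mem_insert, Finset.mem_singleton, not_or] at hi
    exact h1 i hi.1 hi.2 _ (proj_mem i _) (kerProj f i x).2
  · change t (kerSgn f x) = -A.sgn (t x)
    refine huniq _ _ (neg_mem (sgn_mem (ht x).1)) (by rw [map_neg, map_sgn, (ht x).2]; simp) ?_
    change _ = GradedAlgebra.proj A.gr r (A.sgn x.1)
    rw [map_neg, d_sgn, neg_neg, htd, proj_sgn, A.sgn_of_mem (proj_mem r _)]
  · change t x ∈ _
    by_cases hi : i = r
    · rw [hi]
      exact (ht x).1
    · rw [huniq x 0 (zero_mem _) (map_zero _) (by rw [map_zero, proj_of_mem hx, if_neg hi])]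
      exact zero_mem _

end Kernel

/-- As for simplicial algebras, the kernel lies in `I_A`: its degree `0` part consists of boundaries
if `r = 0` and is zero otherwise. -/
lemma sqZero_of_tinyAcyclic [Algebra ℚ R] {A B : (nilpFlat R).FullSubcategory} {f : A ⟶ B}
    (hf : tinyAcyclic R f) (k : SimplexCategoryᵒᵖ) :
    DerivedDeligne.sqZero R (((path R).map f.hom).app k) := by
  obtain ⟨h1, h2, r, h3, h4⟩ := hf
  refine sqZero_path_map h1 (fun x y hx hy => h2 x ?_ y hy) k
  change GradedAlgebra.proj A.obj.gr 0 x ∈ (A.obj.gr 1).map A.obj.d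
  have hx' : f.hom.hom (GradedAlgebra.proj A.obj.gr 0 x) = 0 := by rw [map_proj, hx, map_zero]
  obtain _ | r := r
  · obtain ⟨y, hy, hy'⟩ := h4.surjOn
      (show GradedAlgebra.proj A.obj.gr 0 x ∈
        ({x | x ∈ A.obj.gr 0 ∧ f.hom.hom x = 0} : Set A.obj.carrier) from ⟨proj_mem 0 x, hx'⟩)
    exact ⟨y, hy.1, hy'⟩
  · rw [h3 0 (by omega) (by omega) _ (proj_mem 0 x) hx']
    exact zero_mem _

lemma formMap_ker_formD {A B : CDGA R} (f : A ⟶ B) {m : SimplexCategory}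
    (z : ker f ⊗[R] Forms R m) :
    formMap (ker f).subtype (𝟙 _) (formD (kerD f) (kerSgn f) m z) =
      formD A.d A.sgn m (formMap (ker f).subtype (𝟙 _) z) :=
  formMap_formD (d := kerD f) (s := kerSgn f) (d' := A.d) (s' := A.sgn) (g := (ker f).subtype)
    (fun _ => rfl) (fun _ => rfl) _ z

lemma formMap_ker_formMap {A B : CDGA R} (f : A ⟶ B) {m k : SimplexCategory} (α : k ⟶ m)
    (z : ker f ⊗[R] Forms R m) :
    formMap (ker f).subtype (𝟙 _) (formMap LinearMap.id α z) =
      formMap (LinearMap.id (R := R) (M := A.carrier)) α (formMap (ker f).subtype (𝟙 _) z) := by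
  rw [formMap_formMap, formMap_formMap, Category.id_comp, Category.comp_id, LinearMap.comp_id,
    LinearMap.id_comp]

lemma formMap_ker {A B : CDGA R} (f : A ⟶ B) {m : SimplexCategory} (z : ker f ⊗[R] Forms R m) :
    formMap f.hom.toLinearMap (𝟙 _) (formMap (ker f).subtype (𝟙 _) z) = 0 := by
  have : f.hom.toLinearMap ∘ₗ (ker f).subtype = 0 := LinearMap.ext fun x => x.2
  rw [formMap_formMap, this, formMap_zero]

/-- The extension `E z` of `z` from the `0`-th face need not be closed, so `D (s (E z))` is used
instead. It is a cycle since `D² = 0`. Its `0`-th face is `D (s z) = z - s (D z) = z`, and its other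
faces vanish because those of `E z` do. -/
lemma exists_filler {A B : CDGA R} {f : A ⟶ B} {s : ker f →ₗ[R] ker f}
    (hds : ∀ x, kerD f (s x) + s (kerD f x) = x) (hs : ∀ x, s (kerSgn f x) = -kerSgn f (s x))
    (hsm : ∀ i (x : ker f), x.1 ∈ A.gr i → (s x).1 ∈ A.gr (i + 1)) {n N : ℕ}
    {z : ker f ⊗[R] Forms R ⦋n⦌} (hz1 : formD (kerD f) (kerSgn f) ⦋n⦌ z = 0)
    (hz2 : formTrunc (kerProj f) ⦋n⦌ N z = z)
    (hzα : ∀ {q : SimplexCategory} (α : q ⟶ ⦋n⦌), ¬ Function.Surjective α.toOrderHom →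
      formMap (LinearMap.id (R := R) (M := ker f)) α z = 0) :
    ∃ y : ker f ⊗[R] Forms R ⦋n + 1⦌, formD (kerD f) (kerSgn f) _ y = 0 ∧
      formMap (ker f).subtype (𝟙 _) y ∈ A.diagonal ⦋n + 1⦌ 0 ∧
      formMap LinearMap.id (SimplexCategory.δ 0) y = z ∧
      ∀ i : Fin (n + 1), formMap LinearMap.id (SimplexCategory.δ i.succ) y = 0 := by
  have hface (j : Fin (n + 2)) (v : ker f ⊗[R] Forms R ⦋n + 1⦌) :
      formMap LinearMap.id (SimplexCategory.δ j)
        (formD (kerD f) (kerSgn f) _ (LinearMap.rTensor _ s v)) =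
      formD (kerD f) (kerSgn f) _ (LinearMap.rTensor _ s (formMap LinearMap.id
        (SimplexCategory.δ j) v)) := by
    rw [formMap_formD (d' := kerD f) (s' := kerSgn f) (g := LinearMap.id) (fun _ => rfl) (fun _ => rfl)]
    congr 1
    induction v using TensorProduct.induction_on with
    | zero => simp
    | tmul x ω => rfl
    | add x y h h' => simp only [map_add, h, h']
  refine ⟨formD (kerD f) (kerSgn f) _
    (LinearMap.rTensor _ s (LinearMap.lTensor _ (Forms.extend R n) z)),
    formD_formD (fun x => Subtype.ext (A.d_d x.1)) (fun x => Subtype.ext (d_sgn x.1)) _, ?_, ?_,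
    fun i => ?_⟩
  -- `s` raises the degree in the kernel by one, so `s (E z)` has bidegrees `(i + 1, i)`, and both
  -- terms of `D` bring it back to the diagonal.
  · rw [← hz2, formTrunc, LinearMap.sum_apply]
    simp only [map_sum]
    refine sum_mem fun i _ => ?_
    generalize z = v
    induction v using TensorProduct.induction_on with
    | zero => simp
    | tmul k ω =>
      have hk := hsm i (kerProj f i k) (proj_mem i k.1)
      have hω : Forms.extend R n (GradedAlgebra.proj (Forms.gr R ⦋n⦌) i ω) ∈
          Forms.gr R ⦋n + 1⦌ i := Forms.extend_mem (by
        rw [GradedAlgebra.proj_apply]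
        exact SetLike.coe_mem _)
      rw [TensorProduct.map_tmul, LinearMap.lTensor_tmul, LinearMap.rTensor_tmul,
        formMap_ker_formD, formMap_tmul, Forms.pull_id, formD_tmul]
      exact add_mem (tmul_mem_diagonal (A.d_mem hk) hω rfl)
        (tmul_mem_diagonal (sgn_mem hk) (Forms.dform_mem hω) rfl)
    | add x y h h' =>
      simp only [map_add]
      exact add_mem h h'
  · rw [hface, formMap_δ_zero_extend hzα]
    have h := formD_contraction hds hs z
    rwa [hz1, map_zero, add_zero] at h
  · rw [hface, formMap_δ_succ_extend hzα, map_zero, map_zero]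

/-- By flatness, forms with coefficients in the kernel embed in those with coefficients in `A`. So
the conditions on a cycle of the kernel descend to such forms, and the filler found there is mapped
back to `A`. -/
lemma acyclicKernel_path_map [Algebra ℚ R] {A B : CDGA R} {f : A ⟶ B}
    (hf : Function.Surjective f.hom) {s : ker f →ₗ[R] ker f}
    (hds : ∀ x, kerD f (s x) + s (kerD f x) = x) (hs : ∀ x, s (kerSgn f x) = -kerSgn f (s x))
    (hsm : ∀ i (x : ker f), x.1 ∈ A.gr i → (s x).1 ∈ A.gr (i + 1)) :
    AlgAcyclicKernel ((path R).map f) := by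
  rintro n ⟨x, hx0⟩ hx hx'
  obtain ⟨x, rfl⟩ := (of R A.gr (Forms.gr R ⦋n⦌)).surjective x
  obtain ⟨hx1, hx2⟩ := of_mem_pathZero_iff.1 hx0
  have hx3 : formMap f.hom.toLinearMap (𝟙 _) x = 0 :=
    (tensorMap_of f (𝟙 _) x).symm.trans (congrArg Subtype.val hx)
  have hx4 {q : SimplexCategory} (α : q ⟶ ⦋n⦌) (hα : ¬ Function.Surjective α.toOrderHom) :
      formMap (LinearMap.id (R := R) (M := A.carrier)) α x = 0 :=
    (tensorMap_of (𝟙 A) α _).symm.trans (congrArg Subtype.val (hx' α hα))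
  obtain ⟨z, rfl⟩ := exists_of_formMap_eq_zero (g := f.hom.toLinearMap) hf hx3
  have hι {m : SimplexCategory} : Function.Injective (formMap (n := m) (ker f).subtype (𝟙 m)) :=
    formMap_injective Subtype.val_injective
  obtain ⟨N, hN⟩ := exists_formTrunc_eq hx1
  have hz1 : formD (kerD f) (kerSgn f) ⦋n⦌ z = 0 :=
    hι ((formMap_ker_formD f z).trans (hx2.trans (map_zero _).symm))
  have hz2 : formTrunc (kerProj f) ⦋n⦌ N z = z :=
    hι ((formMap_formTrunc (q := GradedAlgebra.proj A.gr) (fun _ _ => rfl) N z).trans (hN N le_rfl))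
  obtain ⟨y, hy1, hy2, hy3, hy4⟩ := exists_filler hds hs hsm hz1 hz2 fun α hα =>
    hι ((formMap_ker_formMap f α z).trans ((hx4 α hα).trans (map_zero _).symm))
  have hy5 : of R A.gr (Forms.gr R ⦋n + 1⦌) (formMap (ker f).subtype (𝟙 _) y) ∈
      A.pathZero ⦋n + 1⦌ :=
    of_mem_pathZero_iff.2 ⟨hy2, (formMap_ker_formD f y).symm.trans
      ((congrArg _ hy1).trans (map_zero _))⟩
  refine ⟨⟨_, hy5⟩, Subtype.ext ?_, Subtype.ext ?_, fun i => Subtype.ext ?_⟩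
  · exact (tensorMap_of f (𝟙 _) _).trans (congrArg _ (formMap_ker f y))
  · exact (tensorMap_of (𝟙 A) (SimplexCategory.δ 0) _).trans
      (congrArg _ ((formMap_ker_formMap f _ y).symm.trans (congrArg _ hy3)))
  · exact (tensorMap_of (𝟙 A) (SimplexCategory.δ i.succ) _).trans
      (congrArg _ ((formMap_ker_formMap f _ y).symm.trans
        ((congrArg _ (hy4 i)).trans (map_zero _))))

lemma acyclicKernel_of_tinyAcyclic [Algebra ℚ R] {A B : (nilpFlat R).FullSubcategory} {f : A ⟶ B}
    (hf : tinyAcyclic R f) : AlgAcyclicKernel ((path R).map f.hom) := by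
  obtain ⟨h1, h2, r, h3, h4⟩ := hf
  obtain ⟨s, hs1, hs2, hs3⟩ := exists_contraction h3 h4
  exact acyclicKernel_path_map h1 hs1 hs2 hs3

end CDGA

end

end DerivedDeligne

/-! ### The simplicial and differential graded cases of the proposition -/

theorem mainTheorem10 {R : Type u} [CommRing R]
    (G : CommAlgCat.{u} R ⥤ CosimplicialObject GrpCat.{w})
    (hG : Homogeneous (sqZero R) G)
    (hG' : ∀ (n : SimplexCategory) ⦃A B : CommAlgCat.{u} R⦄ (f : A ⟶ B), sqZero R f →
      Function.Surjective ((G.map f).app n)) :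
    (Homogeneous (SAlg.sqZero R) (sUline G ⋙ derivedDelNerve) ∧
      FormallyQuasiSmooth (SAlg.sqZero R) (SAlg.tinyAcyclic R) (sUline G ⋙ derivedDelNerve) ∧
      Homogeneous (SAlg.sqZero R) (sUline G ⋙ delNerve) ∧
      PreHomotopic (SAlg.tinyAcyclic R) (sUline G ⋙ delNerve) ∧
      FormallyQuasiPresmooth (SAlg.sqZero R) (sUline G ⋙ delNerve)) ∧
    (∀ [Algebra ℚ R],
      Homogeneous (CDGA.sqZero R) (dgUline G ⋙ derivedDelNerve) ∧
      FormallyQuasiSmooth (CDGA.sqZero R) (CDGA.tinyAcyclic R) (dgUline G ⋙ derivedDelNerve) ∧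
      Homogeneous (CDGA.sqZero R) (dgUline G ⋙ delNerve) ∧
      PreHomotopic (CDGA.tinyAcyclic R) (dgUline G ⋙ delNerve) ∧
      FormallyQuasiPresmooth (CDGA.sqZero R) (dgUline G ⋙ delNerve)) := by
  have hG₀ := isFormallySmooth_evaluation G hG hG'
  exact ⟨deligneNerve_properties G hG₀ (SAlg.nilpFlat R).ι _ _ (fun A B f hf => hf)
      (fun P A B C p q f g _ h => SAlg.setPullback_of_isPullback h)
      (fun A B f hf => ⟨SAlg.sqZero_of_tinyAcyclic hf, SAlg.acyclicKernel_of_tinyAcyclic hf⟩),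
    fun [_] => deligneNerve_properties G hG₀ ((CDGA.nilpFlat R).ι ⋙ CDGA.path R) _ _
      (fun A B f hf => CDGA.sqZero_path_map hf.1 hf.2)
      (fun P A B C p q f g _ h => CDGA.setPullback_of_isPullback h)
      (fun A B f hf => ⟨CDGA.sqZero_of_tinyAcyclic hf, CDGA.acyclicKernel_of_tinyAcyclic hf⟩)⟩
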